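/- **Setting.** Let $d\ge 2$, $\nu>0$, $p>1$, and let $\mathbb T^d=(\mathbb R/\mathbb Z)^d$ carry Lebesgue measure. Let $\mathcal V$ be the space of real, divergence-free, mean-zero trigonometric polynomials $v=\sum_{z\in\mathbb Z^d\setminus\{0\}}\hat v_z e^{2\pi i z\cdot x}$, $v:\mathbb T^d\to\mathbb R^d$. For $v\in\mathcal V$ put $(1-\Delta)^{\alpha/2}v=\sum_z(1+4\pi^2|z|^2)^{\alpha/2}\hat v_z e^{2\pi i z\cdot x}$ and $\|v\|_{p,\alpha}^p=\int_{\mathbb T^d}|(1-\Delta)^{\alpha/2}v|^p\,dx$; let $\langle\cdot,\cdot\rangle$ and $\|\cdot\|_2$ be the inner product and norm of $L_2$, and let $V_{2,0}$ be the completion of $\mathcal V$ in $\|\cdot\|_2$. Put $e(v)=\bigl(\tfrac{\partial_iv_j+\partial_jv_i}{2}\bigr)_{ij}$, $\tau(v)=2\nu(1+|e(v)|^2)^{(p-2)/2}e(v)$, and let $b(v)$ be the functional $\langle\varphi,b(v)\rangle=\langle v,(v\cdot\nabla)\varphi\rangle-\langle e(\varphi),\tau(v)\rangle$, $\varphi\in\mathcal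 V$. For $n\ge1$ let $\mathcal V_n\subset\mathcal V$ be the span of the fields $\sqrt2\,a\cos(2\pi z\cdot x)$, $\sqrt2\,a\sin(2\pi z\cdot x)$ with $z\in\mathbb Z^d\setminus\{0\}$, $z\in[-n,n]^d$, $a\in\mathbb R^d$, $a\cdot z=0$. Let $\mathcal P_n:V_{2,0}\to\mathcal V_n$ be the orthogonal projection, and for $v\in\mathcal V_n$ let $\mathcal P_nb(v)\in\mathcal V_n$ be the element with $\langle\varphi,\mathcal P_nb(v)\rangle=\langle\varphi,b(v)\rangle$ for all $\varphi\in\mathcal V_n$. Let $\Gamma:V_{2,0}\to V_{2,0}$ be a bounded, self-adjoint, nonnegative definite operator of trace class, let $\mu_0$ be a Borel probability measure on $V_{2,0}$ with $m_0=\int\|v\|_2^2\,\mu_0(dv)<\infty$, and let $(\Omega,\mathcal F,P)$ be any probability space carrying a $V_{2,0}$-valued random variable $\xi$ with law $\mu_0$ and, independent of $\xi$, a $V_{2,0}$-valued Brownian motion $W$ with covariance operator $\Gamma$: $W$ has continuous paths, $W_0=0$ a.s., and $E[e^{i\langle\varphi,W_t-W_s\rangle}\mid\sigma(W_u,u\le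 s)]=e^{-\frac{t-s}2\langle\varphi,\Gamma\varphi\rangle}$ a.s. for all $\varphi\in V_{2,0}$, $0\le s<t$. Let $\mathcal G_t=\sigma(\xi,W_s,s\le t)$, $\mathcal G_\infty=\sigma(\bigcup_t\mathcal G_t)$, and $\mathcal F_t=\sigma(\mathcal G_t\cup\mathcal N)$, where $\mathcal N$ is the family of all subsets of $P$-null sets of $\mathcal G_\infty$. **Theorem.** There are constants $C=C(d,p,\nu)\in(0,\infty)$ and $C'=C'(d,p,\nu,\Gamma,m_0)\in(0,\infty)$ such that, in every such setting and for each $n=1,2,\dots$, there exists a process $X^n=(X^n_t)_{t\ge0}$ with values in $\mathcal V_n$ and a.s. continuous paths such that (a) $X^n_t$ is $\mathcal F_t$-measurable for all $t\ge0$; (b) almost surely, $X^n_t=\mathcal P_n\xi+\int_0^t\mathcal P_nb(X^n_s)\,ds+\mathcal P_nW_t$ for all $t\ge0$. Any two a.s. continuous processes satisfying (a) and (b) coincide almost surely for all $t\ge0$. The process $X^n$ satisfies moreover (c) for every $T>0$, $$E\Bigl[\|X^n_T\|_2^2+2\int_0^T\langle e(X^n_t),\tau(X^n_t)\rangle\,dt\Bigr]=E\bigl[\|X^n_0\|_2^2\bigr]+\operatorname{tr}(\Gamma\mathcal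 P_n)\,T,$$ $$E\Bigl[\|X^n_T\|_2^2+\frac1C\int_0^T\|X^n_t\|_{p,1}^p\,dt\Bigr]\le m_0+(C+\operatorname{tr}\Gamma)\,T<\infty.$$ If in addition $p\ge\frac{2d}{d+2}$, then for every $T>0$ $$E\Bigl[\sup_{t\le T}\|X^n_t\|_2^2+\int_0^T\|X^n_t\|_{p,1}^p\,dt\Bigr]\le(1+T)\,C'<\infty .$$ -/

import Mathlib

open MeasureTheory ProbabilityTheory Filter
open scoped NNReal ENNReal Topology InnerProductSpace

namespace PowerLawFluid

noncomputable section

/-! ### Trace and Brownian motion in a real Hilbert space -/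

section Hilbert

variable {H : Type*} [NormedAddCommGroup H] [InnerProductSpace ℝ H] [CompleteSpace H]

/-- An orthonormal (Hilbert) basis of `H`, as a set of vectors. -/
def basisSet (H : Type*) [NormedAddCommGroup H] [InnerProductSpace ℝ H] [CompleteSpace H] :
    Set H :=
  (exists_hilbertBasis ℝ H).choose

/-- The trace `∑ ⟨e, A e⟩` over an orthonormal basis of `H`; for operators of trace class the value
does not depend on the basis. -/
def hilbertTrace (A : H →L[ℝ] H) : ℝ :=
  ∑' e : basisSet H, ⟪(e : H), A e⟫_ℝ

/-- A bounded, self-adjoint, nonnegative definite operator of trace class. (A nonnegative operator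
is of trace class iff the sum of `⟨e, Γ e⟩` over one, equivalently any, orthonormal basis is
finite.) -/
structure IsCovarianceOp (Γ : H →L[ℝ] H) : Prop where
  isSelfAdjoint : IsSelfAdjoint Γ
  nonneg : ∀ v : H, 0 ≤ ⟪v, Γ v⟫_ℝ
  traceClass : Summable fun e : basisSet H => ⟪(e : H), Γ e⟫_ℝ

/-- `H`-valued Brownian motion with covariance operator `Γ`, started at `0`. -/
structure IsHilbertBM [MeasurableSpace H] {Ω : Type*} [MeasurableSpace Ω]
    (Γ : H →L[ℝ] H) (W : ℝ≥0 → Ω → H) (P : Measure Ω) : Prop where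
  measurable : ∀ t, Measurable (W t)
  continuous : ∀ ω, Continuous fun t => W t ω
  start : ∀ᵐ ω ∂P, W 0 ω = 0
  condChar : ∀ (φ : H) (s t : ℝ≥0), s < t →
    P[fun ω => Complex.exp (Complex.I * ((⟪φ, W t ω - W s ω⟫_ℝ : ℝ) : ℂ)) |
        ⨆ u : Set.Iic s, MeasurableSpace.comap (W u) inferInstance]
      =ᵐ[P] fun _ => Complex.exp ((-(((t : ℝ) - s) / 2 * ⟪φ, Γ φ⟫_ℝ) : ℝ) : ℂ)

end Hilbert

/-! ### Vector fields on the torus -/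

variable {d : ℕ}

/-- The torus `(ℝ/ℤ)^d`. -/
abbrev Torus (d : ℕ) : Type := UnitAddTorus (Fin d)

/-- Lebesgue measure on the torus, of total mass one. -/
abbrev torusVol (d : ℕ) : Measure (Torus d) :=
  Measure.pi fun _ => (AddCircle.haarAddCircle : Measure UnitAddCircle)

/-- The square integrable vector fields on the torus. -/
abbrev L2Field (d : ℕ) := Lp (EuclideanSpace ℝ (Fin d)) 2 (torusVol d)

instance : MeasurableSpace (L2Field d) := borel _

instance : BorelSpace (L2Field d) := ⟨rfl⟩

/-- The space `𝒱` of real, divergence free, mean-zero trigonometric polynomials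
`v(x) = ∑ c_z exp(2πi z·x)`, as a subspace of `L²`. -/
def trigFields (d : ℕ) : Submodule ℝ (L2Field d) where
  carrier := {v | ∃ c : (Fin d → ℤ) →₀ (Fin d → ℂ),
    c 0 = 0 ∧
    (∀ z i, (starRingEnd ℂ) (c z i) = c (-z) i) ∧
    (∀ z, ∑ i, (z i : ℂ) * c z i = 0) ∧
    ∀ᵐ x ∂(torusVol d), ∀ i, ((v x i : ℝ) : ℂ) = c.sum fun z a => a i * UnitAddTorus.mFourier z x}
  zero_mem' := by
    refine ⟨0, rfl, by simp, by simp, ?_⟩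
    filter_upwards [Lp.coeFn_zero (EuclideanSpace ℝ (Fin d)) 2 (torusVol d)] with x hx i
    rw [hx]
    simp
  add_mem' := by
    rintro v w ⟨c, c0, c1, c2, c3⟩ ⟨c', c0', c1', c2', c3'⟩
    refine ⟨c + c', by simp [c0, c0'], ?_, ?_, ?_⟩
    · intro z i
      simp [c1, c1']
    · intro z
      simp [mul_add, Finset.sum_add_distrib, c2, c2']
    · filter_upwards [c3, c3', Lp.coeFn_add v w] with x h h' hx i
      rw [hx, Finsupp.sum_add_index']
      · simp [h, h']
      · simp
      · intros
        simp [add_mul]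
  smul_mem' := by
    rintro r v ⟨c, c0, c1, c2, c3⟩
    refine ⟨r • c, by simp [c0], ?_, ?_, ?_⟩
    · intro z i
      simp [c1]
    · intro z
      have := congrArg (fun y : ℂ => (r : ℂ) * y) (c2 z)
      simp only [Finset.mul_sum, mul_zero] at this
      rw [← this]
      refine Finset.sum_congr rfl fun i _ => ?_
      simp
      ring
    · filter_upwards [c3, Lp.coeFn_smul r v] with x h hx i
      rw [hx, Finsupp.sum_smul_index']
      · simp only [Pi.smul_apply, PiLp.smul_apply, smul_eq_mul, Complex.ofReal_mul, h,
          Finsupp.sum, Finset.mul_sum, Complex.real_smul]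
        refine Finset.sum_congr rfl fun i _ => ?_
        ring
      · simp

/-- `V_{2,0}`: the completion of `𝒱` in the `L²` norm. -/
def V20 (d : ℕ) : Submodule ℝ (L2Field d) := (trigFields d).topologicalClosure

instance : CompleteSpace (V20 d) :=
  (Submodule.isClosed_topologicalClosure (trigFields d)).completeSpace_coe

/-- The field `x ↦ √2 cos(2π z·x) a`. -/
def cosMode (z : Fin d → ℤ) (a : EuclideanSpace ℝ (Fin d)) : L2Field d :=
  ContinuousMap.toLp 2 (torusVol d) ℝ
    ⟨fun x => (√2 * (UnitAddTorus.mFourier z x).re) • a, by fun_prop⟩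

/-- The field `x ↦ √2 sin(2π z·x) a`. -/
def sinMode (z : Fin d → ℤ) (a : EuclideanSpace ℝ (Fin d)) : L2Field d :=
  ContinuousMap.toLp 2 (torusVol d) ℝ
    ⟨fun x => (√2 * (UnitAddTorus.mFourier z x).im) • a, by fun_prop⟩

/-- The Galerkin space `𝒱_n`: the span of the modes `√2 cos(2π z·x) a` and `√2 sin(2π z·x) a` with
`z ∈ [-n, n]^d`, `z ≠ 0`, and `a ⟂ z`. (Letting `a` run through an orthonormal basis of the
hyperplane `z^⟂` only gives the same span.) -/
def Vn (d n : ℕ) : Submodule ℝ (V20 d) :=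
  Submodule.span ℝ {v | ∃ (z : Fin d → ℤ) (a : EuclideanSpace ℝ (Fin d)),
    z ≠ 0 ∧ (∀ i, |z i| ≤ (n : ℤ)) ∧ ∑ i, (z i : ℝ) * a i = 0 ∧
    ((v : L2Field d) = cosMode z a ∨ (v : L2Field d) = sinMode z a)}

/-! ### Fourier coefficients, derivatives and norms of trigonometric polynomials -/

/-- The `i`-th component of the `z`-th Fourier coefficient of `v`. -/
def coeff (v : L2Field d) (z : Fin d → ℤ) (i : Fin d) : ℂ :=
  UnitAddTorus.mFourierCoeff (fun x : Torus d => ((v x i : ℝ) : ℂ)) z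

/-- The vector field `(1 - Δ)^{α/2} v`, for a trigonometric polynomial `v` (all but finitely many
terms of the sum vanish, and the sum is real). -/
def bessel (α : ℝ) (v : L2Field d) (x : Torus d) : EuclideanSpace ℝ (Fin d) :=
  WithLp.toLp 2 fun i => (∑' z : Fin d → ℤ,
    (((1 + 4 * Real.pi ^ 2 * ∑ k, (z k : ℝ) ^ 2) ^ (α / 2) : ℝ) : ℂ) * coeff v z i *
      UnitAddTorus.mFourier z x).re

/-- The norm `‖v‖_{p,α}` of a trigonometric polynomial `v`. -/
def sobolevNorm (p α : ℝ) (v : L2Field d) : ℝ :=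
  (∫ x, ‖bessel α v x‖ ^ p ∂(torusVol d)) ^ (1 / p)

/-- The smooth representative of a trigonometric polynomial `v` given as a class in `L²`. -/
def field (v : L2Field d) (x : Torus d) : EuclideanSpace ℝ (Fin d) :=
  WithLp.toLp 2 fun i => (∑' z : Fin d → ℤ, coeff v z i * UnitAddTorus.mFourier z x).re

/-- The partial derivative `∂_j f` of a function on the torus. -/
def pderiv (j : Fin d) (f : Torus d → ℝ) (x : Torus d) : ℝ :=
  deriv (fun h : ℝ => f (x + Pi.single j (h : UnitAddCircle))) 0

/-- The rate of strain tensor `e(v)`. -/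
def strain (v : L2Field d) (x : Torus d) (i j : Fin d) : ℝ :=
  (pderiv i (fun y => field v y j) x + pderiv j (fun y => field v y i) x) / 2

/-- The extra stress tensor `τ(v) = 2ν (1 + |e(v)|²)^{(p-2)/2} e(v)`. -/
def stress (ν p : ℝ) (v : L2Field d) (x : Torus d) (i j : Fin d) : ℝ :=
  2 * ν * (1 + ∑ k, ∑ l, strain v x k l ^ 2) ^ ((p - 2) / 2) * strain v x i j

/-- The pairing `⟨e(φ), τ(v)⟩`. -/
def strainStress (ν p : ℝ) (φ v : L2Field d) : ℝ :=
  ∫ x, ∑ i, ∑ j, strain φ x i j * stress ν p v x i j ∂(torusVol d)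

/-- The pairing `⟨w, (v·∇)φ⟩`. -/
def advection (w v φ : L2Field d) : ℝ :=
  ∫ x, ∑ i, field w x i * ∑ j, field v x j * pderiv j (fun y => field φ y i) x ∂(torusVol d)

/-- The pairing `⟨φ, b(v)⟩`, where `b(v) = -(v·∇)v + div τ(v)` as a functional of `φ`. -/
def driftForm (ν p : ℝ) (v φ : L2Field d) : ℝ :=
  advection v v φ - strainStress ν p φ v

/-! ### The Galerkin spaces are finite-dimensional spaces of trigonometric polynomials -/

theorem mem_trigFields_of_ae (z : Fin d → ℤ) (a : EuclideanSpace ℝ (Fin d)) (hz : z ≠ 0)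
    (ha : ∑ i, (z i : ℝ) * a i = 0) (w : ℂ) (v : L2Field d)
    (hv : ∀ᵐ x ∂(torusVol d), v x = (2 * (w * UnitAddTorus.mFourier z x).re) • a) :
    v ∈ trigFields d := by
  have hz' : -z ≠ 0 := neg_ne_zero.mpr hz
  have hzz : -z ≠ z := by
    intro h
    apply hz
    funext i
    have := congrFun h i
    simp only [Pi.neg_apply, Pi.zero_apply] at this ⊢
    omega
  have ha' : ∑ i, (z i : ℂ) * (a i : ℂ) = 0 := by exact_mod_cast ha
  refine ⟨Finsupp.single z (fun i => w * (a i : ℂ)) +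
    Finsupp.single (-z) (fun i => (starRingEnd ℂ) w * (a i : ℂ)), ?_, ?_, ?_, ?_⟩
  · simp [hz]
  · intro y i
    by_cases h1 : z = y <;> by_cases h2 : -z = y
    · exact absurd (h2.trans h1.symm) hzz
    · subst h1
      have : z ≠ -z := fun h => h2 h.symm
      simp [h2, this]
    · subst h2
      have : -z ≠ z := fun h => h1 h.symm
      simp [h1, this]
    · have h3 : z ≠ -y := fun h => h2 (by rw [h, neg_neg])
      simp [h1, h2, h3]
  · intro y
    by_cases h1 : z = y <;> by_cases h2 : -z = y
    · exact absurd (h2.trans h1.symm) hzz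
    · subst h1
      calc _ = w * ∑ i, (z i : ℂ) * (a i : ℂ) := by
            rw [Finset.mul_sum]
            refine Finset.sum_congr rfl fun i _ => ?_
            simp [h2]
            ring
        _ = 0 := by rw [ha', mul_zero]
    · subst h2
      calc _ = -(starRingEnd ℂ) w * ∑ i, (z i : ℂ) * (a i : ℂ) := by
            rw [Finset.mul_sum]
            refine Finset.sum_congr rfl fun i _ => ?_
            simp [h1]
            ring
        _ = 0 := by rw [ha', mul_zero]
    · simp [h1, h2]
  · filter_upwards [hv] with x hx i
    rw [hx, Finsupp.sum_add_index' (by simp) (by intros; simp [add_mul]),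
      Finsupp.sum_single_index (by simp), Finsupp.sum_single_index (by simp),
      UnitAddTorus.mFourier_neg]
    have := Complex.add_conj (w * UnitAddTorus.mFourier z x)
    simp only [map_mul] at this
    simp only [PiLp.smul_apply, smul_eq_mul, Complex.ofReal_mul] at this ⊢
    rw [← this]
    ring

theorem cosMode_mem_V20 (z : Fin d → ℤ) (a : EuclideanSpace ℝ (Fin d)) (hz : z ≠ 0)
    (ha : ∑ i, (z i : ℝ) * a i = 0) : cosMode z a ∈ V20 d := by
  refine Submodule.le_topologicalClosure _ (mem_trigFields_of_ae z a hz ha ((√2 / 2 : ℝ) : ℂ) _ ?_)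
  filter_upwards [ContinuousMap.coeFn_toLp (p := 2) (𝕜 := ℝ) (torusVol d)
    (⟨fun x => (√2 * (UnitAddTorus.mFourier z x).re) • a, by fun_prop⟩ :
      C(Torus d, EuclideanSpace ℝ (Fin d)))] with x hx
  rw [cosMode, hx, ContinuousMap.coe_mk, Complex.re_ofReal_mul]
  congr 1
  ring

theorem sinMode_mem_V20 (z : Fin d → ℤ) (a : EuclideanSpace ℝ (Fin d)) (hz : z ≠ 0)
    (ha : ∑ i, (z i : ℝ) * a i = 0) : sinMode z a ∈ V20 d := by
  refine Submodule.le_topologicalClosure _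
    (mem_trigFields_of_ae z a hz ha (((-(√2 / 2) : ℝ) : ℂ) * Complex.I) _ ?_)
  filter_upwards [ContinuousMap.coeFn_toLp (p := 2) (𝕜 := ℝ) (torusVol d)
    (⟨fun x => (√2 * (UnitAddTorus.mFourier z x).im) • a, by fun_prop⟩ :
      C(Torus d, EuclideanSpace ℝ (Fin d)))] with x hx
  rw [sinMode, hx, ContinuousMap.coe_mk, mul_assoc, Complex.re_ofReal_mul, Complex.I_mul_re]
  congr 1
  ring

theorem cosMode_mem_span (z : Fin d → ℤ) (a : EuclideanSpace ℝ (Fin d)) :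
    cosMode z a ∈ Submodule.span ℝ
      (Set.range fun i : Fin d => cosMode z (EuclideanSpace.single i (1 : ℝ))) := by
  have h : cosMode z a = ∑ i, a i • cosMode z (EuclideanSpace.single i (1 : ℝ)) := by
    simp only [cosMode, ← map_smul, ← map_sum]
    congr 1
    ext x k
    simp [Finset.sum_apply, mul_comm, Pi.single_apply]
  rw [h]
  exact Submodule.sum_mem _ fun i _ => Submodule.smul_mem _ _ (Submodule.subset_span ⟨i, rfl⟩)

theorem sinMode_mem_span (z : Fin d → ℤ) (a : EuclideanSpace ℝ (Fin d)) :
    sinMode z a ∈ Submodule.span ℝ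
      (Set.range fun i : Fin d => sinMode z (EuclideanSpace.single i (1 : ℝ))) := by
  have h : sinMode z a = ∑ i, a i • sinMode z (EuclideanSpace.single i (1 : ℝ)) := by
    simp only [sinMode, ← map_smul, ← map_sum]
    congr 1
    ext x k
    simp [Finset.sum_apply, mul_comm, Pi.single_apply]
  rw [h]
  exact Submodule.sum_mem _ fun i _ => Submodule.smul_mem _ _ (Submodule.subset_span ⟨i, rfl⟩)

instance finiteDimensional_Vn (d n : ℕ) : FiniteDimensional ℝ (Vn d n) := by
  let B : Set (Fin d → ℤ) := Set.Icc (fun _ => -(n : ℤ)) (fun _ => (n : ℤ))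
  let S : Set (L2Field d) := ⋃ z ∈ B,
    (Set.range (fun i : Fin d => cosMode z (EuclideanSpace.single i (1 : ℝ))) ∪
      Set.range (fun i : Fin d => sinMode z (EuclideanSpace.single i (1 : ℝ))))
  have hS : S.Finite := (Set.finite_Icc _ _).biUnion fun z _ =>
    (Set.finite_range _).union (Set.finite_range _)
  have : FiniteDimensional ℝ (Submodule.span ℝ S) := FiniteDimensional.span_of_finite ℝ hS
  have hle : (Vn d n).map (V20 d).subtype ≤ Submodule.span ℝ S := by
    rw [Vn, Submodule.map_span, Submodule.span_le]
    rintro _ ⟨v, ⟨z, a, -, hz, -, h⟩, rfl⟩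
    have hB : z ∈ B := ⟨fun i => (abs_le.mp (hz i)).1, fun i => (abs_le.mp (hz i)).2⟩
    rcases h with h | h
    · simp only [Submodule.subtype_apply, SetLike.mem_coe, h]
      exact Submodule.span_mono (Set.subset_union_left.trans
        (Set.subset_biUnion_of_mem (u := fun z => _ ∪ _) hB)) (cosMode_mem_span z a)
    · simp only [Submodule.subtype_apply, SetLike.mem_coe, h]
      exact Submodule.span_mono (Set.subset_union_right.trans
        (Set.subset_biUnion_of_mem (u := fun z => _ ∪ _) hB)) (sinMode_mem_span z a)
  have : FiniteDimensional ℝ ((Vn d n).map (V20 d).subtype) := Submodule.finiteDimensional_of_le hle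
  exact LinearEquiv.finiteDimensional
    ((Vn d n).equivMapOfInjective (V20 d).subtype (V20 d).injective_subtype).symm

/-! ### The Galerkin equation -/

/-- The orthogonal projection `𝒫_n : V_{2,0} → 𝒱_n`. -/
def proj (d n : ℕ) : V20 d →L[ℝ] Vn d n := (Vn d n).orthogonalProjectionOnto

/-- An element of `𝒱_n` as a vector field. -/
abbrev toField {n : ℕ} (v : Vn d n) : L2Field d := ((v : V20 d) : L2Field d)

/-- `𝒫_n b(v) = ∑ ⟨e_k, b(v)⟩ e_k` over an orthonormal basis of `𝒱_n`: the element of `𝒱_n` that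
represents the functional `b(v)` on `𝒱_n`. -/
def drift (ν p : ℝ) {n : ℕ} (v : Vn d n) : Vn d n :=
  ∑ k, driftForm ν p (toField v) (toField (stdOrthonormalBasis ℝ (Vn d n) k)) •
    stdOrthonormalBasis ℝ (Vn d n) k

/-- `tr(Γ 𝒫_n)`. -/
def traceProj (Γ : V20 d →L[ℝ] V20 d) (n : ℕ) : ℝ :=
  hilbertTrace (Γ ∘L (Vn d n).subtypeL ∘L proj d n)

section Solution

variable {Ω : Type*} [MeasurableSpace Ω]

/-- `𝒢_t = σ(ξ, W_s, s ≤ t)`. -/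
abbrev rawFiltration (ξ : Ω → V20 d) (W : ℝ≥0 → Ω → V20 d) (t : ℝ≥0) : MeasurableSpace Ω :=
  MeasurableSpace.comap ξ inferInstance ⊔
    ⨆ s : Set.Iic t, MeasurableSpace.comap (W s) inferInstance

/-- The subsets of the `P`-null sets of `𝒢_∞ = σ(⋃ 𝒢_t)`. -/
def nullSets (ξ : Ω → V20 d) (W : ℝ≥0 → Ω → V20 d) (P : Measure Ω) : Set (Set Ω) :=
  {N | ∃ N' : Set Ω, MeasurableSet[⨆ t, rawFiltration ξ W t] N' ∧ N ⊆ N' ∧ P N' = 0}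

/-- The augmented filtration `ℱ_t = σ(𝒢_t ∪ 𝒩)`. -/
abbrev augFiltration (ξ : Ω → V20 d) (W : ℝ≥0 → Ω → V20 d) (P : Measure Ω) (t : ℝ≥0) :
    MeasurableSpace Ω :=
  rawFiltration ξ W t ⊔ MeasurableSpace.generateFrom (nullSets ξ W P)

/-- `X` is a strong solution of `X_t = 𝒫_n ξ + ∫_0^t 𝒫_n b(X_s) ds + 𝒫_n W_t`, `t ≥ 0`: a continuous
process in `𝒱_n`, adapted to the augmented filtration of `ξ` and `W`, that satisfies the equation. -/
structure IsGalerkinSolution (ν p : ℝ) (n : ℕ) (ξ : Ω → V20 d) (W : ℝ≥0 → Ω → V20 d)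
    (P : Measure Ω) (X : ℝ≥0 → Ω → Vn d n) : Prop where
  adapted : ∀ t, Measurable[augFiltration ξ W P t] (X t)
  continuous : ∀ᵐ ω ∂P, Continuous fun t => X t ω
  equation : ∀ᵐ ω ∂P, ∀ t : ℝ≥0,
    X t ω = proj d n (ξ ω) + (∫ s in (0 : ℝ)..t, drift ν p (X s.toNNReal ω)) + proj d n (W t ω)

end Solution

end

end PowerLawFluid

open PowerLawFluid

namespace PowerLawFluid

noncomputable section

/-! ### A sub-mean-value inequality -/

/-! The noise is additive and the Galerkin space is finite-dimensional, so the equation can be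
solved path by path. With f_t = 𝒫_n ξ + 𝒫_n W_t, the difference y = X − f solves the ordinary
equation y' = b(y + f). The drift is an integral over the torus of a smooth function of v, ∇v and
the test gradient (smooth because 1 + |e(v)|² never vanishes), hence Lipschitz on balls
(`exists_lipschitz_drift`). Advection does not contribute to ⟨x, b(x)⟩ and the stress is
dissipative, which gives ⟨x − w, b(x)⟩ ≤ C(1 + |x|²) for w in a bounded set
(`exists_coercive_drift`). Gronwall's inequality then bounds the solutions of all truncated
equations at once (`Coercive.exists_bound`), so on every [0, T] they stop changing once the
truncation level is large. Their limit `globalSol` is the only solution of the path equation. It is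
adapted, because the truncated solutions are limits of Picard iterates, which are measurable
functionals of the path up to the current time.

The moment statements are proved without stochastic integrals. A deterministic identity
(`IsSolUpTo.energy`) expresses the increment of |X|² − 2∫⟨X, b(X)⟩ − tθ, with θ = tr(Γ𝒫_n), through
increments of f. Each of its terms is a quantity known at some time u paired with a later,
independent and centred increment, so the increment is orthogonal to the past
(`integral_mul_energyIncr`). Along a uniform grid one gets square integrable martingale increments;
their second moments are summed and the grid is refined, which gives an L² bound that does not see
the truncation (`integral_energyIncr_sq_le`). This bound lets the zero mean pass to `globalSol` and
yields the energy identity (`energy_globalSol`); together with Doob's maximal inequality and Fatou's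
lemma it gives the bound on the supremum (`integral_iSup_globalSol_le`).

The constants must not depend on n. This requires ‖v‖_{p,1}^p ≤ K(⟨e(v), τ(v)⟩/ν + 1) for all
trigonometric polynomials in question with one K (`exists_sobolevNorm_le`), that is, Korn's
inequality in L^p (`korn_trigSum`). On the Fourier side ∂_k v_j is a sum of products of two Riesz
transforms applied to the strain, and (1 − Δ)^{1/2} is a similar combination of the identity and the
first derivatives. The Riesz transforms are bounded by the method of rotations
(`isMultiplier_extend`), as averages of sign multipliers in all directions. Sign multipliers are
transferred from the torus to the circle (`sign_multiplier`), where they reduce to the theorem of M.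
Riesz for analytic polynomials (`riesz_analytic`), which follows from the sub-mean-value property of
an explicit subharmonic function.

Finally, tr(Γ𝒫_n) ≤ tr Γ holds by comparing finite compressions of Γ through Bessel's inequality
(`sum_inner_le_hilbertTrace`), and the conditional characteristic functions of W show that its
projected increments are Gaussian and independent of the past (`IsHilbertBM.isNoise`). -/

/-- `h` is a function of two real variables with continuous first and unmixed second partial
derivatives `hs`, `ht`, `hss`, `htt`. -/
structure HasPartials (h hs ht hss htt : ℝ → ℝ → ℝ) : Prop where
  ds : ∀ s t, HasDerivAt (fun x => h x t) (hs s t) s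
  dt : ∀ s t, HasDerivAt (fun x => h s x) (ht s t) t
  dss : ∀ s t, HasDerivAt (fun x => hs x t) (hss s t) s
  dtt : ∀ s t, HasDerivAt (fun x => ht s x) (htt s t) t
  c : Continuous fun q : ℝ × ℝ => h q.1 q.2
  cs : Continuous fun q : ℝ × ℝ => hs q.1 q.2
  ct : Continuous fun q : ℝ × ℝ => ht q.1 q.2
  css : Continuous fun q : ℝ × ℝ => hss q.1 q.2
  ctt : Continuous fun q : ℝ × ℝ => htt q.1 q.2

namespace HasPartials

variable {h hs ht hss htt k ks kt kss ktt : ℝ → ℝ → ℝ}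

theorem const (a : ℝ) : HasPartials (fun _ _ => a) (fun _ _ => 0) (fun _ _ => 0)
    (fun _ _ => 0) (fun _ _ => 0) := by
  constructor <;> intros <;> first | exact hasDerivAt_const _ _ | exact continuous_const

theorem add (H : HasPartials h hs ht hss htt) (K : HasPartials k ks kt kss ktt) :
    HasPartials (fun s t => h s t + k s t) (fun s t => hs s t + ks s t)
      (fun s t => ht s t + kt s t) (fun s t => hss s t + kss s t)
      (fun s t => htt s t + ktt s t) where
  ds s t := (H.ds s t).add (K.ds s t)
  dt s t := (H.dt s t).add (K.dt s t)
  dss s t := (H.dss s t).add (K.dss s t)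
  dtt s t := (H.dtt s t).add (K.dtt s t)
  c := H.c.add K.c
  cs := H.cs.add K.cs
  ct := H.ct.add K.ct
  css := H.css.add K.css
  ctt := H.ctt.add K.ctt

theorem mul (H : HasPartials h hs ht hss htt) (K : HasPartials k ks kt kss ktt) :
    HasPartials (fun s t => h s t * k s t) (fun s t => hs s t * k s t + h s t * ks s t)
      (fun s t => ht s t * k s t + h s t * kt s t)
      (fun s t => hss s t * k s t + hs s t * ks s t + (hs s t * ks s t + h s t * kss s t))
      (fun s t => htt s t * k s t + ht s t * kt s t + (ht s t * kt s t + h s t * ktt s t)) where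
  ds s t := (H.ds s t).mul (K.ds s t)
  dt s t := (H.dt s t).mul (K.dt s t)
  dss s t := ((H.dss s t).mul (K.ds s t)).add ((H.ds s t).mul (K.dss s t))
  dtt s t := ((H.dtt s t).mul (K.dt s t)).add ((H.dt s t).mul (K.dtt s t))
  c := H.c.mul K.c
  cs := (H.cs.mul K.c).add (H.c.mul K.cs)
  ct := (H.ct.mul K.c).add (H.c.mul K.ct)
  css := ((H.css.mul K.c).add (H.cs.mul K.cs)).add ((H.cs.mul K.cs).add (H.c.mul K.css))
  ctt := ((H.ctt.mul K.c).add (H.ct.mul K.ct)).add ((H.ct.mul K.ct).add (H.c.mul K.ctt))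

theorem rpow (H : HasPartials h hs ht hss htt) (hpos : ∀ s t, 0 < h s t) (r : ℝ) :
    HasPartials (fun s t => h s t ^ r) (fun s t => hs s t * r * h s t ^ (r - 1))
      (fun s t => ht s t * r * h s t ^ (r - 1))
      (fun s t => hss s t * r * h s t ^ (r - 1) +
        hs s t * r * (hs s t * (r - 1) * h s t ^ (r - 1 - 1)))
      (fun s t => htt s t * r * h s t ^ (r - 1) +
        ht s t * r * (ht s t * (r - 1) * h s t ^ (r - 1 - 1))) where
  ds s t := (H.ds s t).rpow_const (Or.inl (hpos s t).ne')
  dt s t := (H.dt s t).rpow_const (Or.inl (hpos s t).ne')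
  dss s t := ((H.dss s t).mul_const r).mul ((H.ds s t).rpow_const (Or.inl (hpos s t).ne'))
  dtt s t := ((H.dtt s t).mul_const r).mul ((H.dt s t).rpow_const (Or.inl (hpos s t).ne'))
  c := H.c.rpow_const fun q => Or.inl (hpos q.1 q.2).ne'
  cs := (H.cs.mul continuous_const).mul (H.c.rpow_const fun q => Or.inl (hpos q.1 q.2).ne')
  ct := (H.ct.mul continuous_const).mul (H.c.rpow_const fun q => Or.inl (hpos q.1 q.2).ne')
  css := ((H.css.mul continuous_const).mul (H.c.rpow_const fun q => Or.inl (hpos q.1 q.2).ne')).add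
    ((H.cs.mul continuous_const).mul ((H.cs.mul continuous_const).mul
      (H.c.rpow_const fun q => Or.inl (hpos q.1 q.2).ne')))
  ctt := ((H.ctt.mul continuous_const).mul (H.c.rpow_const fun q => Or.inl (hpos q.1 q.2).ne')).add
    ((H.ct.mul continuous_const).mul ((H.ct.mul continuous_const).mul
      (H.c.rpow_const fun q => Or.inl (hpos q.1 q.2).ne')))

end HasPartials

theorem hasDerivAt_intervalIntegral_param {f f' : ℝ → ℝ → ℝ}
    (hf : Continuous fun q : ℝ × ℝ => f q.1 q.2) (hf' : Continuous fun q : ℝ × ℝ => f' q.1 q.2)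
    (hd : ∀ s t, HasDerivAt (fun x => f x t) (f' s t) s) (a b s : ℝ) :
    HasDerivAt (fun x => ∫ t in a..b, f x t) (∫ t in a..b, f' s t) s := by
  obtain ⟨B, hB⟩ := (((isCompact_closedBall s 1).prod (isCompact_uIcc (a := a) (b := b))).image
    hf').isBounded.exists_norm_le
  have hcf : ∀ x, Continuous (f x) := fun x => hf.comp (by fun_prop : Continuous fun t => (x, t))
  have hcf' : ∀ x, Continuous (f' x) := fun x => hf'.comp (by fun_prop : Continuous fun t => (x, t))
  refine (intervalIntegral.hasDerivAt_integral_of_dominated_loc_of_deriv_le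
    (bound := fun _ => B) (F := f) (F' := f') (Metric.ball_mem_nhds s one_pos)
    (Eventually.of_forall fun x => (hcf x).aestronglyMeasurable)
    ((hcf s).intervalIntegrable _ _) (hcf' s).aestronglyMeasurable ?_
    intervalIntegrable_const (Eventually.of_forall fun t _ x _ => hd x t)).2
  refine Eventually.of_forall fun t ht x hx => hB _ ⟨(x, t), ⟨Metric.ball_subset_closedBall hx, ?_⟩, rfl⟩
  exact Set.uIoc_subset_uIcc ht

/-- The chord slopes of a convex function increase. The slope over [r, s] tends to 0 as r → −∞,
because the function is bounded there, so the slope over [s, 0] is nonnegative. -/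
theorem le_of_convexOn_of_bounded {M : ℝ → ℝ} (hM : ConvexOn ℝ Set.univ M) {B : ℝ}
    (hB : ∀ s ≤ 0, |M s| ≤ B) {s : ℝ} (hs : s < 0) : M s ≤ M 0 := by
  have key : ∀ r < s, -(2 * B) / (s - r) ≤ (M 0 - M s) / (0 - s) := fun r hr => by
    refine le_trans ?_ (hM.slope_mono_adjacent (Set.mem_univ r) (Set.mem_univ 0) hr hs)
    have h1 := abs_le.1 (hB r (hr.le.trans hs.le))
    have h2 := abs_le.1 (hB s hs.le)
    exact div_le_div_of_nonneg_right (by linarith) (by linarith)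
  have hlim : Tendsto (fun r => -(2 * B) / (s - r)) atBot (𝓝 0) :=
    Tendsto.div_atTop tendsto_const_nhds
      ((tendsto_atTop_add_const_left atBot s tendsto_neg_atBot_atTop).congr fun r =>
        (sub_eq_add_neg s r).symm)
  have h0 : 0 ≤ (M 0 - M s) / (0 - s) :=
    le_of_tendsto hlim ((eventually_lt_atBot s).mono fun r hr => key r hr)
  rcases div_nonneg_iff.1 h0 with h | h
  · linarith [h.1]
  · linarith [h.2]

/-- The sub-mean-value inequality for a subharmonic function in logarithmic polar coordinates. -/
theorem submean_of_partials {h hs ht hss htt : ℝ → ℝ → ℝ} (H : HasPartials h hs ht hss htt)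
    (hlap : ∀ s t, 0 ≤ hss s t + htt s t) {τ : ℝ} (hτ : 0 ≤ τ) (hper : ∀ s, ht s τ = ht s 0)
    {L : ℝ} (hlim : Tendsto (fun s => ∫ t in (0 : ℝ)..τ, h s t) atBot (𝓝 L)) :
    L ≤ ∫ t in (0 : ℝ)..τ, h 0 t := by
  set M : ℝ → ℝ := fun s => ∫ t in (0 : ℝ)..τ, h s t with hMdef
  have d1 : ∀ s, HasDerivAt M (∫ t in (0 : ℝ)..τ, hs s t) s :=
    hasDerivAt_intervalIntegral_param H.c H.cs H.ds 0 τ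
  have d2 : ∀ s, HasDerivAt (fun s => ∫ t in (0 : ℝ)..τ, hs s t) (∫ t in (0 : ℝ)..τ, hss s t) s :=
    hasDerivAt_intervalIntegral_param H.cs H.css H.dss 0 τ
  have hcss : ∀ s, Continuous (hss s) :=
    fun x => H.css.comp (by fun_prop : Continuous fun t => (x, t))
  have hctt : ∀ s, Continuous (htt s) :=
    fun x => H.ctt.comp (by fun_prop : Continuous fun t => (x, t))
  -- The second `t`-derivative integrates to zero over a period, so the second derivative of the
  -- circular mean is the mean of the Laplacian.
  have nonneg : ∀ s, 0 ≤ ∫ t in (0 : ℝ)..τ, hss s t := fun s => by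
    have e1 : ∫ t in (0 : ℝ)..τ, htt s t = 0 := by
      rw [intervalIntegral.integral_eq_sub_of_hasDerivAt (fun t _ => H.dtt s t)
        ((hctt s).intervalIntegrable _ _), hper, sub_self]
    have e2 : 0 ≤ ∫ t in (0 : ℝ)..τ, (hss s t + htt s t) :=
      intervalIntegral.integral_nonneg hτ fun t _ => hlap s t
    rwa [intervalIntegral.integral_add ((hcss s).intervalIntegrable _ _)
      ((hctt s).intervalIntegrable _ _), e1, add_zero] at e2
  have mono' : Monotone fun s => ∫ t in (0 : ℝ)..τ, hs s t :=
    monotone_of_deriv_nonneg (fun s => (d2 s).differentiableAt) fun s => by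
      rw [(d2 s).deriv]; exact nonneg s
  have hconv : ConvexOn ℝ Set.univ M := by
    refine MonotoneOn.convexOn_of_deriv convex_univ
      (fun s _ => (d1 s).continuousAt.continuousWithinAt)
      (fun s _ => (d1 s).differentiableAt.differentiableWithinAt) ?_
    have : deriv M = fun s => ∫ t in (0 : ℝ)..τ, hs s t := funext fun s => (d1 s).deriv
    rw [this]
    exact mono'.monotoneOn _
  have hcont : Continuous M := continuous_iff_continuousAt.2 fun s => (d1 s).continuousAt
  obtain ⟨s₀, hs₀⟩ : ∃ s₀, ∀ s ≤ s₀, |M s - L| < 1 := by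
    have := (Metric.tendsto_nhds.1 hlim) 1 one_pos
    obtain ⟨s₀, h⟩ := eventually_atBot.1 this
    exact ⟨s₀, fun s hs => by simpa [Real.dist_eq] using h s hs⟩
  obtain ⟨B, hB⟩ := ((isCompact_Icc (a := s₀) (b := 0)).image hcont).isBounded.exists_norm_le
  -- Near −∞ the mean is close to its limit L; on the remaining compact interval it is bounded by
  -- continuity.
  have hbd : ∀ s ≤ 0, |M s| ≤ max B (|L| + 1) := fun s hs => by
    rcases le_total s s₀ with h | h
    · refine le_max_of_le_right ?_
      have := hs₀ s h
      have h3 : |M s| ≤ |M s - L| + |L| := by simpa using abs_add_le (M s - L) L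
      linarith
    · exact le_max_of_le_left (hB _ ⟨s, ⟨h, hs⟩, rfl⟩)
  exact le_of_tendsto hlim ((eventually_lt_atBot 0).mono fun s hs =>
    le_of_convexOn_of_bounded hconv hbd hs)

/-! ### The theorem of M. Riesz for analytic trigonometric polynomials -/

/-- The Laplacian inequality behind the case `1 < p ≤ 2`, where `r = p / 2`. -/
theorem lap_ineq_small {r u v x g D : ℝ} (hr : 1 / 2 < r) (hr1 : r ≤ 1) (hx : 0 < x)
    (hux : u ^ 2 ≤ x) (hxg : x ≤ g) (hD : 0 ≤ D) :
    4 * r * D * (g ^ (r - 1 - 1) * ((r - 1) * (u ^ 2 + v ^ 2)) + g ^ (r - 1)) ≤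
      2 / (2 * r - 1) * (2 * r * D * (x ^ (r - 1 - 1) * (2 * (r - 1) * u ^ 2) + x ^ (r - 1))) := by
  have hg : 0 < g := hx.trans_le hxg
  have h1 : g ^ (r - 1 - 1) * ((r - 1) * (u ^ 2 + v ^ 2)) ≤ 0 :=
    mul_nonpos_of_nonneg_of_nonpos (Real.rpow_nonneg hg.le _)
      (mul_nonpos_of_nonpos_of_nonneg (by linarith) (by positivity))
  have h2 : x ^ (r - 1) = x ^ (r - 1 - 1) * x := by
    rw [← Real.rpow_add_one hx.ne']; congr 1; ring
  -- The factor 2r − 1 = p − 1 is 1 + 2(r − 1): as r ≤ 1, the negative term is at worst its value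
  -- for u² = x. This is where p > 1 is needed.
  have h3 : (2 * r - 1) * x ^ (r - 1) ≤ x ^ (r - 1 - 1) * (2 * (r - 1) * u ^ 2) + x ^ (r - 1) := by
    have : 0 ≤ x ^ (r - 1 - 1) := Real.rpow_nonneg hx.le _
    have h5 : 0 ≤ x ^ (r - 1 - 1) * ((1 - r) * (x - u ^ 2)) :=
      mul_nonneg this (mul_nonneg (by linarith) (by linarith))
    rw [h2]; nlinarith
  have h4 : g ^ (r - 1) ≤ x ^ (r - 1) := Real.rpow_le_rpow_of_nonpos hx hxg (by linarith)
  have hpos : 0 < 2 * r - 1 := by linarith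
  calc 4 * r * D * (g ^ (r - 1 - 1) * ((r - 1) * (u ^ 2 + v ^ 2)) + g ^ (r - 1))
      ≤ 4 * r * D * x ^ (r - 1) :=
        mul_le_mul_of_nonneg_left (by linarith) (by have : 0 < r := by linarith
                                                    positivity)
    _ = 2 / (2 * r - 1) * (2 * r * D * ((2 * r - 1) * x ^ (r - 1))) := by
      rw [div_mul_eq_mul_div, eq_div_iff hpos.ne']; ring
    _ ≤ _ := by
      refine mul_le_mul_of_nonneg_left (mul_le_mul_of_nonneg_left h3 ?_) (by positivity)
      have : 0 < r := by linarith
      positivity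

/-- The Laplacian inequality behind the case `2 ≤ p`, where `r = p / 2`. -/
theorem lap_ineq_large {r u v x g D : ℝ} (hr : 1 ≤ r) (hx : 0 < x)
    (hxg : x ≤ g) (huv : u ^ 2 + v ^ 2 ≤ g) (hD : 0 ≤ D) :
    4 * r * D * (g ^ (r - 1 - 1) * ((r - 1) * (u ^ 2 + v ^ 2)) + g ^ (r - 1)) ≤
      2 * r ^ 2 * (2 * D * g ^ (r - 1) + 8 * u ^ 2 * D * ((r - 1) * g ^ (r - 1 - 1)) +
        x * (4 * (r - 1) * D * (g ^ (r - 1 - 1 - 1) * ((r - 1 - 1) * (u ^ 2 + v ^ 2)) +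
          g ^ (r - 1 - 1)))) := by
  have hg : 0 < g := hx.trans_le hxg
  have e1 : g ^ (r - 1) = g ^ (r - 1 - 1) * g := by
    rw [← Real.rpow_add_one hg.ne']; congr 1; ring
  have e2 : g ^ (r - 1 - 1) = g ^ (r - 1 - 1 - 1) * g := by
    rw [← Real.rpow_add_one hg.ne']; congr 1; ring
  have p1 : 0 ≤ g ^ (r - 1 - 1) := Real.rpow_nonneg hg.le _
  have p2 : 0 ≤ g ^ (r - 1 - 1 - 1) := Real.rpow_nonneg hg.le _
  have p0 : 0 ≤ g ^ (r - 1) := Real.rpow_nonneg hg.le _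
  have hr0 : 0 ≤ r - 1 := by linarith
  have h1 : g ^ (r - 1 - 1) * ((r - 1) * (u ^ 2 + v ^ 2)) + g ^ (r - 1) ≤ r * g ^ (r - 1) := by
    have : 0 ≤ g ^ (r - 1 - 1) * ((r - 1) * (g - (u ^ 2 + v ^ 2))) :=
      mul_nonneg p1 (mul_nonneg hr0 (by linarith))
    rw [e1]; nlinarith
  -- Up to a nonnegative factor this is the Laplacian of g^(r−1). Only the term with the Laplacian
  -- of x is needed for the estimate; this one and the cross term are nonnegative and are dropped.
  have h2 : 0 ≤ g ^ (r - 1 - 1 - 1) * ((r - 1 - 1) * (u ^ 2 + v ^ 2)) + g ^ (r - 1 - 1) := by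
    have h3 : 0 ≤ g ^ (r - 1 - 1 - 1) * (g - (u ^ 2 + v ^ 2)) := mul_nonneg p2 (by linarith)
    have h4 : 0 ≤ g ^ (r - 1 - 1 - 1) * ((r - 1) * (u ^ 2 + v ^ 2)) :=
      mul_nonneg p2 (mul_nonneg hr0 (by positivity))
    rw [e2]; nlinarith
  have h3 : 0 ≤ 8 * u ^ 2 * D * ((r - 1) * g ^ (r - 1 - 1)) := by positivity
  have h4 := mul_nonneg hx.le (mul_nonneg (mul_nonneg (mul_nonneg zero_le_four hr0) hD) h2)
  calc _ ≤ 4 * r * D * (r * g ^ (r - 1)) :=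
        mul_le_mul_of_nonneg_left h1 (by have : 0 < r := by linarith
                                         positivity)
    _ = 2 * r ^ 2 * (2 * D * g ^ (r - 1)) := by ring
    _ ≤ _ := mul_le_mul_of_nonneg_left (by linarith) (by positivity)

section Riesz

variable {ι : Type*}

/-- The function `ζ ↦ ∑ c_i exp(k_i ζ)`. -/
def expSum (S : Finset ι) (k : ι → ℕ) (c : ι → ℂ) (ζ : ℂ) : ℂ :=
  ∑ i ∈ S, c i * Complex.exp (k i * ζ)

theorem hasDerivAt_expSum (S : Finset ι) (k : ι → ℕ) (c : ι → ℂ) (ζ : ℂ) :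
    HasDerivAt (expSum S k c) (expSum S k (fun i => k i * c i) ζ) ζ := by
  unfold expSum
  refine HasDerivAt.fun_sum fun i _ => ?_
  have := (((hasDerivAt_id ζ).const_mul (k i : ℂ)).cexp).const_mul (c i)
  simp only [id, mul_one] at this
  convert! this using 1
  ring

theorem continuous_expSum (S : Finset ι) (k : ι → ℕ) (c : ι → ℂ) : Continuous (expSum S k c) := by
  unfold expSum; fun_prop

theorem hasDerivAt_re_im_s (S : Finset ι) (k : ι → ℕ) (c : ι → ℂ) (s t : ℝ) :
    HasDerivAt (fun x : ℝ => expSum S k c (x + t * Complex.I))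
      (expSum S k (fun i => k i * c i) (s + t * Complex.I)) s := by
  have h1 : HasDerivAt (fun x : ℝ => (x : ℂ) + t * Complex.I) 1 s :=
    (Complex.ofRealCLM.hasDerivAt (x := s)).add_const _
  simpa [Function.comp_def] using (hasDerivAt_expSum S k c (s + t * Complex.I)).comp s h1

theorem hasDerivAt_re_im_t (S : Finset ι) (k : ι → ℕ) (c : ι → ℂ) (s t : ℝ) :
    HasDerivAt (fun x : ℝ => expSum S k c (s + x * Complex.I))
      (expSum S k (fun i => k i * c i) (s + t * Complex.I) * Complex.I) t := by
  have h1 : HasDerivAt (fun x : ℝ => (s : ℂ) + x * Complex.I) Complex.I t := by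
    simpa using ((Complex.ofRealCLM.hasDerivAt (x := t)).mul_const Complex.I).const_add (s : ℂ)
  simpa [Function.comp_def] using (hasDerivAt_expSum S k c (s + t * Complex.I)).comp t h1

/-- Differentiation along s is complex differentiation and along t it is multiplication of that by i
(Cauchy–Riemann); the two second derivatives are opposite, so the function is harmonic. -/
theorem HasPartials.expSum_re (S : Finset ι) (k : ι → ℕ) (c : ι → ℂ) :
    HasPartials (fun s t => (expSum S k c (s + t * Complex.I)).re)
      (fun s t => (expSum S k (fun i => k i * c i) (s + t * Complex.I)).re)
      (fun s t => -(expSum S k (fun i => k i * c i) (s + t * Complex.I)).im)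
      (fun s t => (expSum S k (fun i => k i * (k i * c i)) (s + t * Complex.I)).re)
      (fun s t => -(expSum S k (fun i => k i * (k i * c i)) (s + t * Complex.I)).re) where
  ds s t := Complex.reCLM.hasFDerivAt.comp_hasDerivAt s (hasDerivAt_re_im_s S k c s t)
  dt s t := by
    simpa using! Complex.reCLM.hasFDerivAt.comp_hasDerivAt t (hasDerivAt_re_im_t S k c s t)
  dss s t := Complex.reCLM.hasFDerivAt.comp_hasDerivAt s (hasDerivAt_re_im_s S k _ s t)
  dtt s t := by
    simpa using! (Complex.imCLM.hasFDerivAt.comp_hasDerivAt t (hasDerivAt_re_im_t S k _ s t)).neg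
  c := Complex.continuous_re.comp ((continuous_expSum S k _).comp (by fun_prop))
  cs := Complex.continuous_re.comp ((continuous_expSum S k _).comp (by fun_prop))
  ct := (Complex.continuous_im.comp ((continuous_expSum S k _).comp (by fun_prop))).neg
  css := Complex.continuous_re.comp ((continuous_expSum S k _).comp (by fun_prop))
  ctt := (Complex.continuous_re.comp ((continuous_expSum S k _).comp (by fun_prop))).neg

theorem HasPartials.expSum_im (S : Finset ι) (k : ι → ℕ) (c : ι → ℂ) :
    HasPartials (fun s t => (expSum S k c (s + t * Complex.I)).im)
      (fun s t => (expSum S k (fun i => k i * c i) (s + t * Complex.I)).im)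
      (fun s t => (expSum S k (fun i => k i * c i) (s + t * Complex.I)).re)
      (fun s t => (expSum S k (fun i => k i * (k i * c i)) (s + t * Complex.I)).im)
      (fun s t => -(expSum S k (fun i => k i * (k i * c i)) (s + t * Complex.I)).im) where
  ds s t := Complex.imCLM.hasFDerivAt.comp_hasDerivAt s (hasDerivAt_re_im_s S k c s t)
  dt s t := by
    simpa using! Complex.imCLM.hasFDerivAt.comp_hasDerivAt t (hasDerivAt_re_im_t S k c s t)
  dss s t := Complex.imCLM.hasFDerivAt.comp_hasDerivAt s (hasDerivAt_re_im_s S k _ s t)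
  dtt s t := by
    simpa using! Complex.reCLM.hasFDerivAt.comp_hasDerivAt t (hasDerivAt_re_im_t S k _ s t)
  c := Complex.continuous_im.comp ((continuous_expSum S k _).comp (by fun_prop))
  cs := Complex.continuous_im.comp ((continuous_expSum S k _).comp (by fun_prop))
  ct := (Complex.continuous_re.comp ((continuous_expSum S k _).comp (by fun_prop)))
  css := Complex.continuous_im.comp ((continuous_expSum S k _).comp (by fun_prop))
  ctt := (Complex.continuous_im.comp ((continuous_expSum S k _).comp (by fun_prop))).neg

theorem expSum_periodic (S : Finset ι) (k : ι → ℕ) (c : ι → ℂ) (s : ℝ) :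
    expSum S k c (s + (2 * Real.pi : ℝ) * Complex.I) = expSum S k c (s + (0 : ℝ) * Complex.I) := by
  unfold expSum
  refine Finset.sum_congr rfl fun i _ => ?_
  congr 1
  rw [Complex.exp_eq_exp_iff_exists_int]
  exact ⟨k i, by push_cast; ring⟩

/-- In the variable ζ = s + it the centre of the disc is s → −∞. All frequencies being at least 1,
the sum decays like e^s there. -/
theorem norm_expSum_le (S : Finset ι) {k : ι → ℕ} (hk : ∀ i ∈ S, 1 ≤ k i) (c : ι → ℂ) {s : ℝ}
    (hs : s ≤ 0) (t : ℝ) :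
    ‖expSum S k c (s + t * Complex.I)‖ ≤ (∑ i ∈ S, ‖c i‖) * Real.exp s := by
  unfold expSum
  rw [Finset.sum_mul]
  refine (norm_sum_le _ _).trans (Finset.sum_le_sum fun i hi => ?_)
  rw [norm_mul, Complex.norm_exp]
  refine mul_le_mul_of_nonneg_left (Real.exp_le_exp.2 ?_) (norm_nonneg _)
  have : (1 : ℝ) ≤ k i := by exact_mod_cast hk i hi
  simp
  nlinarith

/-- The functional on the circle of an analytic polynomial without constant term, for a function
continuous at `0`, tends to the value at the centre. -/
theorem tendsto_integral_expSum (S : Finset ι) {k : ι → ℕ} (hk : ∀ i ∈ S, 1 ≤ k i) (c : ι → ℂ)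
    {Ψ : ℂ → ℝ} (hΨ : Continuous Ψ) {τ : ℝ} (hτ : 0 ≤ τ) :
    Tendsto (fun s : ℝ => ∫ t in (0 : ℝ)..τ, Ψ (expSum S k c (s + t * Complex.I))) atBot
      (𝓝 (τ * Ψ 0)) := by
  set B := ∑ i ∈ S, ‖c i‖
  have hlim : Tendsto (fun s : ℝ => B * Real.exp s) atBot (𝓝 0) := by
    simpa using Real.tendsto_exp_atBot.const_mul B
  rw [Metric.tendsto_nhds]
  intro ε hε
  have hτ1 : 0 < τ + 1 := by linarith
  obtain ⟨δ, hδ, h⟩ := Metric.continuousAt_iff.1 (hΨ.continuousAt (x := 0)) (ε / (τ + 1)) (by positivity)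
  filter_upwards [hlim.eventually (gt_mem_nhds hδ), eventually_le_atBot 0] with s hs hs0
  have hc : Continuous fun t : ℝ => Ψ (expSum S k c (s + t * Complex.I)) :=
    hΨ.comp ((continuous_expSum S k c).comp (by fun_prop))
  have e : τ * Ψ 0 = ∫ t in (0 : ℝ)..τ, Ψ 0 := by simp
  rw [Real.dist_eq, e, ← intervalIntegral.integral_sub (hc.intervalIntegrable _ _)
    (by simp), ← Real.norm_eq_abs]
  refine (intervalIntegral.norm_integral_le_of_norm_le_const (C := ε / (τ + 1)) fun t _ => ?_).trans_lt ?_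
  · refine (h (x := expSum S k c (s + t * Complex.I)) ?_).le
    rw [dist_zero_right]
    exact (norm_expSum_le S hk c hs0 t).trans_lt hs
  · rw [sub_zero, abs_of_nonneg hτ, div_mul_eq_mul_div, div_lt_iff₀ hτ1]
    nlinarith

/-- For F = u + iv the function A(u² + ε)^r − (u² + v² + ε)^r is subharmonic by `lap_ineq_small`. At
the centre, where F = 0, it equals (A − 1)ε^r ≥ 0, so its mean over the circle is nonnegative. The
positive ε keeps the powers differentiable where u or F vanishes. -/
theorem riesz_small (S : Finset ι) {k : ι → ℕ} (hk : ∀ i ∈ S, 1 ≤ k i) (c : ι → ℂ) {r ε : ℝ}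
    (hr : 1 / 2 < r) (hr1 : r ≤ 1) (hε : 0 < ε) :
    ∫ t in (0 : ℝ)..2 * Real.pi, (‖expSum S k c (t * Complex.I)‖ ^ 2 + ε) ^ r ≤
      2 / (2 * r - 1) *
        ∫ t in (0 : ℝ)..2 * Real.pi, ((expSum S k c (t * Complex.I)).re ^ 2 + ε) ^ r := by
  have hpos : 0 < 2 * r - 1 := by linarith
  set A := 2 / (2 * r - 1) with hA
  have hτ : (0 : ℝ) ≤ 2 * Real.pi := by positivity
  have U := HasPartials.expSum_re S k c
  have V := HasPartials.expSum_im S k c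
  have X := (U.mul U).add (HasPartials.const ε)
  have G := ((U.mul U).add (V.mul V)).add (HasPartials.const ε)
  have hXpos : ∀ w : ℂ, 0 < w.re * w.re + ε := fun w => by nlinarith [mul_self_nonneg w.re]
  have hGpos : ∀ w : ℂ, 0 < w.re * w.re + w.im * w.im + ε := fun w => by
    nlinarith [mul_self_nonneg w.re, mul_self_nonneg w.im]
  have Hh := ((HasPartials.const A).mul (X.rpow (fun s t => hXpos _) r)).add
    ((HasPartials.const (-1)).mul (G.rpow (fun s t => hGpos _) r))
  have hlap := submean_of_partials Hh ?_ hτ ?_ (L := 2 * Real.pi * (A * ε ^ r - ε ^ r)) ?_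
  · have h0 : 0 ≤ 2 * Real.pi * (A * ε ^ r - ε ^ r) := by
      have : 1 ≤ A := by rw [hA, le_div_iff₀ hpos]; linarith
      have h2 : 0 ≤ ε ^ r := by positivity
      exact mul_nonneg hτ (by nlinarith)
    have h1 := h0.trans hlap
    have cX : Continuous fun t : ℝ => ((expSum S k c (t * Complex.I)).re ^ 2 + ε) ^ r :=
      Continuous.rpow_const ((((Complex.continuous_re.comp ((continuous_expSum S k c).comp
        (by fun_prop))).pow 2)).add continuous_const) fun t => Or.inl (by positivity)
    have cG : Continuous fun t : ℝ => (‖expSum S k c (t * Complex.I)‖ ^ 2 + ε) ^ r :=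
      Continuous.rpow_const (((continuous_norm.comp ((continuous_expSum S k c).comp
        (by fun_prop))).pow 2).add continuous_const) fun t => Or.inl (by positivity)
    rw [← sub_nonneg, ← intervalIntegral.integral_const_mul, ← intervalIntegral.integral_sub
      ((cX.intervalIntegrable _ _).const_mul A) (cG.intervalIntegrable _ _)]
    refine h1.trans_eq (intervalIntegral.integral_congr fun t _ => ?_)
    simp only [Complex.ofReal_zero, zero_add, ← Complex.normSq_eq_norm_sq, Complex.normSq_apply]
    simp only [pow_two]
    ring
  · intro s t
    generalize expSum S k c (↑s + ↑t * Complex.I) = w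
    generalize expSum S k (fun i => k i * c i) (↑s + ↑t * Complex.I) = w'
    generalize expSum S k (fun i => k i * (k i * c i)) (↑s + ↑t * Complex.I) = w''
    have key := lap_ineq_small (u := w.re) (v := w.im) (x := w.re * w.re + ε)
      (g := w.re * w.re + w.im * w.im + ε) (D := w'.re ^ 2 + w'.im ^ 2) hr hr1 (hXpos w)
      (by nlinarith) (by nlinarith [mul_self_nonneg w.im]) (by positivity)
    rw [← hA] at key
    refine (sub_nonneg.2 key).trans_eq ?_
    ring
  · intro s
    simp only [expSum_periodic]
  · have := tendsto_integral_expSum S hk c (τ := 2 * Real.pi) (Ψ := fun w =>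
      A * (w.re * w.re + ε) ^ r + -1 * (w.re * w.re + w.im * w.im + ε) ^ r) ?_ hτ
    · convert! this using 2
      simp
      ring
    · refine (continuous_const.mul (Continuous.rpow_const (by fun_prop) fun w =>
        Or.inl (hXpos w).ne')).add (continuous_const.mul (Continuous.rpow_const (by fun_prop)
        fun w => Or.inl (hGpos w).ne'))

/-- The same argument with the function A(u² + ε)(|F|² + ε)^(r−1) − (|F|² + ε)^r, which
`lap_ineq_large` shows to be subharmonic. The mixed product on the right is separated afterwards by
`young_large`. -/
theorem riesz_large (S : Finset ι) {k : ι → ℕ} (hk : ∀ i ∈ S, 1 ≤ k i) (c : ι → ℂ) {r ε : ℝ}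
    (hr : 1 ≤ r) (hε : 0 < ε) :
    ∫ t in (0 : ℝ)..2 * Real.pi, (‖expSum S k c (t * Complex.I)‖ ^ 2 + ε) ^ r ≤
      2 * r ^ 2 * ∫ t in (0 : ℝ)..2 * Real.pi, ((expSum S k c (t * Complex.I)).re ^ 2 + ε) *
        (‖expSum S k c (t * Complex.I)‖ ^ 2 + ε) ^ (r - 1) := by
  set A := 2 * r ^ 2 with hA
  have hτ : (0 : ℝ) ≤ 2 * Real.pi := by positivity
  have U := HasPartials.expSum_re S k c
  have V := HasPartials.expSum_im S k c
  have X := (U.mul U).add (HasPartials.const ε)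
  have G := ((U.mul U).add (V.mul V)).add (HasPartials.const ε)
  have hXpos : ∀ w : ℂ, 0 < w.re * w.re + ε := fun w => by nlinarith [mul_self_nonneg w.re]
  have hGpos : ∀ w : ℂ, 0 < w.re * w.re + w.im * w.im + ε := fun w => by
    nlinarith [mul_self_nonneg w.re, mul_self_nonneg w.im]
  have Hh := ((HasPartials.const A).mul (X.mul (G.rpow (fun s t => hGpos _) (r - 1)))).add
    ((HasPartials.const (-1)).mul (G.rpow (fun s t => hGpos _) r))
  have hlap := submean_of_partials Hh ?_ hτ ?_
    (L := 2 * Real.pi * (A * (ε * ε ^ (r - 1)) - ε ^ r)) ?_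
  · have h0 : 0 ≤ 2 * Real.pi * (A * (ε * ε ^ (r - 1)) - ε ^ r) := by
      have e : ε * ε ^ (r - 1) = ε ^ r := by
        rw [mul_comm, ← Real.rpow_add_one hε.ne', sub_add_cancel]
      have : 1 ≤ A := by rw [hA]; nlinarith
      have h2 : 0 ≤ ε ^ r := by positivity
      rw [e]
      exact mul_nonneg hτ (by nlinarith)
    have h1 := h0.trans hlap
    have cG : ∀ r : ℝ, Continuous fun t : ℝ => (‖expSum S k c (t * Complex.I)‖ ^ 2 + ε) ^ r :=
      fun r => Continuous.rpow_const (((continuous_norm.comp ((continuous_expSum S k c).comp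
        (by fun_prop))).pow 2).add continuous_const) fun t => Or.inl (by positivity)
    have cX : Continuous fun t : ℝ => ((expSum S k c (t * Complex.I)).re ^ 2 + ε) *
        (‖expSum S k c (t * Complex.I)‖ ^ 2 + ε) ^ (r - 1) :=
      ((((Complex.continuous_re.comp ((continuous_expSum S k c).comp
        (by fun_prop))).pow 2)).add continuous_const).mul (cG _)
    rw [← sub_nonneg, ← intervalIntegral.integral_const_mul, ← intervalIntegral.integral_sub
      ((cX.intervalIntegrable _ _).const_mul A) ((cG r).intervalIntegrable _ _)]
    refine h1.trans_eq (intervalIntegral.integral_congr fun t _ => ?_)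
    simp only [Complex.ofReal_zero, zero_add, ← Complex.normSq_eq_norm_sq, Complex.normSq_apply]
    simp only [pow_two]
    ring
  · intro s t
    generalize expSum S k c (↑s + ↑t * Complex.I) = w
    generalize expSum S k (fun i => k i * c i) (↑s + ↑t * Complex.I) = w'
    generalize expSum S k (fun i => k i * (k i * c i)) (↑s + ↑t * Complex.I) = w''
    have key := lap_ineq_large (u := w.re) (v := w.im) (x := w.re * w.re + ε)
      (g := w.re * w.re + w.im * w.im + ε) (D := w'.re ^ 2 + w'.im ^ 2) hr (hXpos w)
      (by nlinarith [mul_self_nonneg w.im]) (by nlinarith) (by positivity)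
    rw [← hA] at key
    refine (sub_nonneg.2 key).trans_eq ?_
    ring
  · intro s
    simp only [expSum_periodic]
  · have := tendsto_integral_expSum S hk c (τ := 2 * Real.pi) (Ψ := fun w =>
      A * ((w.re * w.re + ε) * (w.re * w.re + w.im * w.im + ε) ^ (r - 1)) +
        -1 * (w.re * w.re + w.im * w.im + ε) ^ r) ?_ hτ
    · convert! this using 2
      simp
      ring
    · exact (continuous_const.mul (Continuous.mul (by fun_prop) (Continuous.rpow_const
        (by fun_prop) fun w => Or.inl (hGpos w).ne'))).add
        (continuous_const.mul (Continuous.rpow_const (by fun_prop)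
        fun w => Or.inl (hGpos w).ne'))

/-- If 4r²x ≤ g, the left side is at most half of g^r. Otherwise g ≤ 4r²x, and g^(r−1) is replaced
by the power of 4r²x. -/
theorem young_large {r x g : ℝ} (hr : 1 ≤ r) (hx : 0 < x) (hxg : x ≤ g) :
    2 * r ^ 2 * (x * g ^ (r - 1)) ≤ 1 / 2 * g ^ r + 1 / 2 * (4 * r ^ 2) ^ r * x ^ r := by
  have hg : 0 < g := hx.trans_le hxg
  have e : g ^ r = g * g ^ (r - 1) := by
    rw [mul_comm, ← Real.rpow_add_one hg.ne', sub_add_cancel]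
  have p1 : 0 ≤ g ^ (r - 1) := Real.rpow_nonneg hg.le _
  rcases le_total (4 * r ^ 2 * x) g with h | h
  · have h1 : 0 ≤ 1 / 2 * (4 * r ^ 2) ^ r * x ^ r := by positivity
    rw [e]
    nlinarith [mul_le_mul_of_nonneg_right h p1]
  · have hK : (0 : ℝ) < 4 * r ^ 2 := by positivity
    have h1 : g ^ (r - 1) ≤ (4 * r ^ 2 * x) ^ (r - 1) :=
      Real.rpow_le_rpow hg.le h (by linarith)
    have h2 : 4 * r ^ 2 * x * (4 * r ^ 2 * x) ^ (r - 1) = (4 * r ^ 2) ^ r * x ^ r := by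
      rw [mul_comm, ← Real.rpow_add_one (by positivity), sub_add_cancel,
        Real.mul_rpow hK.le hx.le]
    have h3 : 0 ≤ 1 / 2 * g ^ r := by positivity
    have h4 := mul_le_mul_of_nonneg_left h1 (by positivity : 0 ≤ 4 * r ^ 2 * x)
    nlinarith

/-- The constant in the theorem of M. Riesz. -/
def rieszConst (p : ℝ) : ℝ := max (2 / (p - 1)) ((p ^ 2) ^ (p / 2))

theorem riesz_regularized (S : Finset ι) {k : ι → ℕ} (hk : ∀ i ∈ S, 1 ≤ k i) (c : ι → ℂ) {p ε : ℝ}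
    (hp : 1 < p) (hε : 0 < ε) :
    ∫ t in (0 : ℝ)..2 * Real.pi, (‖expSum S k c (t * Complex.I)‖ ^ 2 + ε) ^ (p / 2) ≤
      rieszConst p *
        ∫ t in (0 : ℝ)..2 * Real.pi, ((expSum S k c (t * Complex.I)).re ^ 2 + ε) ^ (p / 2) := by
  have hτ : (0 : ℝ) ≤ 2 * Real.pi := by positivity
  have hnn : 0 ≤ ∫ t in (0 : ℝ)..2 * Real.pi,
      ((expSum S k c (t * Complex.I)).re ^ 2 + ε) ^ (p / 2) :=
    intervalIntegral.integral_nonneg hτ fun t _ => by positivity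
  rcases le_total p 2 with h | h
  · refine (riesz_small S hk c (r := p / 2) (by linarith) (by linarith) hε).trans
      (mul_le_mul_of_nonneg_right ?_ hnn)
    rw [mul_div_cancel₀ _ two_ne_zero]
    exact le_max_left _ _
  · refine le_trans ?_ (mul_le_mul_of_nonneg_right (le_max_right _ _) hnn)
    have h1 := riesz_large S hk c (r := p / 2) (by linarith) hε
    have cG : ∀ r : ℝ, Continuous fun t : ℝ => (‖expSum S k c (t * Complex.I)‖ ^ 2 + ε) ^ r :=
      fun r => Continuous.rpow_const (((continuous_norm.comp ((continuous_expSum S k c).comp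
        (by fun_prop))).pow 2).add continuous_const) fun t => Or.inl (by positivity)
    have cR : Continuous fun t : ℝ => (expSum S k c (t * Complex.I)).re ^ 2 + ε :=
      (((Complex.continuous_re.comp ((continuous_expSum S k c).comp
        (by fun_prop))).pow 2)).add continuous_const
    have cX : Continuous fun t : ℝ => ((expSum S k c (t * Complex.I)).re ^ 2 + ε) ^ (p / 2) :=
      Continuous.rpow_const cR fun t => Or.inl (by positivity)
    -- Half of the integral of the full modulus appears on the right and is absorbed into the left
    -- side; the remaining factor 1/2 then cancels, leaving (p²)^(p/2).
    have h2 : 2 * (p / 2) ^ 2 * ∫ t in (0 : ℝ)..2 * Real.pi,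
        ((expSum S k c (t * Complex.I)).re ^ 2 + ε) *
          (‖expSum S k c (t * Complex.I)‖ ^ 2 + ε) ^ (p / 2 - 1) ≤
        1 / 2 * (∫ t in (0 : ℝ)..2 * Real.pi,
          (‖expSum S k c (t * Complex.I)‖ ^ 2 + ε) ^ (p / 2)) +
        1 / 2 * (p ^ 2) ^ (p / 2) * ∫ t in (0 : ℝ)..2 * Real.pi,
          ((expSum S k c (t * Complex.I)).re ^ 2 + ε) ^ (p / 2) := by
      rw [← intervalIntegral.integral_const_mul, ← intervalIntegral.integral_const_mul,
        ← intervalIntegral.integral_const_mul, ← intervalIntegral.integral_add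
        (((cG _).intervalIntegrable _ _).const_mul _)
        ((cX.intervalIntegrable _ _).const_mul _)]
      refine intervalIntegral.integral_mono_on hτ
        ((continuous_const.mul (cR.mul (cG _))).intervalIntegrable _ _)
        (((continuous_const.mul (cG _)).add (continuous_const.mul cX)).intervalIntegrable _ _)
        fun t _ => ?_
      have := young_large (r := p / 2) (x := (expSum S k c (t * Complex.I)).re ^ 2 + ε)
        (g := ‖expSum S k c (t * Complex.I)‖ ^ 2 + ε) (by linarith) (by positivity) ?_
      · rwa [show 4 * (p / 2) ^ 2 = p ^ 2 by ring] at this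
      · have := sq_abs (expSum S k c (t * Complex.I)).re
        have h3 := Complex.abs_re_le_norm (expSum S k c (t * Complex.I))
        have h4 := pow_le_pow_left₀ (abs_nonneg _) h3 2
        linarith
    linarith

/-- The theorem of M. Riesz for analytic trigonometric polynomials without constant term. -/
theorem riesz_analytic (S : Finset ι) {k : ι → ℕ} (hk : ∀ i ∈ S, 1 ≤ k i) (c : ι → ℂ) {p : ℝ}
    (hp : 1 < p) :
    ∫ t in (0 : ℝ)..2 * Real.pi, ‖expSum S k c (t * Complex.I)‖ ^ p ≤
      rieszConst p * ∫ t in (0 : ℝ)..2 * Real.pi, |(expSum S k c (t * Complex.I)).re| ^ p := by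
  have hτ : (0 : ℝ) ≤ 2 * Real.pi := by positivity
  have lim : ∀ f : ℝ → ℝ, Continuous f →
      Tendsto (fun ε : ℝ => ∫ t in (0 : ℝ)..2 * Real.pi, (f t ^ 2 + ε) ^ (p / 2)) (𝓝[>] 0)
        (𝓝 (∫ t in (0 : ℝ)..2 * Real.pi, |f t| ^ p)) := by
    intro f hf
    have e : (∫ t in (0 : ℝ)..2 * Real.pi, |f t| ^ p) =
        ∫ t in (0 : ℝ)..2 * Real.pi, (f t ^ 2 + 0) ^ (p / 2) := by
      refine intervalIntegral.integral_congr fun t _ => ?_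
      simp only [add_zero]
      rw [← sq_abs, ← Real.rpow_natCast, ← Real.rpow_mul (abs_nonneg _)]
      congr 1
      push_cast
      ring
    rw [e]
    -- The regularization is removed by letting ε → 0; continuity at ε = 0 holds since the exponent
    -- p/2 is positive.
    have hc : Continuous fun ε : ℝ => ∫ t in (0 : ℝ)..2 * Real.pi, (f t ^ 2 + ε) ^ (p / 2) := by
      refine intervalIntegral.continuous_parametric_intervalIntegral_of_continuous' ?_ _ _
      refine Continuous.rpow_const (by fun_prop) fun q => Or.inr (by linarith)
    exact (hc.tendsto 0).mono_left nhdsWithin_le_nhds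
  have l1 := lim (fun t => ‖expSum S k c (t * Complex.I)‖)
    (continuous_norm.comp ((continuous_expSum S k c).comp (by fun_prop)))
  have l2 := (lim (fun t => (expSum S k c (t * Complex.I)).re)
    (Complex.continuous_re.comp ((continuous_expSum S k c).comp (by fun_prop)))).const_mul
      (rieszConst p)
  simp only [abs_norm] at l1
  exact le_of_tendsto_of_tendsto l1 l2 (eventually_nhdsWithin_of_forall fun ε hε =>
    riesz_regularized S hk c hp hε)

end Riesz

/-! ### Sign multipliers on the circle and on the torus -/

theorem norm_sub_rpow_le {p : ℝ} (hp : 1 ≤ p) {a b : ℝ} (ha : 0 ≤ a) (hb : 0 ≤ b) :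
    (a + b) ^ p ≤ 2 ^ (p - 1) * (a ^ p + b ^ p) := by
  lift a to ℝ≥0 using ha
  lift b to ℝ≥0 using hb
  exact_mod_cast NNReal.rpow_add_le_mul_rpow_add_rpow a b hp

/-- The constant for sign multipliers. -/
def signConst (p : ℝ) : ℝ := 2 ^ p * rieszConst p

theorem rieszConst_nonneg {p : ℝ} (hp : 1 < p) : 0 ≤ rieszConst p :=
  le_max_of_le_left (by have : 0 < p - 1 := by linarith
                        positivity)

theorem signConst_nonneg {p : ℝ} (hp : 1 < p) : 0 ≤ signConst p :=
  mul_nonneg (by positivity) (rieszConst_nonneg hp)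

section Circle

variable {ι : Type*}

/-- The coefficients of the analytic function with the same real part as `∑ c_i exp(i k_i t)`. -/
def analyticCoeff (k : ι → ℤ) (c : ι → ℂ) (i : ι) : ℂ :=
  if 0 < k i then c i else (starRingEnd ℂ) (c i)

theorem analyticTerm_pos {k : ι → ℤ} (c : ι → ℂ) {i : ι} (h : 0 < k i) (t : ℝ) :
    analyticCoeff k c i * Complex.exp (((k i).natAbs : ℂ) * (t * Complex.I)) =
      c i * Complex.exp (k i * (t * Complex.I)) := by
  have : (((k i).natAbs : ℤ) : ℂ) = (k i : ℂ) := by rw [Int.natAbs_of_nonneg h.le]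
  rw [analyticCoeff, if_pos h, ← this, Int.cast_natCast]

theorem analyticTerm_neg {k : ι → ℤ} (c : ι → ℂ) {i : ι} (h : k i < 0) (t : ℝ) :
    analyticCoeff k c i * Complex.exp (((k i).natAbs : ℂ) * (t * Complex.I)) =
      (starRingEnd ℂ) (c i * Complex.exp (k i * (t * Complex.I))) := by
  have : (((k i).natAbs : ℤ) : ℂ) = -(k i : ℂ) := by
    rw [Int.ofNat_natAbs_of_nonpos h.le, Int.cast_neg]
  rw [Int.cast_natCast] at this
  rw [analyticCoeff, if_neg (not_lt.2 h.le), this, map_mul, ← Complex.exp_conj]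
  simp

theorem re_expSum_analyticCoeff (S : Finset ι) {k : ι → ℤ} (hk : ∀ i ∈ S, k i ≠ 0) (c : ι → ℂ)
    (t : ℝ) :
    (expSum S (fun i => (k i).natAbs) (analyticCoeff k c) (t * Complex.I)).re =
      (∑ i ∈ S, c i * Complex.exp (k i * (t * Complex.I))).re := by
  rw [expSum, Complex.re_sum, Complex.re_sum]
  refine Finset.sum_congr rfl fun i hi => ?_
  rcases lt_or_gt_of_ne (hk i hi) with h | h
  · rw [analyticTerm_neg c h, Complex.conj_re]
  · rw [analyticTerm_pos c h]

/-- Let f be the given sum, F and G the analytic sums with real parts Re f and Re(−if) = Im f. The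
positive-frequency part of f is (F + iG)/2 and the negative-frequency part is the conjugate of (F −
iG)/2. The sign multiplier takes their difference. -/
theorem norm_signSum_le (S : Finset ι) {k : ι → ℤ} (hk : ∀ i ∈ S, k i ≠ 0) (c : ι → ℂ) (t : ℝ) :
    ‖∑ i ∈ S, (Real.sign (k i) : ℂ) * c i * Complex.exp (k i * (t * Complex.I))‖ ≤
      ‖expSum S (fun i => (k i).natAbs) (analyticCoeff k c) (t * Complex.I)‖ +
      ‖expSum S (fun i => (k i).natAbs) (analyticCoeff k fun i => -Complex.I * c i)
        (t * Complex.I)‖ := by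
  set F := expSum S (fun i => (k i).natAbs) (analyticCoeff k c) (t * Complex.I) with hF
  set G := expSum S (fun i => (k i).natAbs) (analyticCoeff k fun i => -Complex.I * c i)
        (t * Complex.I) with hG
  have e : ∑ i ∈ S, (Real.sign (k i) : ℂ) * c i * Complex.exp (k i * (t * Complex.I)) =
      2⁻¹ * (F + Complex.I * G) - (starRingEnd ℂ) (2⁻¹ * (F - Complex.I * G)) := by
    rw [hF, hG, expSum, expSum, Finset.mul_sum, ← Finset.sum_add_distrib, ← Finset.sum_sub_distrib,
      Finset.mul_sum, Finset.mul_sum, map_sum, ← Finset.sum_sub_distrib]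
    refine Finset.sum_congr rfl fun i hi => ?_
    rcases lt_or_gt_of_ne (hk i hi) with h | h
    · rw [analyticTerm_neg c h, analyticTerm_neg _ h, Real.sign_of_neg (by exact_mod_cast h)]
      simp only [map_mul, map_neg, map_sub, Complex.conj_I, Complex.conj_conj, map_inv₀,
        Complex.conj_ofNat]
      push_cast
      linear_combination (-(1 / 2) * (c i * Complex.exp (k i * (t * Complex.I))) - (1 / 2) *
        ((starRingEnd ℂ) (c i) * (starRingEnd ℂ) (Complex.exp (k i * (t * Complex.I))))) *
        Complex.I_sq
    · rw [analyticTerm_pos c h, analyticTerm_pos _ h, Real.sign_of_pos (by exact_mod_cast h)]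
      simp only [map_mul, map_neg, map_sub, Complex.conj_I, map_inv₀,
        Complex.conj_ofNat]
      push_cast
      linear_combination ((1 / 2) * (c i * Complex.exp (k i * (t * Complex.I))) + (1 / 2) *
        ((starRingEnd ℂ) (c i) * (starRingEnd ℂ) (Complex.exp (k i * (t * Complex.I))))) *
        Complex.I_sq
  have h1 : ‖F + Complex.I * G‖ ≤ ‖F‖ + ‖G‖ := (norm_add_le _ _).trans (by simp)
  have h2 : ‖F - Complex.I * G‖ ≤ ‖F‖ + ‖G‖ := (norm_sub_le _ _).trans (by simp)
  rw [e]
  refine (norm_sub_le _ _).trans ?_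
  rw [RCLike.norm_conj, norm_mul, norm_mul]
  norm_num
  linarith

/-- Sign multipliers are bounded in `L^p` of the circle. -/
theorem riesz_sign (S : Finset ι) {k : ι → ℤ} (hk : ∀ i ∈ S, k i ≠ 0) (c : ι → ℂ) {p : ℝ}
    (hp : 1 < p) :
    ∫ t in (0 : ℝ)..2 * Real.pi,
        ‖∑ i ∈ S, (Real.sign (k i) : ℂ) * c i * Complex.exp (k i * (t * Complex.I))‖ ^ p ≤
      signConst p * ∫ t in (0 : ℝ)..2 * Real.pi,
        ‖∑ i ∈ S, c i * Complex.exp (k i * (t * Complex.I))‖ ^ p := by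
  have hτ : (0 : ℝ) ≤ 2 * Real.pi := by positivity
  have hp0 : 0 ≤ p := by linarith
  have hk' : ∀ i ∈ S, 1 ≤ (k i).natAbs := fun i hi => Int.natAbs_pos.2 (hk i hi)
  have cont : ∀ f : ℝ → ℂ, Continuous f → IntervalIntegrable (fun t => ‖f t‖ ^ p) volume 0
      (2 * Real.pi) := fun f hf =>
    (hf.norm.rpow_const fun _ => Or.inr hp0).intervalIntegrable _ _
  have cE : ∀ c : ι → ℂ, Continuous fun t : ℝ =>
      expSum S (fun i => (k i).natAbs) (analyticCoeff k c) (t * Complex.I) := fun c =>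
    (continuous_expSum S _ _).comp (by fun_prop)
  have cf : ∀ c : ι → ℂ, Continuous fun t : ℝ =>
      ∑ i ∈ S, c i * Complex.exp (k i * (t * Complex.I)) := fun c => by fun_prop
  -- Stated for a general c' so as to apply to c and to −ic: both give sums of the same modulus,
  -- which dominates the real part seen by the theorem of M. Riesz.
  have one : ∀ c' : ι → ℂ, (∀ i, ‖c' i‖ = ‖c i‖) → (∀ t : ℝ,
      ‖∑ i ∈ S, c' i * Complex.exp (k i * (t * Complex.I))‖ =
        ‖∑ i ∈ S, c i * Complex.exp (k i * (t * Complex.I))‖) →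
      ∫ t in (0 : ℝ)..2 * Real.pi,
        ‖expSum S (fun i => (k i).natAbs) (analyticCoeff k c') (t * Complex.I)‖ ^ p ≤
      rieszConst p * ∫ t in (0 : ℝ)..2 * Real.pi,
        ‖∑ i ∈ S, c i * Complex.exp (k i * (t * Complex.I))‖ ^ p := fun c' _ h => by
    refine (riesz_analytic S hk' (analyticCoeff k c') hp).trans
      (mul_le_mul_of_nonneg_left ?_ (rieszConst_nonneg hp))
    refine intervalIntegral.integral_mono_on hτ ?_ (cont _ (cf c)) fun t _ => ?_
    · exact ((Complex.continuous_re.comp (cE c')).abs.rpow_const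
        fun _ => Or.inr hp0).intervalIntegrable _ _
    · rw [re_expSum_analyticCoeff S hk, ← h t]
      exact Real.rpow_le_rpow (abs_nonneg _) (Complex.abs_re_le_norm _) hp0
  have h1 := one c (fun _ => rfl) fun _ => rfl
  have h2 := one (fun i => -Complex.I * c i) (fun i => by simp) fun t => by
    simp only [mul_assoc, ← Finset.mul_sum]
    simp
  calc _ ≤ ∫ t in (0 : ℝ)..2 * Real.pi, 2 ^ (p - 1) *
        (‖expSum S (fun i => (k i).natAbs) (analyticCoeff k c) (t * Complex.I)‖ ^ p +
        ‖expSum S (fun i => (k i).natAbs) (analyticCoeff k fun i => -Complex.I * c i)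
          (t * Complex.I)‖ ^ p) := by
        refine intervalIntegral.integral_mono_on hτ (cont _ (by fun_prop))
          (((cont _ (cE c)).add (cont _ (cE _))).const_mul _) fun t _ => ?_
        exact (Real.rpow_le_rpow (norm_nonneg _) (norm_signSum_le S hk c t) hp0).trans
          (norm_sub_rpow_le hp.le (norm_nonneg _) (norm_nonneg _))
    _ ≤ _ := by
        rw [intervalIntegral.integral_const_mul,
          intervalIntegral.integral_add (cont _ (cE c)) (cont _ (cE _)), signConst]
        have e : (2 : ℝ) ^ p = 2 ^ (p - 1) * 2 := by
          rw [← Real.rpow_add_one two_ne_zero, sub_add_cancel]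
        have h3 : (0 : ℝ) ≤ 2 ^ (p - 1) := by positivity
        rw [e]
        nlinarith [mul_le_mul_of_nonneg_left (add_le_add h1 h2) h3]

end Circle

section TorusMultiplier

variable {d : ℕ}

/-- The translation of the torus by a real vector. -/
def toTorus (y : Fin d → ℝ) : Torus d := fun i => (y i : UnitAddCircle)

theorem continuous_toTorus : Continuous (toTorus (d := d)) :=
  continuous_pi fun i => (AddCircle.continuous_mk' 1).comp (continuous_apply i)

theorem mFourier_toTorus (z : Fin d → ℤ) (y : Fin d → ℝ) :
    UnitAddTorus.mFourier z (toTorus y) =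
      Complex.exp (2 * Real.pi * Complex.I * ∑ i, (z i : ℂ) * y i) := by
  simp only [UnitAddTorus.mFourier, ContinuousMap.coe_mk, toTorus]
  rw [Finset.mul_sum, Complex.exp_sum]
  refine Finset.prod_congr rfl fun i _ => ?_
  rw [fourier_coe_apply]
  congr 1
  push_cast
  ring

theorem mFourier_add_apply (z : Fin d → ℤ) (x y : Torus d) :
    UnitAddTorus.mFourier z (x + y) = UnitAddTorus.mFourier z x * UnitAddTorus.mFourier z y := by
  simp only [UnitAddTorus.mFourier, ContinuousMap.coe_mk, ← Finset.prod_mul_distrib]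
  refine Finset.prod_congr rfl fun i _ => ?_
  simp [fourier_apply, AddCircle.toCircle_add]

theorem integrable_torus {F : Type*} [NormedAddCommGroup F] {f : Torus d → F} (hf : Continuous f) :
    Integrable f (torusVol d) :=
  hf.integrable_of_hasCompactSupport (HasCompactSupport.of_compactSpace f)

theorem integral_torus_add_right {F : Type*} [NormedAddCommGroup F] [NormedSpace ℝ F]
    (f : Torus d → F) (y : Torus d) :
    ∫ x, f (x + y) ∂(torusVol d) = ∫ x, f x ∂(torusVol d) :=
  integral_add_right_eq_self f y

/-- The trigonometric polynomial with coefficients `c` on `S`. -/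
def trigSum (S : Finset (Fin d → ℤ)) (c : (Fin d → ℤ) → ℂ) (x : Torus d) : ℂ :=
  ∑ z ∈ S, c z * UnitAddTorus.mFourier z x

@[fun_prop]
theorem continuous_trigSum (S : Finset (Fin d → ℤ)) (c : (Fin d → ℤ) → ℂ) :
    Continuous (trigSum S c) := by
  unfold trigSum; fun_prop

theorem norm_mFourier_apply (z : Fin d → ℤ) (x : Torus d) : ‖UnitAddTorus.mFourier z x‖ = 1 := by
  simp only [UnitAddTorus.mFourier, ContinuousMap.coe_mk, norm_prod, fourier_apply, Circle.norm_coe,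
    Finset.prod_const_one]

theorem norm_trigSum_le (S : Finset (Fin d → ℤ)) (c : (Fin d → ℤ) → ℂ) (x : Torus d) :
    ‖trigSum S c x‖ ≤ ∑ z ∈ S, ‖c z‖ :=
  (norm_sum_le _ _).trans (Finset.sum_le_sum fun z _ => by
    rw [norm_mul, norm_mFourier_apply, mul_one])

theorem continuous_norm_trigSum_rpow (S : Finset (Fin d → ℤ)) (c : (Fin d → ℤ) → ℂ) {p : ℝ}
    (hp : 0 ≤ p) : Continuous fun x => ‖trigSum S c x‖ ^ p :=
  (continuous_trigSum S c).norm.rpow_const fun _ => Or.inr hp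

/-- Transference: restricted to the line x + tΘ/(2π) and multiplied by e^{imt}, which does not
change the modulus, the polynomial becomes an exponential sum in t with the integer frequencies z·Θ
+ m. The bound on the circle holds for each x; averaging over x removes the translation. -/
theorem sign_multiplier_int {p : ℝ} (hp : 1 < p) (S : Finset (Fin d → ℤ)) (c : (Fin d → ℤ) → ℂ)
    (Θ : Fin d → ℤ) (m : ℤ) (h : ∀ z ∈ S, ∑ i, z i * Θ i + m ≠ 0) :
    ∫ x, ‖trigSum S (fun z => (Real.sign ((∑ i, z i * Θ i + m : ℤ) : ℝ) : ℂ) * c z) x‖ ^ p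
        ∂(torusVol d) ≤
      signConst p * ∫ x, ‖trigSum S c x‖ ^ p ∂(torusVol d) := by
  have hp0 : 0 ≤ p := by linarith
  have hτ : (0 : ℝ) < 2 * Real.pi := by positivity
  set k : (Fin d → ℤ) → ℤ := fun z => ∑ i, z i * Θ i + m with hk
  let g : ((Fin d → ℤ) → ℂ) → Torus d → ℝ → ℂ := fun c x t =>
    ∑ z ∈ S, c z * UnitAddTorus.mFourier z x * Complex.exp (k z * (t * Complex.I))
  have slice : ∀ (c : (Fin d → ℤ) → ℂ) (x : Torus d) (t : ℝ),
      ‖g c x t‖ = ‖trigSum S c (x + toTorus fun i => t / (2 * Real.pi) * Θ i)‖ := by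
    intro c x t
    have e : g c x t = Complex.exp (m * (t * Complex.I)) *
        trigSum S c (x + toTorus fun i => t / (2 * Real.pi) * Θ i) := by
      simp only [g, trigSum, Finset.mul_sum]
      refine Finset.sum_congr rfl fun z _ => ?_
      have hπ : (Real.pi : ℂ) ≠ 0 := by exact_mod_cast Real.pi_ne_zero
      have e2 : Complex.exp (k z * (t * Complex.I)) = Complex.exp (m * (t * Complex.I)) *
          Complex.exp (2 * Real.pi * Complex.I * ∑ i, (z i : ℂ) *
            ((t / (2 * Real.pi) * Θ i : ℝ) : ℂ)) := by
        rw [← Complex.exp_add]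
        congr 1
        have : ∑ i, (z i : ℂ) * ((t / (2 * Real.pi) * Θ i : ℝ) : ℂ) =
            t / (2 * Real.pi) * ∑ i, (z i : ℂ) * Θ i := by
          rw [Finset.mul_sum]
          refine Finset.sum_congr rfl fun i _ => ?_
          push_cast; ring
        rw [this, hk]
        push_cast
        field_simp
        ring
      rw [e2, mFourier_add_apply, mFourier_toTorus]
      ring
    rw [e, norm_mul, show (m : ℂ) * (t * Complex.I) = ((m * t : ℝ) : ℂ) * Complex.I by
      push_cast; ring, Complex.norm_exp_ofReal_mul_I, one_mul]
  have cg : ∀ c : (Fin d → ℤ) → ℂ, Continuous fun q : Torus d × ℝ => ‖g c q.1 q.2‖ ^ p :=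
    fun c => Continuous.rpow_const (by fun_prop) fun _ => Or.inr hp0
  have bg : ∀ (c : (Fin d → ℤ) → ℂ) x t, ‖‖g c x t‖ ^ p‖ ≤ (∑ z ∈ S, ‖c z‖) ^ p := by
    intro c x t
    rw [Real.norm_of_nonneg (by positivity), slice]
    exact Real.rpow_le_rpow (norm_nonneg _) (norm_trigSum_le _ _ _) hp0
  have avg : ∀ c : (Fin d → ℤ) → ℂ, ∫ x, (∫ t in (0 : ℝ)..2 * Real.pi, ‖g c x t‖ ^ p) ∂(torusVol d) =
      2 * Real.pi * ∫ x, ‖trigSum S c x‖ ^ p ∂(torusVol d) := by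
    intro c
    simp only [intervalIntegral.integral_of_le hτ.le]
    rw [integral_integral_swap]
    · have : ∀ t : ℝ, ∫ x, ‖g c x t‖ ^ p ∂(torusVol d) = ∫ x, ‖trigSum S c x‖ ^ p ∂(torusVol d) := by
        intro t
        simp only [slice]
        exact integral_torus_add_right (fun x => ‖trigSum S c x‖ ^ p) _
      simp only [this]
      simp [hτ.le]
    · exact Integrable.of_bound (cg c).aestronglyMeasurable ((∑ z ∈ S, ‖c z‖) ^ p)
        (Eventually.of_forall fun q => bg c q.1 q.2)
  have cint : ∀ c : (Fin d → ℤ) → ℂ,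
      Continuous fun x => ∫ t in (0 : ℝ)..2 * Real.pi, ‖g c x t‖ ^ p := fun c =>
    intervalIntegral.continuous_parametric_intervalIntegral_of_continuous' (cg c) _ _
  have key : ∫ x, (∫ t in (0 : ℝ)..2 * Real.pi,
        ‖g (fun z => (Real.sign ((∑ i, z i * Θ i + m : ℤ) : ℝ) : ℂ) * c z) x t‖ ^ p) ∂(torusVol d) ≤
      ∫ x, (signConst p * ∫ t in (0 : ℝ)..2 * Real.pi, ‖g c x t‖ ^ p) ∂(torusVol d) := by
    refine integral_mono (integrable_torus (cint _)) (integrable_torus (continuous_const.mul (cint _)))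
      fun x => ?_
    have := riesz_sign S (k := k) h (fun z => c z * UnitAddTorus.mFourier z x) hp
    simpa only [g, hk, mul_assoc] using! this
  rw [integral_const_mul, avg, avg] at key
  have : 2 * Real.pi * (∫ x, ‖trigSum S
      (fun z => (Real.sign ((∑ i, z i * Θ i + m : ℤ) : ℝ) : ℂ) * c z) x‖ ^ p ∂(torusVol d)) ≤
      2 * Real.pi * (signConst p * ∫ x, ‖trigSum S c x‖ ^ p ∂(torusVol d)) := by linarith
  exact le_of_mul_le_mul_left this hτ

theorem tendsto_floor_nat_mul_div (a : ℝ) :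
    Tendsto (fun N : ℕ => (⌊(N : ℝ) * a⌋ : ℝ) / N) atTop (𝓝 a) := by
  have h1 : Tendsto (fun N : ℕ => a - 1 / (N : ℝ)) atTop (𝓝 a) := by
    simpa using (tendsto_const_nhds (x := a)).sub (tendsto_one_div_atTop_nhds_zero_nat (𝕜 := ℝ))
  refine tendsto_of_tendsto_of_tendsto_of_le_of_le' h1 tendsto_const_nhds ?_ ?_
  · filter_upwards [eventually_gt_atTop 0] with N hN
    have : (0 : ℝ) < N := by exact_mod_cast hN
    rw [le_div_iff₀ this, sub_mul, one_div_mul_cancel this.ne']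
    linarith [Int.sub_one_lt_floor ((N : ℝ) * a)]
  · filter_upwards [eventually_gt_atTop 0] with N hN
    have : (0 : ℝ) < N := by exact_mod_cast hN
    rw [div_le_iff₀ this]
    linarith [Int.floor_le ((N : ℝ) * a)]

/-- Only finitely many frequencies occur and none of the values z·θ + s is zero, so all signs are
unchanged when θ and s are replaced by ⌊Nθ⌋/N and ⌊Ns⌋/N with N large. The factor 1/N does not
affect the sign, which leaves integer data and the same constant. -/
theorem sign_multiplier {p : ℝ} (hp : 1 < p) (S : Finset (Fin d → ℤ)) (c : (Fin d → ℤ) → ℂ)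
    (θ : Fin d → ℝ) (s : ℝ) (h : ∀ z ∈ S, ∑ i, (z i : ℝ) * θ i + s ≠ 0) :
    ∫ x, ‖trigSum S (fun z => (Real.sign (∑ i, (z i : ℝ) * θ i + s) : ℂ) * c z) x‖ ^ p
        ∂(torusVol d) ≤
      signConst p * ∫ x, ‖trigSum S c x‖ ^ p ∂(torusVol d) := by
  have lim : ∀ z : Fin d → ℤ, Tendsto (fun N : ℕ =>
      ∑ i, (z i : ℝ) * ((⌊(N : ℝ) * θ i⌋ : ℝ) / N) + (⌊(N : ℝ) * s⌋ : ℝ) / N) atTop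
      (𝓝 (∑ i, (z i : ℝ) * θ i + s)) := fun z =>
    (tendsto_finsetSum _ fun i _ => (tendsto_floor_nat_mul_div (θ i)).const_mul _).add
      (tendsto_floor_nat_mul_div s)
  have hfac : ∀ (z : Fin d → ℤ) (N : ℕ),
      ∑ i, (z i : ℝ) * ((⌊(N : ℝ) * θ i⌋ : ℝ) / N) + (⌊(N : ℝ) * s⌋ : ℝ) / N =
      ((∑ i, z i * ⌊(N : ℝ) * θ i⌋ + ⌊(N : ℝ) * s⌋ : ℤ) : ℝ) / N := by
    intro z N
    push_cast
    rw [add_div, Finset.sum_div]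
    simp only [mul_div_assoc]
  have ev : ∀ᶠ N : ℕ in atTop, ∀ z ∈ S,
      (∑ i, z i * ⌊(N : ℝ) * θ i⌋ + ⌊(N : ℝ) * s⌋ ≠ 0) ∧
      Real.sign ((∑ i, z i * ⌊(N : ℝ) * θ i⌋ + ⌊(N : ℝ) * s⌋ : ℤ) : ℝ) =
        Real.sign (∑ i, (z i : ℝ) * θ i + s) := by
    rw [Filter.eventually_all_finset]
    intro z hz
    rcases lt_or_gt_of_ne (h z hz) with hneg | hpos
    · filter_upwards [(lim z).eventually (gt_mem_nhds hneg), eventually_gt_atTop 0] with N h1 hN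
      have hN' : (0 : ℝ) < N := by exact_mod_cast hN
      rw [hfac, div_lt_iff₀ hN', zero_mul] at h1
      exact ⟨fun h0 => by rw [h0] at h1; simp at h1,
        by rw [Real.sign_of_neg h1, Real.sign_of_neg hneg]⟩
    · filter_upwards [(lim z).eventually (lt_mem_nhds hpos), eventually_gt_atTop 0] with N h1 hN
      have hN' : (0 : ℝ) < N := by exact_mod_cast hN
      rw [hfac, lt_div_iff₀ hN', zero_mul] at h1
      exact ⟨fun h0 => by rw [h0] at h1; simp at h1,
        by rw [Real.sign_of_pos h1, Real.sign_of_pos hpos]⟩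
  obtain ⟨N, hN⟩ := ev.exists
  have := sign_multiplier_int hp S c (fun i => ⌊(N : ℝ) * θ i⌋) ⌊(N : ℝ) * s⌋
    fun z hz => (hN z hz).1
  refine le_of_eq_of_le ?_ this
  congr 1
  ext x
  congr 2
  exact Finset.sum_congr rfl fun z hz => by beta_reduce; rw [(hN z hz).2]

end TorusMultiplier

/-! ### The method of rotations -/

section Rotation

variable {κ : Type*} [Fintype κ]

/-- The unit ball of a Euclidean space. -/
abbrev unitBall (κ : Type*) [Fintype κ] : Set (EuclideanSpace ℝ κ) := Metric.ball 0 1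

theorem measurable_sign : Measurable Real.sign := by
  unfold Real.sign
  exact Measurable.ite measurableSet_Iio measurable_const
    (Measurable.ite measurableSet_Ioi measurable_const measurable_const)

theorem abs_sign_le (r : ℝ) : |Real.sign r| ≤ 1 := by
  rcases Real.sign_apply_eq r with h | h | h <;> simp [h]

theorem measurable_sign_inner (w : EuclideanSpace ℝ κ) :
    Measurable fun g : EuclideanSpace ℝ κ => Real.sign ⟪w, g⟫_ℝ :=
  measurable_sign.comp (by fun_prop)

theorem integrable_sign_smul (w : EuclideanSpace ℝ κ) :
    IntegrableOn (fun g : EuclideanSpace ℝ κ => Real.sign ⟪w, g⟫_ℝ • g) (unitBall κ) := by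
  refine Measure.integrableOn_of_bounded (M := 1) measure_ball_lt_top.ne
    ((measurable_sign_inner w).smul measurable_id).aestronglyMeasurable ?_
  filter_upwards [ae_restrict_mem measurableSet_ball] with g hg
  rw [norm_smul, Real.norm_eq_abs]
  exact mul_le_one₀ (abs_sign_le _) (norm_nonneg _) (mem_ball_zero_iff.1 hg).le

/-- The mean of `sign ⟨w, g⟩ g` over the unit ball. -/
def signMean (w : EuclideanSpace ℝ κ) : EuclideanSpace ℝ κ :=
  ∫ g in unitBall κ, Real.sign ⟪w, g⟫_ℝ • g

/-- The unit ball and Lebesgue measure are invariant under linear isometries. With positive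
homogeneity of degree 0 this forces the mean to be a multiple of the unit vector w/|w|. -/
theorem signMean_isometry (ρ : EuclideanSpace ℝ κ ≃ₗᵢ[ℝ] EuclideanSpace ℝ κ)
    (w : EuclideanSpace ℝ κ) : signMean (ρ w) = ρ (signMean w) := by
  have h1 : ∫ g in unitBall κ, Real.sign ⟪ρ w, g⟫_ℝ • g =
      ∫ g in ρ ⁻¹' unitBall κ, Real.sign ⟪ρ w, ρ g⟫_ℝ • ρ g :=
    (ρ.measurePreserving.setIntegral_preimage_emb ρ.toMeasurableEquiv.measurableEmbedding _ _).symm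
  have h2 : ρ ⁻¹' unitBall κ = unitBall κ := by
    ext g; simp
  have h3 := (ρ.toContinuousLinearEquiv : EuclideanSpace ℝ κ →L[ℝ] EuclideanSpace ℝ κ).integral_comp_comm
    (integrable_sign_smul w)
  rw [signMean, h1, h2, signMean]
  simp only [ρ.inner_map_map]
  rw [show ρ (∫ g in unitBall κ, Real.sign ⟪w, g⟫_ℝ • g) = _ from h3.symm]
  simp

theorem signMean_smul {r : ℝ} (hr : 0 < r) (w : EuclideanSpace ℝ κ) :
    signMean (r • w) = signMean w := by
  have : ∀ x : ℝ, Real.sign (r * x) = Real.sign x := fun x => by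
    rcases lt_trichotomy x 0 with h | h | h
    · rw [Real.sign_of_neg h, Real.sign_of_neg (mul_neg_of_pos_of_neg hr h)]
    · simp [h]
    · rw [Real.sign_of_pos h, Real.sign_of_pos (mul_pos hr h)]
  simp only [signMean, real_inner_smul_left, this]

section

variable [DecidableEq κ]

/-- The normalizing constant in the method of rotations. -/
def rotConst (k : κ) : ℝ := ∫ g in unitBall κ, |g k|

theorem signMean_single (k : κ) :
    signMean (EuclideanSpace.single k (1 : ℝ)) = rotConst k • EuclideanSpace.single k (1 : ℝ) := by
  have comp : ∀ j, (signMean (EuclideanSpace.single k (1 : ℝ))) j =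
      ∫ g in unitBall κ, Real.sign (g k) * g j := by
    intro j
    have := (EuclideanSpace.proj j : EuclideanSpace ℝ κ →L[ℝ] ℝ).integral_comp_comm
      (integrable_sign_smul (EuclideanSpace.single k (1 : ℝ)))
    rw [signMean]
    simpa [EuclideanSpace.inner_single_left] using! this.symm
  ext j
  rcases eq_or_ne j k with rfl | hj
  · rw [comp]
    simp only [rotConst, PiLp.smul_apply, PiLp.single_apply, if_true, smul_eq_mul, mul_one]
    congr 1
    ext g
    rcases lt_trichotomy (g j) 0 with h | h | h
    · rw [Real.sign_of_neg h, abs_of_neg h]; ring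
    · simp [h]
    · rw [Real.sign_of_pos h, abs_of_pos h]; ring
  -- The reflection that flips the j-th axis fixes the k-th basis vector, so the j-th component of
  -- the mean equals its own negative.
  · let ρ := Submodule.reflection (ℝ ∙ (EuclideanSpace.single j (1 : ℝ)))ᗮ
    have e1 : ρ (EuclideanSpace.single k (1 : ℝ)) = EuclideanSpace.single k (1 : ℝ) := by
      refine Submodule.reflection_mem_subspace_eq_self ?_
      rw [Submodule.mem_orthogonal_singleton_iff_inner_right]
      simp [EuclideanSpace.inner_single_left, hj]
    have e2 : ρ (EuclideanSpace.single j (1 : ℝ)) = -EuclideanSpace.single j (1 : ℝ) :=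
      Submodule.reflection_orthogonalComplement_singleton_eq_neg _
    have e3 := signMean_isometry ρ (EuclideanSpace.single k (1 : ℝ))
    rw [e1] at e3
    have e4 : ⟪signMean (EuclideanSpace.single k (1 : ℝ)), EuclideanSpace.single j (1 : ℝ)⟫_ℝ =
        -⟪signMean (EuclideanSpace.single k (1 : ℝ)), EuclideanSpace.single j (1 : ℝ)⟫_ℝ := by
      have := ρ.inner_map_map (signMean (EuclideanSpace.single k (1 : ℝ)))
        (EuclideanSpace.single j (1 : ℝ))
      rw [← e3, e2, inner_neg_right] at this
      linarith
    have e5 : ⟪signMean (EuclideanSpace.single k (1 : ℝ)), EuclideanSpace.single j (1 : ℝ)⟫_ℝ = 0 := by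
      linarith
    rw [EuclideanSpace.inner_single_right] at e5
    simpa [hj] using e5

/-- A reflection carries the k-th basis vector to w/|w|. Hence the vector w/|w| is a mean of sign
functions of w, which is the content of the method of rotations. -/
theorem signMean_eq (k : κ) {w : EuclideanSpace ℝ κ} (hw : w ≠ 0) :
    signMean w = (rotConst k / ‖w‖) • w := by
  have hn : 0 < ‖w‖ := norm_pos_iff.2 hw
  have h : ‖EuclideanSpace.single k (1 : ℝ)‖ = ‖‖w‖⁻¹ • w‖ := by
    rw [norm_smul, norm_inv, norm_norm, inv_mul_cancel₀ hn.ne']; simp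
  have e := Submodule.reflection_sub h
  set ρ := Submodule.reflection (ℝ ∙ (EuclideanSpace.single k (1 : ℝ) - ‖w‖⁻¹ • w))ᗮ
  calc signMean w = signMean (‖w‖⁻¹ • w) := (signMean_smul (by positivity) w).symm
    _ = ρ (signMean (EuclideanSpace.single k (1 : ℝ))) := by rw [← e, signMean_isometry]
    _ = _ := by rw [signMean_single, map_smul, e, smul_smul, div_eq_mul_inv]

end

theorem volume_inner_ne_zero {w : EuclideanSpace ℝ κ} (hw : w ≠ 0) :
    ∀ᵐ g : EuclideanSpace ℝ κ, ⟪w, g⟫_ℝ ≠ 0 := by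
  have h : (ℝ ∙ w)ᗮ ≠ ⊤ := by
    intro h
    have : w ∈ (ℝ ∙ w)ᗮ := by rw [h]; trivial
    rw [Submodule.mem_orthogonal_singleton_iff_inner_right, inner_self_eq_zero] at this
    exact hw this
  have := Measure.addHaar_submodule volume _ h
  refine measure_mono_null (fun g hg => ?_) this
  simpa [Submodule.mem_orthogonal_singleton_iff_inner_right] using hg

theorem rotConst_pos [DecidableEq κ] (k : κ) : 0 < rotConst k := by
  have hint : IntegrableOn (fun g : EuclideanSpace ℝ κ => |g k|) (unitBall κ) := by
    refine Measure.integrableOn_of_bounded (M := 1) measure_ball_lt_top.ne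
      (by fun_prop : Continuous fun g : EuclideanSpace ℝ κ => |g k|).aestronglyMeasurable ?_
    filter_upwards [ae_restrict_mem measurableSet_ball] with g hg
    have h1 := PiLp.norm_apply_le g k
    have h2 : ‖g‖ < 1 := by simpa using hg
    simpa using h1.trans h2.le
  refine (setIntegral_pos_iff_support_of_nonneg_ae (Eventually.of_forall fun g => abs_nonneg _)
    hint).2 ?_
  have h0 : (EuclideanSpace.single k (1 : ℝ) : EuclideanSpace ℝ κ) ≠ 0 := by simp
  have hae := volume_inner_ne_zero h0
  have : volume ((Function.support fun g : EuclideanSpace ℝ κ => |g k|) ∩ unitBall κ) =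
      volume (unitBall κ) := by
    refine measure_congr ?_
    filter_upwards [hae] with g hg
    refine propext ⟨fun h => h.2, fun h => ⟨?_, h⟩⟩
    simpa [EuclideanSpace.inner_single_left] using hg
  rw [this]
  exact Metric.measure_ball_pos _ _ one_pos

end Rotation

section Multiplier

variable {d : ℕ}

/-- `m` is a Fourier multiplier on mean-zero trigonometric polynomials, bounded in `L^p`. -/
def IsMultiplier (p A : ℝ) (m : (Fin d → ℤ) → ℝ) : Prop :=
  ∀ (S : Finset (Fin d → ℤ)) (c : (Fin d → ℤ) → ℂ), 0 ∉ S →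
    ∫ x, ‖trigSum S (fun z => (m z : ℂ) * c z) x‖ ^ p ∂(torusVol d) ≤
      A * ∫ x, ‖trigSum S c x‖ ^ p ∂(torusVol d)

theorem IsMultiplier.mul {p A B : ℝ} {m m' : (Fin d → ℤ) → ℝ} (hA : 0 ≤ A)
    (h : IsMultiplier p A m) (h' : IsMultiplier p B m') :
    IsMultiplier p (A * B) fun z => m z * m' z := by
  intro S c hS
  have h1 := h S (fun z => (m' z : ℂ) * c z) hS
  have h2 := mul_le_mul_of_nonneg_left (h' S c hS) hA
  refine le_of_eq_of_le ?_ (h1.trans (h2.trans_eq (by ring)))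
  simp only [Complex.ofReal_mul, mul_assoc]

/-- The vector `(z, ε)` of `ℝ^{d+1}`. -/
def extend (ε : ℝ) (z : Fin d → ℤ) : EuclideanSpace ℝ (Option (Fin d)) :=
  WithLp.toLp 2 fun o => o.elim ε fun i => (z i : ℝ)

theorem inner_extend (ε : ℝ) (z : Fin d → ℤ) (g : EuclideanSpace ℝ (Option (Fin d))) :
    ⟪extend ε z, g⟫_ℝ = ∑ i, (z i : ℝ) * g (some i) + ε * g none := by
  simp [extend, PiLp.inner_apply, Fintype.sum_option, mul_comm, add_comm]

theorem extend_ne_zero (ε : ℝ) {z : Fin d → ℤ} (hz : z ≠ 0) : extend ε z ≠ 0 := by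
  obtain ⟨i, hi⟩ := Function.ne_iff.1 hz
  intro h
  have := congrArg (fun w : EuclideanSpace ℝ (Option (Fin d)) => w (some i)) h
  simp [extend] at this
  exact hi this

/-- The bound in the method of rotations. -/
def rotBound (d : ℕ) (p : ℝ) : ℝ :=
  ((volume : Measure (EuclideanSpace ℝ (Option (Fin d)))).real (unitBall _) /
    rotConst (none : Option (Fin d))) ^ p * signConst p

theorem rotBound_nonneg (d : ℕ) {p : ℝ} (hp : 1 < p) : 0 ≤ rotBound d p :=
  mul_nonneg (Real.rpow_nonneg (div_nonneg measureReal_nonneg (rotConst_pos _).le) _)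
    (signConst_nonneg hp)

/-- The multiplier `(z, ε) / |(z, ε)|` as a mean of sign multipliers. -/
theorem trigSum_extend_eq (ε : ℝ) (k : Option (Fin d)) (S : Finset (Fin d → ℤ))
    (c : (Fin d → ℤ) → ℂ) (hS : 0 ∉ S) (x : Torus d) :
    trigSum S (fun z => ((extend ε z k / ‖extend ε z‖ : ℝ) : ℂ) * c z) x =
      ((rotConst (none : Option (Fin d)))⁻¹ : ℂ) * ∫ g in unitBall (Option (Fin d)),
        ((g k : ℝ) : ℂ) * trigSum S (fun z => (Real.sign ⟪extend ε z, g⟫_ℝ : ℂ) * c z) x := by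
  set κ := rotConst (none : Option (Fin d)) with hκ
  have hκpos : 0 < κ := rotConst_pos _
  have hz : ∀ z ∈ S, ((extend ε z k / ‖extend ε z‖ : ℝ) : ℂ) =
      (κ⁻¹ : ℂ) * ∫ g in unitBall (Option (Fin d)),
        (((Real.sign ⟪extend ε z, g⟫_ℝ * g k : ℝ)) : ℂ) := by
    intro z hz
    have hz0 : z ≠ 0 := fun h => hS (h ▸ hz)
    have h1 := signMean_eq (none : Option (Fin d)) (extend_ne_zero ε hz0)
    have h2 := (EuclideanSpace.proj k : EuclideanSpace ℝ (Option (Fin d)) →L[ℝ] ℝ).integral_comp_comm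
      (integrable_sign_smul (extend ε z))
    have h3 : ∫ g in unitBall (Option (Fin d)), Real.sign ⟪extend ε z, g⟫_ℝ * g k =
        (signMean (extend ε z)) k := by
      simpa [signMean] using! h2
    rw [integral_complex_ofReal, h3, h1, ← hκ, ← Complex.ofReal_inv, ← Complex.ofReal_mul]
    congr 1
    simp only [PiLp.smul_apply, smul_eq_mul]
    field_simp
  have hint : ∀ z ∈ S, IntegrableOn (fun g : EuclideanSpace ℝ (Option (Fin d)) =>
      (((Real.sign ⟪extend ε z, g⟫_ℝ * g k : ℝ)) : ℂ) * (c z * UnitAddTorus.mFourier z x))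
      (unitBall _) := by
    intro z _
    refine Integrable.mul_const (Integrable.ofReal ?_) _
    have := (EuclideanSpace.proj k : EuclideanSpace ℝ (Option (Fin d)) →L[ℝ] ℝ).integrable_comp
      (integrable_sign_smul (extend ε z))
    simpa using! this
  have e : ∀ g : EuclideanSpace ℝ (Option (Fin d)),
      ((g k : ℝ) : ℂ) * trigSum S (fun z => (Real.sign ⟪extend ε z, g⟫_ℝ : ℂ) * c z) x =
      ∑ z ∈ S, (((Real.sign ⟪extend ε z, g⟫_ℝ * g k : ℝ)) : ℂ) *
        (c z * UnitAddTorus.mFourier z x) := by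
    intro g
    simp only [trigSum, Finset.mul_sum]
    refine Finset.sum_congr rfl fun z _ => ?_
    push_cast; ring
  simp only [e]
  rw [integral_finsetSum S hint, Finset.mul_sum]
  simp only [trigSum]
  refine Finset.sum_congr rfl fun z hz' => ?_
  rw [hz z hz', integral_mul_const]
  ring

/-- Jensen's inequality for the normalized measure; the powers of the total mass undo the
normalization. -/
theorem rpow_integral_le {α : Type*} [MeasurableSpace α] {ν : Measure α} [IsFiniteMeasure ν]
    {p : ℝ} (hp : 1 ≤ p) {h : α → ℝ} (hnn : ∀ a, 0 ≤ h a) (hν : 0 < ν.real Set.univ)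
    (i1 : Integrable h ν) (i2 : Integrable (fun a => h a ^ p) ν) :
    (∫ a, h a ∂ν) ^ p ≤ ν.real Set.univ ^ p * ((ν.real Set.univ)⁻¹ * ∫ a, h a ^ p ∂ν) := by
  have : NeZero ν := ⟨fun h => by simp [h] at hν⟩
  have h2 := (convexOn_rpow hp).map_average_le (μ := ν) (f := h)
    (Real.continuous_rpow_const (by linarith)).continuousOn isClosed_Ici
    (Eventually.of_forall hnn) i1 i2
  simp only [average_eq, smul_eq_mul] at h2
  have h3 : 0 ≤ ∫ a, h a ∂ν := integral_nonneg hnn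
  rw [Real.mul_rpow (by positivity) h3] at h2
  have h4 := mul_le_mul_of_nonneg_left h2 (Real.rpow_nonneg hν.le p)
  rwa [← mul_assoc, ← Real.mul_rpow hν.le (by positivity), mul_inv_cancel₀ hν.ne', Real.one_rpow,
    one_mul] at h4

section

variable (ε : ℝ) (S : Finset (Fin d → ℤ)) (c : (Fin d → ℤ) → ℂ)

/-- The sign multiplier in the direction `g`. -/
def signSum (g : EuclideanSpace ℝ (Option (Fin d))) : Torus d → ℂ :=
  trigSum S fun z => (Real.sign ⟪extend ε z, g⟫_ℝ : ℂ) * c z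

theorem norm_signSum_le_sum (g : EuclideanSpace ℝ (Option (Fin d))) (x : Torus d) :
    ‖signSum ε S c g x‖ ≤ ∑ z ∈ S, ‖c z‖ := by
  refine (norm_trigSum_le _ _ _).trans (Finset.sum_le_sum fun z _ => ?_)
  rw [norm_mul, Complex.norm_real, Real.norm_eq_abs]
  exact mul_le_of_le_one_left (norm_nonneg _) (abs_sign_le _)

theorem measurable_signSum :
    Measurable fun q : Torus d × EuclideanSpace ℝ (Option (Fin d)) => signSum ε S c q.2 q.1 := by
  simp only [signSum, trigSum]
  refine Finset.measurable_sum _ fun z _ => Measurable.mul (Measurable.mul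
    (Complex.measurable_ofReal.comp ((measurable_sign_inner _).comp measurable_snd))
    measurable_const) ?_
  exact (UnitAddTorus.mFourier z).continuous.measurable.comp measurable_fst

theorem measurable_signSum_left (x : Torus d) :
    Measurable fun g : EuclideanSpace ℝ (Option (Fin d)) => signSum ε S c g x := by
  simp only [signSum, trigSum]
  exact Finset.measurable_sum _ fun z _ => ((Complex.measurable_ofReal.comp
    (measurable_sign_inner _)).mul measurable_const).mul measurable_const

theorem integrable_norm_signSum_rpow {p : ℝ} (hp0 : 0 ≤ p)
    (ν : Measure (EuclideanSpace ℝ (Option (Fin d)))) [IsFiniteMeasure ν] :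
    Integrable (Function.uncurry fun (x : Torus d) g => ‖signSum ε S c g x‖ ^ p)
      ((torusVol d).prod ν) := by
  refine Integrable.of_bound ((measurable_signSum ε S c).norm.pow_const p).aestronglyMeasurable
    ((∑ z ∈ S, ‖c z‖) ^ p) (Eventually.of_forall fun q => ?_)
  simp only [Function.uncurry]
  rw [Real.norm_of_nonneg (by positivity)]
  exact Real.rpow_le_rpow (norm_nonneg _) (norm_signSum_le_sum _ _ _ _ _) hp0

/-- The weight in the averaging formula is a coordinate of a point of the unit ball, hence at most 1
in modulus. Jensen's inequality in the direction g then moves the power inside the mean, at a fixed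
point x of the torus. -/
theorem norm_trigSum_extend_rpow_le {p : ℝ} (hp : 1 < p) (k : Option (Fin d)) (hS : 0 ∉ S)
    {V : ℝ} (hV : V = (volume.restrict (unitBall (Option (Fin d)))).real Set.univ) (hVpos : 0 < V)
    (x : Torus d) :
    ‖trigSum S (fun z => ((extend ε z k / ‖extend ε z‖ : ℝ) : ℂ) * c z) x‖ ^ p ≤
      (rotConst (none : Option (Fin d)))⁻¹ ^ p * (V ^ p *
        (V⁻¹ * ∫ g in unitBall (Option (Fin d)), ‖signSum ε S c g x‖ ^ p)) := by
  have hp0 : 0 ≤ p := by linarith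
  set κ := rotConst (none : Option (Fin d)) with hκ
  have hκpos : 0 < κ := rotConst_pos _
  have : IsFiniteMeasure (volume.restrict (unitBall (Option (Fin d)))) :=
    ⟨by simpa using! measure_ball_lt_top⟩
  have meas : Measurable fun g => signSum ε S c g x :=
    measurable_signSum_left ε S c x
  have i1 : IntegrableOn (fun g => ‖signSum ε S c g x‖) (unitBall _) :=
    Integrable.of_bound meas.norm.aestronglyMeasurable _
      (Eventually.of_forall fun g => by simpa using norm_signSum_le_sum ε S c g x)
  have i2 : IntegrableOn (fun g => ‖signSum ε S c g x‖ ^ p) (unitBall _) :=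
    Integrable.of_bound (meas.norm.pow_const p).aestronglyMeasurable ((∑ z ∈ S, ‖c z‖) ^ p)
      (Eventually.of_forall fun g => by
        rw [Real.norm_of_nonneg (by positivity)]
        exact Real.rpow_le_rpow (norm_nonneg _) (norm_signSum_le_sum _ _ _ _ _) hp0)
  have h1 : ‖trigSum S (fun z => ((extend ε z k / ‖extend ε z‖ : ℝ) : ℂ) * c z) x‖ ≤
      κ⁻¹ * ∫ g in unitBall (Option (Fin d)), ‖signSum ε S c g x‖ := by
    rw [trigSum_extend_eq ε k S c hS x, norm_mul]
    have : ‖(κ⁻¹ : ℂ)‖ = κ⁻¹ := by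
      rw [← Complex.ofReal_inv, Complex.norm_real, Real.norm_of_nonneg (by positivity)]
    rw [this]
    refine mul_le_mul_of_nonneg_left (norm_integral_le_of_norm_le i1 ?_) (by positivity)
    filter_upwards [ae_restrict_mem measurableSet_ball] with g hg
    rw [norm_mul, Complex.norm_real]
    exact mul_le_of_le_one_left (norm_nonneg _)
      ((PiLp.norm_apply_le g k).trans (mem_ball_zero_iff.1 hg).le)
  refine (Real.rpow_le_rpow (norm_nonneg _) h1 hp0).trans ?_
  rw [Real.mul_rpow (by positivity) (integral_nonneg fun g => norm_nonneg _)]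
  refine mul_le_mul_of_nonneg_left ?_ (by positivity)
  have := rpow_integral_le hp.le (fun g => norm_nonneg (signSum ε S c g x)) (by rw [← hV]; exact hVpos) i1 i2
  rwa [← hV] at this

end

/-- The method of rotations: the components of `(z, ε) / |(z, ε)|` are bounded multipliers. -/
theorem isMultiplier_extend {p : ℝ} (hp : 1 < p) (ε : ℝ) (k : Option (Fin d)) :
    IsMultiplier p (rotBound d p) fun z => extend ε z k / ‖extend ε z‖ := by
  intro S c hS
  have hp0 : 0 ≤ p := by linarith
  set V := (volume : Measure (EuclideanSpace ℝ (Option (Fin d)))).real (unitBall _) with hV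
  set κ := rotConst (none : Option (Fin d)) with hκ
  have hκpos : 0 < κ := rotConst_pos _
  have hVpos : 0 < V := ENNReal.toReal_pos (Metric.measure_ball_pos _ _ one_pos).ne'
    measure_ball_lt_top.ne
  have : IsFiniteMeasure (volume.restrict (unitBall (Option (Fin d)))) :=
    ⟨by simpa using! measure_ball_lt_top⟩
  have hνV : (volume.restrict (unitBall (Option (Fin d)))).real Set.univ = V := by simp [V]
  have hprod := integrable_norm_signSum_rpow ε S c hp0 (volume.restrict (unitBall (Option (Fin d))))
  have swap := integral_integral_swap hprod
  have inner_le : ∫ g in unitBall (Option (Fin d)), ∫ x, ‖signSum ε S c g x‖ ^ p ∂(torusVol d) ≤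
      ∫ _g in unitBall (Option (Fin d)),
        signConst p * ∫ x, ‖trigSum S c x‖ ^ p ∂(torusVol d) := by
    refine integral_mono_ae hprod.integral_prod_right (integrable_const _) ?_
    -- Directions g orthogonal to one of the finitely many vectors (z, ε) form a null set. For all
    -- others `sign_multiplier` applies, the last coordinate of g supplying the shift s = ε g_none.
    have hae : ∀ᵐ g ∂(volume.restrict (unitBall (Option (Fin d)))), ∀ z ∈ S,
        ⟪extend ε z, g⟫_ℝ ≠ 0 := by
      rw [Filter.eventually_all_finset]
      exact fun z hz => ae_restrict_of_ae
        (volume_inner_ne_zero (extend_ne_zero ε fun h => hS (h ▸ hz)))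
    filter_upwards [hae] with g hg
    have := sign_multiplier hp S c (fun i => g (some i)) (ε * g none) fun z hz => by
      rw [← inner_extend]; exact hg z hz
    simpa only [signSum, inner_extend] using! this
  have i3 : Integrable (fun x => κ⁻¹ ^ p * (V ^ p * (V⁻¹ * ∫ g in unitBall (Option (Fin d)),
      ‖signSum ε S c g x‖ ^ p))) (torusVol d) :=
    ((hprod.integral_prod_left.const_mul _).const_mul _).const_mul _
  calc ∫ x, ‖trigSum S (fun z => ((extend ε z k / ‖extend ε z‖ : ℝ) : ℂ) * c z) x‖ ^ p ∂(torusVol d)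
      ≤ ∫ x, κ⁻¹ ^ p * (V ^ p * (V⁻¹ * ∫ g in unitBall (Option (Fin d)),
          ‖signSum ε S c g x‖ ^ p)) ∂(torusVol d) :=
        integral_mono (integrable_torus (continuous_norm_trigSum_rpow _ _ hp0)) i3
          (norm_trigSum_extend_rpow_le ε S c hp k hS hνV.symm hVpos)
    _ = κ⁻¹ ^ p * (V ^ p * (V⁻¹ * ∫ g in unitBall (Option (Fin d)),
          ∫ x, ‖signSum ε S c g x‖ ^ p ∂(torusVol d))) := by
        rw [integral_const_mul, integral_const_mul, integral_const_mul, swap]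
    _ ≤ κ⁻¹ ^ p * (V ^ p * (V⁻¹ * (V * (signConst p *
          ∫ x, ‖trigSum S c x‖ ^ p ∂(torusVol d))))) := by
        refine mul_le_mul_of_nonneg_left (mul_le_mul_of_nonneg_left
          (mul_le_mul_of_nonneg_left (inner_le.trans_eq ?_) (by positivity)) (by positivity))
          (by positivity)
        rw [integral_const, hνV, smul_eq_mul]
    _ = _ := by
        rw [inv_mul_cancel_left₀ hVpos.ne', rotBound, ← hV, ← hκ, div_eq_mul_inv,
          Real.mul_rpow hVpos.le (by positivity)]
        ring

end Multiplier

/-! ### The Poincaré and Korn inequalities for trigonometric polynomials -/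

section Korn

variable {d : ℕ}

theorem norm_integral_rpow_le {α : Type*} [MeasurableSpace α] {ν : Measure α}
    [IsProbabilityMeasure ν] {p : ℝ} (hp : 1 ≤ p) {F : α → ℂ} (i1 : Integrable F ν)
    (i2 : Integrable (fun a => ‖F a‖ ^ p) ν) : ‖∫ a, F a ∂ν‖ ^ p ≤ ∫ a, ‖F a‖ ^ p ∂ν := by
  have h := rpow_integral_le (ν := ν) hp (fun a => norm_nonneg (F a)) (by simp) i1.norm i2
  simp only [probReal_univ, Real.one_rpow, inv_one, one_mul] at h
  exact (Real.rpow_le_rpow (norm_nonneg _) (norm_integral_le_integral_norm _) (by linarith)).trans h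

theorem norm_sum_rpow_le {κ : Type*} [Fintype κ] {p : ℝ} (hp : 1 ≤ p) (a : κ → ℂ) :
    ‖∑ i, a i‖ ^ p ≤ (Fintype.card κ : ℝ) ^ (p - 1) * ∑ i, ‖a i‖ ^ p := by
  refine (Real.rpow_le_rpow (norm_nonneg _) (norm_sum_le _ _) (by linarith)).trans ?_
  have := Real.rpow_sum_le_const_mul_sum_rpow (s := Finset.univ) (f := fun i => ‖a i‖) hp
  simpa using! this

/-- A translation by 1/(2z_i) in a coordinate with z_i ≠ 0 multiplies the character by −1 and
preserves the measure. -/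
theorem integral_mFourier {z : Fin d → ℤ} (hz : z ≠ 0) :
    ∫ x, UnitAddTorus.mFourier z x ∂(torusVol d) = 0 := by
  obtain ⟨i, hi⟩ := Function.ne_iff.1 hz
  have hi' : (z i : ℂ) ≠ 0 := by exact_mod_cast hi
  let y : Fin d → ℝ := Pi.single i (1 / (2 * (z i : ℝ)))
  have hy : UnitAddTorus.mFourier z (toTorus y) = -1 := by
    rw [mFourier_toTorus, Finset.sum_eq_single i]
    · rw [← Complex.exp_pi_mul_I]
      congr 1
      simp only [y, Pi.single_eq_same]
      push_cast
      field_simp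
    · intro j _ hj
      simp [y, hj]
    · simp
  have h := integral_torus_add_right (fun x => UnitAddTorus.mFourier z x) (toTorus y)
  simp only [mFourier_add_apply, hy, mul_neg, mul_one, integral_neg] at h
  linear_combination (-1 / 2) * h

theorem integral_trigSum {S : Finset (Fin d → ℤ)} (hS : 0 ∉ S) (c : (Fin d → ℤ) → ℂ) :
    ∫ x, trigSum S c x ∂(torusVol d) = 0 := by
  simp only [trigSum]
  rw [integral_finsetSum _ fun z _ => integrable_torus (by fun_prop)]
  refine Finset.sum_eq_zero fun z hz => ?_
  rw [integral_const_mul, integral_mFourier fun h => hS (h ▸ hz), mul_zero]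

/-- The coefficients of the `k`-th partial derivative. -/
def dCoeff (k : Fin d) (c : (Fin d → ℤ) → ℂ) (z : Fin d → ℤ) : ℂ :=
  2 * Real.pi * Complex.I * z k * c z

theorem hasDerivAt_trigSum_line (S : Finset (Fin d → ℤ)) (c : (Fin d → ℤ) → ℂ) (x : Torus d)
    (y : Fin d → ℝ) (t : ℝ) :
    HasDerivAt (fun t : ℝ => trigSum S c (x + toTorus (t • y)))
      (∑ k, (y k : ℂ) * trigSum S (dCoeff k c) (x + toTorus (t • y))) t := by
  have e : ∑ k, (y k : ℂ) * trigSum S (dCoeff k c) (x + toTorus (t • y)) =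
      ∑ z ∈ S, c z * (UnitAddTorus.mFourier z x * (Complex.exp (2 * Real.pi * Complex.I *
        ∑ i, (z i : ℂ) * (t • y) i) * (2 * Real.pi * Complex.I * ∑ i, (z i : ℂ) * y i))) := by
    simp only [trigSum, Finset.mul_sum]
    rw [Finset.sum_comm]
    refine Finset.sum_congr rfl fun z _ => Finset.sum_congr rfl fun k _ => ?_
    rw [mFourier_add_apply, mFourier_toTorus, dCoeff, Finset.mul_sum]
    ring
  rw [e]
  simp only [trigSum, mFourier_add_apply, mFourier_toTorus]
  refine HasDerivAt.fun_sum fun z _ => HasDerivAt.const_mul _ (HasDerivAt.const_mul _ ?_)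
  refine HasDerivAt.cexp (HasDerivAt.const_mul _ ?_)
  refine HasDerivAt.fun_sum fun i _ => HasDerivAt.const_mul _ ?_
  have h : HasDerivAt (fun t : ℝ => ((t * y i : ℝ) : ℂ)) ((1 * y i : ℝ) : ℂ) t :=
    ((hasDerivAt_id t).mul_const (y i)).ofReal_comp
  simpa using! h

theorem exists_toTorus_eq (x : Torus d) : ∃ y : Fin d → ℝ, toTorus y = x ∧ ∀ i, |y i| ≤ 1 := by
  have : ∀ i, ∃ r : ℝ, (r : UnitAddCircle) = x i ∧ |r| ≤ 1 := fun i => by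
    have hx : x i ∈ (fun r : ℝ => (r : UnitAddCircle)) '' Set.Icc 0 (0 + 1) := by
      rw [AddCircle.coe_image_Icc_eq]; trivial
    obtain ⟨r, hr, h⟩ := hx
    exact ⟨r, h, abs_le.2 ⟨by linarith [hr.1], by linarith [hr.2]⟩⟩
  choose y hy using this
  exact ⟨y, funext fun i => (hy i).1, fun i => (hy i).2⟩

/-- The difference is the integral of the derivative along a segment whose coordinates are at most 1
in modulus. Jensen's inequality in t and translation invariance of the integral over x give a bound
that does not depend on the shift. -/
theorem integral_diff_rpow_le {p : ℝ} (hp : 1 < p) (S : Finset (Fin d → ℤ)) (c : (Fin d → ℤ) → ℂ)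
    (y : Torus d) :
    ∫ x, ‖trigSum S c (x + y) - trigSum S c x‖ ^ p ∂(torusVol d) ≤
      (d : ℝ) ^ (p - 1) * ∑ k, ∫ x, ‖trigSum S (dCoeff k c) x‖ ^ p ∂(torusVol d) := by
  have hp0 : 0 ≤ p := by linarith
  obtain ⟨y, rfl, hy⟩ := exists_toTorus_eq y
  have cty : Continuous fun q : Torus d × ℝ => q.1 + toTorus (q.2 • y) :=
    continuous_fst.add (continuous_toTorus.comp (by fun_prop))
  have ct : ∀ x : Torus d, Continuous fun t : ℝ => x + toTorus (t • y) := fun x =>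
    continuous_const.add (continuous_toTorus.comp (by fun_prop))
  let G : Torus d → ℝ → ℂ := fun x t => ∑ k, (y k : ℂ) * trigSum S (dCoeff k c) (x + toTorus (t • y))
  have cG : ∀ x, Continuous (G x) := fun x =>
    continuous_finsetSum _ fun k _ => continuous_const.mul ((continuous_trigSum S _).comp (ct x))
  have bound : ∀ x t, ‖G x t‖ ^ p ≤
      (d : ℝ) ^ (p - 1) * ∑ k, ‖trigSum S (dCoeff k c) (x + toTorus (t • y))‖ ^ p := by
    intro x t
    refine (norm_sum_rpow_le hp.le _).trans ?_
    rw [Fintype.card_fin]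
    refine mul_le_mul_of_nonneg_left (Finset.sum_le_sum fun k _ =>
      Real.rpow_le_rpow (norm_nonneg _) ?_ hp0) (by positivity)
    rw [norm_mul, Complex.norm_real]
    exact mul_le_of_le_one_left (norm_nonneg _) (hy k)
  have cB : Continuous fun q : Torus d × ℝ =>
      (d : ℝ) ^ (p - 1) * ∑ k, ‖trigSum S (dCoeff k c) (q.1 + toTorus (q.2 • y))‖ ^ p :=
    continuous_const.mul (continuous_finsetSum _ fun k _ =>
      (continuous_norm_trigSum_rpow S _ hp0).comp cty)
  have cBx : ∀ x : Torus d, Continuous fun t : ℝ =>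
      (d : ℝ) ^ (p - 1) * ∑ k, ‖trigSum S (dCoeff k c) (x + toTorus (t • y))‖ ^ p := fun x =>
    continuous_const.mul (continuous_finsetSum _ fun k _ =>
      (continuous_norm_trigSum_rpow S _ hp0).comp (ct x))
  have pointwise : ∀ x, ‖trigSum S c (x + toTorus y) - trigSum S c x‖ ^ p ≤
      ∫ t in Set.Ioc (0 : ℝ) 1,
        (d : ℝ) ^ (p - 1) * ∑ k, ‖trigSum S (dCoeff k c) (x + toTorus (t • y))‖ ^ p := by
    intro x
    have hcx := cG x
    have ftc : trigSum S c (x + toTorus y) - trigSum S c x = ∫ t in Set.Ioc (0 : ℝ) 1, G x t := by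
      rw [← intervalIntegral.integral_of_le zero_le_one,
        intervalIntegral.integral_eq_sub_of_hasDerivAt
          (fun t _ => hasDerivAt_trigSum_line S c x y t) (hcx.intervalIntegrable _ _)]
      have : toTorus (0 : Fin d → ℝ) = 0 := by ext i; simp [toTorus]
      simp [this]
    have : IsProbabilityMeasure (volume.restrict (Set.Ioc (0 : ℝ) 1)) := ⟨by simp⟩
    have hGp : Continuous fun t => ‖G x t‖ ^ p := hcx.norm.rpow_const fun _ => Or.inr hp0
    have hi : IntegrableOn (fun t => ‖G x t‖ ^ p) (Set.Ioc 0 1) :=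
      hGp.integrableOn_Ioc
    rw [ftc]
    exact (norm_integral_rpow_le hp.le hcx.integrableOn_Ioc hi).trans
      (integral_mono hi (cBx x).integrableOn_Ioc (bound x))
  have hcont : Continuous fun x => ‖trigSum S c (x + toTorus y) - trigSum S c x‖ ^ p :=
    Continuous.rpow_const (((continuous_trigSum S c).comp (by fun_prop)).sub
      (continuous_trigSum S c)).norm fun _ => Or.inr hp0
  have hprod : Integrable (Function.uncurry fun (x : Torus d) (t : ℝ) =>
      (d : ℝ) ^ (p - 1) * ∑ k, ‖trigSum S (dCoeff k c) (x + toTorus (t • y))‖ ^ p)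
      ((torusVol d).prod (volume.restrict (Set.Ioc (0 : ℝ) 1))) := by
    refine Integrable.of_bound cB.aestronglyMeasurable
      ((d : ℝ) ^ (p - 1) * ∑ k, (∑ z ∈ S, ‖dCoeff k c z‖) ^ p) (Eventually.of_forall fun q => ?_)
    simp only [Function.uncurry]
    rw [Real.norm_of_nonneg (by positivity)]
    gcongr
    exact norm_trigSum_le _ _ _
  calc _ ≤ ∫ x, ∫ t in Set.Ioc (0 : ℝ) 1, (d : ℝ) ^ (p - 1) *
        ∑ k, ‖trigSum S (dCoeff k c) (x + toTorus (t • y))‖ ^ p ∂volume ∂(torusVol d) :=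
        integral_mono (integrable_torus hcont) hprod.integral_prod_left pointwise
    _ = ∫ t in Set.Ioc (0 : ℝ) 1, (d : ℝ) ^ (p - 1) *
        ∑ k, ∫ x, ‖trigSum S (dCoeff k c) x‖ ^ p ∂(torusVol d) := by
        rw [integral_integral_swap hprod]
        congr 1
        ext t
        rw [integral_const_mul, integral_finsetSum]
        · congr 2
          ext k
          exact integral_torus_add_right (fun x => ‖trigSum S (dCoeff k c) x‖ ^ p) _
        · exact fun k _ => integrable_torus
            ((continuous_norm_trigSum_rpow S _ hp0).comp (by fun_prop))
    _ = _ := by simp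

/-- The Poincaré inequality for mean-zero trigonometric polynomials. -/
theorem poincare_trigSum {p : ℝ} (hp : 1 < p) {S : Finset (Fin d → ℤ)} (hS : 0 ∉ S)
    (c : (Fin d → ℤ) → ℂ) :
    ∫ x, ‖trigSum S c x‖ ^ p ∂(torusVol d) ≤
      (d : ℝ) ^ (p - 1) * ∑ k, ∫ x, ‖trigSum S (dCoeff k c) x‖ ^ p ∂(torusVol d) := by
  have hp0 : 0 ≤ p := by linarith
  have cD : Continuous fun q : Torus d × Torus d => trigSum S c (q.1 + q.2) - trigSum S c q.1 :=
    ((continuous_trigSum S c).comp (by fun_prop)).sub ((continuous_trigSum S c).comp (by fun_prop))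
  have cDp : Continuous fun q : Torus d × Torus d =>
      ‖trigSum S c (q.1 + q.2) - trigSum S c q.1‖ ^ p := cD.norm.rpow_const fun _ => Or.inr hp0
  have cx : ∀ x : Torus d, Continuous fun y : Torus d => (x, y) := fun x => by fun_prop
  have pointwise : ∀ x, ‖trigSum S c x‖ ^ p ≤
      ∫ y, ‖trigSum S c (x + y) - trigSum S c x‖ ^ p ∂(torusVol d) := by
    intro x
    -- Since the mean vanishes, −f(x) is the average over y of f(x + y) − f(x).
    have h1 : ∫ y, (trigSum S c (x + y) - trigSum S c x) ∂(torusVol d) = -trigSum S c x := by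
      rw [integral_sub (integrable_torus (by fun_prop)) (integrable_const _)]
      simp only [add_comm x]
      rw [integral_torus_add_right (trigSum S c) x, integral_trigSum hS]
      simp
    have h2 := norm_integral_rpow_le (ν := torusVol d) hp.le (integrable_torus (cD.comp (cx x)))
      (integrable_torus (cDp.comp (cx x)))
    simp only [Function.comp_def] at h2
    rwa [h1, norm_neg] at h2
  have hprod : Integrable (Function.uncurry fun x y : Torus d =>
      ‖trigSum S c (x + y) - trigSum S c x‖ ^ p) ((torusVol d).prod (torusVol d)) :=
    cDp.integrable_of_hasCompactSupport (HasCompactSupport.of_compactSpace _)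
  calc _ ≤ ∫ x, ∫ y, ‖trigSum S c (x + y) - trigSum S c x‖ ^ p ∂(torusVol d) ∂(torusVol d) :=
        integral_mono (integrable_torus (continuous_norm_trigSum_rpow S c hp0))
          hprod.integral_prod_left pointwise
    _ = ∫ y, ∫ x, ‖trigSum S c (x + y) - trigSum S c x‖ ^ p ∂(torusVol d) ∂(torusVol d) :=
        integral_integral_swap hprod
    _ ≤ ∫ _y, (d : ℝ) ^ (p - 1) * ∑ k, ∫ x, ‖trigSum S (dCoeff k c) x‖ ^ p ∂(torusVol d)
          ∂(torusVol d) :=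
        integral_mono hprod.integral_prod_right (integrable_const _)
          fun y => integral_diff_rpow_le hp S c y
    _ = _ := by simp

theorem trigSum_sum {κ : Type*} [Fintype κ] (S : Finset (Fin d → ℤ)) (c : κ → (Fin d → ℤ) → ℂ)
    (x : Torus d) : trigSum S (fun z => ∑ i, c i z) x = ∑ i, trigSum S (c i) x := by
  simp only [trigSum, Finset.sum_mul]
  exact Finset.sum_comm

theorem trigSum_const_mul (S : Finset (Fin d → ℤ)) (a : ℂ) (c : (Fin d → ℤ) → ℂ) (x : Torus d) :
    trigSum S (fun z => a * c z) x = a * trigSum S c x := by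
  simp only [trigSum, Finset.mul_sum, mul_assoc]

theorem integral_norm_trigSum_sum_rpow_le {κ : Type*} [Fintype κ] {p : ℝ} (hp : 1 ≤ p)
    (S : Finset (Fin d → ℤ)) (c : κ → (Fin d → ℤ) → ℂ) :
    ∫ x, ‖trigSum S (fun z => ∑ i, c i z) x‖ ^ p ∂(torusVol d) ≤
      (Fintype.card κ : ℝ) ^ (p - 1) * ∑ i, ∫ x, ‖trigSum S (c i) x‖ ^ p ∂(torusVol d) := by
  have hp0 : 0 ≤ p := by linarith
  rw [← integral_finsetSum _ fun i _ => integrable_torus (continuous_norm_trigSum_rpow S _ hp0),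
    ← integral_const_mul]
  refine integral_mono (integrable_torus (continuous_norm_trigSum_rpow S _ hp0))
    (integrable_torus (continuous_const.mul (continuous_finsetSum _ fun i _ =>
      continuous_norm_trigSum_rpow S _ hp0))) fun x => ?_
  simp only [trigSum_sum]
  exact norm_sum_rpow_le hp _

theorem norm_extend_sq (ε : ℝ) (z : Fin d → ℤ) :
    ‖extend ε z‖ ^ 2 = ∑ i, (z i : ℝ) ^ 2 + ε ^ 2 := by
  rw [EuclideanSpace.norm_sq_eq]
  simp [extend, Fintype.sum_option, add_comm]

/-- The coefficients of the rate of strain tensor. -/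
def eCoeff (v : Fin d → (Fin d → ℤ) → ℂ) (i j : Fin d) (z : Fin d → ℤ) : ℂ :=
  Real.pi * Complex.I * (z i * v j z + z j * v i z)

/-- Since z·v = 0, one has Σ_i z_i(z_i v_j + z_j v_i) = |z|² v_j. Hence ∂_k v_j is the sum over i of
the multiplier (z_k/|z|)(z_i/|z|) applied to 2e_ij: two Riesz transforms, and the factor 2^p from
the 2. -/
theorem integral_dCoeff_le {p : ℝ} (hp : 1 < p) {S : Finset (Fin d → ℤ)} (hS : 0 ∉ S)
    (v : Fin d → (Fin d → ℤ) → ℂ) (hv : ∀ z, ∑ i, (z i : ℂ) * v i z = 0) (k j : Fin d) :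
    ∫ x, ‖trigSum S (dCoeff k (v j)) x‖ ^ p ∂(torusVol d) ≤
      (d : ℝ) ^ (p - 1) * (rotBound d p * rotBound d p * 2 ^ p) *
        ∑ i, ∫ x, ‖trigSum S (eCoeff v i j) x‖ ^ p ∂(torusVol d) := by
  have hp0 : 0 ≤ p := by linarith
  have e : ∀ z ∈ S, dCoeff k (v j) z = ∑ i, ((extend 0 z (some k) / ‖extend 0 z‖ *
      (extend 0 z (some i) / ‖extend 0 z‖) : ℝ) : ℂ) * (2 * eCoeff v i j z) := by
    intro z hz
    have hz0 : z ≠ 0 := fun h => hS (h ▸ hz)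
    have hn : ‖extend 0 z‖ ^ 2 = ∑ i, (z i : ℝ) ^ 2 := by rw [norm_extend_sq]; simp
    have hne : ((‖extend 0 z‖ : ℝ) : ℂ) ≠ 0 := by
      exact_mod_cast norm_ne_zero_iff.2 (extend_ne_zero (0 : ℝ) hz0)
    have hn' : ((‖extend 0 z‖ : ℝ) : ℂ) ^ 2 = ∑ i, (z i : ℂ) ^ 2 := by exact_mod_cast hn
    have h1 : ∀ i, ((extend 0 z (some k) / ‖extend 0 z‖ *
        (extend 0 z (some i) / ‖extend 0 z‖) : ℝ) : ℂ) * (2 * eCoeff v i j z) =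
        (2 * Real.pi * Complex.I * z k / (‖extend 0 z‖ : ℂ) ^ 2) *
          ((z i : ℂ) ^ 2 * v j z + z j * (z i * v i z)) := by
      intro i
      simp only [extend, eCoeff, Option.elim_some]
      push_cast
      field_simp
    simp only [h1]
    rw [← Finset.mul_sum, Finset.sum_add_distrib, ← Finset.sum_mul, ← Finset.mul_sum, hv, ← hn',
      dCoeff]
    field_simp
    ring
  have e' : trigSum S (dCoeff k (v j)) = trigSum S fun z => ∑ i,
      ((extend 0 z (some k) / ‖extend 0 z‖ *
      (extend 0 z (some i) / ‖extend 0 z‖) : ℝ) : ℂ) * (2 * eCoeff v i j z) := by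
    ext x
    exact Finset.sum_congr rfl fun z hz => by rw [e z hz]
  rw [e']
  refine (integral_norm_trigSum_sum_rpow_le hp.le S _).trans ?_
  rw [Fintype.card_fin, mul_assoc]
  refine mul_le_mul_of_nonneg_left ?_ (by positivity)
  rw [Finset.mul_sum]
  refine Finset.sum_le_sum fun i _ => ?_
  have h := ((isMultiplier_extend hp 0 (some k)).mul (rotBound_nonneg d hp)
    (isMultiplier_extend hp 0 (some i))) S (fun z => 2 * eCoeff v i j z) hS
  refine h.trans_eq ?_
  simp only [trigSum_const_mul, norm_mul]
  rw [mul_assoc, mul_assoc, mul_assoc]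
  congr 2
  rw [← integral_const_mul]
  congr 1
  ext x
  rw [Real.mul_rpow (by positivity) (by positivity)]
  norm_num

/-- The coefficients of `(1 - Δ)^{1/2}`. -/
def besselCoeff (c : (Fin d → ℤ) → ℂ) (z : Fin d → ℤ) : ℂ :=
  (((1 + 4 * Real.pi ^ 2 * ∑ k, (z k : ℝ) ^ 2) ^ ((1 : ℝ) / 2) : ℝ) : ℂ) * c z

/-- For ε = 1/(2π) and L = 1 + 4π²|z|², the norm of (z, ε) is √L/(2π). Writing √L = (1 + Σ_k 4π²
z_k²)/√L expresses √L c as a sum of components of (z, ε)/|(z, ε)| applied to c itself and to −i∂_k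
c. The auxiliary coordinate ε was introduced for this. -/
theorem integral_besselCoeff_le {p : ℝ} (hp : 1 < p) {S : Finset (Fin d → ℤ)} (hS : 0 ∉ S)
    (c : (Fin d → ℤ) → ℂ) :
    ∫ x, ‖trigSum S (besselCoeff c) x‖ ^ p ∂(torusVol d) ≤
      (d + 1 : ℝ) ^ (p - 1) * (rotBound d p * (∫ x, ‖trigSum S c x‖ ^ p ∂(torusVol d) +
        ∑ k, ∫ x, ‖trigSum S (dCoeff k c) x‖ ^ p ∂(torusVol d))) := by
  set ε : ℝ := 1 / (2 * Real.pi) with hε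
  let q : Option (Fin d) → (Fin d → ℤ) → ℂ := fun o => o.elim c fun k z => -Complex.I * dCoeff k c z
  have e : besselCoeff c = fun z => ∑ o, ((extend ε z o / ‖extend ε z‖ : ℝ) : ℂ) * q o z := by
    ext z
    set L : ℝ := 1 + 4 * Real.pi ^ 2 * ∑ k, (z k : ℝ) ^ 2 with hL
    have hLpos : 0 < L := by positivity
    have hπ : (0 : ℝ) < 2 * Real.pi := by positivity
    have hn : ‖extend ε z‖ = L ^ ((1 : ℝ) / 2) / (2 * Real.pi) := by
      have h1 : ‖extend ε z‖ ^ 2 = (L ^ ((1 : ℝ) / 2) / (2 * Real.pi)) ^ 2 := by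
        rw [norm_extend_sq, div_pow (_ ^ _), ← Real.sqrt_eq_rpow, Real.sq_sqrt hLpos.le, hL, hε]
        field_simp
        ring
      exact (pow_left_inj₀ (norm_nonneg _) (by positivity) two_ne_zero).1 h1
    have hs : (0 : ℝ) < L ^ ((1 : ℝ) / 2) := by positivity
    have hsq : L ^ ((1 : ℝ) / 2) * L ^ ((1 : ℝ) / 2) = L := by
      rw [← Real.rpow_add hLpos]; norm_num
    have hsq' : ((L ^ ((1 : ℝ) / 2) : ℝ) : ℂ) * ((L ^ ((1 : ℝ) / 2) : ℝ) : ℂ) =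
        1 + 4 * Real.pi ^ 2 * ∑ k, (z k : ℂ) ^ 2 := by
      rw [← Complex.ofReal_mul, hsq, hL]; push_cast; ring
    have hs' : ((L ^ ((1 : ℝ) / 2) : ℝ) : ℂ) ≠ 0 := by exact_mod_cast hs.ne'
    have hπ' : (Real.pi : ℂ) ≠ 0 := by exact_mod_cast Real.pi_ne_zero
    have t0 : ((extend ε z none / ‖extend ε z‖ : ℝ) : ℂ) * q none z =
        c z / ((L ^ ((1 : ℝ) / 2) : ℝ) : ℂ) := by
      have : extend ε z none = ε := rfl
      rw [this, hn, hε]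
      simp only [q, Option.elim_none]
      push_cast
      field_simp
    have t1 : ∀ k, ((extend ε z (some k) / ‖extend ε z‖ : ℝ) : ℂ) * q (some k) z =
        (4 * Real.pi ^ 2 * c z / ((L ^ ((1 : ℝ) / 2) : ℝ) : ℂ)) * (z k : ℂ) ^ 2 := by
      intro k
      have : extend ε z (some k) = z k := rfl
      rw [this, hn]
      simp only [q, Option.elim_some, dCoeff]
      push_cast
      field_simp
      linear_combination (-4 * (z k : ℂ) ^ 2 * c z) * Complex.I_sq
    rw [Fintype.sum_option, t0]
    simp only [t1]
    rw [← Finset.mul_sum, besselCoeff, ← hL]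
    field_simp
    rw [pow_two, hsq']
    ring
  rw [e]
  refine (integral_norm_trigSum_sum_rpow_le hp.le S _).trans ?_
  rw [Fintype.card_option, Fintype.card_fin, Nat.cast_add, Nat.cast_one]
  refine mul_le_mul_of_nonneg_left ?_ (by positivity)
  have h : ∀ o, ∫ x, ‖trigSum S (fun z => ((extend ε z o / ‖extend ε z‖ : ℝ) : ℂ) * q o z) x‖ ^ p
      ∂(torusVol d) ≤ rotBound d p * ∫ x, ‖trigSum S (q o) x‖ ^ p ∂(torusVol d) :=
    fun o => isMultiplier_extend hp ε o S (q o) hS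
  refine (Finset.sum_le_sum fun o _ => h o).trans_eq ?_
  rw [← Finset.mul_sum, Fintype.sum_option]
  simp only [q, Option.elim_none, Option.elim_some, trigSum_const_mul]
  simp

/-- The constant in the Korn inequality. -/
def kornConst (d : ℕ) (p : ℝ) : ℝ :=
  (d + 1 : ℝ) ^ (p - 1) * (rotBound d p * (((d : ℝ) ^ (p - 1) + 1) * (d *
    ((d : ℝ) ^ (p - 1) * (rotBound d p * rotBound d p * 2 ^ p)))))

theorem kornConst_nonneg (d : ℕ) {p : ℝ} (hp : 1 < p) : 0 ≤ kornConst d p := by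
  have := rotBound_nonneg d hp
  unfold kornConst
  positivity

/-- The Korn inequality for divergence free mean-zero trigonometric polynomials. -/
theorem korn_trigSum {p : ℝ} (hp : 1 < p) {S : Finset (Fin d → ℤ)} (hS : 0 ∉ S)
    (v : Fin d → (Fin d → ℤ) → ℂ) (hv : ∀ z, ∑ i, (z i : ℂ) * v i z = 0) (j : Fin d) :
    ∫ x, ‖trigSum S (besselCoeff (v j)) x‖ ^ p ∂(torusVol d) ≤
      kornConst d p * ∑ i, ∫ x, ‖trigSum S (eCoeff v i j) x‖ ^ p ∂(torusVol d) := by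
  have hR := rotBound_nonneg d hp
  set M := ∑ i, ∫ x, ‖trigSum S (eCoeff v i j) x‖ ^ p ∂(torusVol d)
  set K := (d : ℝ) ^ (p - 1) * (rotBound d p * rotBound d p * 2 ^ p) with hK
  have h1 : ∑ k, ∫ x, ‖trigSum S (dCoeff k (v j)) x‖ ^ p ∂(torusVol d) ≤ d * (K * M) := by
    refine (Finset.sum_le_sum fun k _ => integral_dCoeff_le hp hS v hv k j).trans_eq ?_
    simp [K, M]
  have h2 := poincare_trigSum hp hS (v j)
  refine (integral_besselCoeff_le hp hS (v j)).trans ?_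
  rw [kornConst, ← hK]
  have h3 : (0 : ℝ) ≤ (d : ℝ) ^ (p - 1) := by positivity
  have h4 := mul_le_mul_of_nonneg_left h1 h3
  rw [mul_assoc, mul_assoc]
  refine mul_le_mul_of_nonneg_left (mul_le_mul_of_nonneg_left ?_ hR) (by positivity)
  linarith

end Korn

/-! ### The Galerkin spaces in Fourier coordinates -/

/-- A function linear in `v` and jointly continuous in `v` and `x` is bounded by a multiple of the
norm of `v`, uniformly in `x`. -/
theorem exists_bound_of_linear {V T : Type*} [NormedAddCommGroup V] [NormedSpace ℝ V]
    [FiniteDimensional ℝ V] [TopologicalSpace T] [CompactSpace T] {f : V → T → ℝ}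
    (hf : Continuous fun q : V × T => f q.1 q.2)
    (hsmul : ∀ (r : ℝ) v x, f (r • v) x = r * f v x) : ∃ K, 0 ≤ K ∧ ∀ v x, |f v x| ≤ K * ‖v‖ := by
  have := FiniteDimensional.proper ℝ V
  obtain ⟨B, hB⟩ := ((((isCompact_closedBall (0 : V) 1).prod isCompact_univ).image
    hf).isBounded).exists_norm_le
  have hB' : ∀ v x, ‖v‖ ≤ 1 → |f v x| ≤ B := fun v x hv =>
    hB _ ⟨(v, x), ⟨by simpa using hv, trivial⟩, rfl⟩
  rcases isEmpty_or_nonempty T with hT | ⟨⟨x₀⟩⟩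
  · exact ⟨0, le_rfl, fun v x => hT.elim x⟩
  refine ⟨B, (abs_nonneg _).trans (hB' 0 x₀ (by simp)), fun v x => ?_⟩
  rcases eq_or_ne v 0 with rfl | hv
  · have := hsmul 0 0 x
    simp only [zero_smul, zero_mul] at this
    simp [this]
  · have hn : 0 < ‖v‖ := norm_pos_iff.2 hv
    have h1 := hB' (‖v‖⁻¹ • v) x (by rw [norm_smul, norm_inv, norm_norm, inv_mul_cancel₀ hn.ne'])
    have h2 : f v x = ‖v‖ * f (‖v‖⁻¹ • v) x := by
      rw [← hsmul, smul_smul, mul_inv_cancel₀ hn.ne', one_smul]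
    rw [h2, abs_mul, abs_of_pos hn, mul_comm]
    exact mul_le_mul_of_nonneg_right h1 hn.le

section GalerkinSpace

variable {d n : ℕ}

/-- The nonzero frequencies in `[-n, n]^d`. -/
def freqs (d n : ℕ) : Finset (Fin d → ℤ) :=
  (Finset.Icc (fun _ => -(n : ℤ)) (fun _ => (n : ℤ))).erase 0

theorem zero_notMem_freqs : (0 : Fin d → ℤ) ∉ freqs d n := by simp [freqs]

theorem mem_freqs {z : Fin d → ℤ} : z ∈ freqs d n ↔ z ≠ 0 ∧ ∀ i, |z i| ≤ (n : ℤ) := by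
  simp only [freqs, Finset.mem_erase, Finset.mem_Icc, Pi.le_def, abs_le, forall_and]

theorem neg_mem_freqs {z : Fin d → ℤ} (hz : z ∈ freqs d n) : -z ∈ freqs d n := by
  rw [mem_freqs] at hz ⊢
  exact ⟨neg_ne_zero.2 hz.1, fun i => by simpa using hz.2 i⟩

/-- `c` is a family of coefficients, on the frequencies in `[-n, n]^d`, of the divergence free
field `w`. -/
structure HasCoeffs (n : ℕ) (w : L2Field d) (c : Fin d → (Fin d → ℤ) → ℂ) : Prop where
  supp : ∀ z ∉ freqs d n, ∀ i, c i z = 0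
  div : ∀ z, ∑ i, (z i : ℂ) * c i z = 0
  ae : ∀ᵐ x ∂(torusVol d), ∀ i, ((w x i : ℝ) : ℂ) = trigSum (freqs d n) (c i) x

theorem HasCoeffs.zero : HasCoeffs n (0 : L2Field d) fun _ _ => 0 where
  supp _ _ _ := rfl
  div _ := by simp
  ae := by
    filter_upwards [Lp.coeFn_zero (EuclideanSpace ℝ (Fin d)) 2 (torusVol d)] with x hx i
    simp [trigSum]

theorem HasCoeffs.add {w w' : L2Field d} {c c' : Fin d → (Fin d → ℤ) → ℂ}
    (h : HasCoeffs n w c) (h' : HasCoeffs n w' c') :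
    HasCoeffs n (w + w') fun i z => c i z + c' i z where
  supp z hz i := by rw [h.supp z hz, h'.supp z hz, add_zero]
  div z := by simp only [mul_add, Finset.sum_add_distrib, h.div, h'.div, add_zero]
  ae := by
    filter_upwards [h.ae, h'.ae, Lp.coeFn_add w w'] with x h1 h2 hx i
    rw [hx]
    simp [h1, h2, trigSum, add_mul, Finset.sum_add_distrib]

theorem HasCoeffs.smul {w : L2Field d} {c : Fin d → (Fin d → ℤ) → ℂ} (r : ℝ)
    (h : HasCoeffs n w c) : HasCoeffs n (r • w) fun i z => r * c i z where
  supp z hz i := by rw [h.supp z hz, mul_zero]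
  div z := by
    have := congrArg (fun y : ℂ => (r : ℂ) * y) (h.div z)
    simp only [Finset.mul_sum, mul_zero] at this
    rw [← this]
    exact Finset.sum_congr rfl fun i _ => by ring
  ae := by
    filter_upwards [h.ae, Lp.coeFn_smul r w] with x h1 hx i
    rw [hx]
    simp [h1, trigSum, Finset.mul_sum, mul_assoc]

theorem HasCoeffs.mode {z : Fin d → ℤ} (hz : z ∈ freqs d n) {a : EuclideanSpace ℝ (Fin d)}
    (ha : ∑ i, (z i : ℝ) * a i = 0) (u : ℂ) {w : L2Field d}
    (hw : ∀ᵐ x ∂(torusVol d), w x = (2 * (u * UnitAddTorus.mFourier z x).re) • a) :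
    HasCoeffs n w fun i y => (if y = z then u * a i else 0) +
      (if y = -z then (starRingEnd ℂ) u * a i else 0) where
  supp y hy i := by
    have h1 : y ≠ z := fun h => hy (h ▸ hz)
    have h2 : y ≠ -z := fun h => hy (h ▸ neg_mem_freqs hz)
    simp [h1, h2]
  div y := by
    have ha' : ∑ i, (z i : ℂ) * (a i : ℂ) = 0 := by exact_mod_cast ha
    have h1 : ∑ i, (y i : ℂ) * (if y = z then u * a i else 0) = 0 := by
      split_ifs with h
      · subst h
        calc _ = u * ∑ i, (y i : ℂ) * (a i : ℂ) := by
              rw [Finset.mul_sum]; exact Finset.sum_congr rfl fun i _ => by ring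
          _ = 0 := by rw [ha', mul_zero]
      · simp
    have h2 : ∑ i, (y i : ℂ) * (if y = -z then (starRingEnd ℂ) u * a i else 0) = 0 := by
      split_ifs with h
      · subst h
        calc _ = -(starRingEnd ℂ) u * ∑ i, (z i : ℂ) * (a i : ℂ) := by
              rw [Finset.mul_sum]
              refine Finset.sum_congr rfl fun i _ => ?_
              simp only [Pi.neg_apply]; push_cast; ring
          _ = 0 := by rw [ha', mul_zero]
      · simp
    simp only [mul_add, Finset.sum_add_distrib, h1, h2, add_zero]
  ae := by
    filter_upwards [hw] with x hx i
    have h3 := Complex.add_conj (u * UnitAddTorus.mFourier z x)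
    simp only [map_mul, ← UnitAddTorus.mFourier_neg] at h3
    rw [hx]
    simp only [trigSum, add_mul, Finset.sum_add_distrib, ite_mul, zero_mul, Finset.sum_ite_eq',
      hz, neg_mem_freqs hz, if_true, PiLp.smul_apply, smul_eq_mul]
    push_cast at h3 ⊢
    rw [← h3]
    ring

theorem exists_hasCoeffs (v : Vn d n) : ∃ c, HasCoeffs n (toField v) c := by
  obtain ⟨v, hv⟩ := v
  unfold toField
  simp only
  induction hv using Submodule.span_induction with
  | mem v h =>
    obtain ⟨z, a, hz, hn, ha, h | h⟩ := h
    · refine ⟨_, HasCoeffs.mode (mem_freqs.2 ⟨hz, hn⟩) ha ((√2 / 2 : ℝ) : ℂ) ?_⟩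
      rw [h]
      filter_upwards [ContinuousMap.coeFn_toLp (p := 2) (𝕜 := ℝ) (torusVol d)
        (⟨fun x => (√2 * (UnitAddTorus.mFourier z x).re) • a, by fun_prop⟩ :
          C(Torus d, EuclideanSpace ℝ (Fin d)))] with x hx
      rw [cosMode, hx, ContinuousMap.coe_mk, Complex.re_ofReal_mul]
      congr 1
      ring
    · refine ⟨_, HasCoeffs.mode (mem_freqs.2 ⟨hz, hn⟩) ha (((-(√2 / 2) : ℝ) : ℂ) * Complex.I) ?_⟩
      rw [h]
      filter_upwards [ContinuousMap.coeFn_toLp (p := 2) (𝕜 := ℝ) (torusVol d)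
        (⟨fun x => (√2 * (UnitAddTorus.mFourier z x).im) • a, by fun_prop⟩ :
          C(Torus d, EuclideanSpace ℝ (Fin d)))] with x hx
      rw [sinMode, hx, ContinuousMap.coe_mk, mul_assoc, Complex.re_ofReal_mul, Complex.I_mul_re]
      congr 1
      ring
  | zero => exact ⟨_, HasCoeffs.zero⟩
  | add v w _ _ hv hw =>
    obtain ⟨c, hc⟩ := hv
    obtain ⟨c', hc'⟩ := hw
    exact ⟨_, hc.add hc'⟩
  | smul r v _ hv =>
    obtain ⟨c, hc⟩ := hv
    exact ⟨_, hc.smul r⟩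

theorem coeff_eq_integral (w : L2Field d) (z : Fin d → ℤ) (i : Fin d) :
    coeff w z i = ∫ x, UnitAddTorus.mFourier (-z) x * ((w x i : ℝ) : ℂ) ∂(torusVol d) := rfl

/-- Orthogonality of the characters. It makes the coefficients of a Galerkin field unique, hence
linear in the field, and turns the infinite sums in `field` and `bessel` into finite ones. -/
theorem HasCoeffs.coeff_eq {w : L2Field d} {c : Fin d → (Fin d → ℤ) → ℂ} (h : HasCoeffs n w c)
    (z : Fin d → ℤ) (i : Fin d) : coeff w z i = c i z := by
  have e1 : coeff w z i = ∫ x, ∑ y ∈ freqs d n, c i y * UnitAddTorus.mFourier (-z + y) x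
      ∂(torusVol d) := by
    rw [coeff_eq_integral]
    refine integral_congr_ae ?_
    filter_upwards [h.ae] with x hx
    rw [hx i, trigSum, Finset.mul_sum]
    refine Finset.sum_congr rfl fun y _ => ?_
    rw [UnitAddTorus.mFourier_add]
    ring
  have e2 : ∀ y, ∫ x, c i y * UnitAddTorus.mFourier (-z + y) x ∂(torusVol d) =
      if y = z then c i y else 0 := by
    intro y
    rw [integral_const_mul]
    split_ifs with hy
    · subst hy
      simp [UnitAddTorus.mFourier_zero]
    · rw [integral_mFourier, mul_zero]
      intro h0
      exact hy (by rw [neg_add_eq_zero] at h0; exact h0.symm)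
  rw [e1, integral_finsetSum _ fun y _ => integrable_torus (by fun_prop)]
  simp only [e2, Finset.sum_ite_eq']
  split_ifs with hz
  · rfl
  · exact (h.supp z hz i).symm

/-- The Fourier coefficients of an element of the Galerkin space. -/
def coords (v : Vn d n) (i : Fin d) (z : Fin d → ℤ) : ℂ := coeff (toField v) z i

theorem hasCoeffs_coords (v : Vn d n) : HasCoeffs n (toField v) (coords v) := by
  obtain ⟨c, hc⟩ := exists_hasCoeffs v
  have : coords v = c := by
    ext i z
    exact hc.coeff_eq z i
  rwa [this]

theorem coords_add (v w : Vn d n) (i : Fin d) (z : Fin d → ℤ) :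
    coords (v + w) i z = coords v i z + coords w i z :=
  ((hasCoeffs_coords v).add (hasCoeffs_coords w)).coeff_eq z i

theorem coords_smul (r : ℝ) (v : Vn d n) (i : Fin d) (z : Fin d → ℤ) :
    coords (r • v) i z = r * coords v i z :=
  ((hasCoeffs_coords v).smul r).coeff_eq z i

/-- The Fourier coefficients as continuous linear maps. -/
def coordsL (n : ℕ) (i : Fin d) (z : Fin d → ℤ) : Vn d n →L[ℝ] ℂ :=
  LinearMap.toContinuousLinearMap
    { toFun := fun v => coords v i z
      map_add' := fun v w => coords_add v w i z
      map_smul' := fun r v => by simp [coords_smul] }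

theorem continuous_coords (i : Fin d) (z : Fin d → ℤ) :
    Continuous fun v : Vn d n => coords v i z := (coordsL n i z).continuous

theorem tsum_coeff_eq (v : Vn d n) (i : Fin d) (m : (Fin d → ℤ) → ℂ) (x : Torus d) :
    ∑' z, m z * coeff (toField v) z i * UnitAddTorus.mFourier z x =
      trigSum (freqs d n) (fun z => m z * coords v i z) x :=
  tsum_eq_sum fun z hz => by
    have : coeff (toField v) z i = 0 := (hasCoeffs_coords v).supp z hz i
    rw [this, mul_zero, zero_mul]

/-- Real-valued trigonometric polynomials: the imaginary part of the field vanishes everywhere. -/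
theorem im_trigSum_coords (v : Vn d n) (i : Fin d) (x : Torus d) :
    (trigSum (freqs d n) (coords v i) x).im = 0 := by
  have hc : Continuous fun x => (trigSum (freqs d n) (coords v i) x).im :=
    Complex.continuous_im.comp (continuous_trigSum _ _)
  have hae : (fun x => (trigSum (freqs d n) (coords v i) x).im) =ᵐ[torusVol d] fun _ => 0 := by
    filter_upwards [(hasCoeffs_coords v).ae] with x hx
    rw [← hx i, Complex.ofReal_im]
  exact congrFun ((Continuous.ae_eq_iff_eq (torusVol d) hc continuous_const).1 hae) x

theorem field_eq (v : Vn d n) (x : Torus d) (i : Fin d) :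
    ((field (toField v) x i : ℝ) : ℂ) = trigSum (freqs d n) (coords v i) x := by
  have h := tsum_coeff_eq v i (fun _ => 1) x
  simp only [one_mul] at h
  apply Complex.ext
  · simp [field, h]
  · simp [im_trigSum_coords]

theorem toTorus_single (j : Fin d) (h : ℝ) :
    toTorus (h • Pi.single j (1 : ℝ)) = Pi.single j (h : UnitAddCircle) := by
  ext i
  rcases eq_or_ne i j with rfl | hij
  · simp [toTorus]
  · simp [toTorus, hij]

theorem hasDerivAt_of_ofReal {f : ℝ → ℝ} {f' : ℂ} {t : ℝ}
    (h : HasDerivAt (fun s => (f s : ℂ)) f' t) : HasDerivAt f f'.re t ∧ f'.im = 0 := by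
  constructor
  · simpa [Function.comp_def] using! Complex.reCLM.hasFDerivAt.comp_hasDerivAt t h
  · have h2 := Complex.imCLM.hasFDerivAt.comp_hasDerivAt t h
    refine ((hasDerivAt_const t (0 : ℝ)).unique ?_).symm
    simpa [Function.comp_def] using! h2

theorem hasDerivAt_field (v : Vn d n) (i j : Fin d) (x : Torus d) :
    HasDerivAt (fun h : ℝ => ((field (toField v) (x + Pi.single j (h : UnitAddCircle)) i : ℝ) : ℂ))
      (trigSum (freqs d n) (dCoeff j (coords v i)) x) 0 := by
  have h := hasDerivAt_trigSum_line (freqs d n) (coords v i) x (Pi.single j 1) 0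
  simp only [toTorus_single] at h
  simp only [field_eq]
  convert! h using 1
  rw [Finset.sum_eq_single j]
  · simp
  · intro k _ hk
    simp [hk]
  · simp

theorem hasDerivAt_field_re (v : Vn d n) (i j : Fin d) (x : Torus d) :
    HasDerivAt (fun h : ℝ => field (toField v) (x + Pi.single j (h : UnitAddCircle)) i)
      (trigSum (freqs d n) (dCoeff j (coords v i)) x).re 0 :=
  (hasDerivAt_of_ofReal (hasDerivAt_field v i j x)).1

theorem pderiv_field_eq (v : Vn d n) (i j : Fin d) (x : Torus d) :
    ((pderiv j (fun y => field (toField v) y i) x : ℝ) : ℂ) =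
      trigSum (freqs d n) (dCoeff j (coords v i)) x := by
  apply Complex.ext
  · rw [Complex.ofReal_re, pderiv, (hasDerivAt_field_re v i j x).deriv]
  · rw [Complex.ofReal_im, (hasDerivAt_of_ofReal (hasDerivAt_field v i j x)).2]

theorem strain_eq (v : Vn d n) (i j : Fin d) (x : Torus d) :
    ((strain (toField v) x i j : ℝ) : ℂ) = trigSum (freqs d n) (eCoeff (coords v) i j) x := by
  rw [strain]
  push_cast
  rw [pderiv_field_eq, pderiv_field_eq, trigSum, trigSum, ← Finset.sum_add_distrib,
    Finset.sum_div, trigSum]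
  refine Finset.sum_congr rfl fun z _ => ?_
  rw [eCoeff, dCoeff, dCoeff]
  ring

theorem bessel_eq (v : Vn d n) (x : Torus d) (i : Fin d) :
    bessel 1 (toField v) x i = (trigSum (freqs d n) (besselCoeff (coords v i)) x).re := by
  have h := tsum_coeff_eq v i
    (fun z => (((1 + 4 * Real.pi ^ 2 * ∑ k, (z k : ℝ) ^ 2) ^ ((1 : ℝ) / 2) : ℝ) : ℂ)) x
  simp only [bessel, h]
  rfl

section Linear

theorem field_add (v w : Vn d n) (x : Torus d) (i : Fin d) :
    field (toField (v + w)) x i = field (toField v) x i + field (toField w) x i := by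
  have : ((field (toField (v + w)) x i : ℝ) : ℂ) =
      ((field (toField v) x i + field (toField w) x i : ℝ) : ℂ) := by
    push_cast
    simp only [field_eq, trigSum, coords_add, add_mul, Finset.sum_add_distrib]
  exact_mod_cast this

theorem pderiv_add (v w : Vn d n) (x : Torus d) (i j : Fin d) :
    pderiv j (fun y => field (toField (v + w)) y i) x =
      pderiv j (fun y => field (toField v) y i) x + pderiv j (fun y => field (toField w) y i) x := by
  have : ((pderiv j (fun y => field (toField (v + w)) y i) x : ℝ) : ℂ) =
      ((pderiv j (fun y => field (toField v) y i) x +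
        pderiv j (fun y => field (toField w) y i) x : ℝ) : ℂ) := by
    push_cast
    simp only [pderiv_field_eq, trigSum, dCoeff, coords_add, mul_add, add_mul,
      Finset.sum_add_distrib]
  exact_mod_cast this

theorem pderiv_smul (r : ℝ) (v : Vn d n) (x : Torus d) (i j : Fin d) :
    pderiv j (fun y => field (toField (r • v)) y i) x =
      r * pderiv j (fun y => field (toField v) y i) x := by
  have : ((pderiv j (fun y => field (toField (r • v)) y i) x : ℝ) : ℂ) =
      ((r * pderiv j (fun y => field (toField v) y i) x : ℝ) : ℂ) := by
    push_cast
    simp only [pderiv_field_eq, trigSum, dCoeff, coords_smul, Finset.mul_sum]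
    exact Finset.sum_congr rfl fun z _ => by ring
  exact_mod_cast this

theorem field_smul (r : ℝ) (v : Vn d n) (x : Torus d) (i : Fin d) :
    field (toField (r • v)) x i = r * field (toField v) x i := by
  have : ((field (toField (r • v)) x i : ℝ) : ℂ) = ((r * field (toField v) x i : ℝ) : ℂ) := by
    push_cast
    simp only [field_eq, trigSum, coords_smul, Finset.mul_sum, mul_assoc]
  exact_mod_cast this

theorem continuous_field (i : Fin d) :
    Continuous fun q : Vn d n × Torus d => field (toField q.1) q.2 i := by
  have h : Continuous fun q : Vn d n × Torus d =>
      (trigSum (freqs d n) (coords q.1 i) q.2).re :=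
    Complex.continuous_re.comp (continuous_finsetSum _ fun z _ =>
      ((continuous_coords i z).comp continuous_fst).mul
        ((UnitAddTorus.mFourier z).continuous.comp continuous_snd))
  simpa only [← field_eq, Complex.ofReal_re] using h

theorem continuous_pderiv (i j : Fin d) :
    Continuous fun q : Vn d n × Torus d => pderiv j (fun y => field (toField q.1) y i) q.2 := by
  have h : Continuous fun q : Vn d n × Torus d =>
      (trigSum (freqs d n) (dCoeff j (coords q.1 i)) q.2).re :=
    Complex.continuous_re.comp (continuous_finsetSum _ fun z _ =>
      (continuous_const.mul ((continuous_coords i z).comp continuous_fst)).mul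
        ((UnitAddTorus.mFourier z).continuous.comp continuous_snd))
  simpa only [← pderiv_field_eq, Complex.ofReal_re] using h

end Linear

end GalerkinSpace

/-! ### Integrals of nonlinear functions of trigonometric polynomials -/

section Nonlinear

variable {V T D : Type*} [NormedAddCommGroup V] [NormedSpace ℝ V]
  [NormedAddCommGroup D] [NormedSpace ℝ D]

theorem exists_lipschitz_closedBall [FiniteDimensional ℝ D] {Φ : D → ℝ} (hΦ : ContDiff ℝ 1 Φ)
    (R : ℝ) : ∃ L, 0 ≤ L ∧ ∀ y y', ‖y‖ ≤ R → ‖y'‖ ≤ R → |Φ y - Φ y'| ≤ L * ‖y - y'‖ := by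
  have := FiniteDimensional.proper ℝ D
  obtain ⟨L, hL⟩ := ((isCompact_closedBall (0 : D) R).image
    (hΦ.continuous_fderiv one_ne_zero)).isBounded.exists_norm_le
  refine ⟨max L 0, le_max_right _ _, fun y y' hy hy' => ?_⟩
  exact (convex_closedBall (0 : D) R).norm_image_sub_le_of_norm_fderiv_le
    (fun z _ => (hΦ.differentiable one_ne_zero) z)
    (fun z hz => (hL _ ⟨z, hz, rfl⟩).trans (le_max_left _ _))
    (by simpa using hy') (by simpa using hy)

theorem continuous_integral_of_continuous [FiniteDimensional ℝ V] [TopologicalSpace T]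
    [CompactSpace T] [MeasurableSpace T] [OpensMeasurableSpace T] {μ : Measure T}
    [IsFiniteMeasure μ] {f : V → T → ℝ}
    (hf : Continuous fun q : V × T => f q.1 q.2) : Continuous fun v => ∫ x, f v x ∂μ := by
  have := FiniteDimensional.proper ℝ V
  have h := continuous_parametric_integral_of_continuous (μ := μ) (f := f) hf
    (isCompact_univ (X := T))
  simpa using h

end Nonlinear

/-- On a ball of V the inner map takes values in a fixed ball of D, where the C¹ function Φ has one
Lipschitz constant valid at all points of T. The drift is of this form, with the values of the
fields and their gradients as inner map. -/
theorem exists_lipschitz_integral {V T D : Type*} [NormedAddCommGroup V]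
    [NormedAddCommGroup D] [NormedSpace ℝ D] [FiniteDimensional ℝ D] [TopologicalSpace T]
    [CompactSpace T] [MeasurableSpace T] [OpensMeasurableSpace T] {μ : Measure T}
    [IsFiniteMeasure μ] {Φ : D → ℝ} (hΦ : ContDiff ℝ 1 Φ) {l : V → T → D}
    (hl : Continuous fun q : V × T => l q.1 q.2) {K : ℝ} (hK : 0 ≤ K)
    (hsub : ∀ v w x, ‖l v x - l w x‖ ≤ K * ‖v - w‖) (h0 : ∀ x, l 0 x = 0) (R : ℝ) :
    ∃ L, 0 ≤ L ∧ ∀ v w, ‖v‖ ≤ R → ‖w‖ ≤ R →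
      |∫ x, Φ (l v x) ∂μ - ∫ x, Φ (l w x) ∂μ| ≤ L * ‖v - w‖ := by
  obtain ⟨L, hL, h⟩ := exists_lipschitz_closedBall hΦ (K * R)
  have hint : ∀ v, Integrable (fun x => Φ (l v x)) μ := fun v =>
    (hΦ.continuous.comp (hl.comp (by fun_prop : Continuous fun x : T => (v, x)))
      ).integrable_of_hasCompactSupport (HasCompactSupport.of_compactSpace _)
  have hb : ∀ v x, ‖v‖ ≤ R → ‖l v x‖ ≤ K * R := fun v x hv => by
    have := hsub v 0 x
    rw [h0, sub_zero, sub_zero] at this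
    exact this.trans (mul_le_mul_of_nonneg_left hv hK)
  refine ⟨L * K * μ.real Set.univ, by positivity, fun v w hv hw => ?_⟩
  rw [← integral_sub (hint v) (hint w)]
  have := norm_integral_le_of_norm_le_const (μ := μ)
    (f := fun x => Φ (l v x) - Φ (l w x)) (C := L * (K * ‖v - w‖)) (Eventually.of_forall fun x =>
      (h _ _ (hb v x hv) (hb w x hw)).trans (mul_le_mul_of_nonneg_left (hsub v w x) hL))
  rw [Real.norm_eq_abs] at this
  linarith

section Slices

variable {X T : Type*} [TopologicalSpace X] [TopologicalSpace T] {f : X → T → ℝ}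

theorem continuous_uncurry_fst (hf : Continuous fun q : X × T => f q.1 q.2) :
    Continuous fun q : (X × X) × T => f q.1.1 q.2 :=
  hf.comp ((continuous_fst.comp continuous_fst).prodMk continuous_snd)

theorem continuous_uncurry_snd (hf : Continuous fun q : X × T => f q.1 q.2) :
    Continuous fun q : (X × X) × T => f q.1.2 q.2 :=
  hf.comp ((continuous_snd.comp continuous_fst).prodMk continuous_snd)

end Slices

theorem integrable_slice {d : ℕ} {X : Type*} [TopologicalSpace X] {f : X → Torus d → ℝ}
    (hf : Continuous fun q : X × Torus d => f q.1 q.2) (a : X) : Integrable (f a) (torusVol d) :=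
  integrable_torus (hf.comp (Continuous.prodMk_right a))

/-! ### The drift of the Galerkin equation is Lipschitz on bounded sets -/

section Drift

variable {d n : ℕ}

theorem field_sub (v w : Vn d n) (x : Torus d) (i : Fin d) :
    field (toField (v - w)) x i = field (toField v) x i - field (toField w) x i := by
  have h := field_add (v - w) w x i
  rw [sub_add_cancel] at h
  linarith

theorem pderiv_sub (v w : Vn d n) (x : Torus d) (i j : Fin d) :
    pderiv j (fun y => field (toField (v - w)) y i) x =
      pderiv j (fun y => field (toField v) y i) x - pderiv j (fun y => field (toField w) y i) x := by
  have h := pderiv_add (v - w) w x i j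
  rw [sub_add_cancel] at h
  linarith

theorem continuous_strain (i j : Fin d) :
    Continuous fun q : Vn d n × Torus d => strain (toField q.1) q.2 i j :=
  ((continuous_pderiv j i).add (continuous_pderiv i j)).div_const 2

theorem continuous_stress (ν p : ℝ) (i j : Fin d) :
    Continuous fun q : Vn d n × Torus d => stress ν p (toField q.1) q.2 i j := by
  have h : Continuous fun q : Vn d n × Torus d =>
      1 + ∑ k, ∑ l, strain (toField q.1) q.2 k l ^ 2 :=
    continuous_const.add (continuous_finsetSum _ fun k _ => continuous_finsetSum _ fun l _ =>
      (continuous_strain k l).pow 2)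
  refine (continuous_const.mul (h.rpow_const fun q => Or.inl ?_)).mul (continuous_strain i j)
  have : 0 ≤ ∑ k, ∑ l, strain (toField q.1) q.2 k l ^ 2 := by positivity
  linarith

theorem exists_bound_field (d n : ℕ) : ∃ K, 0 ≤ K ∧ ∀ (v : Vn d n) (x : Torus d) (i j : Fin d),
    |field (toField v) x i| ≤ K * ‖v‖ ∧
      |pderiv j (fun y => field (toField v) y i) x| ≤ K * ‖v‖ ∧
      |strain (toField v) x i j| ≤ K * ‖v‖ := by
  have h1 : ∀ i, ∃ K, 0 ≤ K ∧ ∀ (v : Vn d n) (x : Torus d), |field (toField v) x i| ≤ K * ‖v‖ :=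
    fun i => exists_bound_of_linear (f := fun (v : Vn d n) x => field (toField v) x i)
      (continuous_field i) fun r v x => field_smul r v x i
  have h2 : ∀ q : Fin d × Fin d, ∃ K, 0 ≤ K ∧ ∀ (v : Vn d n) (x : Torus d),
      |pderiv q.2 (fun y => field (toField v) y q.1) x| ≤ K * ‖v‖ :=
    fun q => exists_bound_of_linear
      (f := fun (v : Vn d n) x => pderiv q.2 (fun y => field (toField v) y q.1) x)
      (continuous_pderiv q.1 q.2) fun r v x => pderiv_smul r v x q.1 q.2
  choose K₁ hK₁ h1 using h1
  choose K₂ hK₂ h2 using h2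
  have le1 : ∀ i, K₁ i ≤ ∑ i, K₁ i + ∑ q, K₂ q := fun i =>
    (Finset.single_le_sum (fun i _ => hK₁ i) (Finset.mem_univ i)).trans
      (le_add_of_nonneg_right (Finset.sum_nonneg fun q _ => hK₂ q))
  have le2 : ∀ q, K₂ q ≤ ∑ i, K₁ i + ∑ q, K₂ q := fun q =>
    (Finset.single_le_sum (fun q _ => hK₂ q) (Finset.mem_univ q)).trans
      (le_add_of_nonneg_left (Finset.sum_nonneg fun i _ => hK₁ i))
  have h2' : ∀ (v : Vn d n) (x : Torus d) (i j : Fin d),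
      |pderiv j (fun y => field (toField v) y i) x| ≤ (∑ i, K₁ i + ∑ q, K₂ q) * ‖v‖ :=
    fun v x i j => (h2 (i, j) v x).trans (mul_le_mul_of_nonneg_right (le2 _) (norm_nonneg _))
  refine ⟨∑ i, K₁ i + ∑ q, K₂ q, add_nonneg (Finset.sum_nonneg fun i _ => hK₁ i)
    (Finset.sum_nonneg fun q _ => hK₂ q), fun v x i j => ⟨?_, h2' v x i j, ?_⟩⟩
  · exact (h1 i v x).trans (mul_le_mul_of_nonneg_right (le1 _) (norm_nonneg _))
  · have ha := abs_le.1 (h2' v x i j)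
    have hb := abs_le.1 (h2' v x j i)
    rw [strain, abs_le]
    constructor <;> linarith [ha.1, ha.2, hb.1, hb.2]

/-- The values of `v`, `∇v` and `∇φ` at `x`. -/
def jet (q : Vn d n × Vn d n) (x : Torus d) :
    (Fin d → ℝ) × (Fin d → Fin d → ℝ) × (Fin d → Fin d → ℝ) :=
  (fun i => field (toField q.1) x i, fun i j => pderiv j (fun y => field (toField q.1) y i) x,
    fun i j => pderiv j (fun y => field (toField q.2) y i) x)

/-- The integrand of the form `⟨φ, b(v)⟩`. -/
def driftIntegrand (d : ℕ) (ν p : ℝ)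
    (y : (Fin d → ℝ) × (Fin d → Fin d → ℝ) × (Fin d → Fin d → ℝ)) : ℝ :=
  ∑ i, y.1 i * ∑ j, y.1 j * y.2.2 i j - ∑ i, ∑ j, (y.2.2 j i + y.2.2 i j) / 2 *
    (2 * ν * (1 + ∑ k, ∑ l, ((y.2.1 l k + y.2.1 k l) / 2) ^ 2) ^ ((p - 2) / 2) *
      ((y.2.1 j i + y.2.1 i j) / 2))

/-- The base of the real power is at least 1, so the power is smooth even for p < 2; the rest is
polynomial. -/
theorem contDiff_driftIntegrand (d : ℕ) (ν p : ℝ) : ContDiff ℝ 1 (driftIntegrand d ν p) := by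
  have h : ContDiff ℝ 1 fun y : (Fin d → ℝ) × (Fin d → Fin d → ℝ) × (Fin d → Fin d → ℝ) =>
      (1 + ∑ k, ∑ l, ((y.2.1 l k + y.2.1 k l) / 2) ^ 2) ^ ((p - 2) / 2) := by
    refine ContDiff.rpow_const_of_ne (by fun_prop) fun y => ?_
    have : 0 ≤ ∑ k, ∑ l, ((y.2.1 l k + y.2.1 k l) / 2) ^ 2 := by positivity
    linarith
  unfold driftIntegrand
  fun_prop

theorem continuous_jet : Continuous fun q : (Vn d n × Vn d n) × Torus d => jet q.1 q.2 :=
  Continuous.prodMk (continuous_pi fun i => continuous_uncurry_fst (f := fun v x => field (toField v) x i) (continuous_field i))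
    (Continuous.prodMk
      (continuous_pi fun i => continuous_pi fun j =>
        continuous_uncurry_fst (f := fun v x => pderiv j (fun y => field (toField v) y i) x)
          (continuous_pderiv i j))
      (continuous_pi fun i => continuous_pi fun j =>
        continuous_uncurry_snd (f := fun v x => pderiv j (fun y => field (toField v) y i) x)
          (continuous_pderiv i j)))

theorem continuous_advection_integrand :
    Continuous fun q : (Vn d n × Vn d n) × Torus d => ∑ i, field (toField q.1.1) q.2 i *
      ∑ j, field (toField q.1.1) q.2 j * pderiv j (fun y => field (toField q.1.2) y i) q.2 := by
  have h1 : ∀ i, Continuous fun q : (Vn d n × Vn d n) × Torus d => field (toField q.1.1) q.2 i :=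
    fun i => continuous_uncurry_fst (f := fun v x => field (toField v) x i) (continuous_field i)
  have h2 : ∀ i j, Continuous fun q : (Vn d n × Vn d n) × Torus d =>
      pderiv j (fun y => field (toField q.1.2) y i) q.2 :=
    fun i j => continuous_uncurry_snd (f := fun v x => pderiv j (fun y => field (toField v) y i) x)
      (continuous_pderiv i j)
  exact continuous_finsetSum _ fun i _ => (h1 i).mul
    (continuous_finsetSum _ fun j _ => (h1 j).mul (h2 i j))

theorem continuous_stress_integrand (ν p : ℝ) :
    Continuous fun q : (Vn d n × Vn d n) × Torus d => ∑ i, ∑ j,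
      strain (toField q.1.1) q.2 i j * stress ν p (toField q.1.2) q.2 i j :=
  continuous_finsetSum _ fun i _ => continuous_finsetSum _ fun j _ =>
    (continuous_uncurry_fst (f := fun v x => strain (toField v) x i j)
      (continuous_strain i j)).mul
      (continuous_uncurry_snd (f := fun v x => stress ν p (toField v) x i j)
        (continuous_stress ν p i j))

theorem integrable_advection (v φ : Vn d n) : Integrable (fun x => ∑ i, field (toField v) x i *
    ∑ j, field (toField v) x j * pderiv j (fun y => field (toField φ) y i) x) (torusVol d) :=
  integrable_slice (f := fun (q : Vn d n × Vn d n) x => ∑ i, field (toField q.1) x i *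
    ∑ j, field (toField q.1) x j * pderiv j (fun y => field (toField q.2) y i) x)
    continuous_advection_integrand (v, φ)

theorem integrable_stress (ν p : ℝ) (φ v : Vn d n) : Integrable (fun x => ∑ i, ∑ j,
    strain (toField φ) x i j * stress ν p (toField v) x i j) (torusVol d) :=
  integrable_slice (f := fun (q : Vn d n × Vn d n) x => ∑ i, ∑ j,
    strain (toField q.1) x i j * stress ν p (toField q.2) x i j)
    (continuous_stress_integrand ν p) (φ, v)

theorem integrable_driftIntegrand (ν p : ℝ) (v φ : Vn d n) :
    Integrable (fun x => driftIntegrand d ν p (jet (v, φ) x)) (torusVol d) :=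
  integrable_slice (f := fun q x => driftIntegrand d ν p (jet q x))
    ((contDiff_driftIntegrand d ν p).continuous.comp continuous_jet) (v, φ)

theorem driftForm_eq (ν p : ℝ) (v φ : Vn d n) : driftForm ν p (toField v) (toField φ) =
    ∫ x, driftIntegrand d ν p (jet (v, φ) x) ∂(torusVol d) := by
  rw [driftForm, advection, strainStress,
    ← integral_sub (integrable_advection v φ) (integrable_stress ν p φ v)]
  rfl

/-- The pair (v, φ) is treated as one variable because the integrand is a C¹ function of the joint
jet, which is linear in the pair; its sup norm over the torus is controlled since the Galerkin space
is finite-dimensional. -/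
theorem exists_lipschitz_driftForm (d n : ℕ) (ν p R : ℝ) : ∃ L, 0 ≤ L ∧
    ∀ q q' : Vn d n × Vn d n, ‖q‖ ≤ R → ‖q'‖ ≤ R →
      |driftForm ν p (toField q.1) (toField q.2) - driftForm ν p (toField q'.1) (toField q'.2)| ≤
        L * ‖q - q'‖ := by
  obtain ⟨K, hK, hb⟩ := exists_bound_field d n
  have := exists_lipschitz_integral (μ := torusVol d) (contDiff_driftIntegrand d ν p)
    (continuous_jet (d := d) (n := n)) hK (fun q q' x => ?_) (fun x => ?_) R
  · simpa only [driftForm_eq] using! this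
  · have h1 : ‖q.1 - q'.1‖ ≤ ‖q - q'‖ := norm_fst_le (q - q')
    have h2 : ‖q.2 - q'.2‖ ≤ ‖q - q'‖ := norm_snd_le (q - q')
    have hn : 0 ≤ K * ‖q - q'‖ := by positivity
    refine norm_prod_le_iff.2 ⟨(pi_norm_le_iff_of_nonneg hn).2 fun i => ?_, norm_prod_le_iff.2
      ⟨(pi_norm_le_iff_of_nonneg hn).2 fun i => (pi_norm_le_iff_of_nonneg hn).2 fun j => ?_,
        (pi_norm_le_iff_of_nonneg hn).2 fun i => (pi_norm_le_iff_of_nonneg hn).2 fun j => ?_⟩⟩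
    · have := (hb (q.1 - q'.1) x i i).1
      rw [field_sub] at this
      exact this.trans (mul_le_mul_of_nonneg_left h1 hK)
    · have := (hb (q.1 - q'.1) x i j).2.1
      rw [pderiv_sub] at this
      exact this.trans (mul_le_mul_of_nonneg_left h1 hK)
    · have := (hb (q.2 - q'.2) x i j).2.1
      rw [pderiv_sub] at this
      exact this.trans (mul_le_mul_of_nonneg_left h2 hK)
  · have h1 : ∀ i, field (toField (0 : Vn d n)) x i = 0 := fun i => by
      simpa using field_smul 0 (0 : Vn d n) x i
    have h2 : ∀ i j, pderiv j (fun y => field (toField (0 : Vn d n)) y i) x = 0 := fun i j => by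
      simpa using pderiv_smul 0 (0 : Vn d n) x i j
    refine Prod.ext (funext fun i => h1 i) (Prod.ext (funext fun i => funext fun j => h2 i j)
      (funext fun i => funext fun j => h2 i j))

theorem driftForm_add (ν p : ℝ) (v φ ψ : Vn d n) :
    driftForm ν p (toField v) (toField (φ + ψ)) =
      driftForm ν p (toField v) (toField φ) + driftForm ν p (toField v) (toField ψ) := by
  simp only [driftForm_eq]
  rw [← integral_add (integrable_driftIntegrand ν p v φ) (integrable_driftIntegrand ν p v ψ)]
  congr 1
  ext x
  simp only [driftIntegrand, jet, pderiv_add, mul_add, add_mul,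
    Finset.sum_add_distrib, add_div]
  ring

theorem driftForm_smul (ν p r : ℝ) (v φ : Vn d n) :
    driftForm ν p (toField v) (toField (r • φ)) = r * driftForm ν p (toField v) (toField φ) := by
  simp only [driftForm_eq]
  rw [← integral_const_mul]
  congr 1
  ext x
  simp only [driftIntegrand, jet, pderiv_smul, mul_sub, Finset.mul_sum]
  congr 1
  · exact Finset.sum_congr rfl fun i _ => Finset.sum_congr rfl fun j _ => by ring
  · exact Finset.sum_congr rfl fun i _ => Finset.sum_congr rfl fun j _ => by ring

/-- The Riesz representative of a linear functional, in an orthonormal basis. -/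
theorem inner_sum_basis {E ι : Type*} [NormedAddCommGroup E] [InnerProductSpace ℝ E] [Fintype ι]
    (e : OrthonormalBasis ι ℝ E) (F : E →ₗ[ℝ] ℝ) (φ : E) :
    ⟪φ, ∑ k, F (e k) • e k⟫_ℝ = F φ := by
  conv_rhs => rw [← e.sum_repr' φ]
  simp only [inner_sum, inner_smul_right, map_sum, map_smul, smul_eq_mul, real_inner_comm φ,
    mul_comm]

theorem inner_drift (ν p : ℝ) (φ v : Vn d n) :
    ⟪φ, drift ν p v⟫_ℝ = driftForm ν p (toField v) (toField φ) :=
  inner_sum_basis (stdOrthonormalBasis ℝ (Vn d n))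
    { toFun := fun φ => driftForm ν p (toField v) (toField φ)
      map_add' := driftForm_add ν p v
      map_smul' := fun r φ => driftForm_smul ν p r v φ } φ

/-- The second argument of F takes only unit vectors as values, hence the radius `max R 1` in the
hypothesis. -/
theorem exists_lipschitz_sum_basis {E ι : Type*} [NormedAddCommGroup E] [InnerProductSpace ℝ E]
    [Fintype ι] (e : OrthonormalBasis ι ℝ E) (F : E → E → ℝ) (R : ℝ)
    (hF : ∃ L, 0 ≤ L ∧ ∀ q q' : E × E, ‖q‖ ≤ max R 1 → ‖q'‖ ≤ max R 1 →
      |F q.1 q.2 - F q'.1 q'.2| ≤ L * ‖q - q'‖) :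
    ∃ L, 0 ≤ L ∧ ∀ v w : E, ‖v‖ ≤ R → ‖w‖ ≤ R →
      ‖∑ k, F v (e k) • e k - ∑ k, F w (e k) • e k‖ ≤ L * ‖v - w‖ := by
  obtain ⟨L, hL, h⟩ := hF
  refine ⟨Fintype.card ι * L, by positivity, fun v w hv hw => ?_⟩
  rw [← Finset.sum_sub_distrib]
  refine (norm_sum_le _ _).trans ((Finset.sum_le_card_nsmul _ _ (L * ‖v - w‖) fun k _ => ?_).trans
    (by simp [mul_assoc]))
  rw [← sub_smul, norm_smul, e.norm_eq_one, mul_one]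
  have := h (v, e k) (w, e k)
    (norm_prod_le_iff.2 ⟨hv.trans (le_max_left _ _), by simp⟩)
    (norm_prod_le_iff.2 ⟨hw.trans (le_max_left _ _), by simp⟩)
  simpa [Prod.norm_def] using this

theorem exists_lipschitz_drift (d n : ℕ) (ν p R : ℝ) : ∃ L, 0 ≤ L ∧
    ∀ v w : Vn d n, ‖v‖ ≤ R → ‖w‖ ≤ R → ‖drift ν p v - drift ν p w‖ ≤ L * ‖v - w‖ :=
  exists_lipschitz_sum_basis (stdOrthonormalBasis ℝ (Vn d n))
    (fun v φ => driftForm ν p (toField v) (toField φ)) R (exists_lipschitz_driftForm d n ν p _)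

end Drift

theorem continuous_slice {X T : Type*} [TopologicalSpace X] [TopologicalSpace T] {f : X → T → ℝ}
    (hf : Continuous fun q : X × T => f q.1 q.2) (a : X) : Continuous (f a) :=
  hf.comp (Continuous.prodMk_right a)

/-! ### Energy balance and coercivity of the drift -/

section Energy

variable {d n : ℕ}

theorem continuous_single_coe (j : Fin d) :
    Continuous fun t : ℝ => (Pi.single j (t : UnitAddCircle) : Torus d) := by
  simp only [← toTorus_single]
  exact continuous_toTorus.comp (by fun_prop)

/-- The derivative of a differentiable function on the torus in a coordinate direction has mean
zero. -/
theorem integral_deriv_line_eq_zero {f g : Torus d → ℝ} (j : Fin d)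
    (hg : Continuous g)
    (h : ∀ x, HasDerivAt (fun t : ℝ => f (x + Pi.single j (t : UnitAddCircle))) (g x) 0) :
    ∫ x, g x ∂(torusVol d) = 0 := by
  have hline : ∀ (x : Torus d) (t : ℝ), HasDerivAt (fun t : ℝ => f (x + Pi.single j (t : UnitAddCircle)))
      (g (x + Pi.single j (t : UnitAddCircle))) t := by
    intro x t
    have h1 := h (x + Pi.single j (t : UnitAddCircle))
    rw [show (0 : ℝ) = t - t by ring] at h1
    have h2 := HasDerivAt.comp_sub_const t t h1
    refine h2.congr_of_eventuallyEq (Eventually.of_forall fun s => ?_)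
    simp only
    rw [add_assoc, ← Pi.single_add, ← AddCircle.coe_add, add_sub_cancel]
  have ct : ∀ x : Torus d, Continuous fun t : ℝ => x + Pi.single j (t : UnitAddCircle) := fun x =>
    continuous_const.add (continuous_single_coe j)
  -- The integral is averaged over translations by t in direction j. After exchanging the integrals,
  -- the inner one is that of a derivative over a closed loop.
  have key : ∫ t in (0 : ℝ)..1, ∫ x, g (x + Pi.single j (t : UnitAddCircle)) ∂(torusVol d) =
      ∫ x, g x ∂(torusVol d) := by
    simp only [integral_torus_add_right]
    simp
  have cg : Continuous fun q : ℝ × Torus d => g (q.2 + Pi.single j (q.1 : UnitAddCircle)) :=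
    hg.comp (continuous_snd.add ((continuous_single_coe j).comp continuous_fst))
  obtain ⟨B, hB⟩ := (isCompact_range hg).isBounded.exists_norm_le
  have hprod : Integrable (Function.uncurry fun (t : ℝ) x => g (x + Pi.single j (t : UnitAddCircle)))
      ((volume.restrict (Set.Ioc (0 : ℝ) 1)).prod (torusVol d)) :=
    Integrable.of_bound cg.aestronglyMeasurable B (Eventually.of_forall fun q => hB _ ⟨_, rfl⟩)
  rw [← key, intervalIntegral.integral_of_le zero_le_one, integral_integral_swap hprod]
  have : ∀ x : Torus d, ∫ t in Set.Ioc (0 : ℝ) 1, g (x + Pi.single j (t : UnitAddCircle)) = 0 := by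
    intro x
    rw [← intervalIntegral.integral_of_le zero_le_one,
      intervalIntegral.integral_eq_sub_of_hasDerivAt (fun t _ => hline x t)
      ((hg.comp (ct x)).intervalIntegrable _ _)]
    have : ((1 : ℝ) : UnitAddCircle) = 0 := AddCircle.coe_period 1
    simp [this]
  simp [this]

theorem sum_pderiv_eq_zero (v : Vn d n) (x : Torus d) :
    ∑ j, pderiv j (fun y => field (toField v) y j) x = 0 := by
  have : ((∑ j, pderiv j (fun y => field (toField v) y j) x : ℝ) : ℂ) = 0 := by
    push_cast
    simp only [pderiv_field_eq, trigSum]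
    rw [Finset.sum_comm]
    refine Finset.sum_eq_zero fun z _ => ?_
    have := (hasCoeffs_coords v).div z
    calc _ = 2 * Real.pi * Complex.I * (∑ i, (z i : ℂ) * coords v i z) *
          UnitAddTorus.mFourier z x := by
          rw [Finset.mul_sum, Finset.sum_mul]
          exact Finset.sum_congr rfl fun i _ => by rw [dCoeff]; ring
      _ = 0 := by rw [this]; ring
  exact_mod_cast this

theorem hasDerivAt_field_pderiv (v : Vn d n) (i j : Fin d) (x : Torus d) :
    HasDerivAt (fun h : ℝ => field (toField v) (x + Pi.single j (h : UnitAddCircle)) i)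
      (pderiv j (fun y => field (toField v) y i) x) 0 :=
  (hasDerivAt_field_re v i j x).differentiableAt.hasDerivAt

theorem continuous_field_right (v : Vn d n) (i : Fin d) :
    Continuous fun x => field (toField v) x i :=
  continuous_slice (f := fun v x => field (toField v) x i) (continuous_field i) v

theorem continuous_pderiv_right (v : Vn d n) (i j : Fin d) :
    Continuous fun x => pderiv j (fun y => field (toField v) y i) x :=
  continuous_slice (f := fun v x => pderiv j (fun y => field (toField v) y i) x)
    (continuous_pderiv i j) v

/-- For each j the integral of ∂_j(v_j |v|²) vanishes. Summed over j, the integrand is (div v)|v|² +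
2v·(v·∇)v, and div v = 0. -/
theorem advection_self (v : Vn d n) : advection (toField v) (toField v) (toField v) = 0 := by
  have h : ∀ j, ∫ x, (pderiv j (fun y => field (toField v) y j) x *
      (∑ i, field (toField v) x i ^ 2) + field (toField v) x j *
        ∑ i, 2 * field (toField v) x i * pderiv j (fun y => field (toField v) y i) x)
      ∂(torusVol d) = 0 := by
    intro j
    have c1 := continuous_field_right v
    have c2 := continuous_pderiv_right v
    refine integral_deriv_line_eq_zero (f := fun x => field (toField v) x j *
      ∑ i, field (toField v) x i ^ 2) j (by fun_prop) fun x => ?_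
    have h0 : (Pi.single j ((0 : ℝ) : UnitAddCircle) : Torus d) = 0 := by simp
    have h1 := (hasDerivAt_field_pderiv v j j x).mul (HasDerivAt.fun_sum (u := Finset.univ)
      fun i _ => (hasDerivAt_field_pderiv v i j x).pow 2)
    simpa [h0] using! h1
  have hsum : ∫ x, ∑ j, (pderiv j (fun y => field (toField v) y j) x *
      (∑ i, field (toField v) x i ^ 2) + field (toField v) x j *
        ∑ i, 2 * field (toField v) x i * pderiv j (fun y => field (toField v) y i) x)
      ∂(torusVol d) = 0 := by
    rw [integral_finsetSum]
    · exact Finset.sum_eq_zero fun j _ => h j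
    · have c1 := continuous_field_right v
      have c2 := continuous_pderiv_right v
      intro j _
      exact integrable_torus (by fun_prop)
  have e : ∀ x, ∑ j, (pderiv j (fun y => field (toField v) y j) x *
      (∑ i, field (toField v) x i ^ 2) + field (toField v) x j *
        ∑ i, 2 * field (toField v) x i * pderiv j (fun y => field (toField v) y i) x) =
      2 * ∑ i, field (toField v) x i *
        ∑ j, field (toField v) x j * pderiv j (fun y => field (toField v) y i) x := by
    intro x
    rw [Finset.sum_add_distrib, ← Finset.sum_mul, sum_pderiv_eq_zero, zero_mul, zero_add]
    simp only [Finset.mul_sum]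
    rw [Finset.sum_comm]
    exact Finset.sum_congr rfl fun i _ => Finset.sum_congr rfl fun j _ => by ring
  simp only [e] at hsum
  rw [integral_const_mul] at hsum
  exact (mul_eq_zero.1 hsum).resolve_left two_ne_zero

theorem inner_drift_self (ν p : ℝ) (v : Vn d n) :
    ⟪v, drift ν p v⟫_ℝ = -strainStress ν p (toField v) (toField v) := by
  rw [inner_drift, driftForm, advection_self, zero_sub]

theorem stress_pairing (ν p : ℝ) (φ v : L2Field d) (x : Torus d) :
    ∑ i, ∑ j, strain φ x i j * stress ν p v x i j =
      2 * ν * (1 + ∑ k, ∑ l, strain v x k l ^ 2) ^ ((p - 2) / 2) *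
        ∑ i, ∑ j, strain φ x i j * strain v x i j := by
  simp only [stress, Finset.mul_sum]
  exact Finset.sum_congr rfl fun i _ => Finset.sum_congr rfl fun j _ => by ring

theorem strainStress_self_nonneg {ν : ℝ} (hν : 0 ≤ ν) (p : ℝ) (v : L2Field d) :
    0 ≤ strainStress ν p v v := by
  refine integral_nonneg fun x => ?_
  simp only [Pi.zero_apply, stress_pairing, ← sq]
  positivity

theorem abs_sum_le_card_mul {ι : Type*} [Fintype ι] (f : ι → ℝ) {B : ℝ} (h : ∀ i, |f i| ≤ B) :
    |∑ i, f i| ≤ Fintype.card ι * B := by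
  refine (Finset.abs_sum_le_sum_abs _ _).trans ((Finset.sum_le_card_nsmul _ _ B fun i _ => h i).trans
    (by simp))

/-- The shift w is the value of the forcing path, since the equation is an ordinary one only for X −
f. By `advection_self` the only advection term left is −⟨x, (x·∇)w⟩, quadratic in x. In the stress
term e(w):e(x) ≤ (|e(w)|² + |e(x)|²)/2 leaves a positive multiple of |e(w)|² − |e(x)|². This is
either nonpositive, or |e(x)| is bounded by |e(w)| and everything is bounded. -/
theorem exists_coercive_drift (d n : ℕ) {ν : ℝ} (hν : 0 ≤ ν) {p : ℝ} (hp : 0 ≤ p) (K : ℝ) :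
    ∃ C, ∀ w x : Vn d n, ‖w‖ ≤ K → ⟪x - w, drift ν p x⟫_ℝ ≤ C * (1 + ‖x‖ ^ 2) := by
  rcases lt_or_ge K 0 with hK0 | hK0
  · exact ⟨0, fun w x hw => absurd (norm_nonneg w) (by linarith)⟩
  obtain ⟨B, hB, hb⟩ := exists_bound_field d n
  set M : ℝ := d * (d * (B * K) ^ 2) with hM
  set C₁ : ℝ := d * (B * (d * (B * (B * K)))) with hC₁
  set C₂ : ℝ := 2 * ν * (1 + M) ^ (p / 2) * (M / 2) with hC₂
  have hM0 : 0 ≤ M := by positivity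
  refine ⟨C₁ + C₂, fun w x hw => ?_⟩
  have hd : ⟪x - w, drift ν p x⟫_ℝ = -advection (toField x) (toField x) (toField w) +
      (strainStress ν p (toField w) (toField x) - strainStress ν p (toField x) (toField x)) := by
    refine (inner_sub_left x w (drift ν p x)).trans ?_
    rw [inner_drift_self, inner_drift, driftForm]
    ring
  have h1 : |advection (toField x) (toField x) (toField w)| ≤ C₁ * ‖x‖ ^ 2 := by
    rw [advection, ← Real.norm_eq_abs]
    refine (norm_integral_le_of_norm_le_const (C := C₁ * ‖x‖ ^ 2)
      (Eventually.of_forall fun y => ?_)).trans (by simp)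
    have := abs_sum_le_card_mul (fun i => field (toField x) y i *
      ∑ j, field (toField x) y j * pderiv j (fun y => field (toField w) y i) y)
      (B := (B * ‖x‖) * (d * ((B * ‖x‖) * (B * K)))) fun i => by
        rw [abs_mul]
        refine mul_le_mul (hb x y i i).1 ?_ (abs_nonneg _) (by positivity)
        have := abs_sum_le_card_mul (fun j =>
          field (toField x) y j * pderiv j (fun y => field (toField w) y i) y)
          (B := (B * ‖x‖) * (B * K)) fun j => by
            rw [abs_mul]
            exact mul_le_mul (hb x y j j).1 ((hb w y i j).2.1.trans
              (mul_le_mul_of_nonneg_left hw hB)) (abs_nonneg _) (by positivity)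
        simpa using this
    rw [Real.norm_eq_abs]
    refine this.trans (le_of_eq ?_)
    rw [hC₁, Fintype.card_fin]
    ring
  have h2 : strainStress ν p (toField w) (toField x) - strainStress ν p (toField x) (toField x) ≤
      C₂ := by
    rw [strainStress, strainStress,
      ← integral_sub (integrable_stress ν p w x) (integrable_stress ν p x x)]
    have hle : ∀ y, ∑ i, ∑ j, strain (toField w) y i j * stress ν p (toField x) y i j -
        ∑ i, ∑ j, strain (toField x) y i j * stress ν p (toField x) y i j ≤ C₂ := by
      intro y
      rw [stress_pairing, stress_pairing, ← mul_sub]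
      set A := ∑ i, ∑ j, strain (toField x) y i j ^ 2 with hA
      set D := ∑ i, ∑ j, strain (toField w) y i j ^ 2 with hD
      have hA0 : 0 ≤ A := by positivity
      have hS : ∑ i, ∑ j, strain (toField w) y i j * strain (toField x) y i j -
          ∑ i, ∑ j, strain (toField x) y i j * strain (toField x) y i j ≤ (D - A) / 2 := by
        rw [hD, hA, ← Finset.sum_sub_distrib, ← Finset.sum_sub_distrib, Finset.sum_div]
        refine Finset.sum_le_sum fun i _ => ?_
        rw [← Finset.sum_sub_distrib, ← Finset.sum_sub_distrib, Finset.sum_div]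
        refine Finset.sum_le_sum fun j _ => ?_
        nlinarith [sq_nonneg (strain (toField w) y i j - strain (toField x) y i j)]
      have hDM : D ≤ M := by
        have := abs_sum_le_card_mul (fun i => ∑ j, strain (toField w) y i j ^ 2)
          (B := d * (B * K) ^ 2) fun i => by
            have := abs_sum_le_card_mul (fun j => strain (toField w) y i j ^ 2)
              (B := (B * K) ^ 2) fun j => by
                rw [abs_pow]
                exact pow_le_pow_left₀ (abs_nonneg _) ((hb w y i j).2.2.trans
                  (mul_le_mul_of_nonneg_left hw hB)) 2
            simpa using this
        simpa using (le_abs_self _).trans this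
      have hc0 : 0 ≤ 2 * ν * (1 + A) ^ ((p - 2) / 2) := by positivity
      rcases le_total D A with hDA | hDA
      · have : (D - A) / 2 ≤ 0 := by linarith
        exact (mul_nonpos_of_nonneg_of_nonpos hc0 (hS.trans this)).trans (by positivity)
      · refine (mul_le_mul_of_nonneg_left hS hc0).trans ?_
        -- The exponent is first raised from (p − 2)/2 to p/2, which the base 1 + A ≥ 1 allows; it
        -- is then nonnegative, so A ≤ M can be used whatever the sign of p − 2.
        have e1 : (1 + A) ^ ((p - 2) / 2) ≤ (1 + M) ^ (p / 2) :=
          (Real.rpow_le_rpow_of_exponent_le (by linarith) (by linarith)).trans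
            (Real.rpow_le_rpow (by linarith) (by linarith) (by linarith))
        refine mul_le_mul (mul_le_mul_of_nonneg_left e1 (by linarith)) (by linarith) (by linarith)
          (by positivity)
    refine (integral_mono ((integrable_stress ν p w x).sub (integrable_stress ν p x x))
      (integrable_const C₂) hle).trans (by simp)
  have hC₂0 : 0 ≤ C₂ := by positivity
  have hC₁0 : 0 ≤ C₁ := by positivity
  rw [hd]
  have := (abs_le.1 h1).1
  nlinarith [sq_nonneg ‖x‖]

/-! ### Control of the Sobolev norm by the dissipation -/

theorem sobolevNorm_rpow {p : ℝ} (hp : 0 < p) (α : ℝ) (v : L2Field d) :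
    sobolevNorm p α v ^ p = ∫ x, ‖bessel α v x‖ ^ p ∂(torusVol d) := by
  rw [sobolevNorm, ← Real.rpow_mul (integral_nonneg fun x => by positivity),
    one_div_mul_cancel hp.ne', Real.rpow_one]

theorem continuous_bessel (d n : ℕ) :
    Continuous fun q : Vn d n × Torus d => bessel 1 (toField q.1) q.2 := by
  have h : ∀ i, Continuous fun q : Vn d n × Torus d =>
      (trigSum (freqs d n) (besselCoeff (coords q.1 i)) q.2).re := fun i =>
    Complex.continuous_re.comp (continuous_finsetSum _ fun z _ =>
      (continuous_const.mul ((continuous_coords i z).comp continuous_fst)).mul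
        ((UnitAddTorus.mFourier z).continuous.comp continuous_snd))
  simp only [← bessel_eq] at h
  exact (PiLp.continuous_toLp 2 _).comp (continuous_pi h)

theorem continuous_sobolevNorm_rpow {p : ℝ} (hp : 0 < p) :
    Continuous fun v : Vn d n => sobolevNorm p 1 (toField v) ^ p := by
  simp only [sobolevNorm_rpow hp]
  exact continuous_integral_of_continuous (V := Vn d n) (f := fun (v : Vn d n) x => ‖bessel 1 (toField v) x‖ ^ p)
    ((continuous_bessel d n).norm.rpow_const fun q => Or.inr hp.le)

/-- Small A is covered by the summand 1. For A ≥ 1 and p < 2 the point is 1 + A ≤ 2A, which costs a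
factor at most 2 as (p − 2)/2 ≥ −1. -/
theorem rpow_le_stress {p A : ℝ} (hp : 0 ≤ p) (hA : 0 ≤ A) :
    A ^ (p / 2) ≤ 2 * ((1 + A) ^ ((p - 2) / 2) * A) + 1 := by
  have h0 : 0 ≤ (1 + A) ^ ((p - 2) / 2) := by positivity
  rcases le_total A 1 with h | h
  · have := Real.rpow_le_one hA h (by positivity : 0 ≤ p / 2)
    nlinarith [mul_nonneg h0 hA]
  · have hA' : 0 < A := by linarith
    have e : A ^ (p / 2) = A ^ ((p - 2) / 2) * A := by
      rw [← Real.rpow_add_one hA'.ne']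
      congr 1
      ring
    have key : A ^ ((p - 2) / 2) ≤ 2 * (1 + A) ^ ((p - 2) / 2) := by
      rcases le_total 2 p with h2 | h2
      · have := Real.rpow_le_rpow hA (by linarith : A ≤ 1 + A) (by linarith : 0 ≤ (p - 2) / 2)
        linarith
      · have h3 := Real.rpow_le_rpow_of_nonpos (by linarith : 0 < 1 + A)
          (by linarith : 1 + A ≤ 2 * A) (by linarith : (p - 2) / 2 ≤ 0)
        rw [Real.mul_rpow zero_le_two hA] at h3
        have h4 : (2 : ℝ) ^ (-1 : ℝ) ≤ 2 ^ ((p - 2) / 2) :=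
          Real.rpow_le_rpow_of_exponent_le one_le_two (by linarith)
        rw [Real.rpow_neg_one] at h4
        nlinarith [Real.rpow_nonneg hA ((p - 2) / 2)]
    rw [e]
    nlinarith

theorem norm_rpow_le_sum {ι : Type*} [Fintype ι] {p : ℝ} (hp : 1 ≤ p) (b : EuclideanSpace ℝ ι) :
    ‖b‖ ^ p ≤ (Fintype.card ι : ℝ) ^ (p - 1) * ∑ i, |b i| ^ p := by
  have h1 : ‖b‖ ≤ ∑ i, |b i| := by
    rw [EuclideanSpace.norm_eq]
    refine Real.sqrt_le_iff.2 ⟨by positivity, ?_⟩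
    exact Finset.sum_sq_le_sq_sum_of_nonneg fun i _ => abs_nonneg _
  refine (Real.rpow_le_rpow (norm_nonneg _) h1 (by linarith)).trans ?_
  have := Real.rpow_sum_le_const_mul_sum_rpow (s := Finset.univ) (f := fun i => b i) hp
  simpa using! this

/-- Each strain component is at most |e(v)|, and `rpow_le_stress` with A = |e(v)|² compares |e(v)|^p
with the dissipation density, which is 2ν(1 + A)^((p−2)/2) A. -/
theorem integral_norm_eCoeff_le {ν p : ℝ} (hν : 0 < ν) (hp : 0 ≤ p) (v : Vn d n) (i j : Fin d) :
    ∫ x, ‖trigSum (freqs d n) (eCoeff (coords v) i j) x‖ ^ p ∂(torusVol d) ≤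
      strainStress ν p (toField v) (toField v) / ν + 1 := by
  have hle : ∀ x, ‖trigSum (freqs d n) (eCoeff (coords v) i j) x‖ ^ p ≤
      (∑ i, ∑ j, strain (toField v) x i j * stress ν p (toField v) x i j) / ν + 1 := by
    intro x
    have hA : 0 ≤ ∑ k, ∑ l, strain (toField v) x k l ^ 2 := by positivity
    have h1 : strain (toField v) x i j ^ 2 ≤ ∑ k, ∑ l, strain (toField v) x k l ^ 2 :=
      (Finset.single_le_sum (f := fun l => strain (toField v) x i l ^ 2)
        (fun l _ => sq_nonneg _) (Finset.mem_univ j)).trans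
        (Finset.single_le_sum (f := fun k => ∑ l, strain (toField v) x k l ^ 2)
          (fun k _ => by positivity) (Finset.mem_univ i))
    have h2 : ‖trigSum (freqs d n) (eCoeff (coords v) i j) x‖ ^ p =
        (strain (toField v) x i j ^ 2) ^ (p / 2) := by
      rw [← strain_eq, Complex.norm_real, Real.norm_eq_abs, ← sq_abs, ← Real.rpow_natCast,
        ← Real.rpow_mul (abs_nonneg _)]
      congr 1
      push_cast
      ring
    have e : (∑ i, ∑ j, strain (toField v) x i j * stress ν p (toField v) x i j) / ν =
        2 * ((1 + ∑ k, ∑ l, strain (toField v) x k l ^ 2) ^ ((p - 2) / 2) *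
          ∑ k, ∑ l, strain (toField v) x k l ^ 2) := by
      rw [stress_pairing]
      simp only [← sq]
      field_simp
    rw [h2, e]
    exact (Real.rpow_le_rpow (sq_nonneg _) h1 (by linarith)).trans (rpow_le_stress hp hA)
  refine (integral_mono (integrable_torus (continuous_norm_trigSum_rpow _ _ hp))
    (((integrable_stress ν p v v).div_const ν).add (integrable_const 1)) hle).trans ?_
  have := integral_add ((integrable_stress ν p v v).div_const ν)
    (integrable_const (μ := torusVol d) (1 : ℝ))
  simp only [integral_div, integral_const, probReal_univ, smul_eq_mul, mul_one] at this
  exact this.le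

/-- Korn's inequality combined with the bound of the strain by the dissipation. The constant is
chosen before n; this uniformity is the reason for the multiplier theory, as for a single n any two
norms would be comparable. -/
theorem exists_sobolevNorm_le (d : ℕ) {ν p : ℝ} (hν : 0 < ν) (hp : 1 < p) : ∃ K, 0 ≤ K ∧
    ∀ (n : ℕ) (v : Vn d n), sobolevNorm p 1 (toField v) ^ p ≤
      K * (strainStress ν p (toField v) (toField v) / ν + 1) := by
  have hk := kornConst_nonneg d hp
  have hp0 : 0 ≤ p := by linarith
  refine ⟨(d : ℝ) ^ (p - 1) * (d * (kornConst d p * d)), by positivity, fun n v => ?_⟩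
  set B := strainStress ν p (toField v) (toField v) / ν + 1
  rw [sobolevNorm_rpow (by linarith)]
  have hle : ∀ x, ‖bessel 1 (toField v) x‖ ^ p ≤ (d : ℝ) ^ (p - 1) *
      ∑ j, ‖trigSum (freqs d n) (besselCoeff (coords v j)) x‖ ^ p := by
    intro x
    refine (norm_rpow_le_sum hp.le _).trans ?_
    rw [Fintype.card_fin]
    refine mul_le_mul_of_nonneg_left (Finset.sum_le_sum fun j _ => ?_) (by positivity)
    rw [bessel_eq]
    exact Real.rpow_le_rpow (abs_nonneg _) (Complex.abs_re_le_norm _) hp0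
  have i1 : ∀ j, Integrable (fun x => ‖trigSum (freqs d n) (besselCoeff (coords v j)) x‖ ^ p)
      (torusVol d) := fun j => integrable_torus (continuous_norm_trigSum_rpow _ _ hp0)
  have i2 : Integrable (fun x => ‖bessel 1 (toField v) x‖ ^ p) (torusVol d) :=
    integrable_slice (f := fun (v : Vn d n) x => ‖bessel 1 (toField v) x‖ ^ p)
      ((continuous_bessel d n).norm.rpow_const fun q => Or.inr hp0) v
  refine (integral_mono i2 ((integrable_finsetSum _ fun j _ => i1 j).const_mul _) hle).trans ?_
  rw [integral_const_mul, integral_finsetSum _ fun j _ => i1 j, mul_assoc]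
  refine mul_le_mul_of_nonneg_left ?_ (by positivity)
  have h3 : ∀ j, ∫ x, ‖trigSum (freqs d n) (besselCoeff (coords v j)) x‖ ^ p ∂(torusVol d) ≤
      kornConst d p * d * B := by
    intro j
    refine (korn_trigSum hp zero_notMem_freqs (coords v) (hasCoeffs_coords v).div j).trans ?_
    rw [mul_assoc]
    refine mul_le_mul_of_nonneg_left ?_ hk
    refine (Finset.sum_le_card_nsmul _ _ B fun i _ => integral_norm_eCoeff_le hν hp0 v i j).trans
      (by simp)
  refine (Finset.sum_le_card_nsmul _ _ _ fun j _ => h3 j).trans ?_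
  simp [mul_assoc]

end Energy

/-! ### Integral equations with a continuous forcing term -/

section IntegralEquation

variable {E : Type*} [NormedAddCommGroup E]

/-- Lipschitz continuity on bounded sets. -/
def LipschitzOnBalls (b : E → E) : Prop :=
  ∀ R : ℝ, ∃ L, 0 ≤ L ∧ ∀ x y, ‖x‖ ≤ R → ‖y‖ ≤ R → ‖b x - b y‖ ≤ L * ‖x - y‖

theorem LipschitzOnBalls.continuous {b : E → E} (hb : LipschitzOnBalls b) : Continuous b := by
  refine continuous_iff_continuousAt.2 fun x => ?_
  obtain ⟨L, hL, h⟩ := hb (‖x‖ + 1)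
  have h0 : ∀ᶠ y in 𝓝 x, ‖y‖ ≤ ‖x‖ + 1 :=
    (continuous_norm.tendsto x).eventually_le_const (by linarith)
  have h1 : Tendsto (fun y => L * ‖y - x‖) (𝓝 x) (𝓝 0) := by
    have : Continuous fun y : E => L * ‖y - x‖ := by fun_prop
    simpa using this.tendsto x
  rw [ContinuousAt, tendsto_iff_norm_sub_tendsto_zero]
  refine squeeze_zero' (Eventually.of_forall fun y => norm_nonneg _) ?_ h1
  filter_upwards [h0] with y hy
  exact h y x hy (by linarith)

theorem exists_norm_le_Iic {x : ℝ≥0 → E} (hx : Continuous x) (T : ℝ≥0) :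
    ∃ R, 0 ≤ R ∧ ∀ t ≤ T, ‖x t‖ ≤ R := by
  obtain ⟨R, hR⟩ := ((isCompact_Icc (a := (0 : ℝ≥0)) (b := T)).image hx).isBounded.exists_norm_le
  exact ⟨max R 0, le_max_right _ _, fun t ht => (hR _ ⟨t, ⟨zero_le, ht⟩, rfl⟩).trans
    (le_max_left _ _)⟩

theorem continuous_comp_toNNReal {F : Type*} [TopologicalSpace F] {b : E → F} {x : ℝ≥0 → E}
    (hb : Continuous b) (hx : Continuous x) : Continuous fun s : ℝ => b (x s.toNNReal) :=
  hb.comp (hx.comp continuous_real_toNNReal)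

variable [NormedSpace ℝ E]

/-- `x` is continuous and solves `x_t = f_t + ∫_0^t b(x_s) ds` for `t ≤ T`. -/
structure IsSolUpTo (b : E → E) (f : ℝ≥0 → E) (T : ℝ≥0) (x : ℝ≥0 → E) : Prop where
  continuous : Continuous x
  eqn : ∀ t ≤ T, x t = f t + ∫ s in (0 : ℝ)..t, b (x s.toNNReal)

theorem integral_congr_toNNReal {F : Type*} [NormedAddCommGroup F] [NormedSpace ℝ F]
    {g g' : ℝ≥0 → F} {t : ℝ≥0} (h : ∀ s ≤ t, g s = g' s) :
    ∫ s in (0 : ℝ)..t, g s.toNNReal = ∫ s in (0 : ℝ)..t, g' s.toNNReal := by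
  refine intervalIntegral.integral_congr fun s hs => ?_
  rw [Set.uIcc_of_le t.coe_nonneg] at hs
  exact h _ (Real.toNNReal_le_iff_le_coe.2 hs.2)

theorem IsSolUpTo.congr {b b' : E → E} {f f' : ℝ≥0 → E} {T : ℝ≥0} {x : ℝ≥0 → E}
    (h : IsSolUpTo b f T x) (hb : ∀ t ≤ T, b (x t) = b' (x t)) (hf : ∀ t ≤ T, f t = f' t) :
    IsSolUpTo b' f' T x :=
  ⟨h.continuous, fun t ht => by
    rw [h.eqn t ht, hf t ht]
    congr 1
    exact integral_congr_toNNReal (g := fun s => b (x s)) (g' := fun s => b' (x s))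
      fun s hs => hb s (hs.trans ht)⟩

/-- Both paths stay in one ball on [0, T], so a single Lipschitz constant L serves. Their difference
is the primitive of b(x) − b(y); its derivative is at most L times its norm, and it starts at 0. -/
theorem IsSolUpTo.unique [CompleteSpace E] {b : E → E} (hb : LipschitzOnBalls b) {f : ℝ≥0 → E}
    {T : ℝ≥0} {x y : ℝ≥0 → E} (hx : IsSolUpTo b f T x) (hy : IsSolUpTo b f T y) :
    ∀ t ≤ T, x t = y t := by
  obtain ⟨R, hR0, hR⟩ := exists_norm_le_Iic hx.continuous T
  obtain ⟨R', hR0', hR'⟩ := exists_norm_le_Iic hy.continuous T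
  obtain ⟨L, hL, h⟩ := hb (max R R')
  have c : Continuous fun s : ℝ => b (x s.toNNReal) - b (y s.toNNReal) :=
    (continuous_comp_toNNReal hb.continuous hx.continuous).sub
      (continuous_comp_toNNReal hb.continuous hy.continuous)
  have hd : ∀ s, HasDerivAt (fun s => ∫ u in (0 : ℝ)..s, (b (x u.toNNReal) - b (y u.toNNReal)))
      (b (x s.toNNReal) - b (y s.toNNReal)) s := fun s => (c.integral_hasStrictDerivAt 0 s).hasDerivAt
  have e : ∀ t : ℝ≥0, t ≤ T → ∫ u in (0 : ℝ)..t, (b (x u.toNNReal) - b (y u.toNNReal)) =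
      x t - y t := by
    intro t ht
    rw [intervalIntegral.integral_sub
      ((continuous_comp_toNNReal hb.continuous hx.continuous).intervalIntegrable _ _)
      ((continuous_comp_toNNReal hb.continuous hy.continuous).intervalIntegrable _ _),
      hx.eqn t ht, hy.eqn t ht]
    abel
  have key := eq_zero_of_abs_deriv_le_mul_abs_self_of_eq_zero_right (K := L) (a := 0) (b := T)
    (fun s _ => (hd s).continuousAt.continuousWithinAt) (fun s _ => (hd s).hasDerivWithinAt)
    (by simp) fun s hs => by
      have hs' : s.toNNReal ≤ T := Real.toNNReal_le_iff_le_coe.2 hs.2.le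
      have e' := e s.toNNReal hs'
      rw [Real.coe_toNNReal s hs.1] at e'
      rw [e']
      exact h _ _ ((hR _ hs').trans (le_max_left _ _)) ((hR' _ hs').trans (le_max_right _ _))
  intro t ht
  have := key t ⟨t.coe_nonneg, ht⟩
  rw [e t ht] at this
  exact sub_eq_zero.1 this

/-- The forcing path is only continuous, so the Picard–Lindelöf theorem is applied to y = x − f,
which solves y' = b(y + f). -/
theorem exists_isSolUpTo [CompleteSpace E] {b : E → E} {K B : ℝ≥0} (hb : LipschitzWith K b)
    (hB : ∀ x, ‖b x‖ ≤ B) {f : ℝ≥0 → E} (hf : Continuous f) (T : ℝ≥0) :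
    ∃ x, IsSolUpTo b f T x := by
  -- A solution of speed at most B stays in the ball of radius B·T up to time T, so no time step
  -- needs to be cut.
  have hpl : IsPicardLindelof (fun t y => b (y + f t.toNNReal)) (tmin := 0) (tmax := T)
      ⟨0, le_rfl, T.coe_nonneg⟩ (0 : E) (B * T) 0 B K := by
    refine ⟨fun t _ => ?_, fun y _ => ?_, fun t _ y _ => hB _, ?_⟩
    · refine LipschitzWith.lipschitzOnWith (LipschitzWith.of_dist_le_mul fun y z => ?_)
      simpa using hb.dist_le_mul (y + f t.toNNReal) (z + f t.toNNReal)
    · exact (hb.continuous.comp (continuous_const.add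
        (hf.comp continuous_real_toNNReal))).continuousOn
    · simp
  obtain ⟨y, hy0, hy⟩ := hpl.exists_eq_forall_mem_Icc_hasDerivWithinAt₀
  simp only at hy0
  have hyc : ContinuousOn y (Set.Icc 0 T) := fun t ht => (hy t ht).continuousWithinAt
  -- Freezing y after T gives a path that is continuous on the whole half-line; beyond T the
  -- equation is not claimed.
  have hxc : Continuous fun t : ℝ≥0 => y (min t T : ℝ≥0) + f t := by
    refine Continuous.add (hyc.comp_continuous (by fun_prop) fun t => ?_) hf
    exact ⟨NNReal.coe_nonneg _, NNReal.coe_le_coe.2 (min_le_right _ _)⟩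
  refine ⟨fun t => y (min t T : ℝ≥0) + f t, hxc, fun t ht => ?_⟩
  have hint := intervalIntegral.integral_eq_sub_of_hasDeriv_right (a := 0) (b := (t : ℝ)) (f := y)
    (f' := fun s => b (y (min s.toNNReal T : ℝ≥0) + f s.toNNReal))
    (hyc.mono (by rw [Set.uIcc_of_le t.coe_nonneg]; exact Set.Icc_subset_Icc le_rfl ht))
    (fun s hs => by
      rw [min_eq_left t.coe_nonneg, max_eq_right t.coe_nonneg] at hs
      have hsT : s < T := hs.2.trans_le ht
      have e : (min s.toNNReal T : ℝ≥0) = s.toNNReal :=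
        min_eq_left (Real.toNNReal_le_iff_le_coe.2 hsT.le)
      rw [e, Real.coe_toNNReal s hs.1.le]
      exact ((hy s ⟨hs.1.le, hsT.le⟩).hasDerivAt (Icc_mem_nhds hs.1 hsT)).hasDerivWithinAt)
    ((continuous_comp_toNNReal hb.continuous hxc).intervalIntegrable _ _)
  rw [hint, hy0, min_eq_left ht]
  abel

/-- The Picard iterates. -/
def picardIter (b : E → E) (f : ℝ≥0 → E) : ℕ → ℝ≥0 → E
  | 0 => f
  | k + 1 => fun t => f t + ∫ s in (0 : ℝ)..t, b (picardIter b f k s.toNNReal)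

theorem continuous_add_integral {b : E → E} (hb : Continuous b) {f x : ℝ≥0 → E}
    (hf : Continuous f) (hx : Continuous x) :
    Continuous fun t : ℝ≥0 => f t + ∫ s in (0 : ℝ)..t, b (x s.toNNReal) :=
  hf.add ((intervalIntegral.continuous_primitive
    (fun _ _ => (continuous_comp_toNNReal hb hx).intervalIntegrable _ _) 0).comp
      NNReal.continuous_coe)

theorem continuous_picardIter {b : E → E} (hb : Continuous b) {f : ℝ≥0 → E} (hf : Continuous f)
    (k : ℕ) : Continuous (picardIter b f k) := by
  induction k with
  | zero => exact hf
  | succ k ih => exact continuous_add_integral hb hf ih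

/-- Induction on k, integrating the Lipschitz bound. The explicit iterates are needed besides the
existence theorem because each of them is visibly measurable in the forcing path, and so is their
limit. -/
theorem norm_picardIter_sub_le {b : E → E} {K B : ℝ≥0} (hb : LipschitzWith K b)
    (hB : ∀ x, ‖b x‖ ≤ B) {f : ℝ≥0 → E} (hf : Continuous f) {T : ℝ≥0} {x : ℝ≥0 → E}
    (hx : IsSolUpTo b f T x) (k : ℕ) : ∀ t ≤ T,
      ‖picardIter b f k t - x t‖ ≤ B * T * ((K * t) ^ k / k.factorial) := by
  induction k with
  | zero =>
    intro t ht
    rw [picardIter, hx.eqn t ht, sub_add_cancel_left, norm_neg]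
    have := intervalIntegral.norm_integral_le_of_norm_le_const (a := 0) (b := (t : ℝ))
      (f := fun s => b (x s.toNNReal)) (C := B) fun s _ => hB _
    refine this.trans ?_
    rw [sub_zero, abs_of_nonneg t.coe_nonneg]
    simp only [pow_zero, Nat.factorial_zero, Nat.cast_one, div_one, mul_one]
    exact mul_le_mul_of_nonneg_left ht B.coe_nonneg
  | succ k ih =>
    intro t ht
    have c1 := continuous_comp_toNNReal hb.continuous (continuous_picardIter hb.continuous hf k)
    have c2 := continuous_comp_toNNReal hb.continuous hx.continuous
    have e : picardIter b f (k + 1) t - x t =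
        ∫ s in (0 : ℝ)..t, (b (picardIter b f k s.toNNReal) - b (x s.toNNReal)) := by
      rw [intervalIntegral.integral_sub (c1.intervalIntegrable _ _) (c2.intervalIntegrable _ _),
        picardIter, hx.eqn t ht]
      exact add_sub_add_left_eq_sub _ _ _
    rw [e]
    have hint : ∫ s in (0 : ℝ)..t, (K : ℝ) * (B * T * ((K * s) ^ k / k.factorial)) =
        B * T * ((K * t) ^ (k + 1) / (k + 1).factorial) := by
      have : (fun s : ℝ => (K : ℝ) * (B * T * ((K * s) ^ k / k.factorial))) = fun s =>
          ((K : ℝ) ^ (k + 1) * B * T / k.factorial) * s ^ k := by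
        ext s
        rw [mul_pow]
        ring
      rw [this, intervalIntegral.integral_const_mul, integral_pow, Nat.factorial_succ, mul_pow]
      push_cast
      field_simp
      simp
    rw [← hint]
    refine intervalIntegral.norm_integral_le_of_norm_le t.coe_nonneg (Eventually.of_forall fun s hs => ?_)
      ((by fun_prop : Continuous fun s : ℝ =>
        (K : ℝ) * (B * T * ((K * s) ^ k / k.factorial))).intervalIntegrable _ _)
    have hs' : s.toNNReal ≤ T := (Real.toNNReal_le_iff_le_coe.2 hs.2).trans ht
    have h1 := ih _ hs'
    rw [Real.coe_toNNReal s hs.1.le] at h1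
    have h2 := hb.dist_le_mul (picardIter b f k s.toNNReal) (x s.toNNReal)
    rw [dist_eq_norm, dist_eq_norm] at h2
    exact h2.trans (mul_le_mul_of_nonneg_left h1 K.coe_nonneg)

theorem tendsto_picardIter {b : E → E} {K B : ℝ≥0} (hb : LipschitzWith K b)
    (hB : ∀ x, ‖b x‖ ≤ B) {f : ℝ≥0 → E} (hf : Continuous f) {T : ℝ≥0} {x : ℝ≥0 → E}
    (hx : IsSolUpTo b f T x) {t : ℝ≥0} (ht : t ≤ T) :
    Tendsto (fun k => picardIter b f k t) atTop (𝓝 (x t)) := by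
  rw [tendsto_iff_norm_sub_tendsto_zero]
  refine squeeze_zero (fun k => norm_nonneg _)
    (fun k => norm_picardIter_sub_le hb hB hf hx k t ht) ?_
  simpa using! (FloorSemiring.tendsto_pow_div_factorial_atTop (K * t : ℝ)).const_mul (B * T : ℝ)

/-- The limit of the Picard iterates. -/
def picardSol (b : E → E) (f : ℝ≥0 → E) (t : ℝ≥0) : E :=
  limUnder atTop fun k => picardIter b f k t

theorem picardSol_eq {b : E → E} {K B : ℝ≥0} (hb : LipschitzWith K b)
    (hB : ∀ x, ‖b x‖ ≤ B) {f : ℝ≥0 → E} (hf : Continuous f) {T : ℝ≥0} {x : ℝ≥0 → E}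
    (hx : IsSolUpTo b f T x) {t : ℝ≥0} (ht : t ≤ T) : picardSol b f t = x t :=
  (tendsto_picardIter hb hB hf hx ht).limUnder_eq

/-- Paths that agree with a solution up to every time are solutions. -/
theorem isSolUpTo_of_forall_exists {b : E → E} {f x : ℝ≥0 → E}
    (h : ∀ T : ℝ≥0, ∃ y, IsSolUpTo b f T y ∧ ∀ t ≤ T, x t = y t) (T : ℝ≥0) :
    IsSolUpTo b f T x := by
  refine ⟨continuous_iff_continuousAt.2 fun t => ?_, fun t _ => ?_⟩
  · obtain ⟨y, hy, hxy⟩ := h (t + 1)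
    refine hy.continuous.continuousAt.congr ?_
    filter_upwards [Iic_mem_nhds (lt_add_one t)] with s hs
    exact (hxy s hs).symm
  · obtain ⟨y, hy, hxy⟩ := h t
    rw [hxy t le_rfl, hy.eqn t le_rfl]
    congr 1
    exact integral_congr_toNNReal (g := fun s => b (y s)) (g' := fun s => b (x s))
      fun s hs => by rw [hxy s hs]

theorem isSolUpTo_picardSol [CompleteSpace E] {b : E → E} {K B : ℝ≥0} (hb : LipschitzWith K b)
    (hB : ∀ x, ‖b x‖ ≤ B) {f : ℝ≥0 → E} (hf : Continuous f) (T : ℝ≥0) :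
    IsSolUpTo b f T (picardSol b f) :=
  isSolUpTo_of_forall_exists (fun T => by
    obtain ⟨y, hy⟩ := exists_isSolUpTo hb hB hf T
    exact ⟨y, hy, fun t ht => picardSol_eq hb hB hf hy ht⟩) T

theorem measurable_integral_path {E : Type*} [NormedAddCommGroup E] [MeasurableSpace E]
    [BorelSpace E] {Ω : Type*} [MeasurableSpace Ω] {F : Type*}
    [NormedAddCommGroup F] [NormedSpace ℝ F] [MeasurableSpace F] [BorelSpace F]
    [SecondCountableTopology F] {x : ℝ≥0 → Ω → E} (hx : ∀ t, Measurable (x t))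
    (hc : ∀ ω, Continuous fun t => x t ω) {b : E → F} (hb : Continuous b) (s t : ℝ) :
    Measurable fun ω => ∫ u in s..t, b (x u.toNNReal ω) := by
  have hm : Measurable (Function.uncurry fun (ω : Ω) (u : ℝ) => b (x u.toNNReal ω)) := by
    have h := measurable_uncurry_of_continuous_of_measurable
      (u := fun (u : ℝ) ω => b (x u.toNNReal ω))
      (fun ω => continuous_comp_toNNReal hb (hc ω)) fun u => hb.measurable.comp (hx _)
    exact h.comp measurable_swap
  have h1 := fun a b : ℝ => (StronglyMeasurable.integral_prod_right
    (ν := (volume : Measure ℝ).restrict (Set.Ioc a b)) hm.stronglyMeasurable).measurable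
  exact (h1 s t).sub (h1 t s)

section Measurability

variable [FiniteDimensional ℝ E] [MeasurableSpace E] [BorelSpace E]

theorem secondCountable_of_finiteDimensional (E : Type*) [NormedAddCommGroup E] [NormedSpace ℝ E]
    [FiniteDimensional ℝ E] : SecondCountableTopology E :=
  have := FiniteDimensional.proper ℝ E
  inferInstance

theorem measurable_picardIter {Ω : Type*} [MeasurableSpace Ω] {b : E → E} (hb : Continuous b)
    {f : ℝ≥0 → Ω → E} (hf : ∀ t, Measurable (f t)) (hc : ∀ ω, Continuous fun t => f t ω) (k : ℕ) :
    ∀ t, Measurable fun ω => picardIter b (fun t => f t ω) k t := by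
  have := secondCountable_of_finiteDimensional E
  induction k with
  | zero => exact hf
  | succ k ih =>
    intro t
    exact (hf t).add (measurable_integral_path (x := fun t ω => picardIter b (fun t => f t ω) k t)
      ih (fun ω => continuous_picardIter hb (hc ω) k) hb 0 t)

theorem measurable_picardSol [CompleteSpace E] {Ω : Type*} [MeasurableSpace Ω] {b : E → E}
    {K B : ℝ≥0} (hb : LipschitzWith K b) (hB : ∀ x, ‖b x‖ ≤ B) {f : ℝ≥0 → Ω → E}
    (hf : ∀ t, Measurable (f t)) (hc : ∀ ω, Continuous fun t => f t ω) (t : ℝ≥0) :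
    Measurable fun ω => picardSol b (fun t => f t ω) t :=
  measurable_of_tendsto_metrizable (fun k => measurable_picardIter hb.continuous hf hc k t)
    (tendsto_pi_nhds.2 fun ω => tendsto_picardIter hb hB (hc ω)
      (isSolUpTo_picardSol hb hB (hc ω) t) le_rfl)

end Measurability

end IntegralEquation

/-! ### Dissipative equations: truncation and global solutions -/

section Truncation

variable {E : Type*} [NormedAddCommGroup E]

/-- The cutoff function `max 0 (min 1 (R + 1 - |x|))`. -/
def cutoff (R : ℝ) (x : E) : ℝ := max 0 (min 1 (R + 1 - ‖x‖))

theorem cutoff_nonneg (R : ℝ) (x : E) : 0 ≤ cutoff R x := le_max_left _ _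

theorem cutoff_le_one (R : ℝ) (x : E) : cutoff R x ≤ 1 := max_le zero_le_one (min_le_left _ _)

theorem cutoff_eq_one {R : ℝ} {x : E} (h : ‖x‖ ≤ R) : cutoff R x = 1 := by
  rw [cutoff, min_eq_left (by linarith), max_eq_right zero_le_one]

theorem cutoff_eq_zero {R : ℝ} {x : E} (h : R + 1 ≤ ‖x‖) : cutoff R x = 0 := by
  rw [cutoff, max_eq_left ((min_le_right _ _).trans (by linarith))]

theorem abs_cutoff_sub_le (R : ℝ) (x y : E) : |cutoff R x - cutoff R y| ≤ ‖x - y‖ := by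
  have h1 := abs_max_sub_max_le_abs (min 1 (R + 1 - ‖x‖)) (min 1 (R + 1 - ‖y‖)) 0
  have h2 := abs_min_sub_min_le_max 1 (R + 1 - ‖x‖) 1 (R + 1 - ‖y‖)
  have h3 := abs_norm_sub_norm_le y x
  rw [norm_sub_rev] at h3
  rw [cutoff, cutoff, max_comm 0, max_comm 0]
  refine h1.trans (h2.trans (max_le (by simp) ?_))
  rw [show R + 1 - ‖x‖ - (R + 1 - ‖y‖) = ‖y‖ - ‖x‖ by ring]
  exact h3

variable [NormedSpace ℝ E]

/-- The truncation of a vector field. -/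
def trunc (b : E → E) (R : ℝ) (x : E) : E := cutoff R x • b x

theorem trunc_eq {b : E → E} {R : ℝ} {x : E} (h : ‖x‖ ≤ R) : trunc b R x = b x := by
  rw [trunc, cutoff_eq_one h, one_smul]

theorem exists_trunc_bounds {b : E → E} (hb : LipschitzOnBalls b) {R : ℝ} (hR : 0 ≤ R) :
    ∃ K B : ℝ≥0, LipschitzWith K (trunc b R) ∧ ∀ x, ‖trunc b R x‖ ≤ B := by
  obtain ⟨L, hL, h⟩ := hb (R + 1)
  set B : ℝ := ‖b 0‖ + L * (R + 1) with hBdef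
  have hB0 : 0 ≤ B := by positivity
  have hB : ∀ x, ‖x‖ ≤ R + 1 → ‖b x‖ ≤ B := by
    intro x hx
    have h1 := h x 0 hx (by simpa using by linarith)
    rw [sub_zero] at h1
    have h2 := norm_le_norm_add_norm_sub' (b x) (b 0)
    nlinarith
  have hout : ∀ x, R + 1 ≤ ‖x‖ → trunc b R x = 0 := fun x hx => by
    rw [trunc, cutoff_eq_zero hx, zero_smul]
  have hnorm : ∀ x, ‖trunc b R x‖ = cutoff R x * ‖b x‖ := fun x => by
    rw [trunc, norm_smul, Real.norm_of_nonneg (cutoff_nonneg R x)]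
  -- When one point lies outside the support of the cutoff, the cutoff at the other point is itself
  -- at most the distance, and b is bounded by B there.
  have hone : ∀ x y, ‖x‖ ≤ R + 1 → R + 1 ≤ ‖y‖ →
      ‖trunc b R x - trunc b R y‖ ≤ (B + L) * ‖x - y‖ := by
    intro x y hx hy
    rw [hout y hy, sub_zero, hnorm]
    have h1 := abs_cutoff_sub_le R x y
    rw [cutoff_eq_zero hy, sub_zero, abs_of_nonneg (cutoff_nonneg R x)] at h1
    have := mul_le_mul h1 (hB x hx) (norm_nonneg _) (norm_nonneg _)
    nlinarith [mul_nonneg hL (norm_nonneg (x - y))]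
  refine ⟨⟨B + L, by positivity⟩, ⟨B, hB0⟩, LipschitzWith.of_dist_le_mul fun x y => ?_, fun x => ?_⟩
  · rw [dist_eq_norm, dist_eq_norm]
    change _ ≤ (B + L) * _
    rcases le_total ‖x‖ (R + 1) with hx | hx <;> rcases le_total ‖y‖ (R + 1) with hy | hy
    · have e : trunc b R x - trunc b R y =
          (cutoff R x - cutoff R y) • b x + cutoff R y • (b x - b y) := by
        rw [trunc, trunc, sub_smul, smul_sub]
        abel
      rw [e]
      refine (norm_add_le _ _).trans ?_
      rw [norm_smul, norm_smul, Real.norm_eq_abs, Real.norm_of_nonneg (cutoff_nonneg R y)]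
      have h1 := mul_le_mul (abs_cutoff_sub_le R x y) (hB x hx) (norm_nonneg _) (norm_nonneg _)
      have h2 := mul_le_mul (cutoff_le_one R y) (h x y hx hy) (norm_nonneg _) zero_le_one
      linarith
    · exact hone x y hx hy
    · rw [norm_sub_rev, norm_sub_rev x]
      exact hone y x hy hx
    · rw [hout x hx, hout y hy, sub_self, norm_zero]
      positivity
  · change _ ≤ B
    rcases le_total ‖x‖ (R + 1) with hx | hx
    · rw [hnorm]
      calc _ ≤ 1 * ‖b x‖ := mul_le_mul_of_nonneg_right (cutoff_le_one R x) (norm_nonneg _)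
        _ ≤ B := by rw [one_mul]; exact hB x hx
    · rw [hout x hx, norm_zero]
      exact hB0

end Truncation

/-! ### Bounds independent of the truncation, and the global solution -/

section Dissipative

variable {E : Type*} [NormedAddCommGroup E] [InnerProductSpace ℝ E]

/-- A dissipativity condition that survives bounded shifts of the argument. -/
def Coercive (b : E → E) : Prop :=
  ∀ K : ℝ, ∃ C, ∀ w x : E, ‖w‖ ≤ K → ⟪x - w, b x⟫_ℝ ≤ C * (1 + ‖x‖ ^ 2)

/-- A bound on the solutions of all truncated equations that does not depend on the truncation. -/
theorem Coercive.exists_bound [CompleteSpace E] {b : E → E} (hb : LipschitzOnBalls b)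
    (hc : Coercive b)
    {f : ℝ≥0 → E} (hf : Continuous f) (T : ℝ≥0) : ∃ ρ : ℝ, ∀ R : ℝ, 0 ≤ R → ∀ x : ℝ≥0 → E,
      IsSolUpTo (trunc b R) f T x → ∀ t ≤ T, ‖x t‖ ≤ ρ := by
  obtain ⟨K, hK0, hK⟩ := exists_norm_le_Iic hf T
  obtain ⟨C, hC⟩ := hc K
  -- The constants come from 2⟨y, b(x)⟩ ≤ 2|C|(1 + |x|²) and |x|² ≤ 2|y|² + 2K².
  set k : ℝ := 4 * |C| with hk
  set ε : ℝ := 2 * |C| * (1 + 2 * K ^ 2) with hε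
  have hk0 : 0 ≤ k := by positivity
  have hε0 : 0 ≤ ε := by positivity
  refine ⟨K + √(gronwallBound 0 k ε T), fun R hR x hx t ht => ?_⟩
  obtain ⟨L, B, hL, -⟩ := exists_trunc_bounds hb hR
  have c : Continuous fun s : ℝ => trunc b R (x s.toNNReal) :=
    continuous_comp_toNNReal hL.continuous hx.continuous
  -- The path x need not be differentiable, but y = x − f is, and the coercivity with w = f controls
  -- the derivative of |y|².
  set y : ℝ → E := fun s => ∫ u in (0 : ℝ)..s, trunc b R (x u.toNNReal) with hy
  have hd : ∀ s, HasDerivAt y (trunc b R (x s.toNNReal)) s :=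
    fun s => (c.integral_hasStrictDerivAt 0 s).hasDerivAt
  have hd2 : ∀ s, HasDerivAt (fun s => ‖y s‖ ^ 2) (2 * ⟪y s, trunc b R (x s.toNNReal)⟫_ℝ) s :=
    fun s => (hd s).norm_sq
  have hbound : ∀ s ∈ Set.Ico (0 : ℝ) T,
      2 * ⟪y s, trunc b R (x s.toNNReal)⟫_ℝ ≤ k * ‖y s‖ ^ 2 + ε := by
    intro s hs
    have hs' : s.toNNReal ≤ T := Real.toNNReal_le_iff_le_coe.2 hs.2.le
    have e : y s = x s.toNNReal - f s.toNNReal := by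
      rw [hx.eqn _ hs', Real.coe_toNNReal s hs.1]
      simp [hy]
    have h1 := hC _ (x s.toNNReal) (hK _ hs')
    have h2 : ‖x s.toNNReal‖ ≤ ‖y s‖ + K := by
      have := norm_add_le (y s) (f s.toNNReal)
      rw [e, sub_add_cancel] at this
      rw [e]
      linarith [hK _ hs']
    have h3 : ‖x s.toNNReal‖ ^ 2 ≤ 2 * ‖y s‖ ^ 2 + 2 * K ^ 2 := by
      nlinarith [norm_nonneg (x s.toNNReal), sq_nonneg (‖y s‖ - K)]
    rw [← e] at h1
    have h4 : ⟪y s, trunc b R (x s.toNNReal)⟫_ℝ =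
        cutoff R (x s.toNNReal) * ⟪y s, b (x s.toNNReal)⟫_ℝ := by
      rw [trunc, inner_smul_right]
    have h5 : ⟪y s, b (x s.toNNReal)⟫_ℝ ≤ |C| * (1 + ‖x s.toNNReal‖ ^ 2) :=
      h1.trans (mul_le_mul_of_nonneg_right (le_abs_self C) (by positivity))
    have h6 : 0 ≤ |C| * (1 + ‖x s.toNNReal‖ ^ 2) := by positivity
    -- The cutoff lies in [0, 1] and the upper bound is nonnegative, so the truncation level drops
    -- out. This is why C was replaced by |C|.
    have h7 : ⟪y s, trunc b R (x s.toNNReal)⟫_ℝ ≤ |C| * (1 + ‖x s.toNNReal‖ ^ 2) := by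
      rw [h4]
      have := cutoff_nonneg R (x s.toNNReal)
      have := cutoff_le_one R (x s.toNNReal)
      nlinarith
    have h8 : |C| * (1 + ‖x s.toNNReal‖ ^ 2) ≤ |C| * (1 + (2 * ‖y s‖ ^ 2 + 2 * K ^ 2)) :=
      mul_le_mul_of_nonneg_left (by linarith) (abs_nonneg C)
    rw [hk, hε]
    nlinarith
  have key := le_gronwallBound_of_liminf_deriv_right_le (δ := 0) (K := k) (ε := ε) (a := 0)
    (b := (T : ℝ)) (fun s _ => (hd2 s).continuousAt.continuousWithinAt)
    (fun s _ r hr => (hd2 s).hasDerivWithinAt.liminf_right_slope_le hr) (by simp [hy]) hbound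
    t ⟨t.coe_nonneg, ht⟩
  have hmono : gronwallBound 0 k ε (t - 0) ≤ gronwallBound 0 k ε T :=
    gronwallBound_mono le_rfl hε0 hk0 (by rw [sub_zero]; exact ht)
  have h9 : ‖y t‖ ≤ √(gronwallBound 0 k ε T) := Real.le_sqrt_of_sq_le (key.trans hmono)
  have e : x t = f t + y t := hx.eqn t ht
  rw [e]
  exact (norm_add_le _ _).trans (add_le_add (hK t ht) h9)

/-- The solution of the equation, as the limit of the solutions of the truncated equations. -/
def globalSol (b : E → E) (f : ℝ≥0 → E) (t : ℝ≥0) : E :=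
  limUnder atTop fun R : ℕ => picardSol (trunc b R) f t

variable [CompleteSpace E] {b : E → E}

/-- Once R exceeds the bound common to all truncations, the cutoff equals 1 along the path on [0,
T]. The truncated solutions then solve the original equation and coincide by uniqueness, so the
limit is attained. -/
theorem exists_globalSol_eq (hb : LipschitzOnBalls b) (hc : Coercive b) {f : ℝ≥0 → E} (hf : Continuous f) (T : ℝ≥0) :
    ∃ R₀ : ℕ, ∀ R : ℕ, R₀ ≤ R →
      IsSolUpTo b f T (picardSol (trunc b R) f) ∧
        ∀ t ≤ T, globalSol b f t = picardSol (trunc b R) f t := by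
  obtain ⟨ρ, hρ⟩ := hc.exists_bound hb hf T
  have hs : ∀ R : ℕ, ρ ≤ R → IsSolUpTo b f T (picardSol (trunc b R) f) := by
    intro R hR
    obtain ⟨L, B, hL, hB⟩ := exists_trunc_bounds hb (Nat.cast_nonneg R)
    have h := isSolUpTo_picardSol hL hB hf T
    exact h.congr (fun t ht => trunc_eq ((hρ R (Nat.cast_nonneg R) _ h t ht).trans hR))
      fun _ _ => rfl
  obtain ⟨R₀, hR₀⟩ := exists_nat_ge ρ
  have hle : ∀ R : ℕ, R₀ ≤ R → ρ ≤ R := fun R hR => hR₀.trans (Nat.cast_le.2 hR)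
  refine ⟨R₀, fun R hR => ⟨hs R (hle R hR), fun t ht => ?_⟩⟩
  refine Tendsto.limUnder_eq (tendsto_const_nhds.congr' ?_)
  filter_upwards [eventually_ge_atTop R₀] with R' hR'
  exact (hs R (hle R hR)).unique hb (hs R' (hle R' hR')) t ht

theorem tendsto_globalSol (hb : LipschitzOnBalls b) (hc : Coercive b) {f : ℝ≥0 → E} (hf : Continuous f) (t : ℝ≥0) :
    Tendsto (fun R : ℕ => picardSol (trunc b R) f t) atTop (𝓝 (globalSol b f t)) := by
  obtain ⟨R₀, h⟩ := exists_globalSol_eq hb hc hf t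
  refine tendsto_const_nhds.congr' ?_
  filter_upwards [eventually_ge_atTop R₀] with R hR
  exact (h R hR).2 t le_rfl

theorem isSolUpTo_globalSol (hb : LipschitzOnBalls b) (hc : Coercive b) {f : ℝ≥0 → E} (hf : Continuous f) (T : ℝ≥0) :
    IsSolUpTo b f T (globalSol b f) :=
  isSolUpTo_of_forall_exists (fun T => by
    obtain ⟨R₀, h⟩ := exists_globalSol_eq hb hc hf T
    exact ⟨_, (h R₀ le_rfl).1, (h R₀ le_rfl).2⟩) T

end Dissipative

/-- A functional of paths that is measurable for every `σ`-algebra and depends on the path up to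
time `t` only is adapted. -/
theorem measurable_of_stopped {E : Type*} [MeasurableSpace E] [TopologicalSpace E] {Ω : Type*}
    {m : MeasurableSpace Ω} {S : (ℝ≥0 → E) → E} {t : ℝ≥0} {f : ℝ≥0 → Ω → E}
    (hS : ∀ g : ℝ≥0 → Ω → E, (∀ s, Measurable[m] (g s)) → (∀ ω, Continuous fun s => g s ω) →
      Measurable[m] fun ω => S fun s => g s ω)
    (heq : ∀ g g' : ℝ≥0 → E, Continuous g → Continuous g' → (∀ s ≤ t, g s = g' s) → S g = S g')
    (hf : ∀ s ≤ t, Measurable[m] (f s)) (hc : ∀ ω, Continuous fun s => f s ω) :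
    Measurable[m] fun ω => S fun s => f s ω := by
  have h := hS (fun s => f (min s t)) (fun s => hf _ (min_le_right _ _))
    fun ω => (hc ω).comp (by fun_prop : Continuous fun s : ℝ≥0 => min s t)
  have e : (fun ω => S fun s => f s ω) = fun ω => S fun s => f (min s t) ω := by
    funext ω
    refine heq _ _ (hc ω) ((hc ω).comp (by fun_prop : Continuous fun s : ℝ≥0 => min s t))
      fun s hs => ?_
    simp [min_eq_left hs]
  rwa [e]

/-! ### Square integrable martingales in discrete time -/

section DiscreteMartingale

variable {Ω : Type*} {m : MeasurableSpace Ω} {P : Measure Ω} {ℱ : Filtration ℕ m} {N : ℕ → Ω → ℝ}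

/-- Square integrable martingale increments. -/
structure IsIncrement (ℱ : Filtration ℕ m) (N : ℕ → Ω → ℝ) (P : Measure Ω) : Prop where
  memLp : ∀ i, MemLp (N i) 2 P
  measurable : ∀ i, Measurable[ℱ (i + 1)] (N i)
  orth : ∀ (i : ℕ) (Z : Ω → ℝ), Measurable[ℱ i] Z → MemLp Z 2 P → ∫ ω, Z ω * N i ω ∂P = 0

theorem IsIncrement.memLp_sum (h : IsIncrement ℱ N P) (k : ℕ) :
    MemLp (fun ω => ∑ i ∈ Finset.range k, N i ω) 2 P :=
  memLp_finsetSum _ fun i _ => h.memLp i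

theorem IsIncrement.measurable_sum (h : IsIncrement ℱ N P) (k : ℕ) :
    Measurable[ℱ k] fun ω => ∑ i ∈ Finset.range k, N i ω :=
  Finset.measurable_fun_sum _ fun i hi =>
    (h.measurable i).mono (ℱ.mono (Finset.mem_range.1 hi)) le_rfl

/-- The cross term vanishes by orthogonality to the partial sum multiplied by the indicator of A.
The set A is carried along because the same identity then shows that the squared sums form a
submartingale. -/
theorem IsIncrement.integral_sq_succ (h : IsIncrement ℱ N P) (k : ℕ) {A : Set Ω}
    (hA : MeasurableSet[ℱ k] A) :
    ∫ ω in A, (∑ i ∈ Finset.range (k + 1), N i ω) ^ 2 ∂P =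
      ∫ ω in A, (∑ i ∈ Finset.range k, N i ω) ^ 2 ∂P + ∫ ω in A, N k ω ^ 2 ∂P := by
  have hA' := ℱ.le k _ hA
  have i1 := (h.memLp_sum k).integrable_sq
  have i2 := (h.memLp k).integrable_sq
  have i3 : Integrable (fun ω => (∑ i ∈ Finset.range k, N i ω) * N k ω) P :=
    (h.memLp_sum k).integrable_mul (h.memLp k)
  have h0 : ∫ ω in A, (∑ i ∈ Finset.range k, N i ω) * N k ω ∂P = 0 := by
    have := h.orth k (A.indicator fun ω => ∑ i ∈ Finset.range k, N i ω)
      ((h.measurable_sum k).indicator hA) ((h.memLp_sum k).indicator hA')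
    rw [← integral_indicator hA', ← this]
    refine integral_congr_ae (Eventually.of_forall fun ω => ?_)
    by_cases hω : ω ∈ A <;> simp [hω]
  have e : ∀ ω, (∑ i ∈ Finset.range (k + 1), N i ω) ^ 2 = (∑ i ∈ Finset.range k, N i ω) ^ 2 +
      N k ω ^ 2 + 2 * ((∑ i ∈ Finset.range k, N i ω) * N k ω) := fun ω => by
    rw [Finset.sum_range_succ]
    ring
  simp only [e]
  have i12 : Integrable (fun ω => (∑ i ∈ Finset.range k, N i ω) ^ 2 + N k ω ^ 2) P := i1.add i2
  rw [integral_add i12.integrableOn (i3.const_mul 2).integrableOn, integral_add i1.integrableOn i2.integrableOn, integral_const_mul, h0, mul_zero, add_zero]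

theorem IsIncrement.integral_sq (h : IsIncrement ℱ N P) (k : ℕ) :
    ∫ ω, (∑ i ∈ Finset.range k, N i ω) ^ 2 ∂P = ∑ i ∈ Finset.range k, ∫ ω, N i ω ^ 2 ∂P := by
  induction k with
  | zero => simp
  | succ k ih =>
    have := h.integral_sq_succ k (A := Set.univ) MeasurableSet.univ
    simp only [Measure.restrict_univ] at this
    rw [this, ih, Finset.sum_range_succ]

theorem IsIncrement.submartingale_sq [IsFiniteMeasure P] (h : IsIncrement ℱ N P) :
    Submartingale (fun k ω => (∑ i ∈ Finset.range k, N i ω) ^ 2) ℱ P :=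
  submartingale_of_setIntegral_le_succ
    (fun k => ((h.measurable_sum k).pow_const 2).stronglyMeasurable)
    (fun k => (h.memLp_sum k).integrable_sq) fun k A hA => by
      rw [h.integral_sq_succ k hA]
      exact le_add_of_nonneg_right (integral_nonneg fun ω => sq_nonneg _)

/-- A random variable with `P(f ≥ t) ≤ r² / t²` has mean at most `2r`. -/
theorem lintegral_le_of_tail [IsProbabilityMeasure P] {f : Ω → ℝ} (hf : Measurable f)
    (h0 : ∀ ω, 0 ≤ f ω) {r : ℝ} (hr : 0 < r)
    (ht : ∀ t : ℝ, 0 < t → P {ω | t ≤ f ω} ≤ ENNReal.ofReal (r ^ 2 / t ^ 2)) :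
    ∫⁻ ω, ENNReal.ofReal (f ω) ∂P ≤ ENNReal.ofReal (2 * r) := by
  -- Layer-cake formula, split at t = r: below r the probability is at most 1, above r the tail
  -- r²/t² has integral r.
  rw [lintegral_eq_lintegral_meas_le P (Eventually.of_forall h0) hf.aemeasurable,
    ← Set.Ioc_union_Ioi_eq_Ioi hr.le, lintegral_union measurableSet_Ioi
      (Set.Ioc_disjoint_Ioi le_rfl), two_mul, ENNReal.ofReal_add hr.le hr.le]
  refine add_le_add ?_ ?_
  · calc _ ≤ ∫⁻ _ in Set.Ioc 0 r, 1 := lintegral_mono fun t => prob_le_one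
      _ = ENNReal.ofReal r := by simp
  · have e : ∀ t ∈ Set.Ioi r, r ^ 2 / t ^ 2 = r ^ 2 * t ^ (-2 : ℝ) := fun t ht => by
      rw [Real.rpow_neg (hr.trans ht).le, div_eq_mul_inv]
      norm_cast
    have hint : IntegrableOn (fun t : ℝ => r ^ 2 / t ^ 2) (Set.Ioi r) :=
      IntegrableOn.congr_fun
        ((integrableOn_Ioi_rpow_of_lt (by norm_num : (-2 : ℝ) < -1) hr).const_mul (r ^ 2))
        (fun t ht => (e t ht).symm) measurableSet_Ioi
    calc _ ≤ ∫⁻ t in Set.Ioi r, ENNReal.ofReal (r ^ 2 / t ^ 2) :=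
          setLIntegral_mono' measurableSet_Ioi fun t h => ht t (hr.trans h)
      _ = ENNReal.ofReal (∫ t in Set.Ioi r, r ^ 2 / t ^ 2) :=
          (ofReal_integral_eq_lintegral_ofReal hint
            (Eventually.of_forall fun t => by positivity)).symm
      _ = ENNReal.ofReal r := by
          rw [setIntegral_congr_fun measurableSet_Ioi e, integral_const_mul,
            integral_Ioi_rpow_of_lt (by norm_num) hr]
          congr 1
          norm_num
          rw [Real.rpow_neg_one]
          field_simp

/-- Doob's maximal inequality for the squared sums gives the tail r²/t² for the maximum, and
`lintegral_le_of_tail` converts it into a bound on the mean. -/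
theorem IsIncrement.lintegral_sup_le [IsProbabilityMeasure P] (h : IsIncrement ℱ N P) (n : ℕ)
    {r : ℝ} (hr : 0 < r) (hn : ∫ ω, (∑ i ∈ Finset.range n, N i ω) ^ 2 ∂P ≤ r ^ 2) :
    ∫⁻ ω, ENNReal.ofReal ((Finset.range (n + 1)).sup' Finset.nonempty_range_add_one
      fun k => |∑ i ∈ Finset.range k, N i ω|) ∂P ≤ ENNReal.ofReal (2 * r) := by
  have hmeas : ∀ k, Measurable fun ω => |∑ i ∈ Finset.range k, N i ω| := fun k =>
    continuous_abs.measurable.comp ((h.measurable_sum k).mono (ℱ.le k) le_rfl)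
  refine lintegral_le_of_tail (Finset.measurable_range_sup'' fun k _ => hmeas k)
    (fun ω => ?_) hr fun t ht => ?_
  · exact (abs_nonneg _).trans (Finset.le_sup' (fun k => |∑ i ∈ Finset.range k, N i ω|)
      (Finset.mem_range.2 (Nat.succ_pos n)))
  · have ht2 : 0 < t ^ 2 := by positivity
    have hset : {ω | t ≤ (Finset.range (n + 1)).sup' Finset.nonempty_range_add_one
        fun k => |∑ i ∈ Finset.range k, N i ω|} =
        {ω | ((t ^ 2).toNNReal : ℝ) ≤ (Finset.range (n + 1)).sup'
          Finset.nonempty_range_add_one fun k => (∑ i ∈ Finset.range k, N i ω) ^ 2} := by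
      ext ω
      simp only [Set.mem_ofPred_eq, Finset.le_sup'_iff, Real.coe_toNNReal _ ht2.le]
      refine exists_congr fun k => and_congr_right fun _ => ?_
      rw [← sq_abs (∑ i ∈ Finset.range k, N i ω), sq_le_sq₀ ht.le (abs_nonneg _)]
    have hmax := maximal_ineq h.submartingale_sq (fun k ω => sq_nonneg _)
      (ε := (t ^ 2).toNNReal) n
    rw [← hset] at hmax
    have hle := hmax.trans (ENNReal.ofReal_le_ofReal ((setIntegral_le_integral
      (h.memLp_sum n).integrable_sq (Eventually.of_forall fun ω => sq_nonneg _)).trans hn))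
    rw [ENNReal.ofReal_div_of_pos ht2, ENNReal.le_div_iff_mul_le (Or.inl (by simpa using ht.ne'))
      (Or.inl ENNReal.ofReal_ne_top), mul_comm]
    exact hle

end DiscreteMartingale

/-! ### Energy increments -/

section EnergyIncrement

variable {E : Type*} [NormedAddCommGroup E] [InnerProductSpace ℝ E]

theorem IsSolUpTo.sub_eq {b : E → E} {f x : ℝ≥0 → E} {T : ℝ≥0}
    (h : IsSolUpTo b f T x) (hb : Continuous b) {s t : ℝ≥0} (hst : s ≤ t) (ht : t ≤ T) :
    x t = x s + (f t - f s) + ∫ u in (s : ℝ)..t, b (x u.toNNReal) := by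
  have c := continuous_comp_toNNReal hb h.continuous
  have := intervalIntegral.integral_add_adjacent_intervals (a := 0) (b := (s : ℝ)) (c := t)
    (μ := volume) (c.intervalIntegrable _ _) (c.intervalIntegrable _ _)
  rw [h.eqn t ht, h.eqn s (hst.trans ht), ← this]
  abel

/-- The increment of `|x|² - 2 ∫ ⟨x, b(x)⟩` over `[s, t]`. -/
theorem IsSolUpTo.energy [CompleteSpace E] {b : E → E} {f x : ℝ≥0 → E} {T : ℝ≥0}
    (h : IsSolUpTo b f T x) (hb : Continuous b) (hf : Continuous f) {s t : ℝ≥0} (hst : s ≤ t)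
    (ht : t ≤ T) :
    ‖x t‖ ^ 2 - ‖x s‖ ^ 2 - 2 * ∫ u in (s : ℝ)..t, ⟪x u.toNNReal, b (x u.toNNReal)⟫_ℝ =
      2 * (∫ u in (s : ℝ)..t, ⟪b (x u.toNNReal), f t - f u.toNNReal⟫_ℝ) +
        2 * ⟪x s, f t - f s⟫_ℝ + ‖f t - f s‖ ^ 2 := by
  have c := continuous_comp_toNNReal hb h.continuous
  have cx : Continuous fun u : ℝ => x u.toNNReal := h.continuous.comp continuous_real_toNNReal
  have cf : Continuous fun u : ℝ => f u.toNNReal := hf.comp continuous_real_toNNReal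
  -- The auxiliary path receives the whole increment f_t − f_s at the start of the interval. It is
  -- therefore differentiable, ends at x_t, and differs from x_u by f_t − f_u, an increment after
  -- time u. This choice produces only pairings of b(x_u) with later noise.
  set q : ℝ → E := fun u => x s + (f t - f s) + ∫ v in (s : ℝ)..u, b (x v.toNNReal) with hq
  have hd : ∀ u, HasDerivAt (fun u => ‖q u‖ ^ 2) (2 * ⟪q u, b (x u.toNNReal)⟫_ℝ) u := fun u =>
    (((c.integral_hasStrictDerivAt s u).hasDerivAt).const_add (x s + (f t - f s))).norm_sq
  have cq : Continuous q := continuous_iff_continuousAt.2 fun u =>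
    (((c.integral_hasStrictDerivAt s u).hasDerivAt).const_add (x s + (f t - f s))).continuousAt
  have hq' : ∀ u ∈ Set.uIcc (s : ℝ) t, 2 * ⟪q u, b (x u.toNNReal)⟫_ℝ =
      2 * ⟪x u.toNNReal, b (x u.toNNReal)⟫_ℝ + 2 * ⟪b (x u.toNNReal), f t - f u.toNNReal⟫_ℝ := by
    intro u hu
    rw [Set.uIcc_of_le (NNReal.coe_le_coe.2 hst)] at hu
    have hu0 : 0 ≤ u := s.coe_nonneg.trans hu.1
    have e := h.sub_eq hb (s := s) (t := u.toNNReal) (Real.le_toNNReal_iff_coe_le hu0 |>.2 hu.1)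
      ((Real.toNNReal_le_iff_le_coe.2 hu.2).trans ht)
    rw [Real.coe_toNNReal u hu0] at e
    have : q u = x u.toNNReal + (f t - f u.toNNReal) := by
      rw [e, hq]
      simp only
      abel
    rw [this, inner_add_left, real_inner_comm (f t - f u.toNNReal)]
    ring
  have hftc := intervalIntegral.integral_eq_sub_of_hasDerivAt (a := (s : ℝ)) (b := t)
    (fun u _ => hd u) ((continuous_const.mul (cq.inner c)).intervalIntegrable _ _)
  rw [intervalIntegral.integral_congr hq', intervalIntegral.integral_add
    ((continuous_const.mul (cx.inner c)).intervalIntegrable _ _)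
    ((continuous_const.mul (c.inner (continuous_const.sub cf))).intervalIntegrable _ _),
    intervalIntegral.integral_const_mul, intervalIntegral.integral_const_mul] at hftc
  have e1 : q t = x t := (h.sub_eq hb hst ht).symm
  have e2 : q s = x s + (f t - f s) := by simp [hq]
  rw [e1, e2, norm_add_sq_real (x s)] at hftc
  linarith

theorem abs_energy_remainder_le {x y D : E} {I B A h : ℝ} (hxy : x = y + D) (hD : ‖D‖ ≤ B * h)
    (hI : |I| ≤ A * h) : |‖x‖ ^ 2 - ‖y‖ ^ 2 - 2 * I| ≤ h * (2 * B * ‖y‖ + B ^ 2 * h + 2 * A) := by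
  have h1 : ‖x‖ ^ 2 - ‖y‖ ^ 2 = 2 * ⟪y, D⟫_ℝ + ‖D‖ ^ 2 := by
    rw [hxy, norm_add_sq_real]
    ring
  have h2 := (abs_real_inner_le_norm y D).trans (mul_le_mul_of_nonneg_left hD (norm_nonneg y))
  have h3 : ‖D‖ ^ 2 ≤ (B * h) ^ 2 := pow_le_pow_left₀ (norm_nonneg _) hD 2
  rw [h1]
  have h4 := abs_le.1 h2
  have h5 := abs_le.1 hI
  rw [abs_le]
  constructor <;> nlinarith [sq_nonneg ‖D‖]

end EnergyIncrement

/-! ### Energy increments of truncated equations and their second moments -/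

section Noise

variable {E : Type*} [NormedAddCommGroup E] [InnerProductSpace ℝ E]
  [MeasurableSpace E]
  {Ω : Type*} {m : MeasurableSpace Ω} {P : Measure Ω} {𝒢 : Filtration ℝ≥0 m}

/-- A continuous adapted process with square integrable initial value and centered increments
independent of the past, of variance `(t - s) θ` and of fourth moment at most `c (t - s)²`. -/
structure IsNoise (𝒢 : Filtration ℝ≥0 m) (f : ℝ≥0 → Ω → E) (θ c : ℝ) (P : Measure Ω) : Prop where
  measurable : ∀ t, Measurable[𝒢 t] (f t)
  continuous : ∀ ω, Continuous fun t => f t ω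
  indep : ∀ s t, s ≤ t →
    Indep (MeasurableSpace.comap (fun ω => f t ω - f s ω) inferInstance) (𝒢 s) P
  memLp : ∀ s t, s ≤ t → MemLp (fun ω => f t ω - f s ω) 4 P
  mean : ∀ s t, s ≤ t → ∫ ω, f t ω - f s ω ∂P = 0
  var : ∀ s t : ℝ≥0, s ≤ t → ∫ ω, ‖f t ω - f s ω‖ ^ 2 ∂P = ((t : ℝ) - s) * θ
  fourth : ∀ s t : ℝ≥0, s ≤ t → ∫ ω, ‖f t ω - f s ω‖ ^ 4 ∂P ≤ c * ((t : ℝ) - s) ^ 2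
  init : MemLp (f 0) 2 P

/-- An adapted solution of the equation with bounded coefficients. -/
structure IsBoundedSol (𝒢 : Filtration ℝ≥0 m) (b : E → E) (B A : ℝ) (f : ℝ≥0 → Ω → E)
    (X : ℝ≥0 → Ω → E) : Prop where
  measurable : ∀ t, Measurable[𝒢 t] (X t)
  sol : ∀ ω T, IsSolUpTo b (fun t => f t ω) T fun t => X t ω
  cont : Continuous b
  bound : ∀ x, ‖b x‖ ≤ B
  bound_inner : ∀ x, |⟪x, b x⟫_ℝ| ≤ A
  inner_nonpos : ∀ x, ⟪x, b x⟫_ℝ ≤ 0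

/-- By independence the mean of the pairing is the pairing of the means. Every orthogonality
statement below reduces to this. -/
theorem integral_inner_eq_zero {F : Type*} [NormedAddCommGroup F] [InnerProductSpace ℝ F]
    [CompleteSpace F] [MeasurableSpace F] [BorelSpace F] {m' : MeasurableSpace Ω} {U D : Ω → F}
    (hU : Measurable[m'] U) (hUi : Integrable U P) (hDi : Integrable D P)
    (hind : Indep (MeasurableSpace.comap D inferInstance) m' P) (h0 : ∫ ω, D ω ∂P = 0) :
    Integrable (fun ω => ⟪U ω, D ω⟫_ℝ) P ∧ ∫ ω, ⟪U ω, D ω⟫_ℝ ∂P = 0 := by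
  have hUD : IndepFun U D P := by
    rw [IndepFun_iff_Indep]
    exact (indep_of_indep_of_le_right hind hU.comap_le).symm
  constructor
  · exact hUD.integrable_bilin hUi hDi (innerSL ℝ : F →L[ℝ] F →L[ℝ] ℝ)
  · have := hUD.integral_bilin hUi hDi (innerSL ℝ : F →L[ℝ] F →L[ℝ] ℝ)
    rw [h0, map_zero] at this
    exact this

variable {f : ℝ≥0 → Ω → E} {θ c : ℝ}

theorem IsNoise.memLp_two [IsFiniteMeasure P] (h : IsNoise 𝒢 f θ c P) {s t : ℝ≥0} (hst : s ≤ t) :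
    MemLp (fun ω => f t ω - f s ω) 2 P :=
  (h.memLp s t hst).mono_exponent (by norm_num)

theorem IsNoise.memLp_path [IsFiniteMeasure P] (h : IsNoise 𝒢 f θ c P) (t : ℝ≥0) :
    MemLp (f t) 2 P := by
  have := h.init.add (h.memLp_two (zero_le (a := t)))
  simpa [Pi.add_def] using this

theorem IsNoise.theta_nonneg (h : IsNoise 𝒢 f θ c P) : 0 ≤ θ := by
  have := h.var 0 1 zero_le
  simp only [NNReal.coe_one, NNReal.coe_zero, sub_zero, one_mul] at this
  rw [← this]
  exact integral_nonneg fun ω => by positivity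

variable {b : E → E} {B A : ℝ} {X : ℝ≥0 → Ω → E}

theorem IsBoundedSol.continuous (h : IsBoundedSol 𝒢 b B A f X) (ω : Ω) :
    Continuous fun t => X t ω := (h.sol ω 0).continuous

/-- The increment of `|X|² - 2 ∫ ⟨X, b(X)⟩ - t θ` over `[s, t]`. -/
def energyIncr (b : E → E) (X : ℝ≥0 → Ω → E) (θ : ℝ) (s t : ℝ≥0) (ω : Ω) : ℝ :=
  ‖X t ω‖ ^ 2 - ‖X s ω‖ ^ 2 - 2 * (∫ u in (s : ℝ)..t, ⟪X u.toNNReal ω, b (X u.toNNReal ω)⟫_ℝ) -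
    ((t : ℝ) - s) * θ

theorem energyIncr_eq [FiniteDimensional ℝ E] (h : IsBoundedSol 𝒢 b B A f X)
    (hf : IsNoise 𝒢 f θ c P) {s t : ℝ≥0} (hst : s ≤ t) (ω : Ω) :
    energyIncr b X θ s t ω =
      2 * (∫ u in (s : ℝ)..t, ⟪b (X u.toNNReal ω), f t ω - f u.toNNReal ω⟫_ℝ) +
        2 * ⟪X s ω, f t ω - f s ω⟫_ℝ + (‖f t ω - f s ω‖ ^ 2 - ((t : ℝ) - s) * θ) := by
  have := FiniteDimensional.complete ℝ E
  rw [energyIncr, (h.sol ω t).energy h.cont (hf.continuous ω) hst le_rfl]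
  ring

/-- Up to the two noise terms, the energy increment is of order t − s, because drift and ⟨x, b(x)⟩
are bounded after truncation. The square of this remainder is of second order and will disappear on
fine grids. -/
theorem abs_energyIncr_le (h : IsBoundedSol 𝒢 b B A f X) [CompleteSpace E]
    {s t : ℝ≥0} (hst : s ≤ t) (ω : Ω) :
    |energyIncr b X θ s t ω - (2 * ⟪X s ω, f t ω - f s ω⟫_ℝ +
      (‖f t ω - f s ω‖ ^ 2 - ((t : ℝ) - s) * θ))| ≤
      ((t : ℝ) - s) * (2 * B * ‖X s ω + (f t ω - f s ω)‖ + B ^ 2 * ((t : ℝ) - s) + 2 * A) := by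
  have hst' : (0 : ℝ) ≤ (t : ℝ) - s := sub_nonneg.2 (NNReal.coe_le_coe.2 hst)
  have hD := intervalIntegral.norm_integral_le_of_norm_le_const (a := (s : ℝ)) (b := (t : ℝ))
    (f := fun s => b (X s.toNNReal ω)) (C := B) fun s _ => h.bound _
  have hI := intervalIntegral.norm_integral_le_of_norm_le_const (a := (s : ℝ)) (b := (t : ℝ))
    (f := fun u => ⟪X u.toNNReal ω, b (X u.toNNReal ω)⟫_ℝ) (C := A) fun s _ => h.bound_inner _
  rw [abs_of_nonneg hst'] at hD hI
  have := abs_energy_remainder_le ((h.sol ω t).sub_eq h.cont hst le_rfl) hD hI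
  have e : energyIncr b X θ s t ω - (2 * ⟪X s ω, f t ω - f s ω⟫_ℝ +
      (‖f t ω - f s ω‖ ^ 2 - ((t : ℝ) - s) * θ)) =
      ‖X t ω‖ ^ 2 - ‖X s ω + (f t ω - f s ω)‖ ^ 2 -
        2 * (∫ u in (s : ℝ)..t, ⟪X u.toNNReal ω, b (X u.toNNReal ω)⟫_ℝ) := by
    rw [energyIncr, norm_add_sq_real]
    ring
  rw [e]
  exact this

theorem sq_energy_le {N I J y x δ r θ A B : ℝ} (hI : |I| ≤ x * δ) (hy : 0 ≤ y) (hyx : y ≤ x + δ) (hN : N = 2 * I + (J + (δ ^ 2 - r * θ)))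
    (hJ : |J| ≤ r * (2 * B * y + B ^ 2 * r + 2 * A)) :
    N ^ 2 ≤ 8 * (x ^ 2 * δ ^ 2) + 96 * B ^ 2 * r ^ 2 * x ^ 2 + 96 * B ^ 2 * r ^ 2 * δ ^ 2 +
      8 * δ ^ 4 + r ^ 2 * (12 * (B ^ 4 * r ^ 2 + 4 * A ^ 2) + 8 * θ ^ 2) := by
  have hI2 : I ^ 2 ≤ x ^ 2 * δ ^ 2 := by
    rw [← sq_abs I, ← mul_pow]
    exact pow_le_pow_left₀ (abs_nonneg _) hI 2
  have hy2 : y ^ 2 ≤ 2 * x ^ 2 + 2 * δ ^ 2 :=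
    (pow_le_pow_left₀ hy hyx 2).trans (by linarith [sq_nonneg (x - δ)])
  have hJ2 : J ^ 2 ≤ r ^ 2 * (2 * B * y + B ^ 2 * r + 2 * A) ^ 2 := by
    rw [← sq_abs J, ← mul_pow]
    exact pow_le_pow_left₀ (abs_nonneg _) hJ 2
  have hK : (2 * B * y + B ^ 2 * r + 2 * A) ^ 2 ≤
      3 * (8 * B ^ 2 * x ^ 2 + 8 * B ^ 2 * δ ^ 2 + B ^ 4 * r ^ 2 + 4 * A ^ 2) := by
    have h4 : B ^ 2 * y ^ 2 ≤ B ^ 2 * (2 * x ^ 2 + 2 * δ ^ 2) :=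
      mul_le_mul_of_nonneg_left hy2 (sq_nonneg B)
    linarith [sq_nonneg (2 * B * y - B ^ 2 * r), sq_nonneg (2 * B * y - 2 * A),
      sq_nonneg (B ^ 2 * r - 2 * A)]
  have hJ3 := hJ2.trans (mul_le_mul_of_nonneg_left hK (sq_nonneg r))
  -- Two applications of (a + b)² ≤ 2a² + 2b², first separating 2I from the rest.
  have h5 : N ^ 2 ≤ 8 * I ^ 2 + 4 * J ^ 2 + 4 * (δ ^ 2 - r * θ) ^ 2 := by
    rw [hN]
    generalize δ ^ 2 - r * θ = k
    linarith [sq_nonneg (2 * I - (J + k)), sq_nonneg (J - k)]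
  have h6 : (δ ^ 2 - r * θ) ^ 2 ≤ 2 * δ ^ 4 + 2 * (r ^ 2 * θ ^ 2) := by
    linarith [sq_nonneg (δ ^ 2 + r * θ)]
  linarith

theorem sq_energyIncr_le (h : IsBoundedSol 𝒢 b B A f X) [CompleteSpace E]
    {s t : ℝ≥0} (hst : s ≤ t) (ω : Ω) :
    energyIncr b X θ s t ω ^ 2 ≤ 8 * (‖X s ω‖ ^ 2 * ‖f t ω - f s ω‖ ^ 2) +
      96 * B ^ 2 * ((t : ℝ) - s) ^ 2 * ‖X s ω‖ ^ 2 +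
      96 * B ^ 2 * ((t : ℝ) - s) ^ 2 * ‖f t ω - f s ω‖ ^ 2 + 8 * ‖f t ω - f s ω‖ ^ 4 +
      ((t : ℝ) - s) ^ 2 * (12 * (B ^ 4 * ((t : ℝ) - s) ^ 2 + 4 * A ^ 2) + 8 * θ ^ 2) :=
  sq_energy_le (abs_real_inner_le_norm (X s ω) (f t ω - f s ω)) (norm_nonneg _) (norm_add_le (X s ω) (f t ω - f s ω)) (by ring)
    (abs_energyIncr_le (θ := θ) h hst ω)

variable [BorelSpace E]

theorem IsBoundedSol.memLp [FiniteDimensional ℝ E] [IsFiniteMeasure P] (h : IsBoundedSol 𝒢 b B A f X)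
    (hf : IsNoise 𝒢 f θ c P) (t : ℝ≥0) : MemLp (X t) 2 P := by
  have := secondCountable_of_finiteDimensional E
  refine ((hf.memLp_path t).norm.add (memLp_const (B * t))).mono
    ((h.measurable t).mono (𝒢.le t) le_rfl).aestronglyMeasurable (Eventually.of_forall fun ω => ?_)
  have h1 := intervalIntegral.norm_integral_le_of_norm_le_const (a := 0) (b := (t : ℝ))
    (f := fun s => b (X s.toNNReal ω)) (C := B) fun s _ => h.bound _
  rw [sub_zero, abs_of_nonneg t.coe_nonneg] at h1
  rw [(h.sol ω t).eqn t le_rfl]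
  refine (norm_add_le _ _).trans ((add_le_add le_rfl h1).trans (le_abs_self _))

theorem measurable_energyIncr [FiniteDimensional ℝ E] {m' : MeasurableSpace Ω} (hb : Continuous b)
    {s t : ℝ≥0} (hst : s ≤ t)
    (hX : ∀ u ≤ t, Measurable[m'] (X u)) (hc : ∀ ω, Continuous fun t => X t ω) :
    Measurable[m'] (energyIncr b X θ s t) := by
  have := secondCountable_of_finiteDimensional E
  have hint : Measurable[m'] fun ω => ∫ u in (s : ℝ)..t, ⟪X u.toNNReal ω, b (X u.toNNReal ω)⟫_ℝ := by
    have h1 := measurable_integral_path (x := fun u => X (min u t))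
      (fun u => hX _ (min_le_right _ _))
      (fun ω => (hc ω).comp (by fun_prop : Continuous fun u : ℝ≥0 => min u t))
      (b := fun x => ⟪x, b x⟫_ℝ) (continuous_id.inner hb) s t
    convert h1 using 2 with ω
    refine intervalIntegral.integral_congr fun u hu => ?_
    rw [Set.uIcc_of_le (NNReal.coe_le_coe.2 hst)] at hu
    rw [min_eq_left (Real.toNNReal_le_iff_le_coe.2 hu.2)]
  exact ((((hX t le_rfl).norm.pow_const 2).sub ((hX s hst).norm.pow_const 2)).sub
    (hint.const_mul 2)).sub measurable_const

/-- The coefficient of `(t - s)²` in the bound for the second moment of the energy increments. -/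
def incrConst (B A θ c Q T : ℝ) : ℝ :=
  12 * (8 * B ^ 2 * Q + 8 * B ^ 2 * (T * θ) + B ^ 4 * T ^ 2 + 4 * A ^ 2) + 8 * c + 8 * θ ^ 2

/-- The state at time s is independent of the later increment, so the mean of the product factors.
This is the only contribution to the second moment that is of first order in t − s. -/
theorem integrable_norm_mul_norm [FiniteDimensional ℝ E] [IsFiniteMeasure P]
    (h : IsBoundedSol 𝒢 b B A f X) (hf : IsNoise 𝒢 f θ c P) {s t : ℝ≥0} (hst : s ≤ t) :
    Integrable (fun ω => ‖X s ω‖ ^ 2 * ‖f t ω - f s ω‖ ^ 2) P ∧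
      ∫ ω, ‖X s ω‖ ^ 2 * ‖f t ω - f s ω‖ ^ 2 ∂P =
        (∫ ω, ‖X s ω‖ ^ 2 ∂P) * (((t : ℝ) - s) * θ) := by
  have hUD : IndepFun (X s) (fun ω => f t ω - f s ω) P := by
    rw [IndepFun_iff_Indep]
    exact (indep_of_indep_of_le_right (hf.indep s t hst) (h.measurable s).comap_le).symm
  have hUD2 := hUD.comp (φ := fun x => ‖x‖ ^ 2) (ψ := fun x => ‖x‖ ^ 2)
    (measurable_norm.pow_const 2) (measurable_norm.pow_const 2)
  have i1 := (h.memLp hf s).integrable_norm_pow (by norm_num)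
  have i2 := (hf.memLp_two hst).integrable_norm_pow (by norm_num)
  refine ⟨hUD2.integrable_mul i1 i2, ?_⟩
  have := hUD2.integral_fun_mul_eq_mul_integral i1.aestronglyMeasurable i2.aestronglyMeasurable
  simp only [Function.comp] at this
  rw [this, hf.var s t hst]

/-- The pointwise bound `sq_energyIncr_le` is integrated. The linear coefficient 8θQ is free of the
truncation constants B and A, which enter only the quadratic one. -/
theorem memLp_energyIncr [FiniteDimensional ℝ E] [IsProbabilityMeasure P]
    (h : IsBoundedSol 𝒢 b B A f X) (hf : IsNoise 𝒢 f θ c P) {s t : ℝ≥0} (hst : s ≤ t) :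
    MemLp (energyIncr b X θ s t) 2 P ∧ ∀ Q T : ℝ, ∫ ω, ‖X s ω‖ ^ 2 ∂P ≤ Q → (t : ℝ) ≤ T →
      ∫ ω, energyIncr b X θ s t ω ^ 2 ∂P ≤
        8 * θ * Q * ((t : ℝ) - s) + incrConst B A θ c Q T * ((t : ℝ) - s) ^ 2 := by
  have := FiniteDimensional.complete ℝ E
  have hm : Measurable (energyIncr b X θ s t) :=
    measurable_energyIncr h.cont hst (fun u _ => (h.measurable u).mono (𝒢.le u) le_rfl)
      h.continuous
  obtain ⟨i1, e1⟩ := integrable_norm_mul_norm h hf hst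
  have i2 := (h.memLp hf s).integrable_norm_pow (by norm_num)
  have i3 := (hf.memLp_two hst).integrable_norm_pow (by norm_num)
  have i4 := (hf.memLp s t hst).integrable_norm_pow (by norm_num)
  have hst' : (0 : ℝ) ≤ (t : ℝ) - s := sub_nonneg.2 (NNReal.coe_le_coe.2 hst)
  set r := (t : ℝ) - s with hr
  set K : ℝ := r ^ 2 * (12 * (B ^ 4 * r ^ 2 + 4 * A ^ 2) + 8 * θ ^ 2) with hK
  have j1 := i1.const_mul 8
  have j2 := i2.const_mul (96 * B ^ 2 * r ^ 2)
  have j3 := i3.const_mul (96 * B ^ 2 * r ^ 2)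
  have j4 := i4.const_mul 8
  have k2 : Integrable (fun ω => 8 * (‖X s ω‖ ^ 2 * ‖f t ω - f s ω‖ ^ 2) +
    96 * B ^ 2 * r ^ 2 * ‖X s ω‖ ^ 2) P := j1.add j2
  have k3 : Integrable (fun ω => 8 * (‖X s ω‖ ^ 2 * ‖f t ω - f s ω‖ ^ 2) +
    96 * B ^ 2 * r ^ 2 * ‖X s ω‖ ^ 2 + 96 * B ^ 2 * r ^ 2 * ‖f t ω - f s ω‖ ^ 2) P := k2.add j3
  have k4 : Integrable (fun ω => 8 * (‖X s ω‖ ^ 2 * ‖f t ω - f s ω‖ ^ 2) +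
    96 * B ^ 2 * r ^ 2 * ‖X s ω‖ ^ 2 + 96 * B ^ 2 * r ^ 2 * ‖f t ω - f s ω‖ ^ 2 +
      8 * ‖f t ω - f s ω‖ ^ 4) P := k3.add j4
  have j := k4.add (integrable_const K)
  have hle := sq_energyIncr_le (θ := θ) h hst
  refine ⟨(memLp_two_iff_integrable_sq hm.aestronglyMeasurable).2 (j.mono'
    (hm.pow_const 2).aestronglyMeasurable (Eventually.of_forall fun ω => ?_)),
    fun Q T hQ hT => ?_⟩
  · rw [Real.norm_of_nonneg (sq_nonneg _)]
    exact hle ω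
  · have h1 := integral_mono_of_nonneg (Eventually.of_forall fun ω => sq_nonneg _) j
      (Eventually.of_forall hle)
    refine h1.trans ?_
    have e := integral_add k4 (integrable_const (μ := P) K)
    rw [integral_add k3 j4, integral_add k2 j3, integral_add j1 j2, integral_const_mul,
      integral_const_mul, integral_const_mul, integral_const_mul, e1, hf.var s t hst,
      integral_const, probReal_univ, one_smul] at e
    refine e.le.trans ?_
    have hθ := hf.theta_nonneg
    have h4 := hf.fourth s t hst
    have hrT : r ≤ T := by
      have := s.coe_nonneg
      linarith
    have q1 : (∫ ω, ‖X s ω‖ ^ 2 ∂P) * (r * θ) ≤ Q * (r * θ) :=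
      mul_le_mul_of_nonneg_right hQ (by positivity)
    have q2 : 96 * B ^ 2 * r ^ 2 * (∫ ω, ‖X s ω‖ ^ 2 ∂P) ≤ 96 * B ^ 2 * r ^ 2 * Q :=
      mul_le_mul_of_nonneg_left hQ (by positivity)
    have q3 : 96 * B ^ 2 * r ^ 2 * (r * θ) ≤ 96 * B ^ 2 * r ^ 2 * (T * θ) :=
      mul_le_mul_of_nonneg_left (mul_le_mul_of_nonneg_right hrT hθ) (by positivity)
    have q4 : r ^ 2 * (12 * (B ^ 4 * r ^ 2)) ≤ r ^ 2 * (12 * (B ^ 4 * T ^ 2)) := by gcongr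
    rw [incrConst, hK]
    linarith

end Noise

/-! ### Orthogonality of the energy increments to the past -/

section Orthogonality

variable {E : Type*} [NormedAddCommGroup E] [InnerProductSpace ℝ E] [FiniteDimensional ℝ E]
  [MeasurableSpace E] [BorelSpace E]
  {Ω : Type*} {m : MeasurableSpace Ω} {P : Measure Ω} {𝒢 : Filtration ℝ≥0 m}
  {f : ℝ≥0 → Ω → E} {θ c : ℝ} {b : E → E} {B A : ℝ} {X : ℝ≥0 → Ω → E}

/-- At each u the vector Z b(X_u) is known at time u, while f_t − f_u is centred and independent of
the past of u; so the pairing has mean zero for every u, and Fubini's theorem allows integration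
over u. -/
theorem integral_inner_drift_noise [IsProbabilityMeasure P]
    (h : IsBoundedSol 𝒢 b B A f X) (hf : IsNoise 𝒢 f θ c P) {s t : ℝ≥0} (hst : s ≤ t)
    {Z : Ω → ℝ} (hZ : Measurable[𝒢 s] Z) (hZ2 : MemLp Z 2 P) :
    Integrable (fun ω => Z ω *
      ∫ u in (s : ℝ)..t, ⟪b (X u.toNNReal ω), f t ω - f u.toNNReal ω⟫_ℝ) P ∧
    ∫ ω, Z ω * (∫ u in (s : ℝ)..t, ⟪b (X u.toNNReal ω), f t ω - f u.toNNReal ω⟫_ℝ) ∂P = 0 := by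
  have := FiniteDimensional.complete ℝ E
  have := secondCountable_of_finiteDimensional E
  have hst' : (s : ℝ) ≤ t := NNReal.coe_le_coe.2 hst
  let F : ℝ → Ω → ℝ := fun u ω => ⟪Z ω • b (X u.toNNReal ω), f t ω - f u.toNNReal ω⟫_ℝ
  have hfm : ∀ u, Measurable (f u) := fun u => (hf.measurable u).mono (𝒢.le u) le_rfl
  have hbm : ∀ u, Measurable fun ω => b (X u ω) := fun u =>
    h.cont.measurable.comp ((h.measurable u).mono (𝒢.le u) le_rfl)
  have hZm : Measurable Z := hZ.mono (𝒢.le s) le_rfl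
  have hFm : Measurable (Function.uncurry F) := by
    refine measurable_uncurry_of_continuous_of_measurable (fun ω => ?_) fun u => ?_
    · exact ((continuous_comp_toNNReal h.cont (h.continuous ω)).const_smul (Z ω)).inner
        (continuous_const.sub ((hf.continuous ω).comp continuous_real_toNNReal))
    · exact (hZm.smul (hbm _)).inner ((hfm t).sub (hfm _))
  have hB : 0 ≤ B := (norm_nonneg _).trans (h.bound 0)
  have hθ := hf.theta_nonneg
  -- The bound on the mean of |F u| does not depend on u; this is what integrability on the product
  -- space requires.
  have hint : ∀ u ∈ Set.Ioc (s : ℝ) t, (Integrable (F u) P ∧ ∫ ω, F u ω ∂P = 0) ∧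
      ∫ ω, ‖F u ω‖ ∂P ≤ B * (∫ ω, Z ω ^ 2 ∂P + t * θ) := by
    intro u hu
    have hu0 : 0 ≤ u := s.coe_nonneg.trans hu.1.le
    have hut : u.toNNReal ≤ t := Real.toNNReal_le_iff_le_coe.2 hu.2
    have hsu : s ≤ u.toNNReal := (Real.le_toNNReal_iff_coe_le hu0).2 hu.1.le
    have hle : ∀ ω, ‖F u ω‖ ≤ B * (Z ω ^ 2 + ‖f t ω - f u.toNNReal ω‖ ^ 2) := by
      intro ω
      have h1 := norm_inner_le_norm (𝕜 := ℝ) (Z ω • b (X u.toNNReal ω)) (f t ω - f u.toNNReal ω)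
      rw [norm_smul, Real.norm_eq_abs] at h1
      refine h1.trans ?_
      calc |Z ω| * ‖b (X u.toNNReal ω)‖ * ‖f t ω - f u.toNNReal ω‖
          ≤ |Z ω| * B * ‖f t ω - f u.toNNReal ω‖ := by
            gcongr
            exact h.bound _
        _ = B * (|Z ω| * ‖f t ω - f u.toNNReal ω‖) := by ring
        _ ≤ B * (Z ω ^ 2 + ‖f t ω - f u.toNNReal ω‖ ^ 2) := by
            refine mul_le_mul_of_nonneg_left ?_ hB
            rw [← sq_abs (Z ω)]
            nlinarith [sq_nonneg (|Z ω| - ‖f t ω - f u.toNNReal ω‖), abs_nonneg (Z ω),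
              norm_nonneg (f t ω - f u.toNNReal ω)]
    have i2 : Integrable (fun ω => ‖f t ω - f u.toNNReal ω‖ ^ 2) P :=
      (hf.memLp_two hut).integrable_norm_pow (by norm_num)
    refine ⟨integral_inner_eq_zero (m' := 𝒢 u.toNNReal) ?_ ?_ ?_ (hf.indep _ t hut)
      (hf.mean _ t hut), ?_⟩
    · exact (hZ.mono (𝒢.mono hsu) le_rfl).smul (h.cont.measurable.comp (h.measurable _))
    · refine ((hZ2.integrable (by norm_num)).norm.mul_const B).mono'
        (hZm.smul (hbm _)).aestronglyMeasurable (Eventually.of_forall fun ω => ?_)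
      rw [norm_smul]
      exact mul_le_mul_of_nonneg_left (h.bound _) (norm_nonneg _)
    · exact (hf.memLp_two hut).integrable (by norm_num)
    · refine (integral_mono_of_nonneg (Eventually.of_forall fun ω => norm_nonneg _)
        ((hZ2.integrable_sq.add i2).const_mul B) (Eventually.of_forall hle)).trans ?_
      have e := integral_add hZ2.integrable_sq i2
      simp only [Pi.add_apply, integral_const_mul]
      rw [e, hf.var _ t hut]
      refine mul_le_mul_of_nonneg_left (add_le_add le_rfl (mul_le_mul_of_nonneg_right ?_ hθ)) hB
      have := u.toNNReal.coe_nonneg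
      linarith
  have hF : Integrable (Function.uncurry F) ((volume.restrict (Set.Ioc (s : ℝ) t)).prod P) := by
    rw [integrable_prod_iff hFm.aestronglyMeasurable]
    refine ⟨(ae_restrict_iff' measurableSet_Ioc).2 (Eventually.of_forall fun u hu =>
      (hint u hu).1.1), ?_⟩
    refine Integrable.of_bound (C := B * (∫ ω, Z ω ^ 2 ∂P + t * θ))
      hFm.norm.stronglyMeasurable.integral_prod_right'.aestronglyMeasurable
      ((ae_restrict_iff' measurableSet_Ioc).2 (Eventually.of_forall fun u hu => ?_))
    rw [Real.norm_of_nonneg (integral_nonneg fun ω => norm_nonneg _)]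
    exact (hint u hu).2
  have e : ∀ ω, Z ω * (∫ u in (s : ℝ)..t, ⟪b (X u.toNNReal ω), f t ω - f u.toNNReal ω⟫_ℝ) =
      ∫ u in Set.Ioc (s : ℝ) t, F u ω := by
    intro ω
    rw [intervalIntegral.integral_of_le hst', ← integral_const_mul]
    simp only [F, real_inner_smul_left]
  simp only [e]
  refine ⟨hF.integral_prod_right, ?_⟩
  rw [← integral_integral_swap hF]
  rw [setIntegral_congr_fun measurableSet_Ioc fun u hu => (hint u hu).1.2]
  simp

/-- The martingale property that Itô's formula would supply. By `energyIncr_eq` the increment has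
three parts: drift paired with later noise, the state at s paired with the increment, and the
centred square of the increment. Each is orthogonal to the past of s. -/
theorem integral_mul_energyIncr [IsProbabilityMeasure P]
    (h : IsBoundedSol 𝒢 b B A f X) (hf : IsNoise 𝒢 f θ c P) {s t : ℝ≥0} (hst : s ≤ t)
    {Z : Ω → ℝ} (hZ : Measurable[𝒢 s] Z) (hZ2 : MemLp Z 2 P) :
    ∫ ω, Z ω * energyIncr b X θ s t ω ∂P = 0 := by
  have := FiniteDimensional.complete ℝ E
  have := secondCountable_of_finiteDimensional E
  obtain ⟨i1, e1⟩ := integral_inner_drift_noise h hf hst hZ hZ2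
  obtain ⟨i2, e2⟩ := integral_inner_eq_zero (U := fun ω => Z ω • X s ω)
    (hZ.smul (h.measurable s)) (memLp_one_iff_integrable.1 (MemLp.smul (h.memLp hf s) hZ2))
    ((hf.memLp_two hst).integrable (by norm_num)) (hf.indep s t hst) (hf.mean s t hst)
  have i3 : Integrable (fun ω => ‖f t ω - f s ω‖ ^ 2) P :=
    (hf.memLp_two hst).integrable_norm_pow (by norm_num)
  obtain ⟨i4, e4⟩ := integral_inner_eq_zero (F := ℝ) (U := Z)
    (D := fun ω => ‖f t ω - f s ω‖ ^ 2 - ((t : ℝ) - s) * θ) hZ (hZ2.integrable (by norm_num))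
    (i3.sub (integrable_const _)) (indep_of_indep_of_le_left (hf.indep s t hst) (by
      have hg : Measurable fun x : E => ‖x‖ ^ 2 - ((t : ℝ) - s) * θ :=
        (measurable_norm.pow_const 2).sub measurable_const
      exact (hg.comp (comap_measurable _)).comap_le)) (by
      rw [integral_sub i3 (integrable_const _), hf.var s t hst]
      simp)
  have e : ∀ ω, Z ω * energyIncr b X θ s t ω =
      2 * (Z ω * ∫ u in (s : ℝ)..t, ⟪b (X u.toNNReal ω), f t ω - f u.toNNReal ω⟫_ℝ) +
        2 * ⟪Z ω • X s ω, f t ω - f s ω⟫_ℝ +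
        ⟪Z ω, ‖f t ω - f s ω‖ ^ 2 - ((t : ℝ) - s) * θ⟫_ℝ := by
    intro ω
    rw [energyIncr_eq h hf hst, real_inner_smul_left, RCLike.inner_apply, conj_trivial]
    ring
  simp only [e]
  have i12 : Integrable (fun ω =>
      2 * (Z ω * ∫ u in (s : ℝ)..t, ⟪b (X u.toNNReal ω), f t ω - f u.toNNReal ω⟫_ℝ) +
        2 * ⟪Z ω • X s ω, f t ω - f s ω⟫_ℝ) P := (i1.const_mul 2).add (i2.const_mul 2)
  rw [integral_add i12 i4, integral_add (i1.const_mul 2) (i2.const_mul 2), integral_const_mul,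
    integral_const_mul, e1, e2, e4]
  simp

/-- The mean energy of a solution grows at most linearly. -/
theorem integral_norm_sq_le [IsProbabilityMeasure P]
    (h : IsBoundedSol 𝒢 b B A f X) (hf : IsNoise 𝒢 f θ c P) (t : ℝ≥0) :
    ∫ ω, ‖X t ω‖ ^ 2 ∂P ≤ ∫ ω, ‖X 0 ω‖ ^ 2 ∂P + t * θ := by
  have h0 : ∫ ω, energyIncr b X θ 0 t ω ∂P = 0 := by
    have := integral_mul_energyIncr h hf (zero_le (a := t)) (Z := fun _ => 1) measurable_const
      (memLp_const 1)
    simpa using this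
  have i1 : Integrable (fun ω => ‖X t ω‖ ^ 2) P := (h.memLp hf t).integrable_norm_pow (by norm_num)
  have i2 : Integrable (fun ω => ‖X 0 ω‖ ^ 2) P := (h.memLp hf 0).integrable_norm_pow (by norm_num)
  have i3 := ((memLp_energyIncr h hf (zero_le (a := t))).1.integrable (by norm_num))
  have i4 : Integrable (fun ω => ‖X 0 ω‖ ^ 2 + t * θ) P := i2.add (integrable_const _)
  have hle : ∀ ω, ‖X t ω‖ ^ 2 ≤ ‖X 0 ω‖ ^ 2 + t * θ + energyIncr b X θ 0 t ω := by
    intro ω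
    have : ∫ u in ((0 : ℝ≥0) : ℝ)..t, ⟪X u.toNNReal ω, b (X u.toNNReal ω)⟫_ℝ ≤ 0 := by
      rw [NNReal.coe_zero]
      have := intervalIntegral.integral_nonneg (f := fun u : ℝ =>
        -⟪X u.toNNReal ω, b (X u.toNNReal ω)⟫_ℝ) (μ := volume) t.coe_nonneg
        fun u _ => neg_nonneg.2 (h.inner_nonpos _)
      rw [intervalIntegral.integral_neg] at this
      linarith
    rw [energyIncr]
    simp only [NNReal.coe_zero] at this ⊢
    linarith
  refine (integral_mono i1 (i4.add i3) hle).trans ?_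
  have e := integral_add i4 i3
  rw [integral_add i2 (integrable_const _), h0] at e
  simp only [integral_const, probReal_univ, one_smul, add_zero] at e
  exact e.le

end Orthogonality

/-! ### Moment bounds on uniform grids -/

section Grid

/-- The points of a uniform grid. -/
def grid (T : ℝ≥0) (n k : ℕ) : ℝ≥0 := k * (T / (n + 1))

theorem grid_zero (T : ℝ≥0) (n : ℕ) : grid T n 0 = 0 := by simp [grid]

theorem grid_last (T : ℝ≥0) (n : ℕ) : grid T n (n + 1) = T := by
  rw [grid]
  push_cast
  field_simp

theorem grid_mono (T : ℝ≥0) (n : ℕ) : Monotone (grid T n) := fun k l hkl =>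
  mul_le_mul_left (Nat.cast_le.2 hkl) _

theorem coe_grid_succ_sub (T : ℝ≥0) (n k : ℕ) :
    (grid T n (k + 1) : ℝ) - grid T n k = T / (n + 1) := by
  simp only [grid]
  push_cast
  ring

theorem grid_le {T : ℝ≥0} {n k : ℕ} (hk : k ≤ n + 1) : grid T n k ≤ T :=
  (grid_mono T n hk).trans (grid_last T n).le

/-- The supremum is attained at some s ≤ T, and the grid points with index ⌊(s/T)(n + 1)⌋ converge
to s. -/
theorem tendsto_sup_grid {h : ℝ≥0 → ℝ} (hh : Continuous h) (T : ℝ≥0) :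
    Tendsto (fun n : ℕ => (Finset.range (n + 2)).sup' Finset.nonempty_range_add_one
      fun k => h (grid T n k)) atTop (𝓝 (⨆ t : Set.Iic T, h t)) := by
  have hc : IsCompact (Set.Iic T) := by
    rw [← Set.Icc_bot]
    exact isCompact_Icc
  obtain ⟨s, hs, hmax⟩ := hc.exists_isMaxOn ⟨T, Set.mem_Iic.2 le_rfl⟩ hh.continuousOn
  have hmax' : ∀ t ≤ T, h t ≤ h s := fun t ht => hmax ht
  have hsup : (⨆ t : Set.Iic T, h t) = h s :=
    le_antisymm (ciSup_le fun t => hmax' t t.2)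
      (le_ciSup (f := fun t : Set.Iic T => h t) ⟨h s, by rintro _ ⟨t, rfl⟩; exact hmax' t t.2⟩
        ⟨s, hs⟩)
  rw [hsup]
  set a : ℝ := s / T with ha
  have ha0 : 0 ≤ a := by positivity
  have ha1 : a ≤ 1 := div_le_one_of_le₀ hs T.coe_nonneg
  have haT : a * T = s := by
    rcases eq_or_ne T 0 with rfl | hT
    · have : s = 0 := le_antisymm hs zero_le
      simp [this]
    · rw [ha, div_mul_cancel₀ _ (NNReal.coe_ne_zero.2 hT)]
  have hfl : Tendsto (fun n : ℕ => grid T n ⌊a * (n + 1 : ℕ)⌋₊) atTop (𝓝 s) := by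
    rw [← NNReal.tendsto_coe, ← haT]
    have h1 := ((tendsto_nat_floor_mul_div_atTop (R := ℝ) ha0).comp
      (tendsto_natCast_atTop_atTop.comp (tendsto_add_atTop_nat 1))).mul_const (T : ℝ)
    refine h1.congr fun n => ?_
    simp only [grid, Function.comp]
    push_cast
    ring
  refine tendsto_of_tendsto_of_tendsto_of_le_of_le ((hh.tendsto s).comp hfl) tendsto_const_nhds
    (fun n => ?_) fun n => ?_
  · refine Finset.le_sup' (fun k => h (grid T n k)) (Finset.mem_range.2 ?_)
    have : ⌊a * (n + 1 : ℕ)⌋₊ ≤ n + 1 := by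
      refine Nat.floor_le_of_le ?_
      exact mul_le_of_le_one_left (Nat.cast_nonneg _) ha1
    omega
  · exact Finset.sup'_le _ _ fun k hk => hmax' _ (grid_le (by
      have := Finset.mem_range.1 hk
      omega))

variable {E : Type*} [NormedAddCommGroup E] [InnerProductSpace ℝ E] [FiniteDimensional ℝ E]
  [MeasurableSpace E] [BorelSpace E]
  {Ω : Type*} {m : MeasurableSpace Ω} {P : Measure Ω} {𝒢 : Filtration ℝ≥0 m}
  {f : ℝ≥0 → Ω → E} {θ c : ℝ} {b : E → E} {B A : ℝ} {X : ℝ≥0 → Ω → E}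

/-- The filtration along a grid. -/
def gridFiltration (𝒢 : Filtration ℝ≥0 m) (T : ℝ≥0) (n : ℕ) : Filtration ℕ m where
  seq k := 𝒢 (grid T n k)
  mono' _ _ h := 𝒢.mono (grid_mono T n h)
  le' _ := 𝒢.le _

theorem isIncrement_energyIncr [IsProbabilityMeasure P] (h : IsBoundedSol 𝒢 b B A f X)
    (hf : IsNoise 𝒢 f θ c P) (T : ℝ≥0) (n : ℕ) :
    IsIncrement (gridFiltration 𝒢 T n)
      (fun k => energyIncr b X θ (grid T n k) (grid T n (k + 1))) P where
  memLp k := (memLp_energyIncr h hf (grid_mono T n k.le_succ)).1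
  measurable k := measurable_energyIncr h.cont (grid_mono T n k.le_succ)
    (fun u hu => (h.measurable u).mono (𝒢.mono hu) le_rfl) h.continuous
  orth k _ hZ hZ2 := integral_mul_energyIncr h hf (grid_mono T n k.le_succ) hZ hZ2

theorem sum_energyIncr (hb : Continuous b) (hX : ∀ ω, Continuous fun t => X t ω) (T : ℝ≥0)
    (n k : ℕ) (ω : Ω) :
    ∑ i ∈ Finset.range k, energyIncr b X θ (grid T n i) (grid T n (i + 1)) ω =
      energyIncr b X θ 0 (grid T n k) ω := by
  induction k with
  | zero => simp [grid_zero, energyIncr]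
  | succ k ih =>
    have c : Continuous fun u : ℝ => ⟪X u.toNNReal ω, b (X u.toNNReal ω)⟫_ℝ :=
      continuous_comp_toNNReal (b := fun x => ⟪x, b x⟫_ℝ) (continuous_id.inner hb) (hX ω)
    have := intervalIntegral.integral_add_adjacent_intervals (a := ((0 : ℝ≥0) : ℝ))
      (b := (grid T n k : ℝ)) (c := grid T n (k + 1))
      (μ := volume) (c.intervalIntegrable _ _) (c.intervalIntegrable _ _)
    rw [Finset.sum_range_succ, ih, energyIncr, energyIncr, energyIncr, ← this]
    ring

/-- The increments over the cells of a grid are orthogonal, so their second moments add up. The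
linear parts sum to 8θQT, while n + 1 quadratic parts of size (T/(n + 1))² tend to zero. The
limiting bound no longer contains B and A and hence holds for all truncations alike. -/
theorem integral_energyIncr_sq_le [IsProbabilityMeasure P] (h : IsBoundedSol 𝒢 b B A f X)
    (hf : IsNoise 𝒢 f θ c P) {Q : ℝ} {T : ℝ≥0} (hQ : ∫ ω, ‖X 0 ω‖ ^ 2 ∂P + T * θ ≤ Q) :
    ∫ ω, energyIncr b X θ 0 T ω ^ 2 ∂P ≤ 8 * θ * Q * T := by
  have hle : ∀ n : ℕ, ∫ ω, energyIncr b X θ 0 T ω ^ 2 ∂P ≤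
      8 * θ * Q * T + incrConst B A θ c Q T * T ^ 2 / ((n + 1 : ℕ) : ℝ) := by
    intro n
    have h1 := (isIncrement_energyIncr h hf T n).integral_sq (n + 1)
    simp only [sum_energyIncr h.cont h.continuous, grid_last] at h1
    rw [h1]
    have h2 : ∀ i ∈ Finset.range (n + 1),
        ∫ ω, energyIncr b X θ (grid T n i) (grid T n (i + 1)) ω ^ 2 ∂P ≤
          8 * θ * Q * (T / (n + 1)) + incrConst B A θ c Q T * (T / (n + 1)) ^ 2 := by
      intro i hi
      have hi' : i + 1 ≤ n + 1 := Finset.mem_range.1 hi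
      have hs : ∫ ω, ‖X (grid T n i) ω‖ ^ 2 ∂P ≤ Q :=
        (integral_norm_sq_le h hf _).trans (le_trans (add_le_add le_rfl
          (mul_le_mul_of_nonneg_right (NNReal.coe_le_coe.2 (grid_le (by omega)))
            hf.theta_nonneg)) hQ)
      have := (memLp_energyIncr h hf (grid_mono T n i.le_succ)).2 Q T hs
        (NNReal.coe_le_coe.2 (grid_le hi'))
      rwa [coe_grid_succ_sub] at this
    refine (Finset.sum_le_card_nsmul _ _ _ h2).trans (le_of_eq ?_)
    rw [Finset.card_range, nsmul_eq_mul]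
    push_cast
    field_simp
  have hlim : Tendsto (fun n : ℕ => 8 * θ * Q * T +
      incrConst B A θ c Q T * T ^ 2 / ((n + 1 : ℕ) : ℝ)) atTop (𝓝 (8 * θ * Q * T + 0)) :=
    tendsto_const_nhds.add ((tendsto_const_div_atTop_nhds_zero_nat _).comp
      (tendsto_add_atTop_nat 1))
  rw [add_zero] at hlim
  exact ge_of_tendsto' hlim hle

theorem integral_inner_nonpos (h : ∀ x, ⟪x, b x⟫_ℝ ≤ 0) (x : ℝ≥0 → E) (t : ℝ≥0) :
    ∫ u in (0 : ℝ)..t, ⟪x u.toNNReal, b (x u.toNNReal)⟫_ℝ ≤ 0 := by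
  have := intervalIntegral.integral_nonneg (f := fun u : ℝ =>
    -⟪x u.toNNReal, b (x u.toNNReal)⟫_ℝ) (μ := volume) t.coe_nonneg fun u _ => neg_nonneg.2 (h _)
  rw [intervalIntegral.integral_neg] at this
  linarith

theorem norm_sq_le_energyIncr (h : ∀ x, ⟪x, b x⟫_ℝ ≤ 0) (t : ℝ≥0) (ω : Ω) :
    ‖X t ω‖ ^ 2 ≤ ‖X 0 ω‖ ^ 2 + t * θ + energyIncr b X θ 0 t ω := by
  have := integral_inner_nonpos h (fun u => X u ω) t
  rw [energyIncr]
  simp only [NNReal.coe_zero]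
  linarith

/-- As ⟨x, b(x)⟩ ≤ 0, the squared norm is dominated by |X_0|² + tθ plus the martingale of the energy
increments, to which the maximal inequality applies. -/
theorem lintegral_sup_grid_le [IsProbabilityMeasure P] (h : IsBoundedSol 𝒢 b B A f X)
    (hf : IsNoise 𝒢 f θ c P) {Q : ℝ} {T : ℝ≥0} (hQ : ∫ ω, ‖X 0 ω‖ ^ 2 ∂P + T * θ ≤ Q) (n : ℕ) :
    ∫⁻ ω, ENNReal.ofReal ((Finset.range (n + 2)).sup' Finset.nonempty_range_add_one
      fun k => ‖X (grid T n k) ω‖ ^ 2) ∂P ≤ ENNReal.ofReal (7 * Q + 2) := by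
  have hθ := hf.theta_nonneg
  have h0 : 0 ≤ ∫ ω, ‖X 0 ω‖ ^ 2 ∂P := integral_nonneg fun ω => by positivity
  have hTθ : 0 ≤ T * θ := mul_nonneg T.coe_nonneg hθ
  have hQ0 : 0 ≤ Q := by linarith
  have hinc := isIncrement_energyIncr h hf T n
  have hsq : ∫ ω, (∑ i ∈ Finset.range (n + 1),
      energyIncr b X θ (grid T n i) (grid T n (i + 1)) ω) ^ 2 ∂P ≤ (3 * Q + 1) ^ 2 := by
    simp only [sum_energyIncr h.cont h.continuous, grid_last]
    refine (integral_energyIncr_sq_le h hf hQ).trans ?_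
    -- Thus 8θQT ≤ 8Q² ≤ (3Q + 1)². The summand 1 makes the radius positive even if Q = 0; doubling
    -- the radius and adding Q gives 7Q + 2.
    have : θ * T ≤ Q := by linarith
    nlinarith
  have hmax := hinc.lintegral_sup_le (n + 1) (by positivity) hsq
  simp only [sum_energyIncr h.cont h.continuous] at hmax
  have i0 : Integrable (fun ω => ‖X 0 ω‖ ^ 2) P := (h.memLp hf 0).integrable_norm_pow (by norm_num)
  have i1 : Integrable (fun ω => ‖X 0 ω‖ ^ 2 + T * θ) P := i0.add (integrable_const _)
  have hle : ∀ ω, ENNReal.ofReal ((Finset.range (n + 2)).sup' Finset.nonempty_range_add_one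
      fun k => ‖X (grid T n k) ω‖ ^ 2) ≤ ENNReal.ofReal (‖X 0 ω‖ ^ 2 + T * θ) +
        ENNReal.ofReal ((Finset.range (n + 1 + 1)).sup' Finset.nonempty_range_add_one
          fun k => |energyIncr b X θ 0 (grid T n k) ω|) := by
    intro ω
    refine le_trans (ENNReal.ofReal_le_ofReal (Finset.sup'_le _ _ fun k hk => ?_))
      ENNReal.ofReal_add_le
    have h2 := norm_sq_le_energyIncr (X := X) (θ := θ) h.inner_nonpos (grid T n k) ω
    have h3 : (grid T n k : ℝ) * θ ≤ T * θ := mul_le_mul_of_nonneg_right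
      (NNReal.coe_le_coe.2 (grid_le (by have := Finset.mem_range.1 hk; omega))) hθ
    have h4 := Finset.le_sup' (fun k => |energyIncr b X θ 0 (grid T n k) ω|) hk
    have h5 := le_abs_self (energyIncr b X θ 0 (grid T n k) ω)
    linarith
  refine (lintegral_mono hle).trans ?_
  rw [lintegral_add_left' i1.aestronglyMeasurable.aemeasurable.ennreal_ofReal]
  have e : ∫⁻ ω, ENNReal.ofReal (‖X 0 ω‖ ^ 2 + T * θ) ∂P =
      ENNReal.ofReal (∫ ω, ‖X 0 ω‖ ^ 2 ∂P + T * θ) := by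
    rw [← ofReal_integral_eq_lintegral_ofReal i1 (Eventually.of_forall fun ω => by positivity),
      integral_add i0 (integrable_const _)]
    simp
  rw [e]
  refine (add_le_add (ENNReal.ofReal_le_ofReal hQ) hmax).trans ?_
  rw [← ENNReal.ofReal_add hQ0 (by positivity)]
  exact ENNReal.ofReal_le_ofReal (by linarith)

end Grid

/-! ### The energy balance of dissipative equations -/

section EnergyBalance

/-- A bound in `L²` allows the passage to the limit in the mean. -/
theorem integrable_of_eventually_eq {Ω : Type*} {m : MeasurableSpace Ω} {P : Measure Ω}
    [IsProbabilityMeasure P] {Y : ℕ → Ω → ℝ} {Z : Ω → ℝ} (hY : ∀ n, MemLp (Y n) 2 P)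
    (h0 : ∀ n, ∫ ω, Y n ω ∂P = 0) {K : ℝ} (hK : ∀ n, ∫ ω, Y n ω ^ 2 ∂P ≤ K)
    (hev : ∀ ω, ∀ᶠ n in atTop, Y n ω = Z ω) : Integrable Z P ∧ ∫ ω, Z ω ∂P = 0 := by
  have hlim : ∀ᵐ ω ∂P, Tendsto (fun n => Y n ω) atTop (𝓝 (Z ω)) := Eventually.of_forall fun ω =>
    tendsto_const_nhds.congr' ((hev ω).mono fun n hn => hn.symm)
  have hZm : AEStronglyMeasurable Z P :=
    aestronglyMeasurable_of_tendsto_ae atTop (fun n => (hY n).1) hlim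
  have hZ : MemLp Z 2 P := by
    refine ⟨hZm, ?_⟩
    have h1 := Lp.eLpNorm_lim_le_liminf_eLpNorm (p := 2) (fun n => (hY n).1) Z hlim
    refine h1.trans_lt ?_
    have h2 : ∀ n, eLpNorm (Y n) 2 P ≤ ENNReal.ofReal (K ^ (2 : ℝ)⁻¹) := by
      intro n
      rw [(hY n).eLpNorm_eq_integral_rpow_norm two_ne_zero ENNReal.ofNat_ne_top]
      refine ENNReal.ofReal_le_ofReal ?_
      simp only [ENNReal.toReal_ofNat]
      refine Real.rpow_le_rpow (integral_nonneg fun ω => by positivity) ?_ (by norm_num)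
      refine le_trans (le_of_eq (integral_congr_ae (Eventually.of_forall fun ω => ?_))) (hK n)
      simp
    refine (liminf_le_of_frequently_le' (Frequently.of_forall h2)).trans_lt ENNReal.ofReal_lt_top
  have hZi : Integrable Z P := hZ.integrable (by norm_num)
  refine ⟨hZi, ?_⟩
  set M : ℝ := 2 * (∫ ω, Z ω ^ 2 ∂P) + 2 * K with hM
  set A : ℕ → Set Ω := fun n => {ω | Z ω - Y n ω ≠ 0} with hA
  have hAm : ∀ n, NullMeasurableSet (A n) P := fun n => by
    have := (hZm.sub (hY n).1).aemeasurable.nullMeasurable (measurableSet_singleton (0 : ℝ)).compl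
    exact this
  have hp : Tendsto (fun n => ∫ ω, (A n).indicator (fun _ => (1 : ℝ)) ω ∂P) atTop (𝓝 0) := by
    have := tendsto_integral_of_dominated_convergence (μ := P) (f := fun _ => (0 : ℝ))
      (F := fun n => (A n).indicator fun _ => (1 : ℝ)) (fun _ => 1)
      (fun n => (aestronglyMeasurable_const.indicator₀ (hAm n))) (integrable_const _)
      (fun n => Eventually.of_forall fun ω => by
        by_cases h : ω ∈ A n <;> simp [h])
      (Eventually.of_forall fun ω => tendsto_const_nhds.congr' ((hev ω).mono fun n hn => by
        have : ω ∉ A n := by simp [hA, hn]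
        simp [this]))
    simpa using this
  -- The second moment of Z − Y_n is at most M, and Z − Y_n vanishes off A n. From |a| ≤ δa² + δ⁻¹
  -- on A n one gets the bound δM + δ⁻¹P(A n); first n → ∞, then δ → 0.
  have key : ∀ δ : ℝ, 0 < δ → |∫ ω, Z ω ∂P| ≤ δ * M := by
    intro δ hδ
    have hle : ∀ n, |∫ ω, Z ω ∂P| ≤
        δ * M + δ⁻¹ * ∫ ω, (A n).indicator (fun _ => (1 : ℝ)) ω ∂P := by
      intro n
      have hYi : Integrable (Y n) P := (hY n).integrable (by norm_num)
      have e : ∫ ω, Z ω ∂P = ∫ ω, (Z ω - Y n ω) ∂P := by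
        rw [integral_sub hZi hYi, h0, sub_zero]
      have j1 := hZ.integrable_sq
      have j2 := (hY n).integrable_sq
      have j3 : Integrable ((A n).indicator fun _ => (1 : ℝ)) P :=
        (integrable_const (1 : ℝ)).indicator₀ (hAm n)
      have j4 : Integrable (fun ω => 2 * Z ω ^ 2 + 2 * Y n ω ^ 2) P :=
        (j1.const_mul 2).add (j2.const_mul 2)
      have hpt : ∀ ω, |Z ω - Y n ω| ≤ δ * (2 * Z ω ^ 2 + 2 * Y n ω ^ 2) +
          δ⁻¹ * (A n).indicator (fun _ => (1 : ℝ)) ω := by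
        intro ω
        by_cases h : ω ∈ A n
        · rw [Set.indicator_of_mem h, mul_one]
          have h1 : δ * δ⁻¹ = 1 := mul_inv_cancel₀ hδ.ne'
          have h2 : 0 < δ⁻¹ := inv_pos.2 hδ
          have h3 : |Z ω - Y n ω| ≤ δ * (Z ω - Y n ω) ^ 2 + δ⁻¹ := by
            rw [← sq_abs (Z ω - Y n ω)]
            nlinarith [mul_nonneg h2.le (sq_nonneg (δ * |Z ω - Y n ω| - 1)),
              abs_nonneg (Z ω - Y n ω)]
          have h4 : (Z ω - Y n ω) ^ 2 ≤ 2 * Z ω ^ 2 + 2 * Y n ω ^ 2 := by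
            nlinarith [sq_nonneg (Z ω + Y n ω)]
          linarith [mul_le_mul_of_nonneg_left h4 hδ.le]
        · rw [Set.indicator_of_notMem h, mul_zero, add_zero]
          have : Z ω - Y n ω = 0 := by simpa [hA] using h
          rw [this, abs_zero]
          positivity
      rw [e]
      refine (abs_integral_le_integral_abs).trans
        ((integral_mono (hZi.sub hYi).abs ((j4.const_mul δ).add (j3.const_mul δ⁻¹)) hpt).trans ?_)
      have e2 := integral_add (j4.const_mul δ) (j3.const_mul δ⁻¹)
      simp only [Pi.add_apply] at e2 ⊢
      rw [e2, integral_const_mul, integral_const_mul, integral_add (j1.const_mul 2) (j2.const_mul 2),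
        integral_const_mul, integral_const_mul]
      have := mul_le_mul_of_nonneg_left (hK n) hδ.le
      rw [hM]
      linarith
    have h1 : Tendsto (fun n => δ * M + δ⁻¹ * ∫ ω, (A n).indicator (fun _ => (1 : ℝ)) ω ∂P) atTop
        (𝓝 (δ * M + δ⁻¹ * 0)) := tendsto_const_nhds.add (hp.const_mul _)
    rw [mul_zero, add_zero] at h1
    exact ge_of_tendsto' h1 hle
  have h2 : Tendsto (fun δ : ℝ => δ * M) (𝓝[>] 0) (𝓝 0) := by
    have : Continuous fun δ : ℝ => δ * M := by fun_prop
    have := this.tendsto 0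
    rw [zero_mul] at this
    exact this.mono_left nhdsWithin_le_nhds
  have h3 : |∫ ω, Z ω ∂P| ≤ 0 := ge_of_tendsto h2 (by
    filter_upwards [self_mem_nhdsWithin] with δ hδ
    exact key δ hδ)
  exact abs_nonpos_iff.1 h3

variable {E : Type*} [NormedAddCommGroup E] [InnerProductSpace ℝ E] [FiniteDimensional ℝ E]
  [MeasurableSpace E] [BorelSpace E]
  {Ω : Type*} {m : MeasurableSpace Ω} {P : Measure Ω} {𝒢 : Filtration ℝ≥0 m}
  {f : ℝ≥0 → Ω → E} {θ c : ℝ} {b : E → E}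

/-- Truncation preserves the sign of ⟨x, b(x)⟩ and makes drift and energy production bounded.
Adaptedness follows because the Picard solution at time t depends on the path up to t only, so that
the path may be stopped. -/
theorem exists_isBoundedSol_trunc (hb : LipschitzOnBalls b) (hin : ∀ x, ⟪x, b x⟫_ℝ ≤ 0)
    (hf : IsNoise 𝒢 f θ c P) (R : ℕ) :
    ∃ B A, IsBoundedSol 𝒢 (trunc b R) B A f
      fun t ω => picardSol (trunc b R) (fun t => f t ω) t := by
  have := FiniteDimensional.complete ℝ E
  obtain ⟨K, B, hK, hB⟩ := exists_trunc_bounds hb (Nat.cast_nonneg (α := ℝ) R)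
  refine ⟨B, (R + 1) * B, ⟨fun t => ?_, fun ω T => isSolUpTo_picardSol hK hB (hf.continuous ω) T,
    hK.continuous, hB, fun x => ?_, fun x => ?_⟩⟩
  · exact measurable_of_stopped (m := 𝒢 t) (S := fun g => picardSol (trunc b R) g t)
      (fun g hg hgc => @measurable_picardSol E _ _ _ _ _ _ Ω (𝒢 t) _ _ _ hK hB g hg hgc t)
      (fun g g' hg hg' h => picardSol_eq hK hB hg
        ((isSolUpTo_picardSol hK hB hg' t).congr (fun _ _ => rfl) fun s hs => (h s hs).symm) le_rfl)
      (fun s hs => (hf.measurable s).mono (𝒢.mono hs) le_rfl) hf.continuous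
  · rcases le_total ‖x‖ (R + 1) with h | h
    · exact (abs_real_inner_le_norm _ _).trans
        (mul_le_mul h (hB x) (norm_nonneg _) (by positivity))
    · rw [trunc, cutoff_eq_zero h, zero_smul, inner_zero_right, abs_zero]
      positivity
  · rw [trunc, inner_smul_right]
    exact mul_nonpos_of_nonneg_of_nonpos (cutoff_nonneg _ _) (hin x)

theorem measurable_globalSol_filtration (hb : LipschitzOnBalls b) (hc : Coercive b)
    (hin : ∀ x, ⟪x, b x⟫_ℝ ≤ 0) (hf : IsNoise 𝒢 f θ c P) (t : ℝ≥0) :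
    Measurable[𝒢 t] fun ω => globalSol b (fun t => f t ω) t := by
  have := FiniteDimensional.complete ℝ E
  refine @measurable_of_tendsto_metrizable _ _ (𝒢 t) _ _ _ _
    (fun (R : ℕ) ω => picardSol (trunc b R) (fun t => f t ω) t) _ (fun R => ?_)
    (tendsto_pi_nhds.2 fun ω => tendsto_globalSol hb hc (hf.continuous ω) t)
  obtain ⟨B, A, h⟩ := exists_isBoundedSol_trunc hb hin hf R
  exact h.measurable t

theorem globalSol_zero {E : Type*} [NormedAddCommGroup E] [InnerProductSpace ℝ E]
    [FiniteDimensional ℝ E] {b : E → E} (hb : LipschitzOnBalls b) (hc : Coercive b) {f : ℝ≥0 → E}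
    (hf : Continuous f) : globalSol b f 0 = f 0 := by
  have := FiniteDimensional.complete ℝ E
  have := (isSolUpTo_globalSol hb hc hf 0).eqn 0 le_rfl
  simpa using this

theorem eventually_energyIncr_eq (hb : LipschitzOnBalls b) (hc : Coercive b)
    (hfc : ∀ ω, Continuous fun t => f t ω) (T : ℝ≥0) (ω : Ω) :
    ∀ᶠ R : ℕ in atTop, (∀ t ≤ T, picardSol (trunc b R) (fun t => f t ω) t =
        globalSol b (fun t => f t ω) t) ∧
      energyIncr (trunc b R) (fun t ω => picardSol (trunc b R) (fun t => f t ω) t) θ 0 T ω =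
        energyIncr b (fun t ω => globalSol b (fun t => f t ω) t) θ 0 T ω := by
  have := FiniteDimensional.complete ℝ E
  obtain ⟨R₀, h⟩ := exists_globalSol_eq hb hc (hfc ω) T
  obtain ⟨ρ, hρ0, hρ⟩ := exists_norm_le_Iic (isSolUpTo_globalSol hb hc (hfc ω) T).continuous T
  obtain ⟨R₁, hR₁⟩ := exists_nat_ge ρ
  filter_upwards [eventually_ge_atTop R₀, eventually_ge_atTop R₁] with R h0 h1
  have e : ∀ t ≤ T, picardSol (trunc b R) (fun t => f t ω) t = globalSol b (fun t => f t ω) t :=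
    fun t ht => ((h R h0).2 t ht).symm
  refine ⟨e, ?_⟩
  rw [energyIncr, energyIncr, e T le_rfl, e 0 zero_le]
  congr 3
  refine intervalIntegral.integral_congr fun u hu => ?_
  rw [Set.uIcc_of_le (NNReal.coe_le_coe.2 zero_le)] at hu
  have hu' : u.toNNReal ≤ T := Real.toNNReal_le_iff_le_coe.2 hu.2
  simp only [e _ hu']
  rw [trunc_eq ((hρ _ hu').trans (hR₁.trans (Nat.cast_le.2 h1)))]

variable [IsProbabilityMeasure P]

/-- For each path the truncated energy increment is eventually equal to the untruncated one, and its
second moments are bounded uniformly in the truncation level; so the zero mean survives the limit.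
-/
theorem integral_energyIncr_globalSol (hb : LipschitzOnBalls b) (hc : Coercive b)
    (hin : ∀ x, ⟪x, b x⟫_ℝ ≤ 0) (hf : IsNoise 𝒢 f θ c P) (T : ℝ≥0) :
    Integrable (energyIncr b (fun t ω => globalSol b (fun t => f t ω) t) θ 0 T) P ∧
      ∫ ω, energyIncr b (fun t ω => globalSol b (fun t => f t ω) t) θ 0 T ω ∂P = 0 := by
  have := FiniteDimensional.complete ℝ E
  have hR := exists_isBoundedSol_trunc hb hin hf
  refine integrable_of_eventually_eq (Y := fun R : ℕ => energyIncr (trunc b R)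
    (fun t ω => picardSol (trunc b R) (fun t => f t ω) t) θ 0 T)
    (K := 8 * θ * (∫ ω, ‖f 0 ω‖ ^ 2 ∂P + T * θ) * T) (fun R => ?_) (fun R => ?_) (fun R => ?_)
    fun ω => (eventually_energyIncr_eq hb hc hf.continuous T ω).mono fun R h => h.2
  all_goals obtain ⟨B, A, h⟩ := hR R
  · exact (memLp_energyIncr h hf zero_le).1
  · simpa using integral_mul_energyIncr h hf (zero_le (a := T)) (Z := fun _ => 1) measurable_const
      (memLp_const 1)
  · refine integral_energyIncr_sq_le h hf (le_of_eq ?_)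
    congr 1
    refine integral_congr_ae (Eventually.of_forall fun ω => ?_)
    simp only [(h.sol ω 0).eqn 0 le_rfl]
    simp

/-- A rearrangement of the zero mean of the energy increment. The squared norm and the dissipation
are both nonnegative and have an integrable weighted sum, so each is integrable and the identity can
be split. -/
theorem energy_globalSol (hb : LipschitzOnBalls b) (hc : Coercive b)
    (hin : ∀ x, ⟪x, b x⟫_ℝ ≤ 0) (hf : IsNoise 𝒢 f θ c P) (T : ℝ≥0) :
    Integrable (fun ω => ‖globalSol b (fun t => f t ω) T‖ ^ 2) P ∧
    Integrable (fun ω => ∫ u in (0 : ℝ)..T, -⟪globalSol b (fun t => f t ω) u.toNNReal,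
      b (globalSol b (fun t => f t ω) u.toNNReal)⟫_ℝ) P ∧
    ∫ ω, ‖globalSol b (fun t => f t ω) T‖ ^ 2 ∂P +
      2 * ∫ ω, (∫ u in (0 : ℝ)..T, -⟪globalSol b (fun t => f t ω) u.toNNReal,
        b (globalSol b (fun t => f t ω) u.toNNReal)⟫_ℝ) ∂P =
      ∫ ω, ‖f 0 ω‖ ^ 2 ∂P + T * θ := by
  have := FiniteDimensional.complete ℝ E
  have := secondCountable_of_finiteDimensional E
  set X : ℝ≥0 → Ω → E := fun t ω => globalSol b (fun t => f t ω) t with hX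
  obtain ⟨i1, e1⟩ := integral_energyIncr_globalSol hb hc hin hf T
  have i0 : Integrable (fun ω => ‖f 0 ω‖ ^ 2) P := hf.init.integrable_norm_pow (by norm_num)
  set D : Ω → ℝ := fun ω => ∫ u in (0 : ℝ)..T, -⟪X u.toNNReal ω, b (X u.toNNReal ω)⟫_ℝ with hD
  have hXm : ∀ t, Measurable (X t) := fun t =>
    (measurable_globalSol_filtration hb hc hin hf t).mono (𝒢.le t) le_rfl
  have hXc : ∀ ω, Continuous fun t => X t ω := fun ω =>
    (isSolUpTo_globalSol hb hc (hf.continuous ω) T).continuous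
  have hDm : Measurable D := measurable_integral_path (b := fun x => -⟪x, b x⟫_ℝ) hXm hXc
    (continuous_id.inner hb.continuous).neg _ _
  have hsum : ∀ ω, ‖X T ω‖ ^ 2 + 2 * D ω = energyIncr b X θ 0 T ω + ‖f 0 ω‖ ^ 2 + T * θ := by
    intro ω
    have h0 : X 0 ω = f 0 ω := globalSol_zero hb hc (hf.continuous ω)
    rw [energyIncr, h0, hD]
    simp only [intervalIntegral.integral_neg, NNReal.coe_zero, sub_zero]
    ring
  have hD0 : ∀ ω, 0 ≤ D ω := fun ω =>
    intervalIntegral.integral_nonneg T.coe_nonneg fun u _ => neg_nonneg.2 (hin _)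
  have i2 : Integrable (fun ω => ‖X T ω‖ ^ 2 + 2 * D ω) P := by
    simp only [hsum]
    exact (i1.add i0).add (integrable_const _)
  have i3 : Integrable (fun ω => ‖X T ω‖ ^ 2) P :=
    i2.mono ((hXm T).norm.pow_const 2).aestronglyMeasurable (Eventually.of_forall fun ω => by
      have := hD0 ω
      rw [Real.norm_of_nonneg (by positivity), Real.norm_of_nonneg (by positivity)]
      linarith)
  have i4 : Integrable D P :=
    i2.mono hDm.aestronglyMeasurable (Eventually.of_forall fun ω => by
      have h1 := hD0 ω
      have h2 : 0 ≤ ‖X T ω‖ ^ 2 := by positivity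
      rw [Real.norm_of_nonneg h1, Real.norm_of_nonneg (by positivity)]
      linarith)
  refine ⟨i3, i4, ?_⟩
  rw [← integral_const_mul, ← integral_add i3 (i4.const_mul 2)]
  simp only [hsum]
  have i5 : Integrable (fun ω => energyIncr b X θ 0 T ω + ‖f 0 ω‖ ^ 2) P := i1.add i0
  rw [integral_add i5 (integrable_const _), integral_add i1 i0, e1]
  simp

/-- Fatou's lemma twice: on a fixed grid along the truncation level, where the values eventually
agree, and then along refining grids, whose maxima converge to the supremum over [0, T]. -/
theorem integral_iSup_globalSol_le (hb : LipschitzOnBalls b) (hc : Coercive b)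
    (hin : ∀ x, ⟪x, b x⟫_ℝ ≤ 0) (hf : IsNoise 𝒢 f θ c P) (T : ℝ≥0) :
    Integrable (fun ω => ⨆ t : Set.Iic T, ‖globalSol b (fun t => f t ω) t‖ ^ 2) P ∧
    ∫ ω, (⨆ t : Set.Iic T, ‖globalSol b (fun t => f t ω) t‖ ^ 2) ∂P ≤
      7 * (∫ ω, ‖f 0 ω‖ ^ 2 ∂P + T * θ) + 2 := by
  have := FiniteDimensional.complete ℝ E
  have := secondCountable_of_finiteDimensional E
  set X : ℝ≥0 → Ω → E := fun t ω => globalSol b (fun t => f t ω) t with hX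
  set Q : ℝ := ∫ ω, ‖f 0 ω‖ ^ 2 ∂P + T * θ with hQ
  have hQ0 : 0 ≤ Q := add_nonneg (integral_nonneg fun ω => by positivity)
    (mul_nonneg T.coe_nonneg hf.theta_nonneg)
  have hXm : ∀ t, Measurable (X t) := fun t =>
    (measurable_globalSol_filtration hb hc hin hf t).mono (𝒢.le t) le_rfl
  have hXc : ∀ ω, Continuous fun t => X t ω := fun ω =>
    (isSolUpTo_globalSol hb hc (hf.continuous ω) T).continuous
  set g : (ℝ≥0 → Ω → E) → ℕ → Ω → ℝ := fun Y n ω =>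
    (Finset.range (n + 2)).sup' Finset.nonempty_range_add_one fun k => ‖Y (grid T n k) ω‖ ^ 2 with hg
  have hgm : ∀ Y : ℝ≥0 → Ω → E, (∀ t, Measurable (Y t)) → ∀ n, Measurable (g Y n) := by
    intro Y hY n
    have := Finset.measurable_sup' (f := fun k ω => ‖Y (grid T n k) ω‖ ^ 2)
      (Finset.nonempty_range_add_one (n := n + 1)) fun k _ => (hY (grid T n k)).norm.pow_const 2
    convert this using 1
    funext ω
    rw [Finset.sup'_apply]
  have h1 : ∀ n, ∫⁻ ω, ENNReal.ofReal (g X n ω) ∂P ≤ ENNReal.ofReal (7 * Q + 2) := by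
    intro n
    set Y : ℕ → ℝ≥0 → Ω → E := fun R t ω => picardSol (trunc b R) (fun t => f t ω) t with hY
    have hYm : ∀ R t, Measurable (Y R t) := fun R t => by
      obtain ⟨B, A, h⟩ := exists_isBoundedSol_trunc hb hin hf R
      exact (h.measurable t).mono (𝒢.le t) le_rfl
    have hle : ∀ R, ∫⁻ ω, ENNReal.ofReal (g (Y R) n ω) ∂P ≤ ENNReal.ofReal (7 * Q + 2) := by
      intro R
      obtain ⟨B, A, h⟩ := exists_isBoundedSol_trunc hb hin hf R
      refine lintegral_sup_grid_le h hf (le_of_eq ?_) n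
      rw [hQ]
      congr 1
      refine integral_congr_ae (Eventually.of_forall fun ω => ?_)
      simp only [(h.sol ω 0).eqn 0 le_rfl]
      simp
    have hev : ∀ ω, ENNReal.ofReal (g X n ω) ≤
        liminf (fun R => ENNReal.ofReal (g (Y R) n ω)) atTop := by
      intro ω
      have hl : Tendsto (fun R => ENNReal.ofReal (g (Y R) n ω)) atTop
          (𝓝 (ENNReal.ofReal (g X n ω))) := by
        refine tendsto_const_nhds.congr' ?_
        filter_upwards [eventually_energyIncr_eq (θ := θ) hb hc hf.continuous T ω] with R hR
        congr 1
        refine Finset.sup'_congr _ rfl fun k hk => ?_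
        have := hR.1 (grid T n k) (grid_le (by have := Finset.mem_range.1 hk; omega))
        simp only [hX, hY, this]
      exact hl.liminf_eq.ge
    refine (lintegral_mono hev).trans ((lintegral_liminf_le fun R =>
      (hgm (Y R) (hYm R) n).ennreal_ofReal).trans ?_)
    exact liminf_le_of_frequently_le' (Frequently.of_forall hle)
  have hlim : ∀ ω, Tendsto (fun n => g X n ω) atTop (𝓝 (⨆ t : Set.Iic T, ‖X t ω‖ ^ 2)) :=
    fun ω => tendsto_sup_grid (h := fun t => ‖X t ω‖ ^ 2) ((hXc ω).norm.pow 2) T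
  have hsm : Measurable fun ω => ⨆ t : Set.Iic T, ‖X t ω‖ ^ 2 :=
    measurable_of_tendsto_metrizable (hgm X hXm) (tendsto_pi_nhds.2 hlim)
  have hs0 : ∀ ω, 0 ≤ ⨆ t : Set.Iic T, ‖X t ω‖ ^ 2 := fun ω =>
    Real.iSup_nonneg fun t => by positivity
  have h2 : ∫⁻ ω, ENNReal.ofReal (⨆ t : Set.Iic T, ‖X t ω‖ ^ 2) ∂P ≤ ENNReal.ofReal (7 * Q + 2) := by
    refine (lintegral_mono fun ω =>
      ((ENNReal.continuous_ofReal.tendsto _).comp (hlim ω)).liminf_eq.ge).trans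
      ((lintegral_liminf_le fun n => (hgm X hXm n).ennreal_ofReal).trans ?_)
    exact liminf_le_of_frequently_le' (Frequently.of_forall h1)
  have hi : Integrable (fun ω => ⨆ t : Set.Iic T, ‖X t ω‖ ^ 2) P :=
    ⟨hsm.aestronglyMeasurable, (hasFiniteIntegral_iff_ofReal (Eventually.of_forall hs0)).2
      (h2.trans_lt ENNReal.ofReal_lt_top)⟩
  refine ⟨hi, ?_⟩
  rw [← ofReal_integral_eq_lintegral_ofReal hi (Eventually.of_forall hs0)] at h2
  exact (ENNReal.ofReal_le_ofReal_iff (by positivity)).1 h2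

end EnergyBalance

/-! ### Traces of compressions -/

section Trace

variable {H : Type*} [NormedAddCommGroup H] [InnerProductSpace ℝ H] [CompleteSpace H]

open scoped MatrixOrder in
theorem exists_factor_of_posSemidef {ι : Type*} [Fintype ι] {G : Matrix ι ι ℝ}
    (hG : G.PosSemidef) : ∃ B : Matrix ι ι ℝ, ∀ i j, G i j = ∑ l, B l i * B l j := by
  classical
  obtain ⟨B, hB⟩ := CStarAlgebra.nonneg_iff_eq_star_mul_self.mp hG.nonneg
  refine ⟨B, fun i j => ?_⟩
  rw [hB, Matrix.mul_apply]
  simp [Matrix.star_apply]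

/-- The diagonal of a nonnegative form on an orthonormal family is dominated by the diagonal on any
family through which the orthonormal one is expanded. -/
theorem sum_compression_le {N : Type*} [Fintype N] {v : N → H} (hv : Orthonormal ℝ v) {Γ : H →L[ℝ] H}
    (hs : IsSelfAdjoint Γ) (h0 : ∀ x, 0 ≤ ⟪x, Γ x⟫_ℝ) {ι : Type*} [Fintype ι] {e : ι → H}
    (he : Orthonormal ℝ e) :
    ∑ k, ⟪∑ i, ⟪e i, v k⟫_ℝ • e i, Γ (∑ i, ⟪e i, v k⟫_ℝ • e i)⟫_ℝ ≤ ∑ i, ⟪e i, Γ (e i)⟫_ℝ := by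
  classical
  have hsym : ∀ x y, ⟪Γ x, y⟫_ℝ = ⟪x, Γ y⟫_ℝ :=
    (ContinuousLinearMap.isSelfAdjoint_iff_isSymmetric.1 hs)
  set G : Matrix ι ι ℝ := Matrix.of fun i j => ⟪e i, Γ (e j)⟫_ℝ with hG
  have hquad : ∀ x : ι → ℝ, ⟪∑ i, x i • e i, Γ (∑ i, x i • e i)⟫_ℝ =
      ∑ i, ∑ j, x i * x j * G i j := by
    intro x
    simp only [map_sum, map_smul, sum_inner, inner_sum, real_inner_smul_left,
      real_inner_smul_right, hG, Matrix.of_apply]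
    rw [Finset.sum_comm]
    exact Finset.sum_congr rfl fun i _ => Finset.sum_congr rfl fun j _ => by ring
  have hpos : G.PosSemidef := by
    refine Matrix.PosSemidef.of_dotProduct_mulVec_nonneg ?_ fun x => ?_
    · ext i j
      simp only [hG, Matrix.conjTranspose_apply, Matrix.of_apply, star_trivial]
      rw [← hsym, real_inner_comm]
    · have := hquad x ▸ h0 (∑ i, x i • e i)
      refine this.trans_eq ?_
      simp only [dotProduct, Matrix.mulVec, Pi.star_apply, star_trivial, Finset.mul_sum]
      exact Finset.sum_congr rfl fun i _ => Finset.sum_congr rfl fun j _ => by ring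
  obtain ⟨B, hGB⟩ := exists_factor_of_posSemidef hpos
  have hsq : ∀ x : ι → ℝ, ∑ i, ∑ j, x i * x j * G i j = ∑ l, (∑ i, x i * B l i) ^ 2 := by
    intro x
    simp only [sq (Finset.sum _ _), Finset.sum_mul_sum]
    rw [Finset.sum_comm]
    conv_rhs => rw [Finset.sum_comm]
    rw [Finset.sum_comm]
    refine Finset.sum_congr rfl fun i _ => ?_
    rw [Finset.sum_comm]
    refine Finset.sum_congr rfl fun j _ => ?_
    rw [hGB, Finset.mul_sum]
    exact Finset.sum_congr rfl fun l _ => by ring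
  simp only [hquad, hsq]
  rw [Finset.sum_comm]
  have hdiag : ∑ i, ⟪e i, Γ (e i)⟫_ℝ = ∑ l, ∑ i, B l i ^ 2 := by
    rw [Finset.sum_comm]
    refine Finset.sum_congr rfl fun i _ => ?_
    have := hGB i i
    simp only [hG, Matrix.of_apply] at this
    rw [this]
    exact Finset.sum_congr rfl fun l _ => by ring
  rw [hdiag]
  refine Finset.sum_le_sum fun l _ => ?_
  -- With the Gram matrix factored as BᵀB, the l-th row of B defines a vector, and the sum over k of
  -- the squares of its inner products with v_k is at most its squared norm, by Bessel's inequality.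
  have h1 := hv.sum_inner_products_le (s := Finset.univ) (x := ∑ i, B l i • e i)
  have h2 : ‖∑ i, B l i • e i‖ ^ 2 = ∑ i, B l i ^ 2 := by
    rw [← real_inner_self_eq_norm_sq, he.inner_sum]
    simp [sq]
  rw [← h2]
  refine le_trans (le_of_eq (Finset.sum_congr rfl fun k _ => ?_)) h1
  rw [Real.norm_eq_abs, sq_abs]
  congr 1
  rw [inner_sum]
  refine Finset.sum_congr rfl fun i _ => ?_
  rw [real_inner_smul_right, real_inner_comm (e i), mul_comm]

theorem exists_basisSet : ∃ b : HilbertBasis (basisSet H) ℝ H, ⇑b = ((↑) : basisSet H → H) :=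
  (exists_hilbertBasis ℝ H).choose_spec

/-- The trace of a nonnegative operator dominates the partial traces. -/
theorem sum_inner_le_hilbertTrace {N : Type*} [Fintype N] {v : N → H} (hv : Orthonormal ℝ v)
    {Γ : H →L[ℝ] H} (hΓ : IsCovarianceOp Γ) : ∑ k, ⟪v k, Γ (v k)⟫_ℝ ≤ hilbertTrace Γ := by
  classical
  obtain ⟨b, hb⟩ := exists_basisSet (H := H)
  -- Each v_k is approximated by its partial expansions in the Hilbert basis. For every finite set
  -- of basis vectors the compression bound holds with a partial sum of the trace on the right.
  have hlim : ∀ k, Tendsto (fun F : Finset (basisSet H) => ∑ i ∈ F, ⟪b i, v k⟫_ℝ • b i) atTop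
      (𝓝 (v k)) := by
    intro k
    have := b.hasSum_repr (v k)
    simp only [HilbertBasis.repr_apply_apply] at this
    exact this
  have hlim2 : Tendsto (fun F : Finset (basisSet H) =>
      ∑ k, ⟪∑ i ∈ F, ⟪b i, v k⟫_ℝ • b i, Γ (∑ i ∈ F, ⟪b i, v k⟫_ℝ • b i)⟫_ℝ) atTop
      (𝓝 (∑ k, ⟪v k, Γ (v k)⟫_ℝ)) :=
    tendsto_finsetSum _ fun k _ => (hlim k).inner ((Γ.continuous.tendsto _).comp (hlim k))
  refine le_of_tendsto' hlim2 fun F => ?_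
  have h1 := sum_compression_le hv hΓ.isSelfAdjoint hΓ.nonneg (ι := F) (e := fun i => b i)
    (b.orthonormal.comp _ Subtype.val_injective)
  have h2 : ∀ k, ∑ i : F, ⟪b i, v k⟫_ℝ • b i = ∑ i ∈ F, ⟪b i, v k⟫_ℝ • b i := fun k =>
    Finset.sum_coe_sort F fun i => ⟪b i, v k⟫_ℝ • b i
  have h3 : ∑ i : F, ⟪b i, Γ (b i)⟫_ℝ = ∑ i ∈ F, ⟪b i, Γ (b i)⟫_ℝ :=
    Finset.sum_coe_sort F fun i => ⟪b i, Γ (b i)⟫_ℝ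
  simp only [h2, h3] at h1
  refine h1.trans ?_
  rw [hilbertTrace]
  simp only [hb]
  exact hΓ.traceClass.sum_le_tsum F fun i _ => hΓ.nonneg _

theorem hilbertTrace_nonneg {Γ : H →L[ℝ] H} (hΓ : IsCovarianceOp Γ) : 0 ≤ hilbertTrace Γ :=
  tsum_nonneg fun _ => hΓ.nonneg _

/-- The trace of the composition with an orthogonal projection of finite rank. -/
theorem hilbertTrace_comp_eq {N : Type*} [Fintype N] {v : N → H} (Γ : H →L[ℝ] H) {Q : H →L[ℝ] H}
    (hQ : ∀ x, Q x = ∑ k, ⟪v k, x⟫_ℝ • v k) :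
    hilbertTrace (Γ ∘L Q) = ∑ k, ⟪v k, Γ (v k)⟫_ℝ := by
  obtain ⟨b, hb⟩ := exists_basisSet (H := H)
  -- Parseval's identity for the pairs v_k, Γ v_k in the Hilbert basis that defines the trace.
  have h := hasSum_sum (s := Finset.univ) fun k (_ : k ∈ Finset.univ) =>
    b.hasSum_inner_mul_inner (v k) (Γ (v k))
  rw [hilbertTrace, ← h.tsum_eq]
  refine tsum_congr fun i => ?_
  rw [← hb]
  simp only [ContinuousLinearMap.comp_apply, hQ, map_sum, map_smul, inner_sum,
    real_inner_smul_right]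

end Trace

/-! ### Finite-dimensional projections of Brownian motion -/

section BrownianMotion

theorem sup_eq_generateFrom_inter {Ω : Type*} (m₁ m₂ : MeasurableSpace Ω) :
    m₁ ⊔ m₂ = MeasurableSpace.generateFrom
      {S | ∃ A B, MeasurableSet[m₁] A ∧ MeasurableSet[m₂] B ∧ A ∩ B = S} := by
  refine le_antisymm (sup_le (fun A hA => ?_) fun B hB => ?_)
    (MeasurableSpace.generateFrom_le ?_)
  · exact MeasurableSpace.measurableSet_generateFrom
      ⟨A, Set.univ, hA, MeasurableSet.univ, Set.inter_univ A⟩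
  · exact MeasurableSpace.measurableSet_generateFrom
      ⟨Set.univ, B, MeasurableSet.univ, hB, Set.univ_inter B⟩
  · rintro S ⟨A, B, hA, hB, rfl⟩
    exact MeasurableSet.inter ((le_sup_left : m₁ ≤ m₁ ⊔ m₂) A hA)
      ((le_sup_right : m₂ ≤ m₁ ⊔ m₂) B hB)

/-- If `m₁` is independent of `m₂`, and `m₃` is independent of `m₁ ⊔ m₂`, then `m₁` is independent
of `m₃ ⊔ m₂`. -/
theorem indep_sup_of_indep {Ω : Type*} {m : MeasurableSpace Ω} {P : Measure Ω}
    [IsProbabilityMeasure P] {m₁ m₂ m₃ m₄ : MeasurableSpace Ω} (h₁ : m₁ ≤ m₄) (h₂ : m₂ ≤ m₄)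
    (h₃ : m₃ ≤ m) (h₄ : m₄ ≤ m) (h₁₂ : Indep m₁ m₂ P) (h₃₄ : Indep m₃ m₄ P) :
    Indep m₁ (m₃ ⊔ m₂) P := by
  refine IndepSets.indep (h₁.trans h₄) (sup_le h₃ (h₂.trans h₄))
    (@MeasurableSpace.isPiSystem_measurableSet Ω m₁) ?_
    (@MeasurableSpace.generateFrom_measurableSet Ω m₁).symm (sup_eq_generateFrom_inter m₃ m₂) ?_
  · rintro _ ⟨A, B, hA, hB, rfl⟩ _ ⟨A', B', hA', hB', rfl⟩ -
    exact ⟨A ∩ A', B ∩ B', hA.inter hA', hB.inter hB', Set.inter_inter_inter_comm A A' B B'⟩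
  · rw [IndepSets_iff]
    rintro S _ hS ⟨A, B, hA, hB, rfl⟩
    rw [Indep_iff] at h₁₂ h₃₄
    rw [Set.inter_left_comm, h₃₄ A (S ∩ B) hA (MeasurableSet.inter (h₁ S hS) (h₂ B hB)),
      h₁₂ S B hS hB, h₃₄ A B hA (h₂ B hB)]
    ring

variable {H : Type*} [NormedAddCommGroup H] [InnerProductSpace ℝ H] [CompleteSpace H]
  [MeasurableSpace H] [BorelSpace H] {Ω : Type*} [MeasurableSpace Ω] {P : Measure Ω}
  [IsProbabilityMeasure P] {Γ : H →L[ℝ] H} {W : ℝ≥0 → Ω → H}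

theorem IsHilbertBM.measurable_inner (hW : IsHilbertBM Γ W P) (φ : H) (s t : ℝ≥0) :
    Measurable fun ω => ⟪φ, W t ω - W s ω⟫_ℝ := by
  have h : ∀ t, Measurable fun ω => ⟪φ, W t ω⟫_ℝ := fun t =>
    (continuous_const.inner continuous_id : Continuous fun x : H => ⟪φ, x⟫_ℝ).measurable.comp
      (hW.measurable t)
  simp only [inner_sub_right]
  exact (h t).sub (h s)

theorem IsHilbertBM.setIntegral_exp (hW : IsHilbertBM Γ W P) (φ : H) {s t : ℝ≥0} (hst : s ≤ t)
    {A : Set Ω} (hA : MeasurableSet[⨆ u : Set.Iic s, MeasurableSpace.comap (W u) inferInstance] A) :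
    ∫ ω in A, Complex.exp (Complex.I * ((⟪φ, W t ω - W s ω⟫_ℝ : ℝ) : ℂ)) ∂P =
      (P.real A : ℂ) * Complex.exp ((-(((t : ℝ) - s) / 2 * ⟪φ, Γ φ⟫_ℝ) : ℝ) : ℂ) := by
  rcases hst.eq_or_lt with rfl | hst
  · simp
  have hm : (⨆ u : Set.Iic s, MeasurableSpace.comap (W u) inferInstance) ≤ ‹MeasurableSpace Ω› :=
    iSup_le fun u => (hW.measurable u).comap_le
  have hi : Integrable (fun ω => Complex.exp (Complex.I * ((⟪φ, W t ω - W s ω⟫_ℝ : ℝ) : ℂ))) P := by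
    refine Integrable.of_bound (C := 1) ?_ (Eventually.of_forall fun ω => ?_)
    · exact (Complex.measurable_exp.comp ((Complex.measurable_ofReal.comp
        (hW.measurable_inner φ s t)).const_mul _)).aestronglyMeasurable
    · rw [mul_comm, Complex.norm_exp_ofReal_mul_I]
  rw [← setIntegral_condExp hm hi hA, setIntegral_congr_ae (hm A hA)
    ((hW.condChar φ s t hst).mono fun ω h _ => h), setIntegral_const]
  simp

/-- The characteristic function at r is the defining identity of W for the vector rφ. -/
theorem IsHilbertBM.map_inner (hΓ : ∀ v : H, 0 ≤ ⟪v, Γ v⟫_ℝ) (hW : IsHilbertBM Γ W P) (φ : H)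
    {s t : ℝ≥0} (hst : s ≤ t) :
    P.map (fun ω => ⟪φ, W t ω - W s ω⟫_ℝ) =
      gaussianReal 0 (((t : ℝ) - s) * ⟪φ, Γ φ⟫_ℝ).toNNReal := by
  have hm := hW.measurable_inner φ s t
  have := Measure.isProbabilityMeasure_map (μ := P) hm.aemeasurable
  refine Measure.ext_of_charFun ?_
  funext r
  have h := hW.setIntegral_exp (r • φ) hst (A := Set.univ) MeasurableSet.univ
  have h0 : 0 ≤ ((t : ℝ) - s) * ⟪φ, Γ φ⟫_ℝ :=
    mul_nonneg (sub_nonneg.2 (NNReal.coe_le_coe.2 hst)) (hΓ φ)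
  rw [charFun_gaussianReal, charFun_apply_real, integral_map hm.aemeasurable (by fun_prop),
    Real.coe_toNNReal _ h0]
  rw [Measure.restrict_univ] at h
  convert h using 1
  · refine integral_congr_ae (Eventually.of_forall fun ω => ?_)
    simp only [real_inner_smul_left]
    push_cast
    ring_nf
  · rw [real_inner_smul_left, map_smul, real_inner_smul_right]
    rw [probReal_univ]
    push_cast
    ring_nf

variable {E : Type*} [NormedAddCommGroup E] [InnerProductSpace ℝ E] [FiniteDimensional ℝ E]
  [MeasurableSpace E] [BorelSpace E] {L : H →L[ℝ] E} {ι : E → H}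

/-- For an event A of the past, the law of the increment restricted to A and P(A) times its law are
finite measures with the same characteristic function, hence equal. This is independence. -/
theorem IsHilbertBM.indep_increment (hι : ∀ e x, ⟪e, L x⟫_ℝ = ⟪ι e, x⟫_ℝ)
    (hW : IsHilbertBM Γ W P) {s t : ℝ≥0} (hst : s ≤ t) :
    Indep (MeasurableSpace.comap (fun ω => L (W t ω) - L (W s ω)) inferInstance)
      (⨆ u : Set.Iic s, MeasurableSpace.comap (W u) inferInstance) P := by
  have := FiniteDimensional.complete ℝ E
  have := secondCountable_of_finiteDimensional E
  set D : Ω → E := fun ω => L (W t ω) - L (W s ω) with hD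
  have hDm : Measurable D := (L.continuous.measurable.comp (hW.measurable t)).sub
    (L.continuous.measurable.comp (hW.measurable s))
  have hm : (⨆ u : Set.Iic s, MeasurableSpace.comap (W u) inferInstance) ≤ ‹MeasurableSpace Ω› :=
    iSup_le fun u => (hW.measurable u).comap_le
  have hchar : ∀ A, MeasurableSet[⨆ u : Set.Iic s, MeasurableSpace.comap (W u) inferInstance] A →
      ∀ e, charFun ((P.restrict A).map D) e = (P.real A : ℂ) *
        Complex.exp ((-(((t : ℝ) - s) / 2 * ⟪ι e, Γ (ι e)⟫_ℝ) : ℝ) : ℂ) := by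
    intro A hA e
    rw [charFun_apply, integral_map hDm.aemeasurable (by fun_prop), ← hW.setIntegral_exp _ hst hA]
    refine integral_congr_ae (Eventually.of_forall fun ω => ?_)
    simp only [hD]
    rw [real_inner_comm, ← map_sub, hι, mul_comm]
  rw [Indep_iff]
  rintro _ A ⟨B, hB, rfl⟩ hA
  have hA' := hm A hA
  have e : (P.restrict A).map D = P A • P.map D := by
    have : IsFiniteMeasure (P A • P.map D) := (P.map D).smul_finite (measure_ne_top P A)
    refine Measure.ext_of_charFun ?_
    funext e
    have h1 := hchar Set.univ MeasurableSet.univ e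
    rw [Measure.restrict_univ, probReal_univ, Complex.ofReal_one, one_mul] at h1
    rw [hchar A hA, ← h1, charFun_apply, charFun_apply, integral_smul_measure]
    simp [Measure.real]
  have := congrArg (fun μ : Measure E => μ B) e
  simp only [Measure.smul_apply, smul_eq_mul] at this
  rw [Measure.map_apply hDm hB, Measure.map_apply hDm hB,
    Measure.restrict_apply (hDm hB)] at this
  rw [this, mul_comm]

/-- The filtration generated by an initial value and a process. -/
def pathFiltration {m : MeasurableSpace Ω} {ξ : Ω → H} (hξ : Measurable ξ)
    (hW : ∀ t, Measurable (W t)) : Filtration ℝ≥0 m where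
  seq t := MeasurableSpace.comap ξ inferInstance ⊔
    ⨆ s : Set.Iic t, MeasurableSpace.comap (W s) inferInstance
  mono' s t hst := sup_le_sup le_rfl (iSup_le fun u =>
    le_iSup (fun v : Set.Iic t => MeasurableSpace.comap (W v) inferInstance)
      ⟨u, (u.2.out).trans hst⟩)
  le' t := sup_le hξ.comap_le (iSup_le fun u => (hW u).comap_le)

/-- The past also contains ξ. Since ξ is independent of the whole path of W, it can be adjoined
without destroying the independence of increment and past. -/
theorem IsHilbertBM.indep_increment_pathFiltration (hι : ∀ e x, ⟪e, L x⟫_ℝ = ⟪ι e, x⟫_ℝ)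
    (hW : IsHilbertBM Γ W P) {ξ : Ω → H} (hξ : Measurable ξ)
    (hind : IndepFun ξ (fun ω (t : ℝ≥0) => W t ω) P) {s t : ℝ≥0} (hst : s ≤ t) :
    Indep (MeasurableSpace.comap (fun ω => L (W t ω) - L (W s ω)) inferInstance)
      (pathFiltration hξ hW.measurable s) P := by
  have := secondCountable_of_finiteDimensional E
  have hpath : Measurable fun ω (t : ℝ≥0) => W t ω := measurable_pi_iff.2 hW.measurable
  have hev : ∀ u, Measurable[MeasurableSpace.comap (fun ω (t : ℝ≥0) => W t ω) inferInstance] (W u) :=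
    fun u => (measurable_pi_apply (X := fun _ : ℝ≥0 => H) u).comp
      (comap_measurable fun ω (t : ℝ≥0) => W t ω)
  rw [IndepFun_iff_Indep] at hind
  refine indep_sup_of_indep
    (m₄ := MeasurableSpace.comap (fun ω (t : ℝ≥0) => W t ω) inferInstance) ?_
    (iSup_le fun u => (hev u).comap_le) hξ.comap_le hpath.comap_le (hW.indep_increment hι hst) hind
  exact ((L.continuous.measurable.comp (hev t)).sub
    (L.continuous.measurable.comp (hev s))).comap_le

theorem integral_pow_four_gaussianReal (v : ℝ≥0) :
    ∫ x, x ^ 4 ∂(gaussianReal 0 v) = (v : ℝ) ^ 2 * ∫ x, x ^ 4 ∂(gaussianReal 0 1) := by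
  have h := gaussianReal_map_const_mul (μ := 0) (v := 1) (√v)
  rw [mul_zero, mul_one] at h
  have e : (NNReal.mk (√(v : ℝ) ^ 2) (sq_nonneg _)) = v :=
    NNReal.eq (Real.sq_sqrt v.coe_nonneg)
  rw [e] at h
  rw [← h, integral_map (by fun_prop) (by fun_prop), ← integral_const_mul]
  refine integral_congr_ae (Eventually.of_forall fun x => ?_)
  have := Real.sq_sqrt v.coe_nonneg
  simp only
  rw [mul_pow, show √(v : ℝ) ^ 4 = (√(v : ℝ) ^ 2) ^ 2 by ring, this]

theorem integral_sq_gaussianReal (v : ℝ≥0) : ∫ x, x ^ 2 ∂(gaussianReal 0 v) = v := by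
  have h := variance_fun_id_gaussianReal (μ := 0) (v := v)
  rw [variance_of_integral_eq_zero (by fun_prop) (by simp)] at h
  exact h

/-- The projection of a Brownian motion with a square integrable initial value is a noise. -/
theorem IsHilbertBM.isNoise (hι : ∀ e x, ⟪e, L x⟫_ℝ = ⟪ι e, x⟫_ℝ)
    (hΓ : ∀ v : H, 0 ≤ ⟪v, Γ v⟫_ℝ)
    (hW : IsHilbertBM Γ W P) {ξ : Ω → H} (hξ : Measurable ξ)
    (hind : IndepFun ξ (fun ω (t : ℝ≥0) => W t ω) P)
    (hξ2 : MemLp (fun ω => L (ξ ω)) 2 P) {N : Type*} [Fintype N] (e : OrthonormalBasis N ℝ E) :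
    ∃ c, IsNoise (pathFiltration hξ hW.measurable) (fun t ω => L (ξ ω) + L (W t ω))
      (∑ k, ⟪ι (e k), Γ (ι (e k))⟫_ℝ) c P := by
  have := FiniteDimensional.complete ℝ E
  have := secondCountable_of_finiteDimensional E
  set f : ℝ≥0 → Ω → E := fun t ω => L (ξ ω) + L (W t ω) with hf
  set q : N → ℝ := fun k => ⟪ι (e k), Γ (ι (e k))⟫_ℝ with hq
  have hq0 : ∀ k, 0 ≤ q k := fun k => hΓ _
  have hdiff : ∀ s t ω, f t ω - f s ω = L (W t ω) - L (W s ω) := fun s t ω => by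
    simp only [hf]
    abel
  have hcoord : ∀ s t ω k, ⟪e k, f t ω - f s ω⟫_ℝ = ⟪ι (e k), W t ω - W s ω⟫_ℝ := by
    intro s t ω k
    rw [hdiff, ← map_sub, hι]
  have hmap : ∀ s t, s ≤ t → ∀ k, P.map (fun ω => ⟪e k, f t ω - f s ω⟫_ℝ) =
      gaussianReal 0 (((t : ℝ) - s) * q k).toNNReal := by
    intro s t hst k
    simp only [hcoord]
    exact hW.map_inner hΓ _ hst
  have hcm : ∀ s t k, Measurable fun ω => ⟪e k, f t ω - f s ω⟫_ℝ := fun s t k => by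
    simp only [hcoord]
    exact hW.measurable_inner _ _ _
  have hvar : ∀ s t : ℝ≥0, s ≤ t → ∀ k,
      (((((t : ℝ) - s) * q k).toNNReal : ℝ≥0) : ℝ) = ((t : ℝ) - s) * q k := fun s t hst k =>
    Real.coe_toNNReal _ (mul_nonneg (sub_nonneg.2 (NNReal.coe_le_coe.2 hst)) (hq0 k))
  have hcl : ∀ s t, s ≤ t → ∀ k (p : ℝ≥0), MemLp (fun ω => ⟪e k, f t ω - f s ω⟫_ℝ) p P := by
    intro s t hst k p
    have h := memLp_id_gaussianReal (μ := 0) (v := (((t : ℝ) - s) * q k).toNNReal) p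
    rw [← hmap s t hst k] at h
    exact h.comp_of_map (hcm s t k).aemeasurable
  have hsum : ∀ s t ω, ∑ k, ⟪e k, f t ω - f s ω⟫_ℝ • e k = f t ω - f s ω := fun s t ω =>
    e.sum_repr' _
  have hnorm : ∀ s t ω, ‖f t ω - f s ω‖ ^ 2 = ∑ k, ⟪e k, f t ω - f s ω⟫_ℝ ^ 2 := fun s t ω => by
    rw [← e.sum_sq_norm_inner_right]
    simp
  have hmem : ∀ s t, s ≤ t → ∀ p : ℝ≥0, MemLp (fun ω => f t ω - f s ω) p P := by
    intro s t hst p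
    have h : MemLp (fun ω => ∑ k, ⟪e k, f t ω - f s ω⟫_ℝ • e k) p P :=
      memLp_finsetSum _ fun k _ => (memLp_top_const (e k)).smul (hcl s t hst k p)
    simpa only [hsum] using h
  have hi2 : ∀ s t, s ≤ t → ∀ k, ∫ ω, ⟪e k, f t ω - f s ω⟫_ℝ ^ 2 ∂P = ((t : ℝ) - s) * q k := by
    intro s t hst k
    rw [← hvar s t hst k, ← integral_sq_gaussianReal, ← hmap s t hst k,
      integral_map (hcm s t k).aemeasurable (by fun_prop)]
  have hi4 : ∀ s t, s ≤ t → ∀ k, ∫ ω, ⟪e k, f t ω - f s ω⟫_ℝ ^ 4 ∂P =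
      (((t : ℝ) - s) * q k) ^ 2 * ∫ x, x ^ 4 ∂(gaussianReal 0 1) := by
    intro s t hst k
    rw [← hvar s t hst k, ← integral_pow_four_gaussianReal, ← hmap s t hst k,
      integral_map (hcm s t k).aemeasurable (by fun_prop)]
  -- The fourth moment constant comes from (Σ_k a_k²)² ≤ N Σ_k a_k⁴ in coordinates, each coordinate
  -- being Gaussian with variance (t − s)q_k.
  refine ⟨Fintype.card N * ((∑ k, q k ^ 2) * ∫ x, x ^ 4 ∂(gaussianReal 0 1)), ?_, ?_, ?_, ?_, ?_, ?_,
    ?_, ?_⟩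
  · intro t
    have h1 : Measurable[pathFiltration hξ hW.measurable t] ξ :=
      (comap_measurable ξ).mono le_sup_left le_rfl
    have h2 : Measurable[pathFiltration hξ hW.measurable t] (W t) :=
      (comap_measurable (W t)).mono (le_sup_of_le_right
        (le_iSup (fun v : Set.Iic t => MeasurableSpace.comap (W v) inferInstance) ⟨t, Set.mem_Iic.2 le_rfl⟩)) le_rfl
    exact (L.continuous.measurable.comp h1).add (L.continuous.measurable.comp h2)
  · intro ω
    exact continuous_const.add (L.continuous.comp (hW.continuous ω))
  · intro s t hst
    simp only [hdiff]
    exact hW.indep_increment_pathFiltration hι hξ hind hst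
  · intro s t hst
    exact hmem s t hst 4
  · intro s t hst
    have hi : Integrable (fun ω => f t ω - f s ω) P := memLp_one_iff_integrable.1 (hmem s t hst 1)
    have h : ∀ k, ⟪e k, ∫ ω, f t ω - f s ω ∂P⟫_ℝ = 0 := by
      intro k
      rw [← integral_inner hi]
      have h1 : ∫ x, x ∂(P.map fun ω => ⟪e k, f t ω - f s ω⟫_ℝ) = 0 := by
        rw [hmap s t hst k, integral_id_gaussianReal]
      rwa [integral_map (hcm s t k).aemeasurable (by fun_prop)] at h1
    rw [← e.sum_repr' (∫ ω, f t ω - f s ω ∂P)]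
    simp [h]
  · intro s t hst
    simp only [hnorm]
    rw [integral_finsetSum _ fun k _ => (hcl s t hst k 2).integrable_sq, Finset.mul_sum]
    exact Finset.sum_congr rfl fun k _ => hi2 s t hst k
  · intro s t hst
    have i4 : ∀ k, Integrable (fun ω => ⟪e k, f t ω - f s ω⟫_ℝ ^ 4) P := fun k => by
      have h := (hcl s t hst k 4).integrable_norm_pow (by norm_num)
      refine h.congr (Eventually.of_forall fun ω => ?_)
      simp only [Real.norm_eq_abs]
      exact Even.pow_abs (by decide) _
    have hle : ∀ ω, ‖f t ω - f s ω‖ ^ 4 ≤ Fintype.card N * ∑ k, ⟪e k, f t ω - f s ω⟫_ℝ ^ 4 := by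
      intro ω
      have h := sq_sum_le_card_mul_sum_sq (s := Finset.univ)
        (f := fun k => ⟪e k, f t ω - f s ω⟫_ℝ ^ 2)
      rw [← hnorm] at h
      calc ‖f t ω - f s ω‖ ^ 4 = (‖f t ω - f s ω‖ ^ 2) ^ 2 := by ring
        _ ≤ _ := h
        _ = _ := by
          rw [Finset.card_univ]
          congr 1
          exact Finset.sum_congr rfl fun k _ => by ring
    have is : Integrable (fun ω => Fintype.card N * ∑ k, ⟪e k, f t ω - f s ω⟫_ℝ ^ 4) P :=
      (integrable_finsetSum _ fun k _ => i4 k).const_mul _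
    refine (integral_mono ((hmem s t hst 4).integrable_norm_pow (by norm_num)) is hle).trans
      (le_of_eq ?_)
    rw [integral_const_mul, integral_finsetSum _ fun k _ => i4 k]
    simp only [hi4 s t hst, mul_pow]
    rw [← Finset.sum_mul, ← Finset.mul_sum]
    ring
  -- The process starts at 0 only almost surely, so the initial value is identified up to a null
  -- set.
  · refine (memLp_congr_ae ?_).1 hξ2
    filter_upwards [hW.start] with ω hω
    simp [hf, hω]

end BrownianMotion

/-! ### The moments of the dissipation -/

section Dissipation

variable {E : Type*} [NormedAddCommGroup E] [InnerProductSpace ℝ E] [FiniteDimensional ℝ E]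
  [MeasurableSpace E] [BorelSpace E]
  {Ω : Type*} {m : MeasurableSpace Ω} {P : Measure Ω} [IsProbabilityMeasure P]
  {𝒢 : Filtration ℝ≥0 m} {f : ℝ≥0 → Ω → E} {θ c : ℝ} {b : E → E}

/-- The bound on S is integrated in time along each path and then in the mean. For the Galerkin
equation S is the p-th power of the Sobolev norm. -/
theorem integral_dissipation_le (hb : LipschitzOnBalls b) (hc : Coercive b)
    (hin : ∀ x, ⟪x, b x⟫_ℝ ≤ 0) (hf : IsNoise 𝒢 f θ c P) {S : E → ℝ} (hS : Continuous S)
    (hS0 : ∀ x, 0 ≤ S x) {K ν : ℝ} (hSb : ∀ x, S x ≤ K * (-⟪x, b x⟫_ℝ / ν + 1)) (T : ℝ≥0) :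
    Integrable (fun ω => ∫ u in (0 : ℝ)..T, S (globalSol b (fun t => f t ω) u.toNNReal)) P ∧
    ∫ ω, (∫ u in (0 : ℝ)..T, S (globalSol b (fun t => f t ω) u.toNNReal)) ∂P ≤
      K * ((∫ ω, (∫ u in (0 : ℝ)..T, -⟪globalSol b (fun t => f t ω) u.toNNReal,
        b (globalSol b (fun t => f t ω) u.toNNReal)⟫_ℝ) ∂P) / ν + T) := by
  have := FiniteDimensional.complete ℝ E
  set X : ℝ≥0 → Ω → E := fun t ω => globalSol b (fun t => f t ω) t with hX
  have hXm : ∀ t, Measurable (X t) := fun t =>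
    (measurable_globalSol_filtration hb hc hin hf t).mono (𝒢.le t) le_rfl
  have hXc : ∀ ω, Continuous fun t => X t ω := fun ω =>
    (isSolUpTo_globalSol hb hc (hf.continuous ω) T).continuous
  obtain ⟨-, i1, -⟩ := energy_globalSol hb hc hin hf T
  have hbound : ∀ ω, ∫ u in (0 : ℝ)..T, S (X u.toNNReal ω) ≤
      K * ((∫ u in (0 : ℝ)..T, -⟪X u.toNNReal ω, b (X u.toNNReal ω)⟫_ℝ) / ν + T) := by
    intro ω
    have c1 : Continuous fun u : ℝ => S (X u.toNNReal ω) := continuous_comp_toNNReal hS (hXc ω)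
    have c2 : Continuous fun u : ℝ => -⟪X u.toNNReal ω, b (X u.toNNReal ω)⟫_ℝ :=
      continuous_comp_toNNReal (b := fun x => -⟪x, b x⟫_ℝ)
        (continuous_id.inner hb.continuous).neg (hXc ω)
    have c3 : Continuous fun u : ℝ =>
        K * (-⟪X u.toNNReal ω, b (X u.toNNReal ω)⟫_ℝ / ν + 1) :=
      ((c2.div_const ν).add continuous_const).const_mul K
    refine (intervalIntegral.integral_mono_on T.coe_nonneg (c1.intervalIntegrable _ _)
      (c3.intervalIntegrable _ _) fun u _ => hSb _).trans (le_of_eq ?_)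
    rw [intervalIntegral.integral_const_mul, intervalIntegral.integral_add
      ((c2.div_const ν).intervalIntegrable _ _) (continuous_const.intervalIntegrable _ _),
      intervalIntegral.integral_div]
    simp
  have hmeas : Measurable fun ω => ∫ u in (0 : ℝ)..T, S (X u.toNNReal ω) :=
    measurable_integral_path hXm hXc hS _ _
  have i2 : Integrable (fun ω =>
      K * ((∫ u in (0 : ℝ)..T, -⟪X u.toNNReal ω, b (X u.toNNReal ω)⟫_ℝ) / ν + T)) P :=
    ((i1.div_const ν).add (integrable_const _)).const_mul K
  have i3 : Integrable (fun ω => ∫ u in (0 : ℝ)..T, S (X u.toNNReal ω)) P :=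
    i2.mono' hmeas.aestronglyMeasurable (Eventually.of_forall fun ω => by
      rw [Real.norm_of_nonneg (intervalIntegral.integral_nonneg T.coe_nonneg fun u _ => hS0 _)]
      exact hbound ω)
  refine ⟨i3, (integral_mono i3 i2 hbound).trans (le_of_eq ?_)⟩
  rw [integral_const_mul, integral_add (i1.div_const ν) (integrable_const _), integral_div]
  simp

end Dissipation

/-! ### The Galerkin noise -/

section Projection

variable {H : Type*} [NormedAddCommGroup H] [InnerProductSpace ℝ H] [CompleteSpace H]
  [MeasurableSpace H] [BorelSpace H] (V : Submodule ℝ H) [FiniteDimensional ℝ V]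
  {Ω : Type*} [MeasurableSpace Ω] {P : Measure Ω}

theorem hilbertTrace_comp_projection (Γ : H →L[ℝ] H) {N : Type*} [Fintype N]
    (e : OrthonormalBasis N ℝ V) :
    hilbertTrace (Γ ∘L V.subtypeL ∘L V.orthogonalProjectionOnto) =
      ∑ k, ⟪(e k : H), Γ (e k : H)⟫_ℝ := by
  refine hilbertTrace_comp_eq Γ fun x => ?_
  have h := congrArg (Subtype.val) (e.sum_repr' (V.orthogonalProjectionOnto x))
  simp only [Submodule.inner_orthogonalProjectionOnto_eq_of_mem_left, Submodule.coe_sum,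
    Submodule.coe_smul] at h
  exact h.symm

theorem hilbertTrace_comp_projection_le {Γ : H →L[ℝ] H} (hΓ : IsCovarianceOp Γ) :
    hilbertTrace (Γ ∘L V.subtypeL ∘L V.orthogonalProjectionOnto) ≤ hilbertTrace Γ := by
  rw [hilbertTrace_comp_projection V Γ (stdOrthonormalBasis ℝ V)]
  exact sum_inner_le_hilbertTrace
    ((stdOrthonormalBasis ℝ V).orthonormal.comp_linearIsometry V.subtypeₗᵢ) hΓ

/-- An orthogonal projection does not increase the second moment. -/
theorem memLp_projection {ξ : Ω → H} (hξ : Measurable ξ)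
    (hi : Integrable (fun v : H => ‖v‖ ^ 2) (P.map ξ)) :
    MemLp (fun ω => V.orthogonalProjectionOnto (ξ ω)) 2 P ∧
      ∫ ω, ‖V.orthogonalProjectionOnto (ξ ω)‖ ^ 2 ∂P ≤ ∫ v, ‖v‖ ^ 2 ∂(P.map ξ) := by
  have := secondCountable_of_finiteDimensional V
  have hsq : Measurable fun v : H => ‖v‖ ^ 2 := measurable_norm.pow_const 2
  have hm : Measurable fun ω => V.orthogonalProjectionOnto (ξ ω) :=
    V.orthogonalProjectionOnto.continuous.measurable.comp hξ
  have hi' : Integrable (fun ω => ‖ξ ω‖ ^ 2) P := hi.comp_measurable hξ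
  have hle : ∀ ω, ‖V.orthogonalProjectionOnto (ξ ω)‖ ^ 2 ≤ ‖ξ ω‖ ^ 2 := fun ω =>
    pow_le_pow_left₀ (norm_nonneg _) (V.norm_orthogonalProjectionOnto_apply_le (ξ ω)) 2
  have i1 : Integrable (fun ω => ‖V.orthogonalProjectionOnto (ξ ω)‖ ^ 2) P :=
    hi'.mono' (hm.norm.pow_const 2).aestronglyMeasurable (Eventually.of_forall fun ω => by
      rw [Real.norm_of_nonneg (by positivity)]
      exact hle ω)
  refine ⟨(memLp_two_iff_integrable_sq_norm hm.aestronglyMeasurable).2 i1, ?_⟩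
  rw [integral_map hξ.aemeasurable hsq.aestronglyMeasurable]
  exact integral_mono i1 hi' hle

theorem IsHilbertBM.isNoise_projection [IsProbabilityMeasure P] {Γ : H →L[ℝ] H}
    (hΓ : IsCovarianceOp Γ) {ξ : Ω → H} (hξ : Measurable ξ) {W : ℝ≥0 → Ω → H}
    (hW : IsHilbertBM Γ W P) (hind : IndepFun ξ (fun ω (t : ℝ≥0) => W t ω) P)
    (hi : Integrable (fun v : H => ‖v‖ ^ 2) (P.map ξ)) :
    ∃ c, IsNoise (pathFiltration hξ hW.measurable)
      (fun t ω => V.orthogonalProjectionOnto (ξ ω) + V.orthogonalProjectionOnto (W t ω))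
      (hilbertTrace (Γ ∘L V.subtypeL ∘L V.orthogonalProjectionOnto)) c P := by
  rw [hilbertTrace_comp_projection V Γ (stdOrthonormalBasis ℝ V)]
  exact hW.isNoise (ι := fun e : V => (e : H))
    (fun e x => Submodule.inner_orthogonalProjectionOnto_eq_of_mem_left e x) hΓ.nonneg hξ hind
    (memLp_projection V hξ hi).1 (stdOrthonormalBasis ℝ V)

end Projection

section GalerkinNoise

variable {d : ℕ}

theorem traceProj_le {Γ : V20 d →L[ℝ] V20 d} (hΓ : IsCovarianceOp Γ) (n : ℕ) :
    traceProj Γ n ≤ hilbertTrace Γ :=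
  hilbertTrace_comp_projection_le (Vn d n) hΓ

theorem integral_norm_proj_sq_le {Ω : Type*} [MeasurableSpace Ω] {P : Measure Ω} {ξ : Ω → V20 d}
    (hξ : Measurable ξ) (hi : Integrable (fun v : V20 d => ‖v‖ ^ 2) (P.map ξ)) (n : ℕ) :
    ∫ ω, ‖proj d n (ξ ω)‖ ^ 2 ∂P ≤ ∫ v, ‖v‖ ^ 2 ∂(P.map ξ) :=
  (memLp_projection (Vn d n) hξ hi).2

theorem lipschitzOnBalls_drift (d n : ℕ) (ν p : ℝ) :
    LipschitzOnBalls (drift ν p : Vn d n → Vn d n) :=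
  fun R => exists_lipschitz_drift d n ν p R

theorem coercive_drift (d n : ℕ) {ν p : ℝ} (hν : 0 ≤ ν) (hp : 0 ≤ p) :
    Coercive (drift ν p : Vn d n → Vn d n) :=
  fun K => exists_coercive_drift d n hν hp K

theorem inner_drift_nonpos (n : ℕ) {ν p : ℝ} (hν : 0 ≤ ν) (x : Vn d n) :
    ⟪x, drift ν p x⟫_ℝ ≤ 0 :=
  (inner_drift_self ν p x).trans_le (neg_nonpos.2 (strainStress_self_nonneg hν p (toField x)))

/-- The driving term of the Galerkin equation. -/
def galerkinNoise {Ω : Type*} (n : ℕ) (ξ : Ω → V20 d) (W : ℝ≥0 → Ω → V20 d) (t : ℝ≥0) (ω : Ω) :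
    Vn d n := proj d n (ξ ω) + proj d n (W t ω)

theorem isNoise_galerkinNoise {Ω : Type*} [MeasurableSpace Ω] {P : Measure Ω}
    [IsProbabilityMeasure P] {Γ : V20 d →L[ℝ] V20 d} (hΓ : IsCovarianceOp Γ) {ξ : Ω → V20 d}
    (hξ : Measurable ξ) {W : ℝ≥0 → Ω → V20 d} (hW : IsHilbertBM Γ W P)
    (hind : IndepFun ξ (fun ω (t : ℝ≥0) => W t ω) P)
    (hi : Integrable (fun v : V20 d => ‖v‖ ^ 2) (P.map ξ)) (n : ℕ) :
    ∃ c, IsNoise (pathFiltration hξ hW.measurable) (galerkinNoise n ξ W) (traceProj Γ n) c P :=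
  IsHilbertBM.isNoise_projection (Vn d n) hΓ hξ hW hind hi

end GalerkinNoise

/-! ### Energy identity and moment bounds in terms of abstract constants -/

section Moments

variable {E : Type*} [NormedAddCommGroup E] [InnerProductSpace ℝ E] [FiniteDimensional ℝ E]
  [MeasurableSpace E] [BorelSpace E]
  {Ω : Type*} {m : MeasurableSpace Ω} {P : Measure Ω} [IsProbabilityMeasure P]
  {𝒢 : Filtration ℝ≥0 m} {f X : ℝ≥0 → Ω → E} {θ c : ℝ} {b : E → E} {D S : E → ℝ} {K ν : ℝ}

theorem energy_identity (hb : LipschitzOnBalls b) (hc : Coercive b) (hin : ∀ x, ⟪x, b x⟫_ℝ ≤ 0)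
    (hf : IsNoise 𝒢 f θ c P) (hX : ∀ t ω, X t ω = globalSol b (fun t => f t ω) t)
    (hD : ∀ x, ⟪x, b x⟫_ℝ = -D x) (T : ℝ≥0) :
    Integrable (fun ω => ‖X 0 ω‖ ^ 2) P ∧
    Integrable (fun ω => ‖X T ω‖ ^ 2 + 2 * ∫ t in (0 : ℝ)..T, D (X t.toNNReal ω)) P ∧
    ∫ ω, (‖X T ω‖ ^ 2 + 2 * ∫ t in (0 : ℝ)..T, D (X t.toNNReal ω)) ∂P =
      ∫ ω, ‖X 0 ω‖ ^ 2 ∂P + θ * T := by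
  obtain ⟨i1, i2, e⟩ := energy_globalSol hb hc hin hf T
  have h0 := (energy_globalSol hb hc hin hf 0).1
  simp only [hD, neg_neg] at i2 e
  have e0 : ∫ ω, ‖globalSol b (fun t => f t ω) 0‖ ^ 2 ∂P = ∫ ω, ‖f 0 ω‖ ^ 2 ∂P :=
    integral_congr_ae (Eventually.of_forall fun ω => by
      simp only [globalSol_zero hb hc (hf.continuous ω)])
  simp only [hX]
  refine ⟨h0, i1.add (i2.const_mul 2), ?_⟩
  rw [integral_add i1 (i2.const_mul 2), integral_const_mul, e, e0, mul_comm θ]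

/-- The two conditions on C make the Sobolev term divided by C at most 2A + CT, where A is the mean
dissipation; the energy identity turns the final squared norm plus 2A into the initial energy plus
Tθ. The maximal bound uses A ≤ (M + τ)(1 + T)/2, again from the energy identity. -/
theorem moment_bounds (hb : LipschitzOnBalls b) (hc : Coercive b) (hin : ∀ x, ⟪x, b x⟫_ℝ ≤ 0)
    (hf : IsNoise 𝒢 f θ c P) (hX : ∀ t ω, X t ω = globalSol b (fun t => f t ω) t)
    (hD : ∀ x, ⟪x, b x⟫_ℝ = -D x) (hS : Continuous S) (hS0 : ∀ x, 0 ≤ S x) (hK : 0 ≤ K)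
    (hν : 0 < ν) (hSb : ∀ x, S x ≤ K * (D x / ν + 1)) {M τ : ℝ}
    (hM : ∫ ω, ‖f 0 ω‖ ^ 2 ∂P ≤ M) (hτ : θ ≤ τ) (T : ℝ≥0) :
    (∀ C : ℝ, 0 < C → K / ν ≤ 2 * C → K ≤ C * C →
      Integrable (fun ω => ‖X T ω‖ ^ 2 + 1 / C * ∫ t in (0 : ℝ)..T, S (X t.toNNReal ω)) P ∧
      ∫ ω, (‖X T ω‖ ^ 2 + 1 / C * ∫ t in (0 : ℝ)..T, S (X t.toNNReal ω)) ∂P ≤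
        M + (C + τ) * T) ∧
    Integrable (fun ω => (⨆ t : Set.Iic T, ‖X t ω‖ ^ 2) +
      ∫ t in (0 : ℝ)..T, S (X t.toNNReal ω)) P ∧
    ∫ ω, ((⨆ t : Set.Iic T, ‖X t ω‖ ^ 2) + ∫ t in (0 : ℝ)..T, S (X t.toNNReal ω)) ∂P ≤
      (1 + T) * ((7 + K / (2 * ν)) * (M + τ) + K + 2) := by
  obtain ⟨i1, -, e⟩ := energy_globalSol hb hc hin hf T
  obtain ⟨i2, h2⟩ := integral_dissipation_le hb hc hin hf hS hS0 (K := K) (ν := ν)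
    (fun x => by rw [hD, neg_neg]; exact hSb x) T
  obtain ⟨i3, h3⟩ := integral_iSup_globalSol_le hb hc hin hf T
  simp only [hX]
  have hA : 0 ≤ ∫ ω, (∫ u in (0 : ℝ)..T, -⟪globalSol b (fun t => f t ω) u.toNNReal,
      b (globalSol b (fun t => f t ω) u.toNNReal)⟫_ℝ) ∂P :=
    integral_nonneg fun ω => intervalIntegral.integral_nonneg T.coe_nonneg fun u _ =>
      neg_nonneg.2 (hin _)
  have hN : 0 ≤ ∫ ω, ‖globalSol b (fun t => f t ω) T‖ ^ 2 ∂P := integral_nonneg fun ω => by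
    positivity
  have hM0 : 0 ≤ ∫ ω, ‖f 0 ω‖ ^ 2 ∂P := integral_nonneg fun ω => by positivity
  set A := ∫ ω, (∫ u in (0 : ℝ)..T, -⟪globalSol b (fun t => f t ω) u.toNNReal,
      b (globalSol b (fun t => f t ω) u.toNNReal)⟫_ℝ) ∂P
  set N := ∫ ω, ‖globalSol b (fun t => f t ω) T‖ ^ 2 ∂P
  have hT := T.coe_nonneg
  have hθτ : T * θ ≤ T * τ := mul_le_mul_of_nonneg_left hτ hT
  have hτ0 : 0 ≤ τ := hf.theta_nonneg.trans hτ
  refine ⟨fun C hC hC1 hC2 => ⟨i1.add (i2.const_mul _), ?_⟩, i3.add i2, ?_⟩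
  · rw [integral_add i1 (i2.const_mul _), integral_const_mul]
    have h4 := mul_le_mul_of_nonneg_left h2 (by positivity : 0 ≤ 1 / C)
    have h5 : 1 / C * (K * (A / ν + T)) = (K / ν / C) * A + (K / C) * T := by
      field_simp
    have h6 : K / ν / C ≤ 2 := (div_le_iff₀ hC).2 hC1
    have h7 : K / C ≤ C := (div_le_iff₀ hC).2 hC2
    have h8 := mul_le_mul_of_nonneg_right h6 hA
    have h9 := mul_le_mul_of_nonneg_right h7 hT
    linarith
  · rw [integral_add i3 i2]
    have h4 : A ≤ (M + τ) * (1 + T) / 2 := by nlinarith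
    have h5 : ∫ ω, ‖f 0 ω‖ ^ 2 ∂P + T * θ ≤ (M + τ) * (1 + T) := by nlinarith
    have h6 : K * (A / ν + T) ≤ K / (2 * ν) * ((M + τ) * (1 + T)) + K * T := by
      have h7 := mul_le_mul_of_nonneg_left h4 (by positivity : 0 ≤ K / ν)
      have h8 : K * (A / ν + T) = K / ν * A + K * T := by ring
      have h9 : K / ν * ((M + τ) * (1 + T) / 2) = K / (2 * ν) * ((M + τ) * (1 + T)) := by
        field_simp
      rw [h8, ← h9]
      linarith
    nlinarith

end Moments

theorem unique_globalSol {E : Type*} [NormedAddCommGroup E] [InnerProductSpace ℝ E]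
    [FiniteDimensional ℝ E] {b : E → E} (hb : LipschitzOnBalls b) (hc : Coercive b)
    {f y : ℝ≥0 → E} (hf : Continuous f) (hy : Continuous y)
    (h : ∀ t : ℝ≥0, y t = f t + ∫ s in (0 : ℝ)..t, b (y s.toNNReal)) (t : ℝ≥0) :
    y t = globalSol b f t := by
  have := FiniteDimensional.complete ℝ E
  exact IsSolUpTo.unique hb ⟨hy, fun s _ => h s⟩ (isSolUpTo_globalSol hb hc hf t) t le_rfl

/-! ### The solution of the Galerkin equation and its uniqueness -/

section Galerkin

variable {d : ℕ} {Ω : Type*} [MeasurableSpace Ω] {P : Measure Ω} [IsProbabilityMeasure P]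
  {Γ : V20 d →L[ℝ] V20 d} {ξ : Ω → V20 d} {W : ℝ≥0 → Ω → V20 d}

/-- The solution of the Galerkin equation. -/
def galerkinSol (ν p : ℝ) (n : ℕ) (ξ : Ω → V20 d) (W : ℝ≥0 → Ω → V20 d) (t : ℝ≥0) (ω : Ω) :
    Vn d n := globalSol (drift ν p) (fun t => galerkinNoise n ξ W t ω) t

theorem continuous_galerkinNoise (hW : IsHilbertBM Γ W P) (n : ℕ) (ω : Ω) :
    Continuous fun t => galerkinNoise n ξ W t ω :=
  continuous_const.add ((proj d n).continuous.comp (hW.continuous ω))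

theorem isGalerkinSolution_galerkinSol {ν p : ℝ} (hν : 0 ≤ ν) (hp : 0 ≤ p)
    (hΓ : IsCovarianceOp Γ) (hξ : Measurable ξ) (hW : IsHilbertBM Γ W P)
    (hind : IndepFun ξ (fun ω (t : ℝ≥0) => W t ω) P)
    (hi : Integrable (fun v : V20 d => ‖v‖ ^ 2) (P.map ξ)) (n : ℕ) :
    IsGalerkinSolution ν p n ξ W P (galerkinSol ν p n ξ W) := by
  obtain ⟨c, hf⟩ := isNoise_galerkinNoise hΓ hξ hW hind hi n
  have hb := lipschitzOnBalls_drift d n ν p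
  have hc := coercive_drift d n hν hp
  have := FiniteDimensional.complete ℝ (Vn d n)
  refine ⟨fun t => ?_, Eventually.of_forall fun ω => ?_, Eventually.of_forall fun ω t => ?_⟩
  -- The equation is solved for every ω, so the solution is adapted even to the filtration without
  -- the null sets.
  · exact (measurable_globalSol_filtration hb hc (inner_drift_nonpos n hν) hf t).mono
      le_sup_left le_rfl
  · exact (isSolUpTo_globalSol hb hc (continuous_galerkinNoise hW n ω) 0).continuous
  · exact ((isSolUpTo_globalSol hb hc (continuous_galerkinNoise hW n ω) t).eqn t le_rfl).trans
      (add_right_comm _ _ _)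

theorem IsGalerkinSolution.eq_galerkinSol {ν p : ℝ} (hν : 0 ≤ ν) (hp : 0 ≤ p)
    (hW : IsHilbertBM Γ W P) {n : ℕ} {Y : ℝ≥0 → Ω → Vn d n}
    (hY : IsGalerkinSolution ν p n ξ W P Y) :
    ∀ᵐ ω ∂P, ∀ t, Y t ω = galerkinSol ν p n ξ W t ω := by
  filter_upwards [hY.continuous, hY.equation] with ω h1 h2 t
  exact unique_globalSol (lipschitzOnBalls_drift d n ν p) (coercive_drift d n hν hp)
    (continuous_galerkinNoise hW n ω) h1 (fun t => (h2 t).trans (add_right_comm _ _ _)) t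

end Galerkin

end

end PowerLawFluid

theorem theorem3p1p1 (d : ℕ) (hd : 2 ≤ d) (ν p : ℝ) (hν : 0 < ν) (hp : 1 < p) :
    ∃ C : ℝ, 0 < C ∧
    ∀ Γ : V20 d →L[ℝ] V20 d, IsCovarianceOp Γ →
    ∀ m₀ : ℝ, ∃ C' : ℝ, 0 < C' ∧
    ∀ μ₀ : Measure (V20 d), IsProbabilityMeasure μ₀ →
    Integrable (fun v : V20 d => ‖v‖ ^ 2) μ₀ → ∫ v, ‖v‖ ^ 2 ∂μ₀ = m₀ →
    ∀ (Ω : Type*) [MeasurableSpace Ω] (P : Measure Ω) [IsProbabilityMeasure P]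
      (ξ : Ω → V20 d) (W : ℝ≥0 → Ω → V20 d),
    Measurable ξ → P.map ξ = μ₀ → IsHilbertBM Γ W P →
    IndepFun ξ (fun ω (t : ℝ≥0) => W t ω) P →
    ∀ n : ℕ, 1 ≤ n →
    ∃ X : ℝ≥0 → Ω → Vn d n,
      -- existence
      IsGalerkinSolution ν p n ξ W P X ∧
      -- uniqueness
      (∀ Y : ℝ≥0 → Ω → Vn d n, IsGalerkinSolution ν p n ξ W P Y →
        ∀ᵐ ω ∂P, ∀ t, Y t ω = X t ω) ∧
      -- energy identity
      (∀ T : ℝ≥0, 0 < T →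
        Integrable (fun ω => ‖X 0 ω‖ ^ 2) P ∧
        Integrable (fun ω => ‖X T ω‖ ^ 2 +
          2 * ∫ t in (0 : ℝ)..T, strainStress ν p (toField (X t.toNNReal ω)) (toField (X t.toNNReal ω))) P ∧
        ∫ ω, (‖X T ω‖ ^ 2 +
          2 * ∫ t in (0 : ℝ)..T, strainStress ν p (toField (X t.toNNReal ω)) (toField (X t.toNNReal ω))) ∂P
          = ∫ ω, ‖X 0 ω‖ ^ 2 ∂P + traceProj Γ n * T) ∧
      -- first moment bound
      (∀ T : ℝ≥0, 0 < T →
        Integrable (fun ω => ‖X T ω‖ ^ 2 +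
          1 / C * ∫ t in (0 : ℝ)..T, sobolevNorm p 1 (toField (X t.toNNReal ω)) ^ p) P ∧
        ∫ ω, (‖X T ω‖ ^ 2 +
          1 / C * ∫ t in (0 : ℝ)..T, sobolevNorm p 1 (toField (X t.toNNReal ω)) ^ p) ∂P
          ≤ m₀ + (C + hilbertTrace Γ) * T) ∧
      -- maximal bound, uniform in `n`
      (2 * (d : ℝ) / (d + 2) ≤ p → ∀ T : ℝ≥0, 0 < T →
        Integrable (fun ω => (⨆ t : Set.Iic T, ‖X t ω‖ ^ 2) +
          ∫ t in (0 : ℝ)..T, sobolevNorm p 1 (toField (X t.toNNReal ω)) ^ p) P ∧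
        ∫ ω, ((⨆ t : Set.Iic T, ‖X t ω‖ ^ 2) +
          ∫ t in (0 : ℝ)..T, sobolevNorm p 1 (toField (X t.toNNReal ω)) ^ p) ∂P
          ≤ (1 + T) * C') := by
  obtain ⟨K, hK, hKb⟩ := exists_sobolevNorm_le d hν hp
  have hp0 : 0 < p := zero_lt_one.trans hp
  have hKν : 0 ≤ K / ν := by positivity
  -- The first summand gives K/ν ≤ 2C; the other two give C ≥ K and C ≥ 1, hence K ≤ C².
  have hC : 0 < K / (2 * ν) + K + 1 := by positivity
  refine ⟨K / (2 * ν) + K + 1, hC, fun Γ hΓ m₀ => ?_⟩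
  -- The number m₀ is fixed before any measure with this second moment is given and may be negative
  -- at this point, so the absolute value is what makes the constant positive. Once the measure is
  -- present, m₀ ≥ 0.
  refine ⟨(7 + K / (2 * ν)) * (|m₀| + hilbertTrace Γ) + K + 2, ?_, ?_⟩
  · have := hilbertTrace_nonneg hΓ
    positivity
  intro μ₀ _ hi hm Ω _ P _ ξ W hξ hμ hW hind n _
  subst hμ
  have hsol := isGalerkinSolution_galerkinSol hν.le hp0.le hΓ hξ hW hind hi n
  refine ⟨galerkinSol ν p n ξ W, hsol, fun Y hY => hY.eq_galerkinSol hν.le hp0.le hW, ?_⟩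
  obtain ⟨c, hf⟩ := isNoise_galerkinNoise hΓ hξ hW hind hi n
  have hb := lipschitzOnBalls_drift d n ν p
  have hc := coercive_drift d n hν.le hp0.le
  have hin := fun x : Vn d n => inner_drift_nonpos n hν.le (p := p) x
  have hM : ∫ ω, ‖galerkinNoise n ξ W 0 ω‖ ^ 2 ∂P ≤ |m₀| := by
    refine le_trans (le_of_eq (integral_congr_ae ?_))
      ((integral_norm_proj_sq_le hξ hi n).trans (hm.le.trans (le_abs_self m₀)))
    filter_upwards [hW.start] with ω hω
    simp only [galerkinNoise]
    rw [hω, map_zero, add_zero]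
  have hm0 : |m₀| = m₀ := abs_of_nonneg (hm ▸ integral_nonneg fun v => by positivity)
  have key := fun T => moment_bounds (X := galerkinSol ν p n ξ W) hb hc hin hf (fun _ _ => rfl)
    (inner_drift_self ν p) (continuous_sobolevNorm_rpow hp0)
    (fun x => Real.rpow_nonneg (Real.rpow_nonneg
      (integral_nonneg fun _ => Real.rpow_nonneg (norm_nonneg _) _) _) _)
    hK hν (fun x => hKb n x) hM (traceProj_le hΓ n) T
  refine ⟨fun T _ => energy_identity hb hc hin hf (fun _ _ => rfl) (inner_drift_self ν p) T,
    fun T _ => ?_, fun _ T _ => (key T).2⟩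
  have h := (key T).1 (K / (2 * ν) + K + 1) hC ?_ ?_
  · rwa [hm0] at h
  · have : K / ν = 2 * (K / (2 * ν)) := by field_simp
    linarith
  · have : 0 ≤ K / (2 * ν) := by positivity
    nlinarith
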